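/- All knots are tame knots in $\mathbb{R}^3$. For a knot $K$, let the braid index $br(K)$ be the minimum number of strands, and the braid length $l(K)$ the minimum number of crossings, among all closed braids isotopic to $K$. For $n \ge br(K)$ let $b_n(K)$ be the minimum number of crossings of an $n$-strand braid whose closure is isotopic to $K$, that is, the minimum length of a word in the generators $\sigma_1^{\pm1},\dots,\sigma_{n-1}^{\pm1}$ whose closure is isotopic to $K$, and put $b_n'(K) = b_n(K) - n$. Let $K$ be a prime knot of braid index $m$. If $b_m(K) = l(K)$ and $b_m'(K) = m+1$, then $b_n'(K) = m+1$ for all $n \ge m$. -/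

import Mathlib

/-! Tame knots in `ℝ³`, represented by simple closed polygons up to triangle moves; connected sums
and primeness; closed braids; braid index, braid length and the functions `b_n` and `b_n'`. -/

noncomputable section

namespace BraidStrands

/-- Points of three-dimensional space, with coordinates `x = p 0`, `y = p 1`, `z = p 2`. -/
abbrev Point : Type := Fin 3 → ℝ

/-! ### Polygonal knots and isotopy -/

/-- The directed edges of the closed polygon with the given cyclic list of vertices. -/
def edges (l : List Point) : List (Point × Point) := l.zip (l.rotate 1)

/-- The closed polygon with the given cyclic list of vertices, as a subset of space. -/
def polygon (l : List Point) : Set Point := ⋃ e ∈ edges l, segment ℝ e.1 e.2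

/-- The edge from `e.1` to `e.2` with its initial point and without its end point. -/
def halfOpenEdge (e : Point × Point) : Set Point :=
  (fun t : ℝ => AffineMap.lineMap e.1 e.2 t) '' Set.Ico 0 1

/-- The closed polygon has no self-intersection: running once through its edges visits no point
twice. -/
def IsSimple (l : List Point) : Prop :=
  3 ≤ l.length ∧
    (edges l).Pairwise (fun e f => Disjoint (halfOpenEdge e) (halfOpenEdge f))

/-- A (tame, unoriented) knot: a simple closed polygon in space. -/
def IsKnot (K : Set Point) : Prop := ∃ l : List Point, IsSimple l ∧ K = polygon l

/-- Triangle move: the segment `uv` of `K` is one side of a triangle `uvw` that meets `K` in no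
other point, and it is replaced by the other two sides. -/
def TriangleMove (K K' : Set Point) : Prop :=
  ∃ u v w : Point, AffineIndependent ℝ ![u, v, w] ∧
    convexHull ℝ {u, v, w} ∩ K = segment ℝ u v ∧
    K' = (K \ segment ℝ u v) ∪ (segment ℝ u w ∪ segment ℝ w v)

/-- Isotopy of polygonal knots and links: the equivalence relation generated by triangle moves. -/
def Isotopic (K K' : Set Point) : Prop := Relation.EqvGen TriangleMove K K'

/-- The trivial knot: isotopic to the knot determined by three noncollinear points. -/
def IsTrivial (K : Set Point) : Prop :=
  ∃ a b c : Point, AffineIndependent ℝ ![a, b, c] ∧ Isotopic K (polygon [a, b, c])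

/-- `K` is a connected sum of `J` and `L`: up to isotopy, `K` is a simple closed polygon that the
plane `x = 0` cuts in exactly two points `p` and `q`, into one arc on either side, and `J` and `L`
are obtained by closing up these two arcs with the straight segment from `p` to `q`. -/
def IsConnectedSum (J L K : Set Point) : Prop :=
  ∃ (p q : Point) (A B : List Point),
    p 0 = 0 ∧ q 0 = 0 ∧
    A ≠ [] ∧ (∀ a ∈ A, a 0 < 0) ∧ B ≠ [] ∧ (∀ b ∈ B, 0 < b 0) ∧
    IsSimple (p :: A ++ q :: B) ∧
    Isotopic K (polygon (p :: A ++ q :: B)) ∧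
    Isotopic J (polygon (p :: A ++ [q])) ∧
    Isotopic L (polygon (q :: B ++ [p]))

/-- A prime knot: a nontrivial knot that is a connected sum of two knots only if one of them is
trivial. -/
def IsPrimeKnot (K : Set Point) : Prop :=
  IsKnot K ∧ ¬ IsTrivial K ∧
    ∀ J L : Set Point, IsKnot J → IsKnot L → IsConnectedSum J L K → IsTrivial J ∨ IsTrivial L

/-! ### Closed braids -/

/-- A braid word on `n` strands: the letter `(i, true)` is the generator exchanging the neighbouring
strands in the positions `i` and `i + 1` (counted from `0`), and `(i, false)` is its inverse. The
number of crossings is the length of the list. -/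
abbrev BraidWord (n : ℕ) : Type := List (Fin (n - 1) × Bool)

/-- The part of the braid between the heights `y = k` and `y = k + 1` that carries the letter
`a`. The strands start and end at the points `(j, k, 0)` and `(j, k + 1, 0)`. With `i = a.1`, the
strand going from position `i` to position `i + 1` passes over (for `true`) or under (for `false`)
the strand going from `i + 1` to `i`, seen from `z = +∞`. All other strands are vertical. -/
def braidLayer (n k : ℕ) (a : Fin (n - 1) × Bool) : Set Point :=
  let i : ℝ := ((a.1 : ℕ) : ℝ)
  let mid : Point := ![i + 1 / 2, (k : ℝ) + 1 / 2, if a.2 then 1 else -1]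
  segment ℝ ![i, (k : ℝ), 0] mid ∪ segment ℝ mid ![i + 1, (k : ℝ) + 1, 0] ∪
    segment ℝ ![i + 1, (k : ℝ), 0] ![i, (k : ℝ) + 1, 0] ∪
    ⋃ j : Fin n, ⋃ _ : (j : ℕ) ≠ (a.1 : ℕ) ∧ (j : ℕ) ≠ (a.1 : ℕ) + 1,
      segment ℝ ![((j : ℕ) : ℝ), (k : ℝ), 0] ![((j : ℕ) : ℝ), (k : ℝ) + 1, 0]

/-- The arc joining the top end `(j, c, 0)` of a braid with `c` crossings to its bottom end
`(j, 0, 0)`; it runs behind the braid, inside the plane `x = j`. -/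
def closingArc (c j : ℕ) : Set Point :=
  segment ℝ ![(j : ℝ), (c : ℝ), 0] ![(j : ℝ), (c : ℝ) + 1, -2] ∪
    segment ℝ ![(j : ℝ), (c : ℝ) + 1, -2] ![(j : ℝ), -1, -2] ∪
    segment ℝ ![(j : ℝ), -1, -2] ![(j : ℝ), 0, 0]

/-- The closed braid of a braid word with `c` letters, as a polygonal link. All strands run in the
same direction around the axis `y = c / 2`, `z = -3 / 2`. -/
def closedBraid {n : ℕ} (β : BraidWord n) : Set Point :=
  (⋃ k : Fin β.length, braidLayer n k (β.get k)) ∪ ⋃ j : Fin n, closingArc β.length j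

/-- `K` is represented by the braid word `β`. -/
def Represents {n : ℕ} (β : BraidWord n) (K : Set Point) : Prop := Isotopic (closedBraid β) K

/-! ### Braid index, braid length and the functions `b_n`, `b_n'` -/

/-- The braid index `br(K)`: the minimum number of strands of a closed braid representing `K`. -/
def braidIndex (K : Set Point) : ℕ := sInf {n : ℕ | ∃ β : BraidWord n, Represents β K}

/-- The braid length `l(K)`: the minimum number of crossings of a closed braid representing `K`. -/
def braidLength (K : Set Point) : ℕ :=
  sInf {c : ℕ | ∃ (n : ℕ) (β : BraidWord n), Represents β K ∧ β.length = c}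

/-- `b_n(K)`: the minimum length of an `n`-strand braid representing `K`, for `n ≥ br(K)`. -/
def b (n : ℕ) (K : Set Point) : ℕ :=
  sInf {c : ℕ | ∃ β : BraidWord n, Represents β K ∧ β.length = c}

/-- `b_n'(K) = b_n(K) - n`, an integer (it equals `-1` for the trivial knot). -/
def b' (n : ℕ) (K : Set Point) : ℤ := (b n K : ℤ) - (n : ℤ)

end BraidStrands

end

namespace BraidStrands
open Set

/-! ### Segments -/

theorem segment_param {u v x : Point} :
    x ∈ segment ℝ u v ↔ ∃ t : ℝ, 0 ≤ t ∧ t ≤ 1 ∧ x = u + t • (v - u) := by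
  rw [segment_eq_image']
  constructor
  · rintro ⟨t, ⟨h0, h1⟩, rfl⟩; exact ⟨t, h0, h1, rfl⟩
  · rintro ⟨t, h0, h1, rfl⟩; exact ⟨t, ⟨h0, h1⟩, rfl⟩

theorem segment_union_segment {u v x : Point} (hx : x ∈ segment ℝ u v) :
    segment ℝ u x ∪ segment ℝ x v = segment ℝ u v := by
  apply Subset.antisymm
  · apply union_subset
    · exact (convex_segment u v).segment_subset (left_mem_segment ℝ u v) hx
    · exact (convex_segment u v).segment_subset hx (right_mem_segment ℝ u v)
  · intro p hp
    obtain ⟨t, ht0, ht1, rfl⟩ := segment_param.1 hx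
    obtain ⟨s, hs0, hs1, rfl⟩ := segment_param.1 hp
    rcases le_total s t with h | h
    · left
      rw [segment_param]
      rcases eq_or_lt_of_le ht0 with h0 | h0
      · exact ⟨0, le_rfl, zero_le_one, by
          have : s = 0 := by linarith
          simp [this]⟩
      · refine ⟨s / t, by positivity, by rw [div_le_one h0]; exact h, ?_⟩
        rw [add_sub_cancel_left, smul_smul, div_mul_cancel₀ _ h0.ne']
    · right
      rw [segment_param]
      rcases eq_or_lt_of_le ht1 with h0 | h0
      · exact ⟨0, le_rfl, zero_le_one, by
          have : s = t := by linarith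
          simp [this]⟩
      · have h1 : 0 < 1 - t := by linarith
        refine ⟨(s - t) / (1 - t), div_nonneg (by linarith) h1.le,
          by rw [div_le_one h1]; linarith, ?_⟩
        ext i
        simp only [Pi.add_apply, Pi.smul_apply, Pi.sub_apply, smul_eq_mul]
        field_simp
        ring

theorem segment_inter_segment {u v x : Point} (hx : x ∈ segment ℝ u v) :
    segment ℝ u x ∩ segment ℝ x v ⊆ {x} := by
  rintro p ⟨h1, h2⟩
  obtain ⟨t, ht0, ht1, rfl⟩ := segment_param.1 hx
  obtain ⟨s, hs0, hs1, rfl⟩ := segment_param.1 h1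
  obtain ⟨r, hr0, hr1, h⟩ := segment_param.1 h2
  by_cases huv : v - u = 0
  · simp [huv]
  have key : (s * t - t - r * (1 - t)) • (v - u) = 0 := by
    have : u + s • (u + t • (v - u) - u) - (u + t • (v - u) + r • (v - (u + t • (v - u)))) = 0 :=
      sub_eq_zero.2 h
    rw [← this]
    ext i
    simp only [Pi.add_apply, Pi.smul_apply, Pi.sub_apply, smul_eq_mul]
    ring
  have hk := (smul_eq_zero.1 key).resolve_right huv
  have h3 : s * t = t := by nlinarith [mul_nonneg hr0 (sub_nonneg.2 ht1)]
  rw [mem_singleton_iff, add_sub_cancel_left, smul_smul, h3]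

theorem isClosed_segment (u v : Point) : IsClosed (segment ℝ u v) := by
  rw [segment_eq_image_lineMap]
  exact (isCompact_Icc.image (by fun_prop)).isClosed

theorem isPreconnected_segment (u v : Point) : IsPreconnected (segment ℝ u v) :=
  (convex_segment u v).isPreconnected

theorem convex_segment_diff_left (u v : Point) : Convex ℝ (segment ℝ u v \ {u}) := by
  by_cases h : u = v
  · subst h
    rw [segment_same, sdiff_self]
    exact convex_empty
  · intro x hx y hy a b ha hb hab
    obtain ⟨s, hs0, hs1, rfl⟩ := segment_param.1 hx.1
    obtain ⟨t, ht0, ht1, rfl⟩ := segment_param.1 hy.1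
    refine ⟨convex_segment u v hx.1 hy.1 ha hb hab, ?_⟩
    have hs : s ≠ 0 := by rintro rfl; exact hx.2 (by simp)
    have ht : t ≠ 0 := by rintro rfl; exact hy.2 (by simp)
    have hs' : 0 < s := lt_of_le_of_ne hs0 hs.symm
    have ht' : 0 < t := lt_of_le_of_ne ht0 ht.symm
    have h2 : a • (u + s • (v - u)) + b • (u + t • (v - u)) = u + (a * s + b * t) • (v - u) := by
      have : a = 1 - b := by linarith
      subst this
      module
    rw [h2, mem_singleton_iff, add_eq_left, smul_eq_zero, not_or]
    refine ⟨?_, sub_ne_zero.2 (Ne.symm h)⟩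
    rcases eq_or_lt_of_le ha with h0 | h0
    · have : b = 1 := by linarith
      subst this; rw [← h0]; simpa using ht
    · have := mul_pos h0 hs'
      have := mul_nonneg hb ht0
      linarith

theorem isPreconnected_segment_diff_left (u v : Point) : IsPreconnected (segment ℝ u v \ {u}) :=
  (convex_segment_diff_left u v).isPreconnected

theorem isPreconnected_segment_diff_right (u v : Point) : IsPreconnected (segment ℝ u v \ {v}) := by
  rw [segment_symm]; exact isPreconnected_segment_diff_left v u

theorem isPreconnected_segment_diff (u v : Point) : IsPreconnected (segment ℝ u v \ {u, v}) := by
  have : segment ℝ u v \ {u, v} = (segment ℝ u v \ {u}) ∩ (segment ℝ v u \ {v}) := by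
    rw [segment_symm ℝ v u]; ext; simp; tauto
  rw [this]
  exact ((convex_segment_diff_left u v).inter (convex_segment_diff_left v u)).isPreconnected

/-! ### Polygonal arcs -/

/-- `S` is a simple polygonal arc from `u` to `v`. -/
inductive Arc : Point → Point → Set Point → Prop
  | seg {u v : Point} : u ≠ v → Arc u v (segment ℝ u v)
  | cons {u v w : Point} {S : Set Point} : u ≠ v → Arc v w S → segment ℝ u v ∩ S ⊆ {v} →
      Arc u w (segment ℝ u v ∪ S)

namespace Arc

variable {u v w x : Point} {S T : Set Point}

theorem left_mem (h : Arc u v S) : u ∈ S := by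
  cases h with
  | seg h => exact left_mem_segment ℝ _ _
  | cons h1 h2 h3 => exact Or.inl (left_mem_segment ℝ _ _)

theorem right_mem (h : Arc u v S) : v ∈ S := by
  induction h with
  | seg h => exact right_mem_segment ℝ _ _
  | cons h1 h2 h3 ih => exact Or.inr ih

theorem ne (h : Arc u v S) : u ≠ v := by
  cases h with
  | seg h => exact h
  | cons h1 h2 h3 =>
    rintro rfl
    exact h1 (h3 ⟨left_mem_segment ℝ _ _, h2.right_mem⟩)

theorem isClosed (h : Arc u v S) : IsClosed S := by
  induction h with
  | seg h => exact isClosed_segment _ _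
  | cons h1 h2 h3 ih => exact (isClosed_segment _ _).union ih

theorem isPreconnected (h : Arc u v S) : IsPreconnected S := by
  induction h with
  | seg h => exact isPreconnected_segment _ _
  | @cons u v w S h1 h2 h3 ih =>
    exact (isPreconnected_segment _ _).union v (right_mem_segment ℝ _ _) h2.left_mem ih

theorem isPreconnected_diff_right (h : Arc u v S) : IsPreconnected (S \ {v}) := by
  induction h with
  | seg h => exact isPreconnected_segment_diff_right _ _
  | @cons u v w S h1 h2 h3 ih =>
    have hw : w ∉ segment ℝ u v := fun hw => h2.ne (h3 ⟨hw, h2.right_mem⟩).symm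
    rw [union_sdiff_distrib, sdiff_singleton_eq_self hw]
    exact (isPreconnected_segment _ _).union v (right_mem_segment ℝ _ _) ⟨h2.left_mem, h2.ne⟩ ih

theorem isPreconnected_diff (h : Arc u v S) : IsPreconnected (S \ {u, v}) := by
  cases h with
  | seg h => exact isPreconnected_segment_diff _ _
  | @cons _ b _ S h1 h2 h3 =>
    have hw : v ∉ segment ℝ u b := fun hw => h2.ne (h3 ⟨hw, h2.right_mem⟩).symm
    have hu : u ∉ S := fun hu => h1 (h3 ⟨left_mem_segment ℝ _ _, hu⟩)
    have : (segment ℝ u b ∪ S) \ {u, v} = (segment ℝ u b \ {u}) ∪ (S \ {v}) := by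
      ext p
      simp only [mem_sdiff, mem_union, mem_insert_iff, mem_singleton_iff, not_or]
      constructor
      · tauto
      · rintro (⟨a, b⟩ | ⟨a, b⟩)
        · exact ⟨Or.inl a, b, fun h => hw (h ▸ a)⟩
        · exact ⟨Or.inr a, fun h => hu (h ▸ a), b⟩
    rw [this]
    exact (isPreconnected_segment_diff_left _ _).union b ⟨right_mem_segment ℝ _ _, h1.symm⟩
      ⟨h2.left_mem, h2.ne⟩ h2.isPreconnected_diff_right

theorem append (h : Arc u v S) (h' : Arc v w T) (hST : S ∩ T ⊆ {v}) : Arc u w (S ∪ T) := by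
  induction h with
  | seg h => exact cons h h' hST
  | @cons u v z S h1 h2 h3 ih =>
    rw [union_assoc]
    refine cons h1 (ih h' fun p hp => hST ⟨Or.inr hp.1, hp.2⟩) ?_
    rintro p ⟨hp, hp' | hp'⟩
    · exact h3 ⟨hp, hp'⟩
    · have := hST ⟨Or.inl hp, hp'⟩
      rw [mem_singleton_iff] at this
      subst this
      exact h3 ⟨hp, h2.right_mem⟩

theorem symm (h : Arc u v S) : Arc v u S := by
  induction h with
  | seg h => rw [segment_symm]; exact seg h.symm
  | @cons u v w S h1 h2 h3 ih =>
    rw [union_comm, segment_symm]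
    refine ih.append (seg h1.symm) ?_
    rw [segment_symm, inter_comm]
    exact h3

theorem split (h : Arc u v S) (hx : x ∈ S) (hu : x ≠ u) (hv : x ≠ v) :
    ∃ S₁ S₂, Arc u x S₁ ∧ Arc x v S₂ ∧ S₁ ∩ S₂ ⊆ {x} ∧ S = S₁ ∪ S₂ := by
  induction h with
  | @seg u v h =>
    exact ⟨_, _, seg hu.symm, seg hv, segment_inter_segment hx, (segment_union_segment hx).symm⟩
  | @cons u v w S h1 h2 h3 ih =>
    by_cases hxv : x = v
    · subst hxv
      exact ⟨_, _, seg h1, h2, h3, rfl⟩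
    rcases hx with hx | hx
    · refine ⟨segment ℝ u x, segment ℝ x v ∪ S, seg hu.symm, cons hxv h2 ?_, ?_, ?_⟩
      · rintro p ⟨hp, hp'⟩
        exact h3 ⟨(convex_segment u v).segment_subset hx (right_mem_segment ℝ _ _) hp, hp'⟩
      · rintro p ⟨hp, hp' | hp'⟩
        · exact segment_inter_segment hx ⟨hp, hp'⟩
        · have := h3 ⟨(convex_segment u v).segment_subset (left_mem_segment ℝ _ _) hx hp, hp'⟩
          rw [mem_singleton_iff] at this
          subst this
          exact segment_inter_segment hx ⟨hp, right_mem_segment ℝ _ _⟩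
      · rw [← union_assoc, segment_union_segment hx]
    · obtain ⟨S₁, S₂, a1, a2, a3, a4⟩ := ih hx hxv hv
      refine ⟨segment ℝ u v ∪ S₁, S₂, cons h1 a1 ?_, a2, ?_, by rw [union_assoc, a4]⟩
      · rintro p ⟨hp, hp'⟩
        exact h3 ⟨hp, a4 ▸ Or.inl hp'⟩
      · rintro p ⟨hp | hp, hp'⟩
        · have := h3 ⟨hp, a4 ▸ Or.inr hp'⟩
          rw [mem_singleton_iff] at this
          subst this
          exact a3 ⟨a1.left_mem, hp'⟩
        · exact a3 ⟨hp, hp'⟩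

/-- A connected subset of an arc that contains both end points is the whole arc. -/
theorem eq_of_subset (h : Arc u v S) (hT : IsPreconnected T) (hu : u ∈ T) (hv : v ∈ T)
    (hTS : T ⊆ S) : T = S := by
  refine Subset.antisymm hTS fun x hx => ?_
  by_contra hxT
  have hxu : x ≠ u := fun h => hxT (h ▸ hu)
  have hxv : x ≠ v := fun h => hxT (h ▸ hv)
  obtain ⟨S₁, S₂, a1, a2, a3, a4⟩ := h.split hx hxu hxv
  obtain ⟨y, hy, hy1, hy2⟩ := isPreconnected_closed_iff.1 hT S₁ S₂ a1.isClosed a2.isClosed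
    (a4 ▸ hTS) ⟨u, hu, a1.left_mem⟩ ⟨v, hv, a2.right_mem⟩
  have := a3 ⟨hy1, hy2⟩
  rw [mem_singleton_iff] at this
  exact hxT (this ▸ hy)

end Arc

/-! ### Polygonal loops -/

/-- `K` is a simple closed polygonal curve, cut into two arcs at `u` and `v`. -/
def LoopAt (u v : Point) (K : Set Point) : Prop :=
  ∃ S T, Arc u v S ∧ Arc v u T ∧ S ∩ T ⊆ {u, v} ∧ K = S ∪ T

theorem LoopAt.symm {u v : Point} {K : Set Point} (h : LoopAt u v K) : LoopAt v u K := by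
  obtain ⟨S, T, h1, h2, h3, h4⟩ := h
  exact ⟨T, S, h2, h1, by rw [inter_comm, pair_comm]; exact h3, by rw [h4, union_comm]⟩

theorem LoopAt.change_right {u v w : Point} {K : Set Point} (h : LoopAt u v K) (hw : w ∈ K)
    (hwu : w ≠ u) : LoopAt u w K := by
  obtain ⟨S, T, h1, h2, h3, rfl⟩ := h
  by_cases hwv : w = v
  · subst hwv; exact ⟨S, T, h1, h2, h3, rfl⟩
  have key : ∀ {S T : Set Point}, Arc u v S → Arc v u T → S ∩ T ⊆ {u, v} → w ∈ S →
      LoopAt u w (S ∪ T) := by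
    intro S T h1 h2 h3 hw
    obtain ⟨S₁, S₂, a1, a2, a3, rfl⟩ := h1.split hw hwu hwv
    have hu : u ∉ S₂ := fun hu => hwu (a3 ⟨a1.left_mem, hu⟩).symm
    have hv : v ∉ S₁ := fun hv => hwv (a3 ⟨hv, a2.right_mem⟩).symm
    refine ⟨S₁, S₂ ∪ T, a1, a2.append h2 ?_, ?_, union_assoc _ _ _⟩
    · rintro p ⟨hp, hp'⟩
      rcases h3 ⟨Or.inr hp, hp'⟩ with rfl | h
      · exact absurd hp hu
      · exact h
    · rintro p ⟨hp, hp' | hp'⟩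
      · exact Or.inr (a3 ⟨hp, hp'⟩)
      · rcases h3 ⟨Or.inl hp, hp'⟩ with rfl | h
        · exact Or.inl rfl
        · rw [mem_singleton_iff] at h
          subst h
          exact absurd hp hv
  rcases hw with hw | hw
  · exact key h1 h2 h3 hw
  · rw [union_comm]
    exact key h2.symm h1.symm (by rw [inter_comm]; exact h3) hw

/-- A simple closed polygonal curve. -/
def IsLoop (K : Set Point) : Prop := ∃ u v, LoopAt u v K

theorem IsLoop.loopAt {K : Set Point} (h : IsLoop K) {u v : Point} (hu : u ∈ K) (hv : v ∈ K)
    (huv : u ≠ v) : LoopAt u v K := by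
  obtain ⟨a, b, h⟩ := h
  by_cases hua : u = a
  · subst hua; exact h.change_right hv huv.symm
  · exact ((h.change_right hu hua).symm).change_right hv huv.symm

theorem IsLoop.isPreconnected {K : Set Point} (h : IsLoop K) : IsPreconnected K := by
  obtain ⟨a, b, S, T, h1, h2, -, rfl⟩ := h
  exact h1.isPreconnected.union a h1.left_mem h2.right_mem h2.isPreconnected

/-- An arc in a loop is one of the two arcs into which its end points cut the loop. -/
theorem IsLoop.exists_complementary_arc {K C : Set Point} {u v : Point} (h : IsLoop K)
    (hC : Arc u v C) (hCK : C ⊆ K) : ∃ T, Arc v u T ∧ C ∩ T ⊆ {u, v} ∧ K = C ∪ T := by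
  obtain ⟨S, T, h1, h2, h3, rfl⟩ := h.loopAt (hCK hC.left_mem) (hCK hC.right_mem) hC.ne
  have key : C ⊆ S ∨ C ⊆ T := by
    by_contra hcon
    push Not at hcon
    obtain ⟨hS, hT⟩ := hcon
    obtain ⟨x, hx, hxS⟩ := not_subset.1 hS
    obtain ⟨y, hy, hyT⟩ := not_subset.1 hT
    have hx' : x ∈ T := (hCK hx).resolve_left hxS
    have hy' : y ∈ S := (hCK hy).resolve_right hyT
    obtain ⟨z, hz, hz1, hz2⟩ := isPreconnected_closed_iff.1 hC.isPreconnected_diff S T h1.isClosed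
      h2.isClosed (sdiff_subset.trans hCK)
      ⟨y, ⟨hy, by
        rintro (rfl | rfl)
        · exact hyT h2.right_mem
        · exact hyT h2.left_mem⟩, hy'⟩
      ⟨x, ⟨hx, by
        rintro (rfl | rfl)
        · exact hxS h1.left_mem
        · exact hxS h1.right_mem⟩, hx'⟩
    exact hz.2 (h3 ⟨hz1, hz2⟩)
  rcases key with hk | hk
  · have := h1.eq_of_subset hC.isPreconnected hC.left_mem hC.right_mem hk
    subst this
    exact ⟨T, h2, h3, rfl⟩
  · have := h2.symm.eq_of_subset hC.isPreconnected hC.left_mem hC.right_mem hk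
    subst this
    exact ⟨S, h1.symm, by rw [inter_comm]; exact h3, union_comm _ _⟩

/-! ### Lists of vertices -/

/-- The open polygon with the given list of vertices. -/
def path : List Point → Set Point
  | [] => ∅
  | [a] => {a}
  | a :: b :: l => segment ℝ a b ∪ path (b :: l)

/-- The open polygon with the given list of vertices has no self-intersection. -/
def SimplePath : List Point → Prop
  | a :: b :: l => a ≠ b ∧ segment ℝ a b ∩ path (b :: l) ⊆ {b} ∧ SimplePath (b :: l)
  | _ => True

/-- The directed edges of an open polygon. -/
def pathEdges : List Point → List (Point × Point)
  | a :: b :: l => (a, b) :: pathEdges (b :: l)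
  | _ => []

theorem path_cons_cons (a b : Point) (l : List Point) :
    path (a :: b :: l) = segment ℝ a b ∪ path (b :: l) := rfl

theorem path_pair (a b : Point) : path [a, b] = segment ℝ a b := by
  simp only [path, union_singleton, insert_eq_self]
  exact right_mem_segment ℝ a b

theorem head_mem_path (a : Point) (l : List Point) : a ∈ path (a :: l) := by
  cases l with
  | nil => exact rfl
  | cons b l => exact Or.inl (left_mem_segment ℝ a b)

theorem mem_path_of_mem {a : Point} {l : List Point} (h : a ∈ l) : a ∈ path l := by
  induction l with
  | nil => simp at h
  | cons b l ih =>
    rcases List.mem_cons.1 h with rfl | h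
    · exact head_mem_path _ _
    · cases l with
      | nil => simp at h
      | cons c l => exact Or.inr (ih h)

theorem path_append (C D : List Point) (u : Point) :
    path (C ++ u :: D) = path (C ++ [u]) ∪ path (u :: D) := by
  induction C with
  | nil =>
    simp only [List.nil_append, path, singleton_union]
    exact (insert_eq_of_mem (head_mem_path u D)).symm
  | cons c C ih =>
    cases C with
    | nil => rw [List.cons_append, List.nil_append, path_cons_cons, List.cons_append,
        List.nil_append, path_pair]
    | cons d C =>
      simp only [List.cons_append, path_cons_cons] at ih ⊢
      rw [ih, union_assoc]

theorem isClosed_path (l : List Point) : IsClosed (path l) := by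
  induction l with
  | nil => exact isClosed_empty
  | cons a l ih =>
    cases l with
    | nil => exact isClosed_singleton
    | cons b l => exact (isClosed_segment a b).union ih

theorem pathEdges_eq_zip (u v : Point) (E : List Point) :
    pathEdges (u :: (E ++ [v])) = (u :: E).zip (E ++ [v]) := by
  induction E generalizing u with
  | nil => rfl
  | cons e E ih => simp only [List.cons_append, pathEdges, List.zip_cons_cons, ih]

theorem edges_cons (u : Point) (E : List Point) : edges (u :: E) = pathEdges (u :: (E ++ [u])) := by
  rw [pathEdges_eq_zip, edges]
  simp

theorem pathEdges_append (u v : Point) (C D : List Point) :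
    pathEdges (u :: (C ++ v :: D)) = pathEdges (u :: (C ++ [v])) ++ pathEdges (v :: D) := by
  induction C generalizing u with
  | nil => rfl
  | cons c C ih =>
    simp only [List.cons_append, pathEdges] at ih ⊢
    rw [ih]

theorem path_eq_iUnion (u v : Point) (C : List Point) :
    path (u :: (C ++ [v])) = ⋃ e ∈ pathEdges (u :: (C ++ [v])), segment ℝ e.1 e.2 := by
  induction C generalizing u with
  | nil =>
    rw [List.nil_append, path_pair]
    simp [pathEdges]
  | cons c C ih =>
    simp only [List.cons_append, path_cons_cons, pathEdges, ih]
    simp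

theorem polygon_cons (u : Point) (E : List Point) : polygon (u :: E) = path (u :: (E ++ [u])) := by
  rw [polygon, edges_cons, path_eq_iUnion]

theorem polygon_append (u v : Point) (C D : List Point) :
    polygon (u :: (C ++ v :: D)) = path (u :: (C ++ [v])) ∪ path (v :: (D ++ [u])) := by
  rw [polygon_cons, List.append_assoc, List.cons_append, ← List.cons_append, path_append,
    List.cons_append]

theorem mem_halfOpenEdge {e : Point × Point} {x : Point} :
    x ∈ halfOpenEdge e ↔ ∃ t : ℝ, 0 ≤ t ∧ t < 1 ∧ x = e.1 + t • (e.2 - e.1) := by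
  simp only [halfOpenEdge, mem_image, mem_Ico, AffineMap.lineMap_apply, vsub_eq_sub, vadd_eq_add]
  constructor
  · rintro ⟨t, ⟨h0, h1⟩, rfl⟩; exact ⟨t, h0, h1, add_comm _ _⟩
  · rintro ⟨t, h0, h1, rfl⟩; exact ⟨t, ⟨h0, h1⟩, add_comm _ _⟩

theorem left_mem_halfOpenEdge (u v : Point) : u ∈ halfOpenEdge (u, v) :=
  mem_halfOpenEdge.2 ⟨0, le_rfl, zero_lt_one, by simp⟩

theorem halfOpenEdge_eq {u v : Point} (h : u ≠ v) : halfOpenEdge (u, v) = segment ℝ u v \ {v} := by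
  ext x
  rw [mem_halfOpenEdge, mem_sdiff, segment_param]
  constructor
  · rintro ⟨t, h0, h1, rfl⟩
    refine ⟨⟨t, h0, h1.le, rfl⟩, fun hv => ?_⟩
    have : (1 - t) • (u - v) = 0 := by
      have h2 : u + t • (v - u) - v = 0 := sub_eq_zero.2 hv
      rw [← h2]; module
    rcases smul_eq_zero.1 this with h3 | h3
    · linarith
    · exact h (sub_eq_zero.1 h3)
  · rintro ⟨⟨t, h0, h1, rfl⟩, hv⟩
    refine ⟨t, h0, lt_of_le_of_ne h1 ?_, rfl⟩
    rintro rfl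
    exact hv (by simp)

theorem pairwise_pathEdges_and_iUnion_halfOpenEdge (u v : Point) (C : List Point) :
    (((pathEdges (u :: (C ++ [v]))).Pairwise
      (fun e f => Disjoint (halfOpenEdge e) (halfOpenEdge f)) ∧
      (∀ e ∈ pathEdges (u :: (C ++ [v])), v ∉ halfOpenEdge e)) ↔ SimplePath (u :: (C ++ [v]))) ∧
      (SimplePath (u :: (C ++ [v])) →
        ⋃ e ∈ pathEdges (u :: (C ++ [v])), halfOpenEdge e = path (u :: (C ++ [v])) \ {v}) := by
  induction C generalizing u with
  | nil =>
    have key : v ∉ halfOpenEdge (u, v) ↔ u ≠ v := by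
      constructor
      · rintro h rfl; exact h (left_mem_halfOpenEdge _ _)
      · intro h; rw [halfOpenEdge_eq h]; simp
    constructor
    · simp [pathEdges, SimplePath, path, key]
    · rintro ⟨h, -⟩
      rw [List.nil_append, path_pair]
      simp [pathEdges, halfOpenEdge_eq h]
  | cons c C ih =>
    obtain ⟨ih1, ih2⟩ := ih c
    simp only [List.cons_append, pathEdges, SimplePath, List.pairwise_cons, List.forall_mem_cons]
    have hc : ∃ d, (c, d) ∈ pathEdges (c :: (C ++ [v])) := by
      cases C with
      | nil => exact ⟨v, by simp [pathEdges]⟩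
      | cons d C => exact ⟨d, by simp [pathEdges]⟩
    obtain ⟨d, hd⟩ := hc
    have hvp : v ∈ path (c :: (C ++ [v])) := mem_path_of_mem (by simp)
    have hcp : c ∈ path (c :: (C ++ [v])) := head_mem_path _ _
    refine ⟨⟨?_, ?_⟩, ?_⟩
    · rintro ⟨⟨h1, h2⟩, h3, h4⟩
      have hs := ih1.1 ⟨h2, h4⟩
      have hU := ih2 hs
      have huc : u ≠ c := by
        rintro rfl
        exact disjoint_left.1 (h1 _ hd) (left_mem_halfOpenEdge _ _) (left_mem_halfOpenEdge _ _)
      refine ⟨huc, ?_, hs⟩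
      rintro p ⟨hp, hp'⟩
      by_contra hpc
      have hp1 : p ∈ halfOpenEdge (u, c) := by rw [halfOpenEdge_eq huc]; exact ⟨hp, hpc⟩
      by_cases hpv : p = v
      · exact h3 (hpv ▸ hp1)
      · have : p ∈ path (c :: (C ++ [v])) \ {v} := ⟨hp', hpv⟩
        rw [← hU] at this
        obtain ⟨e, he, hpe⟩ := mem_iUnion₂.1 this
        exact disjoint_left.1 (h1 e he) hp1 hpe
    · rintro ⟨huc, h2, hs⟩
      obtain ⟨h3, h4⟩ := ih1.2 hs
      have hU := ih2 hs
      refine ⟨⟨fun e he => disjoint_left.2 fun p hp hpe => ?_, h3⟩, fun hv => ?_, h4⟩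
      · rw [halfOpenEdge_eq huc] at hp
        have : p ∈ path (c :: (C ++ [v])) \ {v} := hU ▸ mem_iUnion₂.2 ⟨e, he, hpe⟩
        exact hp.2 (h2 ⟨hp.1, this.1⟩)
      · rw [halfOpenEdge_eq huc] at hv
        exact hv.2 (h2 ⟨hv.1, hvp⟩)
    · rintro ⟨huc, h2, hs⟩
      have hvc : v ∉ halfOpenEdge (u, c) := by
        rw [halfOpenEdge_eq huc]
        exact fun hv => hv.2 (h2 ⟨hv.1, hvp⟩)
      have hU := ih2 hs
      have hcv : c ≠ v := fun h => (ih1.2 hs).2 _ hd (h ▸ left_mem_halfOpenEdge _ _)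
      have : ⋃ e ∈ (u, c) :: pathEdges (c :: (C ++ [v])), halfOpenEdge e =
          halfOpenEdge (u, c) ∪ ⋃ e ∈ pathEdges (c :: (C ++ [v])), halfOpenEdge e := by simp
      rw [this, hU, path_cons_cons, halfOpenEdge_eq huc]
      rw [halfOpenEdge_eq huc] at hvc
      ext p
      simp only [mem_union, mem_sdiff, mem_singleton_iff] at hvc ⊢
      constructor
      · rintro (⟨h, h'⟩ | ⟨h, h'⟩)
        · exact ⟨Or.inl h, fun e => hvc ⟨e ▸ h, e ▸ h'⟩⟩
        · exact ⟨Or.inr h, h'⟩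
      · rintro ⟨h | h, h'⟩
        · by_cases hpc : p = c
          · exact Or.inr ⟨hpc ▸ hcp, h'⟩
          · exact Or.inl ⟨h, hpc⟩
        · exact Or.inr ⟨h, h'⟩

theorem simplePath_iff (u v : Point) (C : List Point) :
    ((pathEdges (u :: (C ++ [v]))).Pairwise (fun e f => Disjoint (halfOpenEdge e) (halfOpenEdge f)) ∧
      (∀ e ∈ pathEdges (u :: (C ++ [v])), v ∉ halfOpenEdge e)) ↔ SimplePath (u :: (C ++ [v])) :=
  (pairwise_pathEdges_and_iUnion_halfOpenEdge u v C).1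

theorem SimplePath.iUnion_halfOpenEdge {u v : Point} {C : List Point}
    (h : SimplePath (u :: (C ++ [v]))) :
    ⋃ e ∈ pathEdges (u :: (C ++ [v])), halfOpenEdge e = path (u :: (C ++ [v])) \ {v} :=
  (pairwise_pathEdges_and_iUnion_halfOpenEdge u v C).2 h

theorem isSimple_iff (u v : Point) (C D : List Point) (hCD : C ++ D ≠ []) :
    IsSimple (u :: (C ++ v :: D)) ↔ SimplePath (u :: (C ++ [v])) ∧ SimplePath (v :: (D ++ [u])) ∧
      path (u :: (C ++ [v])) ∩ path (v :: (D ++ [u])) ⊆ {u, v} := by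
  have hlen : 3 ≤ (u :: (C ++ v :: D)).length := by
    have : 0 < (C ++ D).length := List.length_pos_iff.2 hCD
    simp only [List.length_append, List.length_cons] at this ⊢
    omega
  rw [IsSimple, edges_cons, List.append_assoc, List.cons_append, pathEdges_append,
    List.pairwise_append, ← simplePath_iff u v C, ← simplePath_iff v u D]
  have hd : ∀ (u v : Point) (C : List Point), ∃ d, (u, d) ∈ pathEdges (u :: (C ++ [v])) := by
    intro u v C
    cases C with
    | nil => exact ⟨v, by simp [pathEdges]⟩
    | cons d C => exact ⟨d, by simp [pathEdges]⟩
  constructor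
  · rintro ⟨-, h1, h2, h3⟩
    have h4 : ∀ e ∈ pathEdges (u :: (C ++ [v])), v ∉ halfOpenEdge e := by
      intro e he hv
      obtain ⟨d, hd⟩ := hd v u D
      exact disjoint_left.1 (h3 e he _ hd) hv (left_mem_halfOpenEdge _ _)
    have h5 : ∀ e ∈ pathEdges (v :: (D ++ [u])), u ∉ halfOpenEdge e := by
      intro e he hv
      obtain ⟨d, hd⟩ := hd u v C
      exact disjoint_left.1 (h3 _ hd e he) (left_mem_halfOpenEdge _ _) hv
    have s1 := (simplePath_iff u v C).1 ⟨h1, h4⟩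
    have s2 := (simplePath_iff v u D).1 ⟨h2, h5⟩
    refine ⟨⟨h1, h4⟩, ⟨h2, h5⟩, ?_⟩
    rintro p ⟨hp, hp'⟩
    by_contra hcon
    simp only [mem_insert_iff, mem_singleton_iff, not_or] at hcon
    have e1 : p ∈ path (u :: (C ++ [v])) \ {v} := ⟨hp, hcon.2⟩
    have e2 : p ∈ path (v :: (D ++ [u])) \ {u} := ⟨hp', hcon.1⟩
    rw [← s1.iUnion_halfOpenEdge] at e1
    rw [← s2.iUnion_halfOpenEdge] at e2
    obtain ⟨e, he, hpe⟩ := mem_iUnion₂.1 e1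
    obtain ⟨f, hf, hpf⟩ := mem_iUnion₂.1 e2
    exact disjoint_left.1 (h3 e he f hf) hpe hpf
  · rintro ⟨⟨h1, h4⟩, ⟨h2, h5⟩, h6⟩
    have s1 := (simplePath_iff u v C).1 ⟨h1, h4⟩
    have s2 := (simplePath_iff v u D).1 ⟨h2, h5⟩
    refine ⟨hlen, h1, h2, fun e he f hf => disjoint_left.2 fun p hp hp' => ?_⟩
    have e1 : p ∈ path (u :: (C ++ [v])) \ {v} :=
      s1.iUnion_halfOpenEdge ▸ mem_iUnion₂.2 ⟨e, he, hp⟩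
    have e2 : p ∈ path (v :: (D ++ [u])) \ {u} :=
      s2.iUnion_halfOpenEdge ▸ mem_iUnion₂.2 ⟨f, hf, hp'⟩
    rcases h6 ⟨e1.1, e2.1⟩ with h | h
    · exact e2.2 h
    · exact e1.2 h

theorem edges_rotate (l : List Point) (n : ℕ) : edges (l.rotate n) = (edges l).rotate n := by
  simp only [edges, List.zip_eq_zipWith]
  rw [List.zipWith_rotate_distrib _ _ _ _ (by simp), List.rotate_rotate, List.rotate_rotate,
    add_comm]

theorem edges_append_perm (C D : List Point) : (edges (C ++ D)).Perm (edges (D ++ C)) := by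
  rw [← List.rotate_append_length_eq C D, edges_rotate]
  exact (List.rotate_perm _ _).symm

theorem polygon_append_comm (C D : List Point) : polygon (C ++ D) = polygon (D ++ C) := by
  ext x
  simp only [polygon, mem_iUnion, (edges_append_perm C D).mem_iff]

theorem isSimple_append_comm (C D : List Point) : IsSimple (C ++ D) ↔ IsSimple (D ++ C) := by
  rw [IsSimple, IsSimple, List.length_append, List.length_append, add_comm,
    (edges_append_perm C D).pairwise_iff fun h => h.symm]

theorem SimplePath.arc {u v : Point} {C : List Point} (h : SimplePath (u :: (C ++ [v]))) :
    Arc u v (path (u :: (C ++ [v]))) := by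
  induction C generalizing u with
  | nil => rw [List.nil_append, path_pair]; exact Arc.seg h.1
  | cons c C ih => exact Arc.cons h.1 (ih h.2.2) h.2.1

theorem Arc.exists_list {u v : Point} {S : Set Point} (h : Arc u v S) :
    ∃ C, SimplePath (u :: (C ++ [v])) ∧ S = path (u :: (C ++ [v])) := by
  induction h with
  | @seg u v h => exact ⟨[], ⟨h, by simp [path], trivial⟩, by simp [path_pair]⟩
  | @cons u v w S h1 h2 h3 ih =>
    obtain ⟨C, hC, rfl⟩ := ih
    exact ⟨v :: C, ⟨h1, h3, hC⟩, rfl⟩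

theorem not_arc_segments {u v : Point} (h : u ≠ v) : ¬ segment ℝ u v ⊆ {u, v} := by
  intro hs
  have hm : midpoint ℝ u v ∈ segment ℝ u v := midpoint_mem_segment u v
  rcases hs hm with h1 | h1
  · exact h ((midpoint_eq_left_iff ℝ).1 h1)
  · exact h ((midpoint_eq_right_iff ℝ).1 h1)

/-- Two arcs with common end points and no other common points make up a simple polygon. -/
theorem exists_isSimple {u v : Point} {S T : Set Point} (hS : Arc u v S) (hT : Arc v u T)
    (hST : S ∩ T ⊆ {u, v}) : ∃ C D, IsSimple (u :: (C ++ v :: D)) ∧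
      S = path (u :: (C ++ [v])) ∧ T = path (v :: (D ++ [u])) := by
  obtain ⟨C, hC, rfl⟩ := hS.exists_list
  obtain ⟨D, hD, rfl⟩ := hT.exists_list
  refine ⟨C, D, (isSimple_iff u v C D ?_).2 ⟨hC, hD, hST⟩, rfl, rfl⟩
  intro h
  obtain ⟨rfl, rfl⟩ := List.append_eq_nil_iff.1 h
  simp only [List.nil_append, path_pair, segment_symm ℝ v u, inter_self] at hST
  exact not_arc_segments hS.ne hST

theorem isKnot_iff_isLoop (K : Set Point) : IsKnot K ↔ IsLoop K := by
  constructor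
  · rintro ⟨l, hl, rfl⟩
    match l, hl with
    | u :: v :: w :: D, hl =>
      have := (isSimple_iff u v [] (w :: D) (by simp)).1 hl
      have h2 := polygon_append u v [] (w :: D)
      rw [List.nil_append] at h2
      exact ⟨u, v, _, _, this.1.arc, this.2.1.arc, this.2.2, h2⟩
    | [], hl => exact absurd hl.1 (by simp)
    | [_], hl => exact absurd hl.1 (by simp)
    | [_, _], hl => exact absurd hl.1 (by simp)
  · rintro ⟨u, v, S, T, h1, h2, h3, rfl⟩
    obtain ⟨C, D, h, rfl, rfl⟩ := exists_isSimple h1 h2 h3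
    exact ⟨_, h, (polygon_append _ _ _ _).symm⟩

/-! ### Triangles -/

theorem mem_triangle {u v w x : Point} : x ∈ convexHull ℝ {u, v, w} ↔
    ∃ a b c : ℝ, 0 ≤ a ∧ 0 ≤ b ∧ 0 ≤ c ∧ a + b + c = 1 ∧ x = a • u + b • v + c • w := by
  constructor
  · intro hx
    rw [convexHull_insert (by simp), mem_convexJoin] at hx
    obtain ⟨p, hp, q, hq, hx⟩ := hx
    rw [mem_singleton_iff] at hp
    subst hp
    rw [convexHull_pair] at hq
    obtain ⟨a, b, ha, hb, hab, rfl⟩ := hx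
    obtain ⟨c, d, hc, hd, hcd, rfl⟩ := hq
    refine ⟨a, b * c, b * d, ha, by positivity, by positivity, ?_, ?_⟩
    · rw [add_assoc, ← mul_add, hcd, mul_one, hab]
    · rw [smul_add, smul_smul, smul_smul, add_assoc]
  · rintro ⟨a, b, c, ha, hb, hc, h, rfl⟩
    have hconv := convex_convexHull ℝ ({u, v, w} : Set Point)
    have := hconv.sum_mem (t := Finset.univ) (w := ![a, b, c]) (z := ![u, v, w])
      (by intro i _; fin_cases i <;> simpa) (by simp [Fin.sum_univ_three, h])
      (by intro i _; fin_cases i <;> exact subset_convexHull ℝ _ (by simp))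
    simpa [Fin.sum_univ_three] using this

theorem triangle_left (u v w : Point) : segment ℝ u w ⊆ convexHull ℝ {u, v, w} :=
  segment_subset_convexHull (by simp) (by simp)

theorem triangle_right (u v w : Point) : segment ℝ w v ⊆ convexHull ℝ {u, v, w} :=
  segment_subset_convexHull (by simp) (by simp)

theorem triangle_base (u v w : Point) : segment ℝ u v ⊆ convexHull ℝ {u, v, w} :=
  segment_subset_convexHull (by simp) (by simp)

/-- A point of a triangle lies on the segment from a vertex to a point of the opposite side. -/
theorem exists_mem_segment_of_mem_triangle {u v w x : Point} (h : x ∈ convexHull ℝ {u, v, w}) :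
    ∃ y ∈ segment ℝ v w, x ∈ segment ℝ u y := by
  rw [convexHull_insert (by simp), mem_convexJoin] at h
  obtain ⟨p, hp, q, hq, hx⟩ := h
  rw [mem_singleton_iff] at hp
  subst hp
  rw [convexHull_pair] at hq
  exact ⟨q, hq, hx⟩

theorem affineIndependent_of_functional {u v w : Point} (huv : u ≠ v) (g : Point →ₗ[ℝ] ℝ)
    (h : g u = g v) (h' : g w ≠ g u) : AffineIndependent ℝ ![u, v, w] := by
  rw [affineIndependent_iff_not_collinear_set,
    collinear_iff_of_mem (p₀ := u) (by simp)]
  rintro ⟨d, hd⟩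
  obtain ⟨r, hr⟩ := hd v (by simp)
  obtain ⟨s, hs⟩ := hd w (by simp)
  rw [vadd_eq_add] at hr hs
  have hr0 : r ≠ 0 := by rintro rfl; exact huv (by simpa using hr.symm)
  have h1 : r * g d = 0 := by
    have := congrArg g hr
    rw [map_add, map_smul, smul_eq_mul] at this
    linarith
  have h2 : g d = 0 := (mul_eq_zero.1 h1).resolve_left hr0
  exact h' (by rw [hs, map_add, map_smul, h2]; simp)

theorem triangle_sides_inter {u v w : Point} (h : AffineIndependent ℝ ![u, v, w]) :
    segment ℝ u w ∩ segment ℝ w v ⊆ {w} := by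
  rintro p ⟨h1, h2⟩
  by_contra hpw
  rw [affineIndependent_iff_not_collinear_set] at h
  apply h
  obtain ⟨s, hs0, hs1, rfl⟩ := segment_param.1 h1
  obtain ⟨t, ht0, ht1, h3⟩ := segment_param.1 h2
  have hs : 1 - s ≠ 0 := by
    intro hs
    have : s = 1 := by linarith
    subst this
    exact hpw (by simp)
  rw [collinear_iff_of_mem (p₀ := w) (by simp)]
  refine ⟨v - w, ?_⟩
  have hu : u = (t / (1 - s)) • (v - w) + w := by
    have h4 : (1 - s) • u = t • (v - w) + (1 - s) • w := by
      have : u + s • (w - u) - s • w = w + t • (v - w) - s • w := by rw [h3]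
      calc (1 - s) • u = u + s • (w - u) - s • w := by module
        _ = _ := by rw [this]; module
    calc u = (1 - s)⁻¹ • ((1 - s) • u) := by rw [smul_smul, inv_mul_cancel₀ hs, one_smul]
      _ = _ := by
        rw [h4, smul_add, smul_smul, smul_smul, inv_mul_cancel₀ hs, one_smul, div_eq_inv_mul]
  rintro p (rfl | rfl | rfl)
  · exact ⟨_, hu⟩
  · exact ⟨1, by simp⟩
  · exact ⟨0, by simp⟩

theorem affineIndependent_ne {u v w : Point} (h : AffineIndependent ℝ ![u, v, w]) :
    u ≠ v ∧ u ≠ w ∧ v ≠ w := by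
  have hi := h.injective
  refine ⟨fun e => ?_, fun e => ?_, fun e => ?_⟩
  · exact absurd (@hi 0 1 e) (by decide)
  · exact absurd (@hi 0 2 e) (by decide)
  · exact absurd (@hi 1 2 e) (by decide)

/-! ### Isotopy -/

theorem Isotopic.refl (K : Set Point) : Isotopic K K := Relation.EqvGen.refl K

theorem Isotopic.symm {K L : Set Point} (h : Isotopic K L) : Isotopic L K :=
  Relation.EqvGen.symm _ _ h

theorem Isotopic.trans {K L M : Set Point} (h : Isotopic K L) (h' : Isotopic L M) : Isotopic K M :=
  Relation.EqvGen.trans _ _ _ h h'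

/-- Replacing a side of a triangle by the other two sides. -/
theorem isotopic_triangle {u v w : Point} {R : Set Point} (h : AffineIndependent ℝ ![u, v, w])
    (hR : R ∩ convexHull ℝ {u, v, w} ⊆ {u, v}) :
    Isotopic (R ∪ segment ℝ u v) (R ∪ (segment ℝ u w ∪ segment ℝ w v)) := by
  refine Relation.EqvGen.rel _ _ ⟨u, v, w, h, ?_, ?_⟩
  · ext p
    constructor
    · rintro ⟨h1, h2 | h2⟩
      · rcases hR ⟨h2, h1⟩ with rfl | rfl
        · exact left_mem_segment ℝ _ _
        · exact right_mem_segment ℝ _ _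
      · exact h2
    · intro hp
      exact ⟨triangle_base u v w hp, Or.inr hp⟩
  · ext p
    constructor
    · rintro (h1 | h1)
      · by_cases hp : p ∈ segment ℝ u v
        · rcases hR ⟨h1, triangle_base u v w hp⟩ with rfl | rfl
          · exact Or.inr (Or.inl (left_mem_segment ℝ _ _))
          · exact Or.inr (Or.inr (right_mem_segment ℝ _ _))
        · exact Or.inl ⟨Or.inl h1, hp⟩
      · exact Or.inr h1
    · rintro (⟨h1 | h1, h2⟩ | h1)
      · exact Or.inl h1
      · exact absurd h1 h2
      · exact Or.inr h1

/-- A triangle move on a knot, or resulting in a knot, changes one of the two arcs into which the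
end points of the side cut the knot. -/
theorem TriangleMove.exists_arc {K K' : Set Point} (h : TriangleMove K K')
    (hK : IsLoop K ∨ IsLoop K') :
    ∃ u v w T, AffineIndependent ℝ ![u, v, w] ∧ Arc v u T ∧ T ∩ convexHull ℝ {u, v, w} ⊆ {u, v} ∧
      K = segment ℝ u v ∪ T ∧ K' = (segment ℝ u w ∪ segment ℝ w v) ∪ T := by
  obtain ⟨u, v, w, hi, h1, h2⟩ := h
  obtain ⟨n1, n2, n3⟩ := affineIndependent_ne hi
  have hseg : segment ℝ u v ⊆ K := fun p hp => (h1 ▸ hp : p ∈ convexHull ℝ {u, v, w} ∩ K).2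
  rcases hK with hK | hK
  · obtain ⟨T, hT, h3, rfl⟩ := hK.exists_complementary_arc (Arc.seg n1) hseg
    have hTt : T ∩ convexHull ℝ {u, v, w} ⊆ {u, v} := fun p hp =>
      h3 ⟨h1 ▸ ⟨hp.2, Or.inr hp.1⟩, hp.1⟩
    refine ⟨u, v, w, T, hi, hT, hTt, rfl, ?_⟩
    rw [h2]
    ext p
    constructor
    · rintro (⟨h4 | h4, h5⟩ | h4)
      · exact absurd h4 h5
      · exact Or.inr h4
      · exact Or.inl h4
    · rintro (h4 | h4)
      · exact Or.inr h4
      · by_cases hp : p ∈ segment ℝ u v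
        · rcases h3 ⟨hp, h4⟩ with rfl | rfl
          · exact Or.inr (Or.inl (left_mem_segment ℝ _ _))
          · exact Or.inr (Or.inr (right_mem_segment ℝ _ _))
        · exact Or.inl ⟨Or.inr h4, hp⟩
  · have harc : Arc u v (segment ℝ u w ∪ segment ℝ w v) :=
      Arc.cons n2 (Arc.seg n3.symm) (triangle_sides_inter hi)
    obtain ⟨T, hT, h3, h4⟩ := hK.exists_complementary_arc harc (by rw [h2]; exact subset_union_right)
    have hTK : ∀ p ∈ T, p ∈ K ∨ p ∈ segment ℝ u w ∪ segment ℝ w v := by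
      intro p hp
      have : p ∈ K' := h4 ▸ Or.inr hp
      rw [h2] at this
      rcases this with h | h
      · exact Or.inl h.1
      · exact Or.inr h
    have hsub : segment ℝ u w ∪ segment ℝ w v ⊆ convexHull ℝ {u, v, w} :=
      union_subset (triangle_left u v w) (triangle_right u v w)
    have hTt : T ∩ convexHull ℝ {u, v, w} ⊆ {u, v} := by
      rintro p ⟨hp, hp'⟩
      apply h3
      refine ⟨?_, hp⟩
      have : p ∈ K' := h4 ▸ Or.inr hp
      rw [h2] at this
      rcases this with h | h
      · exact absurd (h1 ▸ ⟨hp', h.1⟩ : p ∈ segment ℝ u v) h.2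
      · exact h
    refine ⟨u, v, w, T, hi, hT, hTt, ?_, h4⟩
    ext p
    constructor
    · intro hp
      by_cases hps : p ∈ segment ℝ u v
      · exact Or.inl hps
      · have : p ∈ K' := by rw [h2]; exact Or.inl ⟨hp, hps⟩
        rw [h4] at this
        rcases this with h | h
        · exact absurd (h1 ▸ ⟨hsub h, hp⟩ : p ∈ segment ℝ u v) hps
        · exact Or.inr h
    · rintro (hp | hp)
      · exact hseg hp
      · rcases hTK p hp with h | h
        · exact h
        · rcases h3 ⟨h, hp⟩ with rfl | rfl
          · exact hseg (left_mem_segment ℝ _ _)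
          · exact hseg (right_mem_segment ℝ _ _)

theorem TriangleMove.isLoop_iff {K K' : Set Point} (h : TriangleMove K K') :
    IsLoop K ↔ IsLoop K' := by
  have key : IsLoop K ∨ IsLoop K' → IsLoop K ∧ IsLoop K' := by
    intro hK
    obtain ⟨u, v, w, T, hi, hT, hTt, rfl, rfl⟩ := h.exists_arc hK
    obtain ⟨n1, n2, n3⟩ := affineIndependent_ne hi
    refine ⟨⟨u, v, _, T, Arc.seg n1, hT, fun p hp => hTt ⟨hp.2, triangle_base u v w hp.1⟩, rfl⟩,
      ⟨u, v, _, T, Arc.cons n2 (Arc.seg n3.symm) (triangle_sides_inter hi), hT,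
        fun p hp => hTt ⟨hp.2, ?_⟩, rfl⟩⟩
    exact (union_subset (triangle_left u v w) (triangle_right u v w)) hp.1
  exact ⟨fun h => (key (Or.inl h)).2, fun h => (key (Or.inr h)).1⟩

theorem Isotopic.isLoop_iff {K K' : Set Point} (h : Isotopic K K') : IsLoop K ↔ IsLoop K' := by
  induction h with
  | rel K K' h => exact h.isLoop_iff
  | refl K => exact Iff.rfl
  | symm K K' _ ih => exact ih.symm
  | trans K L M _ _ ih1 ih2 => exact ih1.trans ih2

open Filter Topology

/-! ### Stability of simple polygons -/

theorem simplePath_append (C D : List Point) (u : Point) : SimplePath (C ++ u :: D) ↔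
    SimplePath (C ++ [u]) ∧ SimplePath (u :: D) ∧ path (C ++ [u]) ∩ path (u :: D) ⊆ {u} := by
  induction C with
  | nil =>
    simp only [List.nil_append]
    exact ⟨fun h => ⟨trivial, h, inter_subset_left⟩, fun h => h.2.1⟩
  | cons c C ih =>
    cases C with
    | nil =>
      simp only [List.cons_append, List.nil_append, SimplePath, path_pair]
      exact ⟨fun h => ⟨⟨h.1, by simp [path], trivial⟩, h.2.2, h.2.1⟩, fun h => ⟨h.1.1, h.2.2, h.2.1⟩⟩
    | cons d C =>
      simp only [List.cons_append] at ih ⊢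
      have hpath := path_append (d :: C) D u
      simp only [List.cons_append] at hpath
      rw [SimplePath, SimplePath, ih, hpath, path_cons_cons]
      have hu : u ∈ path (d :: (C ++ [u])) := mem_path_of_mem (by simp)
      constructor
      · rintro ⟨h1, h2, h3, h4, h5⟩
        refine ⟨⟨h1, fun p hp => h2 ⟨hp.1, Or.inl hp.2⟩, h3⟩, h4, ?_⟩
        rintro p ⟨hp | hp, hp'⟩
        · have := h2 ⟨hp, Or.inr hp'⟩
          rw [mem_singleton_iff] at this
          exact h5 ⟨this ▸ head_mem_path _ _, hp'⟩
        · exact h5 ⟨hp, hp'⟩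
      · rintro ⟨⟨h1, h2, h3⟩, h4, h5⟩
        refine ⟨h1, ?_, h3, h4, fun p hp => h5 ⟨Or.inr hp.1, hp.2⟩⟩
        rintro p ⟨hp, hp' | hp'⟩
        · exact h2 ⟨hp, hp'⟩
        · have := h5 ⟨Or.inl hp, hp'⟩
          rw [mem_singleton_iff] at this
          subst this
          exact h2 ⟨hp, hu⟩

/-- Simplicity of a polygon, in terms of one of its vertices and the remaining path. -/
theorem isSimple_vertex (y b a : Point) (E : List Point) :
    IsSimple (y :: b :: (E ++ [a])) ↔ SimplePath (b :: (E ++ [a])) ∧ y ≠ b ∧ y ≠ a ∧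
      segment ℝ y b ∩ path (b :: (E ++ [a])) ⊆ {b} ∧
      segment ℝ a y ∩ path (b :: (E ++ [a])) ⊆ {a} ∧ segment ℝ a y ∩ segment ℝ y b ⊆ {y} := by
  have h := isSimple_iff y a (b :: E) [] (by simp)
  simp only [List.cons_append, List.nil_append] at h
  rw [h, path_cons_cons, path_pair]
  have e1 : SimplePath (y :: b :: (E ++ [a])) ↔ y ≠ b ∧
      segment ℝ y b ∩ path (b :: (E ++ [a])) ⊆ {b} ∧ SimplePath (b :: (E ++ [a])) := Iff.rfl
  have e2 : SimplePath [a, y] ↔ a ≠ y := by simp [SimplePath, path]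
  rw [e1, e2]
  have ha : a ∈ path (b :: (E ++ [a])) := mem_path_of_mem (by simp)
  constructor
  · rintro ⟨⟨h1, h2, h3⟩, h4, h5⟩
    have hy : y ∉ path (b :: (E ++ [a])) := fun hy => h1 (h2 ⟨left_mem_segment ℝ _ _, hy⟩)
    have hab : a ∉ segment ℝ y b := fun hab => h3.arc.ne (h2 ⟨hab, ha⟩).symm
    refine ⟨h3, h1, h4.symm, h2, ?_, ?_⟩
    · rintro p ⟨hp, hp'⟩
      rcases h5 ⟨Or.inr hp', hp⟩ with rfl | h
      · exact absurd hp' hy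
      · exact h
    · rintro p ⟨hp, hp'⟩
      rcases h5 ⟨Or.inl hp', hp⟩ with rfl | h
      · rfl
      · rw [mem_singleton_iff] at h
        subst h
        exact absurd hp' hab
  · rintro ⟨h3, h1, h4, h2, h5, h6⟩
    refine ⟨⟨h1, h2, h3⟩, h4.symm, ?_⟩
    rintro p ⟨hp | hp, hp'⟩
    · exact Or.inl (h6 ⟨hp', hp⟩)
    · exact Or.inr (h5 ⟨hp', hp⟩)

theorem isSimple_iff_simplePath (y b a : Point) (E : List Point) :
    IsSimple (y :: b :: (E ++ [a])) ↔ SimplePath (y :: b :: (E ++ [a])) ∧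
      SimplePath (b :: E ++ a :: [y]) ∧ SimplePath [a, y, b] := by
  rw [isSimple_vertex, simplePath_append]
  simp only [SimplePath, path_pair, List.cons_append]
  have hp : path [y, b] = segment ℝ y b := path_pair y b
  have e : ∀ u v : Point, segment ℝ u v ∩ path [v] ⊆ {v} := fun u v p hp => hp.2
  constructor
  · rintro ⟨h3, h1, h4, h2, h5, h6⟩
    exact ⟨⟨h1, h2, h3⟩, ⟨h3, ⟨h4.symm, e _ _, trivial⟩, by rw [inter_comm]; exact h5⟩, h4.symm, h6,
      h1, e _ _, trivial⟩
  · rintro ⟨⟨h1, h2, h3⟩, ⟨-, -, h5⟩, h4, h6, -⟩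
    exact ⟨h3, h1, h4.symm, h2, by rw [inter_comm]; exact h5, h6⟩

theorem segment_inter_iff_not_sameRay (a b c : Point) :
    (a ≠ b ∧ b ≠ c ∧ segment ℝ a b ∩ segment ℝ b c ⊆ {b}) ↔ ¬ SameRay ℝ (a - b) (c - b) := by
  constructor
  · rintro ⟨h1, h2, h3⟩ h
    rcases h with h | h | ⟨r, s, hr, hs, h⟩
    · exact h1 (sub_eq_zero.1 h)
    · exact h2 (sub_eq_zero.1 h).symm
    · have hrs : 0 < r + s := by linarith
      have hm : b + (r / (r + s)) • (a - b) ∈ segment ℝ a b ∩ segment ℝ b c := by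
        constructor
        · rw [segment_symm, segment_param]
          exact ⟨r / (r + s), by positivity, by rw [div_le_one hrs]; linarith, rfl⟩
        · rw [segment_param]
          refine ⟨s / (r + s), by positivity, by rw [div_le_one hrs]; linarith, ?_⟩
          rw [div_eq_inv_mul, div_eq_inv_mul, mul_smul, mul_smul, h]
      have := h3 hm
      rw [mem_singleton_iff, add_eq_left, smul_eq_zero] at this
      rcases this with h | h
      · have : 0 < r / (r + s) := by positivity
        linarith
      · exact h1 (sub_eq_zero.1 h)
  · intro h
    refine ⟨?_, ?_, ?_⟩
    · rintro rfl; exact h (by simp)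
    · rintro rfl; exact h (by simp)
    · rintro p ⟨hp, hp'⟩
      by_contra hpb
      rw [segment_symm] at hp
      obtain ⟨s, hs0, hs1, rfl⟩ := segment_param.1 hp
      obtain ⟨t, ht0, ht1, h2⟩ := segment_param.1 hp'
      have h3 := add_left_cancel h2
      have hs : s ≠ 0 := by rintro rfl; exact hpb (by simp)
      have ht : t ≠ 0 := by rintro rfl; exact hpb (by rw [h2]; simp)
      exact h (Or.inr (Or.inr ⟨s, t, lt_of_le_of_ne hs0 hs.symm, lt_of_le_of_ne ht0 ht.symm, h3⟩))

theorem simplePath_cons_cons_cons (a b c : Point) (l : List Point) :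
    SimplePath (a :: b :: c :: l) ↔ ¬ SameRay ℝ (a - b) (c - b) ∧
      Disjoint (segment ℝ a b) (path (c :: l)) ∧ SimplePath (b :: c :: l) := by
  rw [← segment_inter_iff_not_sameRay, SimplePath, path_cons_cons]
  constructor
  · rintro ⟨h1, h2, h3⟩
    have hb : b ∉ path (c :: l) := fun hb => h3.1 (h3.2.1 ⟨left_mem_segment ℝ _ _, hb⟩)
    refine ⟨⟨h1, h3.1, fun p hp => h2 ⟨hp.1, Or.inl hp.2⟩⟩, disjoint_left.2 fun p hp hp' => ?_, h3⟩
    have := h2 ⟨hp, Or.inr hp'⟩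
    rw [mem_singleton_iff] at this
    exact hb (this ▸ hp')
  · rintro ⟨⟨h1, h2, h3⟩, h4, h5⟩
    refine ⟨h1, ?_, h5⟩
    rintro p ⟨hp, hp' | hp'⟩
    · exact h3 ⟨hp, hp'⟩
    · exact absurd hp' (disjoint_left.1 h4 hp)

/-- Two lists of points of the same length with corresponding points at distance less than `δ`. -/
def Close (δ : ℝ) : List Point → List Point → Prop := List.Forall₂ fun x y => dist x y < δ

theorem Close.mono {δ ε : ℝ} (h : δ ≤ ε) {l l' : List Point} (hl : Close δ l l') : Close ε l l' :=
  List.Forall₂.imp (fun _ _ h' => lt_of_lt_of_le h' h) hl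

theorem dist_combination_lt {δ s : ℝ} {a b a' b' : Point} (h0 : 0 ≤ s) (h1 : s ≤ 1)
    (ha : dist a a' < δ) (hb : dist b b' < δ) :
    dist (a + s • (b - a)) (a' + s • (b' - a')) < δ := by
  have hc := convex_ball (0 : Point) δ
  have ha' : a - a' ∈ Metric.ball (0 : Point) δ := by rwa [Metric.mem_ball, dist_zero_right, ← dist_eq_norm]
  have hb' : b - b' ∈ Metric.ball (0 : Point) δ := by rwa [Metric.mem_ball, dist_zero_right, ← dist_eq_norm]
  have := hc ha' hb' (sub_nonneg.2 h1) h0 (sub_add_cancel 1 s)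
  rw [Metric.mem_ball, dist_zero_right] at this
  rw [dist_eq_norm]
  have e : a + s • (b - a) - (a' + s • (b' - a')) = (1 - s) • (a - a') + s • (b - b') := by module
  rwa [e]

theorem Close.path_subset {δ : ℝ} {l l' : List Point} (h : Close δ l l') :
    path l' ⊆ Metric.thickening δ (path l) := by
  induction h with
  | nil => exact empty_subset _
  | @cons a a' l l' h hl ih =>
    cases hl with
    | nil =>
      intro p hp
      rw [Metric.mem_thickening_iff]
      exact ⟨a, rfl, by rw [show p = a' from hp, dist_comm]; exact h⟩
    | @cons b b' l l' hb hl =>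
      rintro p (hp | hp)
      · obtain ⟨t, h0, h1, rfl⟩ := segment_param.1 hp
        rw [Metric.mem_thickening_iff]
        refine ⟨a + t • (b - a), Or.inl (segment_param.2 ⟨t, h0, h1, rfl⟩), ?_⟩
        rw [dist_comm]
        exact dist_combination_lt h0 h1 h hb
      · exact Metric.thickening_subset_of_subset _ subset_union_right (ih hp)

theorem exists_close_disjoint {l m : List Point} (h : Disjoint (path l) (path m)) :
    ∃ δ > 0, ∀ l' m', Close δ l l' → Close δ m m' → Disjoint (path l') (path m') := by
  have hc : IsCompact (path l) := by
    induction l with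
    | nil => exact isCompact_empty
    | cons a l ih =>
      cases l with
      | nil => exact isCompact_singleton
      | cons b l =>
        rw [path_cons_cons, disjoint_union_left] at h
        refine IsCompact.union ?_ (ih h.2)
        rw [segment_eq_image_lineMap]
        exact isCompact_Icc.image (by fun_prop)
  obtain ⟨δ, hδ, hd⟩ := h.exists_thickenings hc (isClosed_path m)
  exact ⟨δ, hδ, fun l' m' hl hm => hd.mono hl.path_subset hm.path_subset⟩

theorem exists_close_not_sameRay {a b c : Point} (h : ¬ SameRay ℝ (a - b) (c - b)) :
    ∃ δ > 0, ∀ a' b' c', dist a a' < δ → dist b b' < δ → dist c c' < δ →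
      ¬ SameRay ℝ (a' - b') (c' - b') := by
  have ho : IsOpen {p : Point × Point × Point | ¬ SameRay ℝ (p.1 - p.2.1) (p.2.2 - p.2.1)} := by
    simp only [sameRay_iff_norm_smul_eq]
    exact isOpen_ne_fun (by fun_prop) (by fun_prop)
  obtain ⟨δ, hδ, hb⟩ := Metric.isOpen_iff.1 ho (a, b, c) h
  refine ⟨δ, hδ, fun a' b' c' ha hb' hc => ?_⟩
  have : (a', b', c') ∈ Metric.ball (a, b, c) δ := by
    rw [Metric.mem_ball, Prod.dist_eq, Prod.dist_eq]
    simp only [dist_comm] at ha hb' hc ⊢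
    exact max_lt ha (max_lt hb' hc)
  exact hb this

theorem SimplePath.exists_close {l : List Point} (h : SimplePath l) :
    ∃ δ > 0, ∀ l', Close δ l l' → SimplePath l' := by
  induction l with
  | nil =>
    refine ⟨1, one_pos, fun l' hl => ?_⟩
    cases hl
    trivial
  | cons a l ih =>
    match l, ih, h with
    | [], _, _ =>
      refine ⟨1, one_pos, fun l' hl => ?_⟩
      cases hl with | cons h1 h2 => cases h2; trivial
    | [b], _, h =>
      refine ⟨dist a b / 2, half_pos (dist_pos.2 h.1), fun l' hl => ?_⟩
      cases hl with
      | @cons _ a' _ _ h1 h2 =>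
        cases h2 with
        | @cons _ b' _ _ h2 h3 =>
          cases h3
          refine ⟨?_, fun p hp => hp.2, trivial⟩
          rintro rfl
          have := dist_triangle_right a b a'
          linarith
    | b :: c :: l, ih, h =>
      rw [simplePath_cons_cons_cons] at h
      obtain ⟨h1, h2, h3⟩ := h
      obtain ⟨δ₁, p1, q1⟩ := exists_close_not_sameRay h1
      rw [← path_pair] at h2
      obtain ⟨δ₂, p2, q2⟩ := exists_close_disjoint h2
      obtain ⟨δ₃, p3, q3⟩ := ih h3
      refine ⟨min δ₁ (min δ₂ δ₃), lt_min p1 (lt_min p2 p3), fun l' hl => ?_⟩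
      have l1 := hl.mono (min_le_left _ _)
      have l2 := hl.mono ((min_le_right _ _).trans (min_le_left _ _))
      have l3 := hl.mono ((min_le_right _ _).trans (min_le_right _ _))
      cases l1 with
      | @cons _ a' _ _ e1 l1 =>
        cases l1 with
        | @cons _ b' _ _ e2 l1 =>
          cases l1 with
          | @cons _ c' _ l' e3 l1 =>
            cases l2 with
            | cons f1 l2 =>
              cases l2 with
              | cons f2 l2 =>
                cases l3 with
                | cons g1 l3 =>
                  rw [simplePath_cons_cons_cons, ← path_pair]
                  exact ⟨q1 _ _ _ e1 e2 e3,
                    q2 [a', b'] (c' :: l') (List.Forall₂.cons f1 (List.Forall₂.cons f2 .nil)) l2,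
                    q3 _ l3⟩

theorem exists_eq_append_singleton {l : List Point} (h : 3 ≤ l.length) :
    ∃ y b a E, l = y :: b :: (E ++ [a]) := by
  match l, h with
  | y :: b :: c :: l, _ =>
    have h2 := List.dropLast_append_getLast (l := c :: l) (by simp)
    exact ⟨y, b, _, _, by rw [h2]⟩

theorem IsSimple.exists_close {l : List Point} (h : IsSimple l) :
    ∃ δ > 0, ∀ l', Close δ l l' → IsSimple l' := by
  obtain ⟨y, b, a, E, rfl⟩ := exists_eq_append_singleton h.1
  rw [isSimple_iff_simplePath] at h
  obtain ⟨h1, h2, h3⟩ := h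
  obtain ⟨δ₁, p1, q1⟩ := h1.exists_close
  obtain ⟨δ₂, p2, q2⟩ := h2.exists_close
  obtain ⟨δ₃, p3, q3⟩ := h3.exists_close
  refine ⟨min δ₁ (min δ₂ δ₃), lt_min p1 (lt_min p2 p3), fun l' hl => ?_⟩
  have hlen : 3 ≤ l'.length := by rw [← hl.length_eq]; simp
  obtain ⟨y', b', a', E', rfl⟩ := exists_eq_append_singleton hlen
  rw [isSimple_iff_simplePath]
  have e1 : dist y y' < min δ₁ (min δ₂ δ₃) := (List.forall₂_cons.1 hl).1
  have e2 := (List.forall₂_cons.1 hl).2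
  have e3 : dist b b' < min δ₁ (min δ₂ δ₃) := (List.forall₂_cons.1 e2).1
  have e4 := (List.forall₂_cons.1 e2).2
  have hE : E.length = E'.length := by
    have := e4.length_eq
    simpa using this
  have e5 : List.Forall₂ (fun x y => dist x y < min δ₁ (min δ₂ δ₃)) E E' ∧
      List.Forall₂ (fun x y => dist x y < min δ₁ (min δ₂ δ₃)) [a] [a'] := by
    have t := List.forall₂_take E.length e4
    have d := List.forall₂_drop E.length e4
    rw [List.take_left, hE, List.take_left] at t
    rw [List.drop_left, hE, List.drop_left] at d
    exact ⟨t, d⟩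
  obtain ⟨e5, e6⟩ := e5
  have e7 : dist a a' < min δ₁ (min δ₂ δ₃) := (List.forall₂_cons.1 e6).1
  have l2 : min δ₁ (min δ₂ δ₃) ≤ δ₂ := (min_le_right _ _).trans (min_le_left _ _)
  have l3 : min δ₁ (min δ₂ δ₃) ≤ δ₃ := (min_le_right _ _).trans (min_le_right _ _)
  refine ⟨q1 _ (hl.mono (min_le_left _ _)), q2 _ (Close.mono l2 ?_), q3 _ (Close.mono l3 ?_)⟩
  · exact List.Forall₂.cons e3 (List.rel_append e5 (List.Forall₂.cons e7 (List.Forall₂.cons e1 .nil)))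
  · exact List.Forall₂.cons e7 (List.Forall₂.cons e1 (List.Forall₂.cons e3 .nil))

/-! ### Moving the vertices of a polygon -/

theorem affineIndependent_swap {u v w : Point} (h : AffineIndependent ℝ ![u, v, w]) :
    AffineIndependent ℝ ![u, w, v] := by
  rw [affineIndependent_iff_not_collinear_set] at h ⊢
  rwa [pair_comm w v]

theorem affineIndependent_swap' {u v w : Point} (h : AffineIndependent ℝ ![u, v, w]) :
    AffineIndependent ℝ ![v, u, w] := by
  rw [affineIndependent_iff_not_collinear_set] at h ⊢
  rwa [insert_comm]

theorem polygon_vertex (y b a : Point) (E : List Point) :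
    polygon (y :: b :: (E ++ [a])) = segment ℝ y b ∪ path (b :: (E ++ [a])) ∪ segment ℝ a y := by
  have := polygon_append y a (b :: E) []
  simp only [List.cons_append, List.nil_append] at this
  rw [this, path_cons_cons, path_pair]

theorem map_combination {g : Point →ₗ[ℝ] ℝ} {u v x : Point} (hx : x ∈ segment ℝ u v)
    (h : g u = g v) : g x = g u := by
  obtain ⟨t, -, -, rfl⟩ := segment_param.1 hx
  rw [map_add, map_smul, map_sub, h, sub_self, smul_zero, add_zero]

theorem isotopic_of_functional {v x b a : Point} {E : List Point} {B : Set Point}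
    (hB : Convex ℝ B) (hv : v ∈ B) (hx : x ∈ B) (hs : ∀ y ∈ B, IsSimple (y :: b :: (E ++ [a])))
    (g : Point →ₗ[ℝ] ℝ) (ha : g a = g v) (hb : g b = g v) (hg : g x ≠ g v) :
    Isotopic (polygon (v :: b :: (E ++ [a]))) (polygon (x :: b :: (E ++ [a]))) := by
  obtain ⟨-, v1, v2, -, -, v5⟩ := (isSimple_vertex _ _ _ _).1 (hs v hv)
  have hvx : segment ℝ v x ⊆ B := hB.segment_subset hv hx
  have step1 : Isotopic (path (b :: (E ++ [a])) ∪ segment ℝ a v ∪ segment ℝ v b)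
      (path (b :: (E ++ [a])) ∪ segment ℝ a v ∪ (segment ℝ v x ∪ segment ℝ x b)) := by
    refine isotopic_triangle (affineIndependent_of_functional v1 g hb.symm hg) ?_
    rintro p ⟨hp | hp, hp'⟩
    · rw [insert_comm] at hp'
      obtain ⟨y, hy, hpy⟩ := exists_mem_segment_of_mem_triangle hp'
      obtain ⟨-, -, -, h, -, -⟩ := (isSimple_vertex _ _ _ _).1 (hs y (hvx hy))
      rw [segment_symm] at hpy
      exact Or.inr (h ⟨hpy, hp⟩)
    · obtain ⟨α, β, γ, hα, hβ, hγ, hsum, rfl⟩ := mem_triangle.1 hp'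
      have h1 := map_combination hp ha
      rw [map_add, map_add, map_smul, map_smul, map_smul, smul_eq_mul, smul_eq_mul, smul_eq_mul,
        hb, ha] at h1
      have h2 : γ * (g x - g v) = 0 := by
        have : α = 1 - β - γ := by linarith
        subst this
        linarith
      have h3 : γ = 0 := (mul_eq_zero.1 h2).resolve_right (sub_ne_zero.2 hg)
      subst h3
      refine Or.inl (v5 ⟨hp, ?_⟩)
      exact ⟨α, β, hα, hβ, by linarith, by simp⟩
  have step2 : Isotopic (path (b :: (E ++ [a])) ∪ segment ℝ x b ∪ segment ℝ a x)
      (path (b :: (E ++ [a])) ∪ segment ℝ x b ∪ (segment ℝ a v ∪ segment ℝ v x)) := by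
    refine isotopic_triangle (affineIndependent_swap
      (affineIndependent_of_functional v2.symm g ha (by rwa [ha]))) ?_
    rintro p ⟨hp | hp, hp'⟩
    · obtain ⟨y, hy, hpy⟩ := exists_mem_segment_of_mem_triangle hp'
      rw [segment_symm] at hy
      obtain ⟨-, -, -, -, h, -⟩ := (isSimple_vertex _ _ _ _).1 (hs y (hvx hy))
      exact Or.inl (h ⟨hpy, hp⟩)
    · obtain ⟨α, β, γ, hα, hβ, hγ, hsum, h0⟩ := mem_triangle.1 hp'
      obtain ⟨s, hs0, hs1, rfl⟩ := segment_param.1 hp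
      have h1 := congrArg g h0
      simp only [map_add, map_smul, map_sub, smul_eq_mul, hb, ha] at h1
      have h2 : (1 - s - β) * (g x - g v) = 0 := by
        have : α = 1 - β - γ := by linarith
        subst this
        linarith
      have h3 := (mul_eq_zero.1 h2).resolve_right (sub_ne_zero.2 hg)
      have h4 : β = 1 - s := by linarith
      subst h4
      by_cases hs : s = 0
      · subst hs; simp
      · have h5 : s • b = α • a + γ • v := by
          have : s • b = x + s • (b - x) - (1 - s) • x := by module
          rw [this, h0]; module
        have hs' : 0 < s := lt_of_le_of_ne hs0 (Ne.symm hs)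
        have h6 : b ∈ segment ℝ a v := by
          refine ⟨α / s, γ / s, by positivity, by positivity, ?_, ?_⟩
          · rw [← add_div, div_eq_one_iff_eq hs]; linarith
          · calc (α / s) • a + (γ / s) • v = s⁻¹ • (α • a + γ • v) := by
                  rw [smul_add, smul_smul, smul_smul, div_eq_inv_mul, div_eq_inv_mul]
              _ = b := by rw [← h5, smul_smul, inv_mul_cancel₀ hs, one_smul]
        exact absurd (v5 ⟨h6, right_mem_segment ℝ _ _⟩).symm v1
  rw [polygon_vertex, polygon_vertex]
  have e1 : segment ℝ v b ∪ path (b :: (E ++ [a])) ∪ segment ℝ a v =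
      path (b :: (E ++ [a])) ∪ segment ℝ a v ∪ segment ℝ v b := by
    ext; simp only [mem_union]; tauto
  have e2 : segment ℝ x b ∪ path (b :: (E ++ [a])) ∪ segment ℝ a x =
      path (b :: (E ++ [a])) ∪ segment ℝ x b ∪ segment ℝ a x := by
    ext; simp only [mem_union]; tauto
  have e3 : path (b :: (E ++ [a])) ∪ segment ℝ a v ∪ (segment ℝ v x ∪ segment ℝ x b) =
      path (b :: (E ++ [a])) ∪ segment ℝ x b ∪ (segment ℝ a v ∪ segment ℝ v x) := by
    ext; simp only [mem_union]; tauto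
  rw [e1, e2]
  exact step1.trans (e3 ▸ step2.symm)

theorem exists_functional (a b v : Point) :
    ∃ g : Point →ₗ[ℝ] ℝ, g ≠ 0 ∧ g a = g v ∧ g b = g v := by
  have hlt : Submodule.span ℝ {a - v, b - v} < ⊤ := by
    rw [lt_top_iff_ne_top]
    intro h
    have h1 := finrank_span_le_card (R := ℝ) ({a - v, b - v} : Set Point)
    rw [h, finrank_top, Module.finrank_fin_fun] at h1
    have h2 : ({a - v, b - v} : Set Point).toFinset.card ≤ 2 := by
      rw [toFinset_insert, toFinset_singleton]
      exact Finset.card_le_two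
    omega
  obtain ⟨g, hg, hle⟩ := Submodule.exists_le_ker_of_lt_top _ hlt
  refine ⟨g, hg, ?_, ?_⟩
  · have : a - v ∈ LinearMap.ker g := hle (Submodule.subset_span (by simp))
    rw [LinearMap.mem_ker, map_sub] at this
    linarith
  · have : b - v ∈ LinearMap.ker g := hle (Submodule.subset_span (by simp))
    rw [LinearMap.mem_ker, map_sub] at this
    linarith

theorem isotopic_vertex {v x : Point} {D : List Point} {B : Set Point}
    (hB : Convex ℝ B) (hBo : IsOpen B) (hv : v ∈ B) (hx : x ∈ B)
    (hs : ∀ y ∈ B, IsSimple (y :: D)) : Isotopic (polygon (v :: D)) (polygon (x :: D)) := by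
  obtain ⟨b, a, E, rfl⟩ : ∃ b a E, D = b :: (E ++ [a]) := by
    obtain ⟨y, b, a, E, h⟩ := exists_eq_append_singleton (hs v hv).1
    exact ⟨b, a, E, (List.cons.inj h).2⟩
  obtain ⟨g, hg, ga, gb⟩ := exists_functional a b v
  obtain ⟨g', hg', ga', gb'⟩ := exists_functional a b x
  obtain ⟨z, hz, hz'⟩ : ∃ z, g z ≠ 0 ∧ g' z ≠ 0 := by
    by_contra hcon
    push Not at hcon
    obtain ⟨z1, h1⟩ : ∃ z, g z ≠ 0 := by
      by_contra h; push Not at h; exact hg (LinearMap.ext h)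
    obtain ⟨z2, h2⟩ : ∃ z, g' z ≠ 0 := by
      by_contra h; push Not at h; exact hg' (LinearMap.ext h)
    have h3 := hcon z1 h1
    have h4 : g z2 = 0 := by by_contra h; exact h2 (hcon z2 h)
    have h5 := hcon (z1 + z2) (by rw [map_add, h4, add_zero]; exact h1)
    rw [map_add, h3, zero_add] at h5
    exact h2 h5
  have e1 : ∀ᶠ t : ℝ in 𝓝[≠] 0, v + t • z ∈ B := by
    have : Tendsto (fun t : ℝ => v + t • z) (𝓝 0) (𝓝 (v + (0 : ℝ) • z)) :=
      Continuous.tendsto (by fun_prop) 0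
    rw [zero_smul, add_zero] at this
    exact (this.eventually (hBo.mem_nhds hv)).filter_mono nhdsWithin_le_nhds
  have e2 : ∀ᶠ t : ℝ in 𝓝[≠] 0, t ≠ (g' x - g' v) / g' z := by
    by_cases h0 : (g' x - g' v) / g' z = 0
    · rw [h0]; exact eventually_mem_nhdsWithin
    · exact (eventually_ne_nhds (Ne.symm h0)).filter_mono nhdsWithin_le_nhds
  have e3 : ∀ᶠ t : ℝ in 𝓝[≠] 0, t ≠ 0 := eventually_mem_nhdsWithin
  obtain ⟨t, h1, h2, h3⟩ := (e1.and (e2.and e3)).exists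
  refine (isotopic_of_functional hB hv h1 hs g ga gb ?_).trans
    (isotopic_of_functional hB hx h1 hs g' ga' gb' ?_).symm
  · rw [map_add, map_smul, smul_eq_mul]
    intro h
    exact (mul_ne_zero h3 hz) (by linarith)
  · rw [map_add, map_smul, smul_eq_mul]
    intro h
    exact h2 (by rw [eq_div_iff hz']; linarith)

theorem Close.refl {δ : ℝ} (hδ : 0 < δ) (l : List Point) : Close δ l l := by
  induction l with
  | nil => exact List.Forall₂.nil
  | cons a l ih => exact List.Forall₂.cons (by rwa [dist_self]) ih

theorem isotopic_of_close {l l' : List Point} {δ : ℝ} (hδ : 0 < δ)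
    (hs : ∀ l', Close δ l l' → IsSimple l') (hl : Close δ l l') :
    Isotopic (polygon l) (polygon l') := by
  suffices h : ∀ (s s' p p' : List Point), Close δ s s' → Close δ p p' → p ++ s = l →
      Isotopic (polygon (p' ++ s)) (polygon (p' ++ s')) from
    h l l' [] [] hl .nil rfl
  intro s
  induction s with
  | nil =>
    intro s' p p' h _ _
    cases h
    exact Isotopic.refl _
  | cons v s ih =>
    intro s' p p' h hp hps
    cases h with
    | @cons _ v' _ s' hv h =>
      have h1 : Isotopic (polygon (p' ++ v :: s)) (polygon (p' ++ v' :: s)) := by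
        rw [polygon_append_comm p', polygon_append_comm p', List.cons_append, List.cons_append]
        refine isotopic_vertex (convex_ball v δ) Metric.isOpen_ball (Metric.mem_ball_self hδ)
          (by rw [Metric.mem_ball, dist_comm]; exact hv) fun y hy => ?_
        rw [← List.cons_append, isSimple_append_comm]
        apply hs
        rw [← hps]
        refine List.rel_append hp (List.Forall₂.cons ?_ (Close.refl hδ s))
        rw [dist_comm]; exact hy
      refine h1.trans ?_
      have := ih s' (p ++ [v]) (p' ++ [v']) h (List.rel_append hp (List.Forall₂.cons hv .nil))
        (by simpa using hps)
      simpa using this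

/-- If the vertices of a polygon move continuously, and the polygon is simple at all times, then
its final position is isotopic to its initial position. -/
theorem isotopic_of_motion (fs : List (ℝ → Point)) (hc : ∀ f ∈ fs, ContinuousOn f (Icc 0 1))
    (hs : ∀ t ∈ Icc (0 : ℝ) 1, IsSimple (fs.map fun f => f t)) :
    Isotopic (polygon (fs.map fun f => f 0)) (polygon (fs.map fun f => f 1)) := by
  let r : Setoid (Set Point) := ⟨Isotopic, Isotopic.refl, Isotopic.symm, Isotopic.trans⟩
  let c : Icc (0 : ℝ) 1 → Quotient r := fun t => Quotient.mk r (polygon (fs.map fun f => f t))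
  have hlc : IsLocallyConstant c := by
    rw [IsLocallyConstant.iff_eventually_eq]
    intro t
    obtain ⟨δ, hδ, h⟩ := (hs t t.2).exists_close
    have hev : ∀ᶠ y : Icc (0 : ℝ) 1 in 𝓝 t, Close δ (fs.map fun f => f t) (fs.map fun f => f y) := by
      clear h c hs
      induction fs with
      | nil => exact Eventually.of_forall fun _ => List.Forall₂.nil
      | cons f fs ih =>
        have h1 : Continuous fun y : Icc (0 : ℝ) 1 => f y :=
          continuousOn_iff_continuous_domRestrict.1 (hc f (by simp))
        have h2 : ∀ᶠ y : Icc (0 : ℝ) 1 in 𝓝 t, dist (f t) (f y) < δ := by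
          have := (h1.tendsto t).eventually (Metric.ball_mem_nhds (f t) hδ)
          filter_upwards [this] with y hy
          rw [dist_comm]; exact hy
        filter_upwards [h2, ih fun f hf => hc f (by simp [hf])] with y h3 h4
        exact List.Forall₂.cons h3 h4
    filter_upwards [hev] with y hy
    exact Quotient.sound (Isotopic.symm (isotopic_of_close hδ h hy))
  exact Quotient.exact (hlc.apply_eq_of_preconnectedSpace ⟨0, by simp⟩ ⟨1, by simp⟩)

theorem edges_map (l : List Point) (f : Point → Point) :
    edges (l.map f) = (edges l).map (Prod.map f f) := by
  rw [edges, edges, ← List.map_rotate, List.zip_map]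

theorem polygon_map (l : List Point) (f : Point →ᵃ[ℝ] Point) :
    polygon (l.map f) = f '' polygon l := by
  rw [polygon, edges_map, polygon]
  simp only [image_iUnion, List.mem_map, iUnion_exists, biUnion_and', iUnion_iUnion_eq_right,
    Prod.map_fst, Prod.map_snd]
  refine iUnion_congr fun e => iUnion_congr fun _ => ?_
  exact (image_segment ℝ f _ _).symm

theorem isSimple_map {l : List Point} (h : IsSimple l) (f : Point →ᵃ[ℝ] Point)
    (hf : Function.Injective f) : IsSimple (l.map f) := by
  refine ⟨by simpa using h.1, ?_⟩
  rw [edges_map, List.pairwise_map]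
  refine h.2.imp fun {e e'} hd => ?_
  have key : ∀ e : Point × Point, halfOpenEdge (Prod.map f f e) = f '' halfOpenEdge e := by
    intro e
    rw [halfOpenEdge, halfOpenEdge, image_image]
    refine image_congr fun t _ => ?_
    simp [AffineMap.apply_lineMap]
  rw [key, key]
  exact (disjoint_image_iff hf).2 hd

/-- A continuous path of affine bijections, starting at the identity, moves a knot to an isotopic
one. -/
theorem isotopic_of_affine_path (F : ℝ → Point →ᵃ[ℝ] Point) (hinj : ∀ t, Function.Injective (F t))
    (hc : ∀ x, Continuous fun t => F t x) (h0 : F 0 = AffineMap.id ℝ Point) {K : Set Point}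
    (hK : IsKnot K) : Isotopic K (F 1 '' K) := by
  obtain ⟨l, hl, rfl⟩ := hK
  have := isotopic_of_motion (l.map fun x t => F t x) (by
      intro f hf
      obtain ⟨x, -, rfl⟩ := List.mem_map.1 hf
      exact (hc x).continuousOn)
    (fun t _ => by
      rw [List.map_map]
      exact isSimple_map hl (F t) (hinj t))
  rw [List.map_map, List.map_map] at this
  have e0 : (l.map ((fun f : ℝ → Point => f 0) ∘ fun x t => F t x)) = l := by
    conv_rhs => rw [← List.map_id l]
    refine List.map_congr_left fun x _ => ?_
    simp [h0]
  rw [e0] at this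
  rw [← polygon_map]
  exact this

theorem isotopic_translate {K : Set Point} (hK : IsKnot K) (v : Point) :
    Isotopic K ((fun x => x + v) '' K) := by
  have := isotopic_of_affine_path
    (fun t => AffineMap.id ℝ Point + AffineMap.const ℝ Point (t • v))
    (fun t x y h => by simpa using h)
    (fun x => by simp only [AffineMap.coe_add, AffineMap.coe_const, Pi.add_apply]; fun_prop)
    (by ext; simp) hK
  rw [one_smul] at this
  exact this

/-! ### Beads: arcs between two parallel planes -/

theorem path_reverse (l : List Point) : path l.reverse = path l := by
  induction l with
  | nil => rfl
  | cons a l ih =>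
    cases l with
    | nil => rfl
    | cons b l =>
      rw [List.reverse_cons, List.reverse_cons, List.append_assoc, List.cons_append,
        List.nil_append, path_append, ← List.reverse_cons, ih, path_pair, path_cons_cons,
        segment_symm, union_comm]

theorem SimplePath.reverse {l : List Point} (h : SimplePath l) : SimplePath l.reverse := by
  induction l with
  | nil => trivial
  | cons a l ih =>
    cases l with
    | nil => trivial
    | cons b l =>
      rw [List.reverse_cons, List.reverse_cons, List.append_assoc, List.cons_append,
        List.nil_append, simplePath_append, ← List.reverse_cons, path_reverse, path_pair]
      exact ⟨ih h.2.2, ⟨h.1.symm, fun p hp => hp.2, trivial⟩, by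
        rw [inter_comm, segment_symm]; exact h.2.1⟩

theorem path_subset_of_convex {C : Set Point} (hC : Convex ℝ C) {l : List Point}
    (h : ∀ x ∈ l, x ∈ C) : path l ⊆ C := by
  induction l with
  | nil => exact empty_subset _
  | cons a l ih =>
    cases l with
    | nil => exact singleton_subset_iff.2 (h a (by simp))
    | cons b l =>
      exact union_subset (hC.segment_subset (h a (by simp)) (h b (by simp)))
        (ih fun x hx => h x (List.mem_cons_of_mem _ hx))

theorem convex_lt (f : Point →L[ℝ] ℝ) (r : ℝ) : Convex ℝ {x | r < f x} :=
  convex_halfSpace_gt (f : Point →ₗ[ℝ] ℝ).isLinear r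

theorem convex_le (f : Point →L[ℝ] ℝ) (r : ℝ) : Convex ℝ {x | r ≤ f x} :=
  convex_halfSpace_ge (f : Point →ₗ[ℝ] ℝ).isLinear r

theorem lt_or_eq_of_mem_path {f : Point →L[ℝ] ℝ} {r : ℝ} {a p : Point} {l : List Point}
    (ha : r ≤ f a) (hl : ∀ y ∈ l, r < f y) (hp : p ∈ path (a :: l)) : r < f p ∨ p = a := by
  cases l with
  | nil => exact Or.inr hp
  | cons b l =>
    rcases hp with hp | hp
    · obtain ⟨t, h0, h1, rfl⟩ := segment_param.1 hp
      rcases eq_or_lt_of_le h0 with h | h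
      · right; rw [← h]; simp
      · left
        rw [map_add, map_smul, map_sub, smul_eq_mul]
        have := hl b (by simp)
        nlinarith
    · exact Or.inl (path_subset_of_convex (convex_lt f r) hl hp)

/-- A polygonal arc with end points on two parallel planes and with its interior in between. -/
structure Bead where
  /-- the initial point -/
  a : Point
  /-- the end point -/
  c : Point
  /-- the other vertices -/
  α : List Point
  /-- the functional defining the planes -/
  f : Point →L[ℝ] ℝ
  simple : SimplePath (a :: (α ++ [c]))
  left : f a = -1
  right : f c = 1
  inner : ∀ y ∈ α, -1 < f y ∧ f y < 1

namespace Bead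

variable (b : Bead)

/-- The list of vertices. -/
def verts : List Point := b.a :: (b.α ++ [b.c])

/-- The bead with the opposite orientation. -/
def rev : Bead where
  a := b.c
  c := b.a
  α := b.α.reverse
  f := -b.f
  simple := by simpa using b.simple.reverse
  left := by simp [b.right]
  right := by simp [b.left]
  inner := by
    intro y hy
    have := b.inner y (by simpa using hy)
    simp only [neg_apply]
    exact ⟨by linarith, by linarith⟩

theorem rev_verts : b.rev.verts = b.verts.reverse := by simp [verts, rev]

theorem left_bound {p : Point} (hp : p ∈ path b.verts) : -1 < b.f p ∨ p = b.a := by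
  refine lt_or_eq_of_mem_path b.left.ge ?_ hp
  intro y hy
  rcases List.mem_append.1 hy with hy | hy
  · exact (b.inner y hy).1
  · rw [List.mem_singleton.1 hy, b.right]; norm_num

theorem right_bound {p : Point} (hp : p ∈ path b.verts) : b.f p < 1 ∨ p = b.c := by
  have := b.rev.left_bound (p := p) (by rwa [rev_verts, path_reverse])
  refine this.imp (fun h => ?_) id
  have : -1 < -b.f p := h
  linarith

/-- The affine map with linear part `A` and translation part `x`. -/
def frame (x : Point) (A : Point →L[ℝ] Point) : Point →ᵃ[ℝ] Point :=
  AffineMap.const ℝ Point x + (A : Point →ₗ[ℝ] Point).toAffineMap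

theorem frame_apply (x : Point) (A : Point →L[ℝ] Point) (y : Point) : frame x A y = x + A y := rfl

/-- The polygon through the image of the bead under an affine map, and then through the vertices
in `D`. -/
def hostList (x : Point) (A : Point →L[ℝ] Point) (D : List Point) : List Point :=
  b.verts.map (frame x A) ++ D

/-- The image of the bead under an affine map, with segments joining it to `s` and `t`. -/
def hostSet (x : Point) (A : Point →L[ℝ] Point) (s t : Point) : Set Point :=
  segment ℝ s (frame x A b.a) ∪ path (b.verts.map (frame x A)) ∪ segment ℝ (frame x A b.c) t

end Bead

theorem path_map (l : List Point) (F : Point →ᵃ[ℝ] Point) : path (l.map F) = F '' path l := by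
  induction l with
  | nil => simp [path]
  | cons a l ih =>
    cases l with
    | nil => simp [path]
    | cons b l =>
      simp only [List.map_cons, path_cons_cons, image_union] at ih ⊢
      rw [ih, image_segment]

theorem SimplePath.map {l : List Point} (h : SimplePath l) {F : Point →ᵃ[ℝ] Point}
    (hF : Function.Injective F) : SimplePath (l.map F) := by
  induction l with
  | nil => trivial
  | cons a l ih =>
    cases l with
    | nil => trivial
    | cons b l =>
      refine ⟨hF.ne h.1, ?_, ih h.2.2⟩
      have := path_map (b :: l) F
      rw [List.map_cons] at this
      rw [this, ← image_segment, ← image_inter hF]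
      rintro _ ⟨y, hy, rfl⟩
      rw [h.2.1 hy]; rfl

namespace Bead

variable (b : Bead)

theorem hostList_eq (x : Point) (A : Point →L[ℝ] Point) (D : List Point) :
    b.hostList x A D =
      frame x A b.a :: (b.α.map (frame x A) ++ frame x A b.c :: D) := by
  simp [hostList, verts]

theorem polygon_hostList (x : Point) (A : Point →L[ℝ] Point) (s t : Point) (E : List Point) :
    polygon (b.hostList x A (t :: (E ++ [s]))) = b.hostSet x A s t ∪ path (t :: (E ++ [s])) := by
  rw [hostList_eq, polygon_append, hostSet]
  have e1 : b.verts.map (frame x A) =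
      frame x A b.a :: (b.α.map (frame x A) ++ [frame x A b.c]) := by
    simp [verts]
  have e2 : path (t :: (E ++ [s]) ++ [frame x A b.a]) =
      path (t :: (E ++ [s])) ∪ segment ℝ s (frame x A b.a) := by
    have := path_append (t :: E) [frame x A b.a] s
    simpa [path_pair] using this
  rw [← e1, List.cons_append, path_cons_cons, ← List.cons_append, e2]
  ext; simp only [mem_union]; tauto

theorem frame_injective {x : Point} {A : Point →L[ℝ] Point} (hA : Function.Injective A) :
    Function.Injective (frame x A) := by
  intro y z h
  rw [frame_apply, frame_apply] at h
  exact hA (add_left_cancel h)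

variable {b}

theorem isSimple_hostList {x s t : Point} {A : Point →L[ℝ] Point} {E : List Point}
    {ξ : Point →L[ℝ] ℝ} {ε : ℝ} (hA : Function.Injective A) (hε : 0 < ε)
    (hξ : ∀ y, ξ (A y) = ε * b.f y) (ht : ε < ξ (t - x)) (hs : ξ (s - x) < -ε)
    (hP : SimplePath (t :: (E ++ [s])))
    (h1 : segment ℝ (frame x A b.c) t ∩ path (t :: (E ++ [s])) ⊆ {t})
    (h2 : segment ℝ s (frame x A b.a) ∩ path (t :: (E ++ [s])) ⊆ {s})
    (h3 : Disjoint (path (b.verts.map (frame x A))) (path (t :: (E ++ [s])))) :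
    IsSimple (b.hostList x A (t :: (E ++ [s]))) := by
  have e1 : b.verts.map (frame x A) =
      frame x A b.a :: (b.α.map (frame x A) ++ [frame x A b.c]) := by
    simp [verts]
  have hca : ξ (frame x A b.c) = ξ x + ε := by
    rw [frame_apply, map_add, hξ, b.right, mul_one]
  have haa : ξ (frame x A b.a) = ξ x - ε := by
    rw [frame_apply, map_add, hξ, b.left]; ring
  rw [map_sub] at ht hs
  have hR : ∀ p ∈ segment ℝ (frame x A b.c) t, ξ x + ε < ξ p ∨ p = frame x A b.c := by
    intro p hp
    rw [← path_pair] at hp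
    refine lt_or_eq_of_mem_path hca.ge ?_ hp
    simp only [List.mem_singleton, forall_eq]
    linarith
  have hL : ∀ p ∈ segment ℝ s (frame x A b.a), ξ p < ξ x - ε ∨ p = frame x A b.a := by
    intro p hp
    rw [segment_symm, ← path_pair] at hp
    refine (lt_or_eq_of_mem_path (f := -ξ) (r := -(ξ x - ε)) (a := frame x A b.a)
      (by simp [haa]) ?_ hp).imp (fun h => ?_) id
    · simp only [List.mem_singleton, forall_eq, neg_apply]
      linarith
    · simp only [neg_apply] at h; linarith
  have hM : ∀ p ∈ path (b.verts.map (frame x A)),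
      (ξ x - ε < ξ p ∨ p = frame x A b.a) ∧ (ξ p < ξ x + ε ∨ p = frame x A b.c) := by
    intro p hp
    rw [path_map] at hp
    obtain ⟨y, hy, rfl⟩ := hp
    rw [frame_apply, map_add, hξ]
    constructor
    · rcases b.left_bound hy with h | h
      · left; nlinarith
      · right; rw [h]; rfl
    · rcases b.right_bound hy with h | h
      · left; nlinarith
      · right; rw [h]; rfl
  have hsP : s ∈ path (t :: (E ++ [s])) := mem_path_of_mem (by simp)
  have htP : t ∈ path (t :: (E ++ [s])) := head_mem_path _ _
  have e2 : path (t :: (E ++ [s]) ++ [frame x A b.a]) =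
      path (t :: (E ++ [s])) ∪ segment ℝ s (frame x A b.a) := by
    have := path_append (t :: E) [frame x A b.a] s
    simpa [path_pair] using this
  rw [hostList_eq, isSimple_iff _ _ _ _ (by simp), ← e1]
  refine ⟨b.simple.map (frame_injective hA), ⟨?_, ?_, ?_⟩, ?_⟩
  · intro h
    rw [h] at hca
    linarith
  · rintro p ⟨hp, hp'⟩
    replace hp' : p ∈ path (t :: (E ++ [s]) ++ [frame x A b.a]) := hp'
    rw [e2] at hp'
    rcases hp' with hp' | hp'
    · exact h1 ⟨hp, hp'⟩
    · exfalso
      rcases hR p hp with h | h <;> rcases hL p hp' with h' | h'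
      · linarith
      · rw [h'] at h; linarith
      · rw [h] at h'; linarith
      · rw [h] at h'; rw [h'] at hca; linarith
  · have := simplePath_append (t :: E) [frame x A b.a] s
    change SimplePath (t :: E ++ s :: [frame x A b.a]) ↔ _ at this
    have e3 : t :: (E ++ [s]) ++ [frame x A b.a] = t :: E ++ s :: [frame x A b.a] := by simp
    change SimplePath (t :: (E ++ [s]) ++ [frame x A b.a])
    rw [e3, this]
    refine ⟨hP, ⟨?_, fun p hp => hp.2, trivial⟩, ?_⟩
    · intro h
      rw [h] at hs
      linarith
    · rw [path_pair, inter_comm]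
      exact h2
  · rintro p ⟨hp, hp'⟩
    rw [List.cons_append, path_cons_cons, ← List.cons_append, e2] at hp'
    obtain ⟨hm1, hm2⟩ := hM p hp
    rcases hp' with hp' | hp' | hp'
    · right
      rcases hm2 with h | h
      · rcases hR p hp' with h' | h'
        · linarith
        · exact h'
      · exact h
    · exact absurd hp' (disjoint_left.1 h3 hp)
    · left
      rcases hm1 with h | h
      · rcases hL p hp' with h' | h'
        · linarith
        · exact h'
      · exact h

end Bead

/-! ### Moving a small bead -/

theorem exists_uniform_isSimple (x : ℝ → Point) (D : List (ℝ → Point)) (hx : Continuous x)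
    (hD : ∀ g ∈ D, Continuous g)
    (hs : ∀ t ∈ Icc (0 : ℝ) 1, IsSimple (x t :: D.map fun g => g t)) :
    ∃ δ > 0, ∀ t ∈ Icc (0 : ℝ) 1, ∀ y, dist y (x t) < δ → IsSimple (y :: D.map fun g => g t) := by
  refine isCompact_Icc.induction_on
    (p := fun S => ∃ δ > 0, ∀ t ∈ S, ∀ y, dist y (x t) < δ → IsSimple (y :: D.map fun g => g t))
    ⟨1, one_pos, by simp⟩ ?_ ?_ ?_
  · rintro S T hST ⟨δ, hδ, h⟩
    exact ⟨δ, hδ, fun t ht => h t (hST ht)⟩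
  · rintro S T ⟨δ, hδ, h⟩ ⟨δ', hδ', h'⟩
    refine ⟨min δ δ', lt_min hδ hδ', ?_⟩
    rintro t (ht | ht) y hy
    · exact h t ht y (hy.trans_le (min_le_left _ _))
    · exact h' t ht y (hy.trans_le (min_le_right _ _))
  · intro t ht
    obtain ⟨δ, hδ, h⟩ := (hs t ht).exists_close
    have hev : ∀ᶠ r in 𝓝 t, Close δ (D.map fun g => g t) (D.map fun g => g r) := by
      clear h hs
      induction D with
      | nil => exact Eventually.of_forall fun _ => List.Forall₂.nil
      | cons g D ih =>
        have h2 : ∀ᶠ r in 𝓝 t, dist (g t) (g r) < δ := by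
          have := ((hD g (by simp)).tendsto t).eventually (Metric.ball_mem_nhds (g t) hδ)
          filter_upwards [this] with y hy
          rw [dist_comm]; exact hy
        filter_upwards [h2, ih fun f hf => hD f (by simp [hf])] with y h3 h4
        exact List.Forall₂.cons h3 h4
    have hev2 : ∀ᶠ r in 𝓝 t, dist (x r) (x t) < δ / 2 :=
      (hx.tendsto t).eventually (Metric.ball_mem_nhds (x t) (half_pos hδ))
    refine ⟨_, nhdsWithin_le_nhds (hev.and hev2), δ / 2, half_pos hδ, ?_⟩
    rintro r ⟨h1, h2⟩ y hy
    refine h _ (List.Forall₂.cons ?_ h1)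
    have := dist_triangle y (x r) (x t)
    rw [dist_comm]
    linarith

namespace Bead

variable (b : Bead)

theorem exists_isSimple_hostList (x : ℝ → Point) (M : ℝ → Point →L[ℝ] Point)
    (ξ : ℝ → Point →L[ℝ] ℝ) (s t : ℝ → Point) (E : List (ℝ → Point))
    (hx : Continuous x) (hM : Continuous M) (hξ : Continuous ξ) (hsc : Continuous s)
    (htc : Continuous t) (hE : ∀ g ∈ E, Continuous g)
    (hinj : ∀ r, Function.Injective (M r)) (hf : ∀ r y, ξ r (M r y) = b.f y)
    (ht : ∀ r ∈ Icc (0 : ℝ) 1, 0 < ξ r (t r - x r)) (hs : ∀ r ∈ Icc (0 : ℝ) 1, ξ r (s r - x r) < 0)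
    (hsim : ∀ r ∈ Icc (0 : ℝ) 1, IsSimple (x r :: t r :: (E.map (fun g => g r) ++ [s r]))) :
    ∃ ε₀ : ℝ, 0 < ε₀ ∧ ∀ ε : ℝ, 0 < ε → ε < ε₀ → ∀ r ∈ Icc (0 : ℝ) 1,
      IsSimple (b.hostList (x r) (ε • M r) (t r :: (E.map (fun g => g r) ++ [s r]))) := by
  have e0 : ∀ r, (t :: (E ++ [s])).map (fun g => g r) = t r :: (E.map (fun g => g r) ++ [s r]) := by
    intro r; simp
  obtain ⟨δ, hδ, hd⟩ := exists_uniform_isSimple x (t :: (E ++ [s])) hx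
    (by
      intro g hg
      simp only [List.mem_cons, List.mem_append, List.not_mem_nil, or_false] at hg
      rcases hg with rfl | hg | rfl
      · exact htc
      · exact hE g hg
      · exact hsc)
    (by intro r hr; rw [e0]; exact hsim r hr)
  simp only [e0] at hd
  obtain ⟨rt, hrt, ht'⟩ := isCompact_Icc.exists_isMinOn (nonempty_Icc.2 zero_le_one)
    (Continuous.continuousOn (s := Icc (0 : ℝ) 1) (f := fun r => ξ r (t r - x r)) (by fun_prop))
  obtain ⟨rs, hrs, hs'⟩ := isCompact_Icc.exists_isMaxOn (nonempty_Icc.2 zero_le_one)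
    (Continuous.continuousOn (s := Icc (0 : ℝ) 1) (f := fun r => ξ r (s r - x r)) (by fun_prop))
  obtain ⟨C, hC⟩ := isCompact_Icc.exists_bound_of_continuousOn hM.continuousOn (s := Icc (0 : ℝ) 1)
  have hC0 : 0 ≤ C := (norm_nonneg _).trans (hC 0 (by simp))
  obtain ⟨B, hB⟩ : ∃ B : ℝ, ∀ y ∈ path b.verts, ‖y‖ ≤ B := by
    obtain ⟨B, hB⟩ : ∃ B : ℝ, ∀ y ∈ b.verts, ‖y‖ ≤ B := by
      generalize b.verts = l
      induction l with
      | nil => exact ⟨0, by simp⟩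
      | cons a l ih =>
        obtain ⟨B, hB⟩ := ih
        refine ⟨max ‖a‖ B, ?_⟩
        intro y hy
        rcases List.mem_cons.1 hy with rfl | hy
        · exact le_max_left _ _
        · exact (hB y hy).trans (le_max_right _ _)
    refine ⟨B, fun y hy => ?_⟩
    have := path_subset_of_convex (convex_closedBall (0 : Point) B)
      (fun x hx => by rw [mem_closedBall_zero_iff]; exact hB x hx) hy
    rwa [mem_closedBall_zero_iff] at this
  have hB0 : 0 ≤ B := (norm_nonneg _).trans (hB b.a (head_mem_path _ _))
  have hK : 0 < C * B + 1 := by positivity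
  refine ⟨min (δ / (C * B + 1)) (min (ξ rt (t rt - x rt)) (-ξ rs (s rs - x rs))),
    lt_min (by positivity) (lt_min (ht _ hrt) (neg_pos.2 (hs _ hrs))), ?_⟩
  intro ε hε hε0 r hr
  obtain ⟨l1, l2⟩ := lt_min_iff.1 hε0
  obtain ⟨l2, l3⟩ := lt_min_iff.1 l2
  rw [lt_div_iff₀ hK] at l1
  have hnear : ∀ y ∈ path b.verts, dist (frame (x r) (ε • M r) y) (x r) < δ := by
    intro y hy
    rw [frame_apply, dist_eq_norm, add_sub_cancel_left]
    calc ‖(ε • M r) y‖ = ε * ‖M r y‖ := by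
          rw [smul_apply, norm_smul, Real.norm_of_nonneg hε.le]
      _ ≤ ε * (C * B) := by
          refine mul_le_mul_of_nonneg_left ?_ hε.le
          exact ((M r).le_opNorm y).trans (mul_le_mul (hC r hr) (hB y hy) (norm_nonneg _) hC0)
      _ < δ := by nlinarith
  have h1 := fun y hy => (isSimple_vertex _ _ _ _).1 (hd r hr _ (hnear y hy))
  have hca := h1 b.c (mem_path_of_mem (by simp [verts]))
  have haa := h1 b.a (head_mem_path _ _)
  refine isSimple_hostList (ξ := ξ r) (ε := ε) ?_ hε ?_ ?_ ?_ hca.1 hca.2.2.2.1 haa.2.2.2.2.1 ?_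
  · intro y z h
    simp only [smul_apply] at h
    exact hinj r (smul_right_injective _ hε.ne' h)
  · intro y
    rw [smul_apply, map_smul, hf, smul_eq_mul]
  · exact l2.trans_le (ht' hr)
  · have : ξ r (s r - x r) ≤ ξ rs (s rs - x rs) := hs' hr
    linarith
  · rw [disjoint_left, path_map]
    rintro _ ⟨y, hy, rfl⟩ hp
    obtain ⟨-, h2, -, h3, -⟩ := h1 y hy
    exact h2 (h3 ⟨left_mem_segment ℝ _ _, hp⟩)

/-- If the bead is placed at `x` with linear part `ε • M` and joined to the arc `R` from `t` to `s`,
then the result is isotopic to `C` for all small `ε`. -/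
def Hosted (C : Set Point) (x : Point) (M : Point →L[ℝ] Point) (s t : Point) (R : Set Point) :
    Prop :=
  ∀ᶠ ε : ℝ in 𝓝[>] 0, Isotopic (b.hostSet x (ε • M) s t ∪ R) C

variable {b}

theorem eventually_of_lt {P : ℝ → Prop} {ε₀ : ℝ} (h0 : 0 < ε₀) (h : ∀ ε, 0 < ε → ε < ε₀ → P ε) :
    ∀ᶠ ε : ℝ in 𝓝[>] 0, P ε := by
  filter_upwards [Ioo_mem_nhdsGT h0] with ε hε
  exact h ε hε.1 hε.2

theorem Hosted.congr {C : Set Point} {x x' : Point} {M M' : Point →L[ℝ] Point} {s t s' t' : Point}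
    {R R' : Set Point} (h : b.Hosted C x M s t R)
    (hi : ∀ᶠ ε : ℝ in 𝓝[>] 0,
      Isotopic (b.hostSet x (ε • M) s t ∪ R) (b.hostSet x' (ε • M') s' t' ∪ R')) :
    b.Hosted C x' M' s' t' R' := by
  filter_upwards [h, hi] with ε h1 h2
  exact h2.symm.trans h1

/-- Motion of a small bead together with the polygon that carries it. -/
theorem eventually_isotopic_of_motion (x : ℝ → Point) (M : ℝ → Point →L[ℝ] Point)
    (ξ : ℝ → Point →L[ℝ] ℝ) (s t : ℝ → Point) (E : List (ℝ → Point))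
    (hx : Continuous x) (hM : Continuous M) (hξ : Continuous ξ) (hsc : Continuous s)
    (htc : Continuous t) (hE : ∀ g ∈ E, Continuous g)
    (hinj : ∀ r, Function.Injective (M r)) (hf : ∀ r y, ξ r (M r y) = b.f y)
    (ht : ∀ r ∈ Icc (0 : ℝ) 1, 0 < ξ r (t r - x r)) (hs : ∀ r ∈ Icc (0 : ℝ) 1, ξ r (s r - x r) < 0)
    (hsim : ∀ r ∈ Icc (0 : ℝ) 1, IsSimple (x r :: t r :: (E.map (fun g => g r) ++ [s r]))) :
    ∀ᶠ ε : ℝ in 𝓝[>] 0, ∀ r ∈ Icc (0 : ℝ) 1,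
      Isotopic (b.hostSet (x 0) (ε • M 0) (s 0) (t 0) ∪ path (t 0 :: (E.map (fun g => g 0) ++ [s 0])))
        (b.hostSet (x r) (ε • M r) (s r) (t r) ∪ path (t r :: (E.map (fun g => g r) ++ [s r]))) := by
  obtain ⟨ε₀, h0, h⟩ := b.exists_isSimple_hostList x M ξ s t E hx hM hξ hsc htc hE hinj hf ht hs hsim
  refine eventually_of_lt h0 fun ε hε hε0 r hr => ?_
  rw [← polygon_hostList, ← polygon_hostList]
  have e : ∀ q, b.hostList (x (q * r)) (ε • M (q * r)) (t (q * r) ::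
      (E.map (fun g => g (q * r)) ++ [s (q * r)])) =
      (((b.verts.map fun y q => frame (x (q * r)) (ε • M (q * r)) y) ++
      (t :: (E ++ [s])).map fun g q => g (q * r)) : List (ℝ → Point)).map fun f => f q := by
    intro q
    simp [hostList, Function.comp_def]
  have := isotopic_of_motion ((b.verts.map fun y q => frame (x (q * r)) (ε • M (q * r)) y) ++
      (t :: (E ++ [s])).map fun g q => g (q * r)) ?_ ?_
  · rw [← e, ← e] at this
    simpa using this
  · intro f hf
    apply Continuous.continuousOn
    rcases List.mem_append.1 hf with hf | hf
    · obtain ⟨y, -, rfl⟩ := List.mem_map.1 hf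
      simp only [frame_apply, smul_apply]
      have h1 : Continuous fun q => M (q * r) := by fun_prop
      fun_prop
    · obtain ⟨g, hg, rfl⟩ := List.mem_map.1 hf
      have hgc : Continuous g := by
        simp only [List.mem_cons, List.mem_append, List.not_mem_nil, or_false] at hg
        rcases hg with rfl | hg | rfl
        · exact htc
        · exact hE g hg
        · exact hsc
      fun_prop
  · intro q hq
    rw [← e]
    exact h ε hε hε0 _ ⟨mul_nonneg hq.1 hr.1, mul_le_one₀ hq.2 hr.1 hr.2⟩

end Bead

theorem openSegment_param {u v x : Point} :
    x ∈ openSegment ℝ u v ↔ ∃ t : ℝ, 0 < t ∧ t < 1 ∧ x = u + t • (v - u) := by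
  rw [openSegment_eq_image']
  constructor
  · rintro ⟨t, ⟨h0, h1⟩, rfl⟩; exact ⟨t, h0, h1, rfl⟩
  · rintro ⟨t, h0, h1, rfl⟩; exact ⟨t, ⟨h0, h1⟩, rfl⟩

/-- The point `x` lies inside the segment from `s` to `t`, which together with the arc `R` makes up
a simple closed curve. -/
structure Carrier (x s t : Point) (R : Set Point) : Prop where
  arc : Arc t s R
  mem : x ∈ openSegment ℝ s t
  inter : segment ℝ s t ∩ R ⊆ {s, t}

namespace Carrier

variable {x s t : Point} {R : Set Point}

theorem symm (h : Carrier x s t R) : Carrier x t s R :=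
  ⟨h.arc.symm, by rw [openSegment_symm]; exact h.mem, by
    rw [segment_symm, pair_comm]; exact h.inter⟩

theorem ne_left (h : Carrier x s t R) : x ≠ s := by
  rintro rfl
  exact h.arc.ne (left_mem_openSegment_iff.1 h.mem).symm

theorem ne_right (h : Carrier x s t R) : x ≠ t := h.symm.ne_left

theorem notMem (h : Carrier x s t R) : x ∉ R := by
  intro hx
  rcases h.inter ⟨openSegment_subset_segment ℝ s t h.mem, hx⟩ with h1 | h1
  · exact h.ne_left h1
  · exact h.ne_right h1

theorem eq_compl (h : Carrier x s t R) : R = ((segment ℝ s t ∪ R) \ segment ℝ s t) ∪ {s, t} := by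
  ext p
  constructor
  · intro hp
    by_cases hps : p ∈ segment ℝ s t
    · exact Or.inr (h.inter ⟨hps, hp⟩)
    · exact Or.inl ⟨Or.inr hp, hps⟩
  · rintro (⟨hp | hp, hp'⟩ | rfl | rfl)
    · exact absurd hp hp'
    · exact hp
    · exact h.arc.right_mem
    · exact h.arc.left_mem

theorem of_mem {y : Point} (h : Carrier x s t R) (hy : y ∈ openSegment ℝ s t) : Carrier y s t R :=
  ⟨h.arc, hy, h.inter⟩

theorem right_inter (h : Carrier x s t R) : segment ℝ x t ∩ R ⊆ {t} := by
  rintro p ⟨hp, hp'⟩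
  have hx := openSegment_subset_segment ℝ s t h.mem
  rcases h.inter ⟨(convex_segment s t).segment_subset hx (right_mem_segment ℝ _ _) hp, hp'⟩
    with rfl | h1
  · exact absurd (segment_inter_segment hx ⟨left_mem_segment ℝ _ _, hp⟩).symm h.ne_left
  · exact h1

theorem left_inter (h : Carrier x s t R) : segment ℝ s x ∩ R ⊆ {s} := by
  rw [segment_symm]; exact h.symm.right_inter

theorem isSimple (h : Carrier x s t R) {E : List Point} (hE : SimplePath (t :: (E ++ [s])))
    (hR : R = path (t :: (E ++ [s]))) : IsSimple (x :: t :: (E ++ [s])) := by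
  rw [isSimple_vertex, ← hR]
  exact ⟨hE, h.ne_right, h.ne_left, h.right_inter, h.left_inter,
    segment_inter_segment (openSegment_subset_segment ℝ s t h.mem)⟩

theorem isLoop (h : Carrier x s t R) : IsLoop (segment ℝ s t ∪ R) :=
  ⟨s, t, _, R, Arc.seg h.arc.ne.symm, h.arc, h.inter, rfl⟩

theorem subdivide (h : Carrier x s t R) {t' : Point} (ht' : t' ∈ openSegment ℝ x t) :
    Carrier x s t' (segment ℝ t' t ∪ R) ∧
      segment ℝ s t' ∪ (segment ℝ t' t ∪ R) = segment ℝ s t ∪ R := by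
  have hx := openSegment_subset_segment ℝ s t h.mem
  have h1 : t' ∈ segment ℝ x t := openSegment_subset_segment ℝ _ _ ht'
  have h2 : t' ∈ segment ℝ s t :=
    (convex_segment s t).segment_subset hx (right_mem_segment ℝ _ _) h1
  have hne : t' ≠ t := by
    rintro rfl; exact h.ne_right (right_mem_openSegment_iff.1 ht')
  have hne' : t' ≠ x := by
    rintro rfl; exact h.ne_right (left_mem_openSegment_iff.1 ht')
  have hs : s ∉ segment ℝ x t := fun hs =>
    h.ne_left (segment_inter_segment hx ⟨left_mem_segment ℝ _ _, hs⟩).symm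
  have hsub : segment ℝ t' t ⊆ segment ℝ x t :=
    (convex_segment x t).segment_subset h1 (right_mem_segment ℝ _ _)
  refine ⟨⟨Arc.cons hne h.arc fun p hp => h.right_inter ⟨hsub hp.1, hp.2⟩, ?_, ?_⟩, ?_⟩
  · refine mem_openSegment_of_ne_left_right h.ne_left.symm hne' ?_
    rcases (segment_union_segment h2).symm ▸ hx with h3 | h3
    · exact h3
    · exact absurd (segment_inter_segment h1 ⟨left_mem_segment ℝ _ _, h3⟩).symm hne'
  · rintro p ⟨hp, hp' | hp'⟩
    · exact Or.inr (segment_inter_segment h2 ⟨hp, hp'⟩)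
    · rcases h.inter ⟨(convex_segment s t).segment_subset (left_mem_segment ℝ _ _) h2 hp, hp'⟩
        with h3 | h3
      · exact Or.inl h3
      · rw [mem_singleton_iff] at h3
        subst h3
        exact absurd (segment_inter_segment h2 ⟨hp, right_mem_segment ℝ _ _⟩).symm hne
  · rw [← union_assoc, segment_union_segment h2]

end Carrier

namespace Bead

variable {b : Bead}

theorem rev_hostSet (x : Point) (A : Point →L[ℝ] Point) (s t : Point) :
    b.rev.hostSet x A t s = b.hostSet x A s t := by
  rw [hostSet, hostSet, rev_verts, List.map_reverse, path_reverse, segment_symm ℝ t,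
    segment_symm ℝ _ s]
  change segment ℝ (frame x A b.c) t ∪ _ ∪ segment ℝ s (frame x A b.a) = _
  ext; simp only [mem_union]; tauto

theorem rev_hosted_iff {C : Set Point} {x : Point} {M : Point →L[ℝ] Point} {s t : Point}
    {R : Set Point} : b.rev.Hosted C x M t s R ↔ b.Hosted C x M s t R := by
  simp only [Hosted, rev_hostSet]

theorem Hosted.slide {C : Set Point} {x y : Point} {M : Point →L[ℝ] Point} {s t : Point}
    {R : Set Point} {ξ : Point →L[ℝ] ℝ} (h : b.Hosted C x M s t R) (hc : Carrier x s t R)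
    (hy : y ∈ openSegment ℝ s t) (hM : Function.Injective M) (hf : ∀ y, ξ (M y) = b.f y)
    (hξ : 0 < ξ (t - s)) : b.Hosted C y M s t R := by
  obtain ⟨E, hE, hR⟩ := hc.arc.exists_list
  have hmem : ∀ r ∈ Icc (0 : ℝ) 1, x + r • (y - x) ∈ openSegment ℝ s t := fun r hr =>
    (convex_openSegment s t).segment_subset hc.mem hy (segment_param.2 ⟨r, hr.1, hr.2, rfl⟩)
  have hpos : ∀ z ∈ openSegment ℝ s t, 0 < ξ (t - z) ∧ ξ (s - z) < 0 := by
    intro z hz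
    obtain ⟨u, h0, h1, rfl⟩ := openSegment_param.1 hz
    have e1 : t - (s + u • (t - s)) = (1 - u) • (t - s) := by module
    have e2 : s - (s + u • (t - s)) = -(u • (t - s)) := by module
    rw [e1, e2, map_neg, map_smul, map_smul, smul_eq_mul, smul_eq_mul]
    exact ⟨mul_pos (by linarith) hξ, neg_neg_of_pos (mul_pos h0 hξ)⟩
  have := eventually_isotopic_of_motion (b := b) (fun r => x + r • (y - x)) (fun _ => M) (fun _ => ξ)
    (fun _ => s) (fun _ => t) (E.map fun p _ => p) (by fun_prop) (by fun_prop) (by fun_prop)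
    (by fun_prop) (by fun_prop)
    (by
      intro g hg
      obtain ⟨p, -, rfl⟩ := List.mem_map.1 hg
      fun_prop)
    (fun _ => hM) (fun _ => hf) (fun r hr => (hpos _ (hmem r hr)).1)
    (fun r hr => (hpos _ (hmem r hr)).2)
    (fun r hr => by
      have := (hc.of_mem (hmem r hr)).isSimple hE hR
      simpa [Function.comp_def] using this)
  refine h.congr ?_
  filter_upwards [this] with ε hε
  have := hε 1 (by simp)
  simpa [Function.comp_def, ← hR] using this

theorem hosted_subdivide_iff {C : Set Point} {x : Point} {M : Point →L[ℝ] Point} {s t t' : Point}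
    {R : Set Point} {ξ : Point →L[ℝ] ℝ} (hc : Carrier x s t R)
    (ht' : t' ∈ openSegment ℝ x t) (hM : Function.Injective M) (hf : ∀ y, ξ (M y) = b.f y)
    (hξ : 0 < ξ (t - s)) : b.Hosted C x M s t R ↔ b.Hosted C x M s t' (segment ℝ t' t ∪ R) := by
  obtain ⟨E, hE, hR⟩ := hc.arc.exists_list
  obtain ⟨τ, hτ0, hτ1, hτ⟩ := openSegment_param.1 ht'
  have hc' := (hc.subdivide ht').1
  have hE' : SimplePath (t' :: (t :: E ++ [s])) := by
    have := hc'.arc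
    refine ⟨?_, ?_, hE⟩
    · rintro rfl; exact hc.ne_right (right_mem_openSegment_iff.1 ht')
    · rintro p ⟨hp, hp'⟩
      exact hc.right_inter ⟨(convex_segment x t).segment_subset
        (openSegment_subset_segment ℝ _ _ ht') (right_mem_segment ℝ _ _) hp,
        by rw [hR]; exact hp'⟩
  have hR' : segment ℝ t' t ∪ R = path (t' :: (t :: E ++ [s])) := by rw [hR]; rfl
  obtain ⟨δ, hδ, hd⟩ := (hc'.isSimple hE' hR').exists_close
  obtain ⟨κ, hκ, hκ1⟩ : ∃ κ : ℝ, 0 < κ ∧ κ * ‖M b.c‖ < δ := by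
    refine ⟨δ / (‖M b.c‖ + 1), by positivity, ?_⟩
    rw [div_mul_eq_mul_div, div_lt_iff₀ (by positivity)]
    nlinarith [norm_nonneg (M b.c)]
  have hxs : 0 < ξ (t - x) ∧ ξ (s - x) < 0 := by
    obtain ⟨u, h0, h1, hu⟩ := openSegment_param.1 hc.mem
    have e1 : t - x = (1 - u) • (t - s) := by rw [hu]; module
    have e2 : s - x = -(u • (t - s)) := by rw [hu]; module
    rw [e1, e2, map_neg, map_smul, map_smul, smul_eq_mul, smul_eq_mul]
    exact ⟨mul_pos (by linarith) hξ, neg_neg_of_pos (mul_pos h0 hξ)⟩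
  have key := eventually_isotopic_of_motion (b := b) (fun _ => x) (fun _ => M) (fun _ => ξ)
    (fun _ => s) (fun r => (x + (r * κ) • M b.c) + τ • (t - (x + (r * κ) • M b.c)))
    ((t :: E).map fun p _ => p) (by fun_prop) (by fun_prop) (by fun_prop)
    (by fun_prop) (by fun_prop)
    (by
      intro g hg
      obtain ⟨p, -, rfl⟩ := List.mem_map.1 hg
      fun_prop)
    (fun _ => hM) (fun _ => hf)
    (fun r hr => by
      have e : x + (r * κ) • M b.c + τ • (t - (x + (r * κ) • M b.c)) - x =
        ((1 - τ) * (r * κ)) • M b.c + τ • (t - x) := by module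
      rw [e, map_add, map_smul, map_smul, hf, b.right, smul_eq_mul, smul_eq_mul, mul_one]
      have h1 : 0 ≤ (1 - τ) * (r * κ) := mul_nonneg (by linarith) (mul_nonneg hr.1 hκ.le)
      have h2 := mul_pos hτ0 hxs.1
      linarith)
    (fun r hr => hxs.2)
    (fun r hr => by
      simp only [List.map_map, Function.comp_def, List.map_id']
      apply hd
      refine List.Forall₂.cons (by rwa [dist_self]) (List.Forall₂.cons ?_ (Close.refl hδ _))
      rw [dist_comm, dist_eq_norm, hτ]
      have e : x + (r * κ) • M b.c + τ • (t - (x + (r * κ) • M b.c)) - (x + τ • (t - x)) =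
        ((1 - τ) * (r * κ)) • M b.c := by module
      rw [e, norm_smul, Real.norm_of_nonneg (mul_nonneg (by linarith) (mul_nonneg hr.1 hκ.le))]
      have h1 : (1 - τ) * (r * κ) ≤ κ := by
        have h2 : r * κ ≤ κ := mul_le_of_le_one_left hκ.le hr.2
        have h3 : 0 ≤ r * κ := mul_nonneg hr.1 hκ.le
        nlinarith
      exact lt_of_le_of_lt (mul_le_mul_of_nonneg_right h1 (norm_nonneg _)) hκ1)
  have hi : ∀ᶠ ε : ℝ in 𝓝[>] 0, Isotopic (b.hostSet x (ε • M) s t' ∪ (segment ℝ t' t ∪ R))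
      (b.hostSet x (ε • M) s t ∪ R) := by
    filter_upwards [key, Ioo_mem_nhdsGT hκ] with ε hε hεκ
    have h1 := hε (ε / κ) ⟨div_nonneg hεκ.1.le hκ.le, (div_le_one hκ).2 hεκ.2.le⟩
    have e1 : (ε / κ) * κ = ε := div_mul_cancel₀ _ hκ.ne'
    simp only [List.map_map, Function.comp_def, List.map_id', zero_mul, zero_smul, add_zero, e1,
      ← hτ] at h1
    have e2 : x + ε • M b.c = frame x (ε • M) b.c := rfl
    rw [e2, ← hR'] at h1
    have hmem : frame x (ε • M) b.c + τ • (t - frame x (ε • M) b.c) ∈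
        segment ℝ (frame x (ε • M) b.c) t := segment_param.2 ⟨τ, hτ0.le, hτ1.le, rfl⟩
    have e3 : b.hostSet x (ε • M) s (frame x (ε • M) b.c + τ • (t - frame x (ε • M) b.c)) ∪
        path ((frame x (ε • M) b.c + τ • (t - frame x (ε • M) b.c)) :: (t :: E ++ [s])) =
        b.hostSet x (ε • M) s t ∪ R := by
      rw [List.cons_append, path_cons_cons, ← hR, hostSet, hostSet, ← segment_union_segment hmem]
      ext; simp only [mem_union]; tauto
    rwa [e3] at h1
  constructor
  · intro h
    refine h.congr ?_
    filter_upwards [hi] with ε hε using hε.symm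
  · intro h
    exact h.congr hi

end Bead
namespace Bead

variable {b : Bead}

theorem rev_f_apply (y : Point) : b.rev.f y = -b.f y := rfl

theorem hosted_shrink_iff {C : Set Point} {x : Point} {M : Point →L[ℝ] Point} {s t s' t' : Point}
    {R : Set Point} {ξ : Point →L[ℝ] ℝ} (hc : Carrier x s t R)
    (hs' : s' ∈ openSegment ℝ x s) (ht' : t' ∈ openSegment ℝ x t) (hM : Function.Injective M)
    (hf : ∀ y, ξ (M y) = b.f y) (hξ : 0 < ξ (t - s)) : ∃ R', Carrier x s' t' R' ∧
      segment ℝ s' t' ∪ R' = segment ℝ s t ∪ R ∧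
      (b.Hosted C x M s t R ↔ b.Hosted C x M s' t' R') := by
  obtain ⟨hc1, hu1⟩ := hc.subdivide ht'
  have h1 := hosted_subdivide_iff (C := C) hc ht' hM hf hξ
  have h2 := hosted_subdivide_iff (b := b.rev) (C := C) (ξ := -ξ) hc1.symm hs' hM
    (fun y => by rw [neg_apply, hf, rev_f_apply])
    (by
      obtain ⟨u, u0, u1, hu⟩ := openSegment_param.1 hc.mem
      obtain ⟨v, v0, v1, hv⟩ := openSegment_param.1 ht'
      have e : s - t' = -((u + v * (1 - u)) • (t - s)) := by rw [hv, hu]; module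
      rw [e, neg_apply, map_neg, neg_neg, map_smul, smul_eq_mul]
      have : 0 < v * (1 - u) := mul_pos v0 (by linarith)
      positivity)
  obtain ⟨hc2, hu2⟩ := hc1.symm.subdivide hs'
  refine ⟨_, hc2.symm, ?_, ?_⟩
  · rw [segment_symm, hu2, segment_symm, hu1]
  · rw [h1, ← rev_hosted_iff, h2, rev_hosted_iff]

theorem Carrier.pos_of_mem {x s t : Point} {R : Set Point} {ξ : Point →L[ℝ] ℝ}
    (hc : Carrier x s t R) (hξ : 0 < ξ (t - s)) : 0 < ξ (t - x) ∧ 0 < ξ (x - s) := by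
  obtain ⟨u, h0, h1, hu⟩ := openSegment_param.1 hc.mem
  have e1 : t - x = (1 - u) • (t - s) := by rw [hu]; module
  have e2 : x - s = u • (t - s) := by rw [hu]; module
  rw [e1, e2, map_smul, map_smul, smul_eq_mul, smul_eq_mul]
  exact ⟨mul_pos (by linarith) hξ, mul_pos h0 hξ⟩

/-- Near `x`, the loop agrees with its carrier segment. -/
theorem eventually_mem_segment {x s t : Point} {R : Set Point} (hc : Carrier x s t R) {z : Point}
    (hz : segment ℝ x z ⊆ segment ℝ s t ∪ R) :
    ∀ᶠ τ : ℝ in 𝓝[>] 0, x + τ • (z - x) ∈ segment ℝ s t \ R := by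
  have h1 : Tendsto (fun τ : ℝ => x + τ • (z - x)) (𝓝 0) (𝓝 (x + (0 : ℝ) • (z - x))) :=
    Continuous.tendsto (by fun_prop) 0
  rw [zero_smul, add_zero] at h1
  have h2 : ∀ᶠ τ : ℝ in 𝓝[>] 0, x + τ • (z - x) ∉ R :=
    (h1.eventually (hc.arc.isClosed.isOpen_compl.mem_nhds hc.notMem)).filter_mono
      nhdsWithin_le_nhds
  filter_upwards [h2, Ioo_mem_nhdsGT one_pos] with τ h3 h4
  exact ⟨(hz (segment_param.2 ⟨τ, h4.1.le, h4.2.le, rfl⟩)).resolve_right h3, h3⟩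

/-- Two carrier segments of the same loop through the same point are parallel there. -/
theorem exists_parallel {x s t s₂ t₂ : Point} {R R₂ : Set Point} (hc : Carrier x s t R)
    (hc₂ : Carrier x s₂ t₂ R₂) (h : segment ℝ s t ∪ R = segment ℝ s₂ t₂ ∪ R₂) :
    ∃ r : ℝ, r ≠ 0 ∧ t₂ - s₂ = r • (t - s) := by
  have hsub : segment ℝ x t₂ ⊆ segment ℝ s t ∪ R := by
    rw [h]
    exact ((convex_segment s₂ t₂).segment_subset (openSegment_subset_segment ℝ _ _ hc₂.mem)
      (right_mem_segment ℝ _ _)).trans subset_union_left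
  obtain ⟨τ, h1, h2⟩ := ((eventually_mem_segment hc hsub).and eventually_mem_nhdsWithin).exists
  obtain ⟨u, -, -, hu⟩ := segment_param.1 h1.1
  obtain ⟨v, -, -, hv⟩ := openSegment_param.1 hc.mem
  obtain ⟨w, w0, w1, hw⟩ := openSegment_param.1 hc₂.mem
  have hτ : (0 : ℝ) < τ := h2
  have e1 : (τ * (1 - w)) • (t₂ - s₂) = (u - v) • (t - s) := by
    have e2 : t₂ - x = (1 - w) • (t₂ - s₂) := by rw [hw]; module
    calc (τ * (1 - w)) • (t₂ - s₂) = τ • (t₂ - x) := by rw [e2, smul_smul]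
      _ = (x + τ • (t₂ - x)) - x := by module
      _ = (s + u • (t - s)) - (s + v • (t - s)) := by rw [hu, ← hv]
      _ = _ := by module
  have h3 : τ * (1 - w) ≠ 0 := (mul_pos hτ (by linarith)).ne'
  have e3 : t₂ - s₂ = ((u - v) / (τ * (1 - w))) • (t - s) := by
    rw [div_eq_inv_mul, mul_smul, ← e1, smul_smul, inv_mul_cancel₀ h3, one_smul]
  refine ⟨_, fun h0 => ?_, e3⟩
  rw [h0, zero_smul, sub_eq_zero] at e3
  exact hc₂.arc.ne e3

theorem mem_openSegment_of_pos {x s t y : Point} {R : Set Point} {ξ : Point →L[ℝ] ℝ}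
    (hc : Carrier x s t R) (hξ : 0 < ξ (t - s)) (hy : y ∈ segment ℝ s t \ R) (h : 0 < ξ (y - x)) :
    y ∈ openSegment ℝ x t := by
  refine mem_openSegment_of_ne_left_right ?_ ?_ ?_
  · rintro rfl; simp at h
  · rintro rfl; exact hy.2 hc.arc.left_mem
  · have hx := openSegment_subset_segment ℝ _ _ hc.mem
    rcases (segment_union_segment hx).symm ▸ hy.1 with h1 | h1
    · exfalso
      obtain ⟨u, u0, u1, rfl⟩ := segment_param.1 h1
      have e : s + u • (x - s) - x = -((1 - u) • (x - s)) := by module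
      rw [e, map_neg, map_smul, smul_eq_mul] at h
      have := (Carrier.pos_of_mem hc hξ).2
      nlinarith
    · exact h1

theorem hosted_change_segment {C : Set Point} {x : Point} {M : Point →L[ℝ] Point}
    {s t s₂ t₂ : Point} {R R₂ : Set Point} {ξ : Point →L[ℝ] ℝ} (hc : Carrier x s t R)
    (hc₂ : Carrier x s₂ t₂ R₂) (h : segment ℝ s t ∪ R = segment ℝ s₂ t₂ ∪ R₂)
    (hM : Function.Injective M) (hf : ∀ y, ξ (M y) = b.f y) (hξ : 0 < ξ (t - s))
    (hξ₂ : 0 < ξ (t₂ - s₂)) (hh : b.Hosted C x M s t R) : b.Hosted C x M s₂ t₂ R₂ := by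
  have hsub : segment ℝ x t₂ ⊆ segment ℝ s t ∪ R := by
    rw [h]
    exact ((convex_segment s₂ t₂).segment_subset (openSegment_subset_segment ℝ _ _ hc₂.mem)
      (right_mem_segment ℝ _ _)).trans subset_union_left
  have hsub' : segment ℝ x s₂ ⊆ segment ℝ s t ∪ R := by
    rw [h]
    exact ((convex_segment s₂ t₂).segment_subset (openSegment_subset_segment ℝ _ _ hc₂.mem)
      (left_mem_segment ℝ _ _)).trans subset_union_left
  have p2 := Carrier.pos_of_mem hc₂ hξ₂
  obtain ⟨τ, h1, h2, hτ⟩ := ((eventually_mem_segment hc hsub).and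
    ((eventually_mem_segment hc hsub').and (Ioo_mem_nhdsGT one_pos))).exists
  have t1 : x + τ • (t₂ - x) ∈ openSegment ℝ x t := by
    refine mem_openSegment_of_pos hc hξ h1 ?_
    rw [add_sub_cancel_left, map_smul, smul_eq_mul]
    exact mul_pos hτ.1 p2.1
  have s1 : x + τ • (s₂ - x) ∈ openSegment ℝ x s := by
    refine mem_openSegment_of_pos (ξ := -ξ) hc.symm ?_ (by rw [segment_symm]; exact h2) ?_
    · rw [neg_apply, ← map_neg, neg_sub]; exact hξ
    · rw [add_sub_cancel_left, map_smul, smul_eq_mul, neg_apply, ← map_neg, neg_sub]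
      exact mul_pos hτ.1 p2.2
  obtain ⟨R', a1, a2, a3⟩ := hosted_shrink_iff (C := C) hc s1 t1 hM hf hξ
  obtain ⟨R'', b1, b2, b3⟩ := hosted_shrink_iff (C := C) hc₂
    (openSegment_param.2 ⟨τ, hτ.1, hτ.2, rfl⟩) (openSegment_param.2 ⟨τ, hτ.1, hτ.2, rfl⟩) hM hf hξ₂
  have e : R' = R'' := by
    rw [a1.eq_compl, b1.eq_compl, a2, b2, h]
  rw [b3, ← e, ← a3]
  exact hh

/-- An injective linear map that does not change the isotopy type of any knot. -/
def Positive (M : Point →L[ℝ] Point) : Prop :=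
  Function.Injective M ∧ ∀ K, IsKnot K → Isotopic K (M '' K)

theorem positive_id : Positive (ContinuousLinearMap.id ℝ Point) :=
  ⟨Function.injective_id, fun K _ => by
    rw [ContinuousLinearMap.coe_id', image_id]; exact Isotopic.refl K⟩

theorem Hosted.change_functional {C : Set Point} {x : Point} {M : Point →L[ℝ] Point}
    {s t : Point} {R : Set Point} {ξ ξ₁ : Point →L[ℝ] ℝ} (h : b.Hosted C x M s t R)
    (hc : Carrier x s t R) (hM : Positive M) (hf : ∀ y, ξ (M y) = b.f y)
    (hξ : 0 < ξ (t - s)) (hξ₁ : 0 < ξ₁ (t - s)) :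
    ∃ M₁, Positive M₁ ∧ (∀ y, ξ₁ (M₁ y) = b.f y) ∧ b.Hosted C x M₁ s t R := by
  obtain ⟨E, hE, hR⟩ := hc.arc.exists_list
  set e := t - s with he
  let c : ℝ → ℝ := fun r => max 0 (min r 1)
  have hc0 : ∀ r, 0 ≤ c r := fun r => le_max_left _ _
  have hc1 : ∀ r, c r ≤ 1 := fun r => max_le zero_le_one (min_le_right _ _)
  have hcc : Continuous c := by fun_prop
  have c0 : c 0 = 0 := by simp [c]
  have c1 : c 1 = 1 := by simp [c]
  let η : ℝ → Point →L[ℝ] ℝ := fun r => ξ + c r • (ξ₁ - ξ)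
  have hη : Continuous η := by fun_prop
  have hηe : ∀ r, 0 < η r e := by
    intro r
    have : η r e = (1 - c r) * ξ e + c r * ξ₁ e := by
      simp only [η, add_apply, smul_apply, sub_apply, smul_eq_mul]; ring
    rw [this]
    rcases eq_or_lt_of_le (hc0 r) with h0 | h0
    · rw [← h0]; simpa using hξ
    · have := mul_pos h0 hξ₁
      have := mul_nonneg (sub_nonneg.2 (hc1 r)) hξ.le
      linarith
  let G : ℝ → Point →L[ℝ] Point := fun r =>
    ContinuousLinearMap.id ℝ Point + (η r e)⁻¹ • (ξ - η r).smulRight e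
  have hG : ∀ r y, G r y = y + ((η r e)⁻¹ * (ξ y - η r y)) • e := by
    intro r y
    simp only [G, add_apply, smul_apply, ContinuousLinearMap.smulRight_apply,
      ContinuousLinearMap.id_apply, sub_apply, smul_smul]
  have hηG : ∀ r y, η r (G r y) = ξ y := by
    intro r y
    rw [hG, map_add, map_smul, smul_eq_mul]
    field_simp [(hηe r).ne']
    ring
  have hGi : ∀ r, Function.Injective (G r) := by
    intro r
    rw [injective_iff_map_eq_zero]
    intro y hy
    have h1 : ξ y = 0 := by rw [← hηG r, hy, map_zero]
    rw [hG] at hy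
    have h2 : y = -((η r e)⁻¹ * (ξ y - η r y)) • e := by
      rw [neg_smul]; exact eq_neg_of_add_eq_zero_left hy
    rw [h2, map_smul, smul_eq_mul] at h1
    have h3 := (mul_eq_zero.1 h1).resolve_right hξ.ne'
    rw [h2, h3, zero_smul]
  have hGc : Continuous G := by
    have h1 : Continuous fun r => η r e := by fun_prop
    have h2 : Continuous fun r => (η r e)⁻¹ := h1.inv₀ fun r => (hηe r).ne'
    have h3 : Continuous fun r => (ContinuousLinearMap.smulRightL ℝ Point Point (ξ - η r)) e := by
      fun_prop
    have h4 : G = fun r => ContinuousLinearMap.id ℝ Point +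
        (η r e)⁻¹ • (ContinuousLinearMap.smulRightL ℝ Point Point (ξ - η r)) e := by
      funext r; ext; simp [G]; left; ring
    rw [h4]
    fun_prop
  have G0 : ∀ y, G 0 y = y := by
    intro y
    rw [hG]
    simp [η, c0]
  have η1 : η 1 = ξ₁ := by simp [η, c1]
  have hpos : ∀ r, 0 < η r (t - x) ∧ η r (s - x) < 0 := fun r => by
    have := Carrier.pos_of_mem hc (hηe r)
    exact ⟨this.1, by rw [← neg_sub, map_neg]; linarith⟩
  have key := eventually_isotopic_of_motion (b := b) (fun _ => x) (fun r => (G r).comp M) η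
    (fun _ => s) (fun _ => t) (E.map fun p _ => p) (by fun_prop) (by fun_prop) hη
    (by fun_prop) (by fun_prop)
    (by
      intro g hg
      obtain ⟨p, -, rfl⟩ := List.mem_map.1 hg
      fun_prop)
    (fun r => (hGi r).comp hM.1)
    (fun r y => by rw [ContinuousLinearMap.comp_apply, hηG, hf])
    (fun r hr => (hpos r).1) (fun r hr => (hpos r).2)
    (fun r hr => by
      have := hc.isSimple hE hR
      simpa [Function.comp_def] using this)
  have hG0M : (G 0).comp M = M := by ext y; simp [G0]
  refine ⟨(G 1).comp M, ⟨(hGi 1).comp hM.1, fun K hK => ?_⟩, fun y => ?_, h.congr ?_⟩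
  · have hMK := hM.2 K hK
    have hMK' : IsKnot (M '' K) := by
      rw [isKnot_iff_isLoop] at hK ⊢
      exact hMK.isLoop_iff.1 hK
    have h2 := isotopic_of_affine_path (fun r => (G r : Point →ₗ[ℝ] Point).toAffineMap) hGi
      (fun y => by
        change Continuous fun r => G r y
        fun_prop)
      (by ext y; simp [G0]) hMK'
    rw [ContinuousLinearMap.coe_comp, image_comp]
    exact hMK.trans h2
  · rw [← η1, ContinuousLinearMap.comp_apply, hηG, hf]
  · filter_upwards [key] with ε hε
    have := hε 1 (by simp)
    simp only [hG0M] at this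
    simpa [Function.comp_def, ← hR] using this

end Bead

/-! ### Transferring a bead along triangle moves -/

theorem exists_positive_functional {p q w : Point} (h : AffineIndependent ℝ ![p, q, w]) :
    ∃ ξ : Point →L[ℝ] ℝ, 0 < ξ (w - p) ∧ 0 < ξ (q - w) := by
  have h0 : (0 : Point) ∉ segment ℝ (w - p) (q - w) := by
    intro h0
    obtain ⟨t, t0, t1, ht⟩ := segment_param.1 h0
    rw [affineIndependent_iff_linearIndependent_vsub ℝ _ (0 : Fin 3)] at h
    have h1 := Fintype.linearIndependent_iff.1 h
    have h2 := (linearIndependent_equiv (finSuccAboveEquiv (0 : Fin 3))).2 h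
    have h3 := Fintype.linearIndependent_iff.1 h2 ![t, 1 - 2 * t] (by
      simp only [Fin.sum_univ_two, Function.comp_apply, finSuccAboveEquiv_apply]
      simp only [Matrix.cons_val_zero, Matrix.cons_val_one, vsub_eq_sub]
      change t • (q - p) + (1 - 2 * t) • (w - p) = 0
      rw [ht]; module)
    have h4 := h3 0
    have h5 := h3 1
    simp only [Matrix.cons_val_zero, Matrix.cons_val_one] at h4 h5
    linarith
  obtain ⟨f, u, hu, hf⟩ := geometric_hahn_banach_point_closed (convex_segment (w - p) (q - w))
    (isClosed_segment _ _) h0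
  rw [map_zero] at hu
  exact ⟨f, hu.trans (hf _ (left_mem_segment ℝ _ _)), hu.trans (hf _ (right_mem_segment ℝ _ _))⟩

theorem isSimple_of_monotone {p q x t : Point} {E : List Point} {H : Set Point}
    {ξ : Point →L[ℝ] ℝ} (hE : SimplePath (q :: (E ++ [p]))) (hH : Convex ℝ H)
    (hi : path (q :: (E ++ [p])) ∩ H ⊆ {p, q}) (hp : p ∈ H) (hq : q ∈ H) (hx : x ∈ H) (ht : t ∈ H)
    (h1 : ξ p < ξ x) (h2 : ξ x < ξ t) (h3 : ξ t < ξ q) :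
    IsSimple (x :: t :: ((q :: E) ++ [p])) := by
  have hlow : ∀ a b y : Point, y ∈ segment ℝ a b → ξ a < ξ b → ξ a < ξ y ∨ y = a := by
    intro a b y hy hab
    rw [← path_pair] at hy
    refine lt_or_eq_of_mem_path le_rfl ?_ hy
    simpa using hab
  have hhigh : ∀ a b y : Point, y ∈ segment ℝ a b → ξ a < ξ b → ξ y < ξ b ∨ y = b := by
    intro a b y hy hab
    rw [segment_symm, ← path_pair] at hy
    refine (lt_or_eq_of_mem_path (f := -ξ) (r := -ξ b) le_rfl ?_ hy).imp
      (fun h => neg_lt_neg_iff.1 h) id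
    simpa using hab
  have ne : ∀ a b : Point, ξ a < ξ b → a ≠ b := by
    rintro a b h rfl; exact lt_irrefl _ h
  rw [isSimple_vertex]
  refine ⟨⟨ne _ _ h3, ?_, hE⟩, ne _ _ h2, (ne _ _ h1).symm, ?_, ?_, ?_⟩
  · rintro y ⟨hy, hy'⟩
    rcases hi ⟨hy', hH.segment_subset ht hq hy⟩ with rfl | h
    · rcases hlow _ _ _ hy h3 with h | h
      · linarith
      · rw [h] at h1; linarith
    · exact h
  · rw [List.cons_append, path_cons_cons]
    rintro y ⟨hy, hy' | hy'⟩
    · rcases hhigh _ _ _ hy h2 with h | h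
      · rcases hlow _ _ _ hy' h3 with h' | h'
        · linarith
        · exact h'
      · exact h
    · exfalso
      have e1 : ξ x ≤ ξ y := (hlow _ _ _ hy h2).elim le_of_lt (fun h => by rw [h])
      have e2 : ξ y ≤ ξ t := (hhigh _ _ _ hy h2).elim le_of_lt (fun h => by rw [h])
      rcases hi ⟨hy', hH.segment_subset hx ht hy⟩ with h | h <;> rw [h] at e1 e2 <;> linarith
  · rw [List.cons_append, path_cons_cons]
    rintro y ⟨hy, hy' | hy'⟩
    · exfalso
      have e2 : ξ y ≤ ξ x := (hhigh _ _ _ hy h1).elim le_of_lt (fun h => by rw [h])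
      have e1 : ξ t ≤ ξ y := (hlow _ _ _ hy' h3).elim le_of_lt (fun h => by rw [h])
      linarith
    · have e2 : ξ y ≤ ξ x := (hhigh _ _ _ hy h1).elim le_of_lt (fun h => by rw [h])
      rcases hi ⟨hy', hH.segment_subset hp hx hy⟩ with h | h
      · exact h
      · rw [h] at e2; linarith
  · rintro y ⟨hy, hy'⟩
    rcases hhigh _ _ _ hy h1 with h | h
    · rcases hlow _ _ _ hy' h2 with h' | h'
      · linarith
      · exact h'
    · exact h

namespace Bead

variable {b : Bead}

theorem hosted_triangle_iff {C : Set Point} {p q w x₀ x₁ : Point} {T : Set Point}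
    {M : Point →L[ℝ] Point} {ξ : Point →L[ℝ] ℝ} (hT : Arc q p T)
    (hi : T ∩ convexHull ℝ {p, q, w} ⊆ {p, q}) (hp : 0 < ξ (w - p)) (hq : 0 < ξ (q - w))
    (hM : Function.Injective M) (hf : ∀ y, ξ (M y) = b.f y) (h0 : x₀ ∈ openSegment ℝ p q)
    (h1 : x₁ ∈ openSegment ℝ p w) :
    b.Hosted C x₀ M p q T ↔ b.Hosted C x₁ M p w (segment ℝ w q ∪ T) := by
  have hc : Carrier x₀ p q T := ⟨hT, h0, fun y hy => hi ⟨hy.2, triangle_base _ _ _ hy.1⟩⟩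
  have hpq : 0 < ξ (q - p) := by
    have e : q - p = (q - w) + (w - p) := by module
    rw [e, map_add]; positivity
  obtain ⟨u, u0, u1, hu⟩ := openSegment_param.1 h0
  obtain ⟨v, v0, v1, hv⟩ := openSegment_param.1 h1
  set t₀ := x₀ + (1 / 2 : ℝ) • (q - x₀) with ht₀
  have ht : t₀ ∈ openSegment ℝ x₀ q := openSegment_param.2 ⟨1 / 2, by norm_num, by norm_num, rfl⟩
  rw [hosted_subdivide_iff hc ht hM hf hpq]
  obtain ⟨E, hE, hR⟩ := hT.exists_list
  have hH := convex_convexHull ℝ ({p, q, w} : Set Point)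
  have hpH : p ∈ convexHull ℝ ({p, q, w} : Set Point) := subset_convexHull ℝ _ (by simp)
  have hqH : q ∈ convexHull ℝ ({p, q, w} : Set Point) := subset_convexHull ℝ _ (by simp)
  have hwH : w ∈ convexHull ℝ ({p, q, w} : Set Point) := subset_convexHull ℝ _ (by simp)
  have hx0H := hH.segment_subset hpH hqH (openSegment_subset_segment ℝ _ _ h0)
  have hx1H := hH.segment_subset hpH hwH (openSegment_subset_segment ℝ _ _ h1)
  have ht0H := hH.segment_subset hx0H hqH (openSegment_subset_segment ℝ _ _ ht)
  have hmem : ∀ r ∈ Icc (0 : ℝ) 1, ∀ y ∈ convexHull ℝ ({p, q, w} : Set Point),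
      ∀ z ∈ convexHull ℝ ({p, q, w} : Set Point),
      y + r • (z - y) ∈ convexHull ℝ ({p, q, w} : Set Point) := fun r hr y hy z hz =>
    hH.segment_subset hy hz (segment_param.2 ⟨r, hr.1, hr.2, rfl⟩)
  rw [map_sub] at hp hq hpq
  have e0 : ξ x₀ = ξ p + u * (ξ q - ξ p) := by rw [hu]; simp
  have e1 : ξ x₁ = ξ p + v * (ξ w - ξ p) := by rw [hv]; simp
  have et : ξ t₀ = ξ x₀ + (1 / 2) * (ξ q - ξ x₀) := by rw [ht₀]; simp
  have k0 : 0 < u * (ξ q - ξ p) := mul_pos u0 hpq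
  have k0' : 0 < (1 - u) * (ξ q - ξ p) := mul_pos (by linarith) hpq
  have k1 : 0 < v * (ξ w - ξ p) := mul_pos v0 hp
  have k1' : 0 < (1 - v) * (ξ w - ξ p) := mul_pos (by linarith) hp
  have hcomb : ∀ r ∈ Icc (0 : ℝ) 1, ∀ y z : ℝ, 0 < y → 0 < z → 0 < (1 - r) * y + r * z := by
    intro r hr y z hy hz
    rcases eq_or_lt_of_le hr.1 with h | h
    · rw [← h]; simpa using hy
    · have := mul_pos h hz
      have := mul_nonneg (sub_nonneg.2 hr.2) hy.le
      linarith
  have hξc : ∀ (r : ℝ) (y z : Point), ξ (y + r • (z - y)) = (1 - r) * ξ y + r * ξ z := by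
    intro r y z
    rw [map_add, map_smul, map_sub, smul_eq_mul]; ring
  have hord : ∀ r ∈ Icc (0 : ℝ) 1, ξ p < ξ (x₀ + r • (x₁ - x₀)) ∧
      ξ (x₀ + r • (x₁ - x₀)) < ξ (t₀ + r • (w - t₀)) ∧ ξ (t₀ + r • (w - t₀)) < ξ q := by
    intro r hr
    simp only [hξc]
    have a1 := hcomb r hr (ξ x₀ - ξ p) (ξ x₁ - ξ p) (by linarith) (by linarith)
    have a2 := hcomb r hr (ξ t₀ - ξ x₀) (ξ w - ξ x₁) (by linarith) (by linarith)
    have a3 := hcomb r hr (ξ q - ξ t₀) (ξ q - ξ w) (by linarith) (by linarith)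
    refine ⟨by linarith, by linarith, by linarith⟩
  have key := eventually_isotopic_of_motion (b := b) (fun r => x₀ + r • (x₁ - x₀)) (fun _ => M)
    (fun _ => ξ) (fun _ => p) (fun r => t₀ + r • (w - t₀)) ((q :: E).map fun z _ => z)
    (by fun_prop) (by fun_prop) (by fun_prop) (by fun_prop) (by fun_prop)
    (by
      intro g hg
      obtain ⟨z, -, rfl⟩ := List.mem_map.1 hg
      fun_prop)
    (fun _ => hM) (fun _ => hf)
    (fun r hr => by rw [map_sub]; linarith [(hord r hr).2.1])
    (fun r hr => by rw [map_sub]; linarith [(hord r hr).1])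
    (fun r hr => by
      simp only [List.map_map, Function.comp_def, List.map_id']
      exact isSimple_of_monotone hE hH (by rw [← hR]; exact hi) hpH hqH (hmem r hr _ hx0H _ hx1H)
        (hmem r hr _ ht0H _ hwH) (hord r hr).1 (hord r hr).2.1 (hord r hr).2.2)
  have hi' : ∀ᶠ ε : ℝ in 𝓝[>] 0, Isotopic (b.hostSet x₀ (ε • M) p t₀ ∪ (segment ℝ t₀ q ∪ T))
      (b.hostSet x₁ (ε • M) p w ∪ (segment ℝ w q ∪ T)) := by
    filter_upwards [key] with ε hε
    have := hε 1 (by simp)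
    simp only [List.map_map, Function.comp_def, List.map_id', zero_smul, add_zero, one_smul,
      add_sub_cancel] at this
    rw [hR]
    exact this
  constructor
  · intro h
    exact h.congr hi'
  · intro h
    exact h.congr (hi'.mono fun _ h => h.symm)

/-- The knot `L`, with the bead inserted somewhere, is isotopic to `C`. -/
def HostedOn (b : Bead) (C L : Set Point) : Prop :=
  ∃ (x s t : Point) (R : Set Point) (M : Point →L[ℝ] Point) (ξ : Point →L[ℝ] ℝ),
    Carrier x s t R ∧ L = segment ℝ s t ∪ R ∧ Positive M ∧ (∀ y, ξ (M y) = b.f y) ∧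
      0 < ξ (t - s) ∧ b.Hosted C x M s t R

theorem HostedOn.rev {C L : Set Point} (h : b.HostedOn C L) : b.rev.HostedOn C L := by
  obtain ⟨x, s, t, R, M, ξ, hc, hL, hM, hf, hξ, hh⟩ := h
  refine ⟨x, t, s, R, M, -ξ, hc.symm, by rw [segment_symm, hL], hM, fun y => ?_, ?_,
    rev_hosted_iff.2 hh⟩
  · rw [neg_apply, hf, rev_f_apply]
  · rw [neg_apply, ← map_neg, neg_sub]; exact hξ

theorem hostedOn_rev_iff {C L : Set Point} : b.rev.HostedOn C L ↔ b.HostedOn C L := by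
  refine ⟨fun h => ?_, HostedOn.rev⟩
  have := h.rev
  have e : b.rev.rev = b := by
    cases b; simp [Bead.rev]
  rwa [e] at this

theorem hostSet_subset {x s t : Point} {A : Point →L[ℝ] Point} {H : Set Point} (hH : Convex ℝ H)
    (hs : s ∈ H) (ht : t ∈ H) (hb : ∀ y ∈ b.verts, frame x A y ∈ H) : b.hostSet x A s t ⊆ H := by
  refine union_subset (union_subset ?_ ?_) ?_
  · exact hH.segment_subset hs (hb _ (by simp [verts]))
  · refine path_subset_of_convex hH ?_
    intro z hz
    obtain ⟨y, hy, rfl⟩ := List.mem_map.1 hz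
    exact hb y hy
  · exact hH.segment_subset (hb _ (by simp [verts])) ht

theorem eventually_hostSet_subset (x s t : Point) (M : Point →L[ℝ] Point) {H : Set Point}
    (hH : Convex ℝ H) (hHo : IsOpen H) (hs : s ∈ H) (ht : t ∈ H) (hx : x ∈ H) :
    ∀ᶠ ε : ℝ in 𝓝[>] 0, b.hostSet x (ε • M) s t ⊆ H := by
  have : ∀ᶠ ε : ℝ in 𝓝[>] 0, ∀ y ∈ b.verts, frame x (ε • M) y ∈ H := by
    have h1 : ∀ y, ∀ᶠ ε : ℝ in 𝓝[>] 0, frame x (ε • M) y ∈ H := by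
      intro y
      have h2 : Tendsto (fun ε : ℝ => x + ε • M y) (𝓝 0) (𝓝 (x + (0 : ℝ) • M y)) :=
        Continuous.tendsto (by fun_prop) 0
      rw [zero_smul, add_zero] at h2
      exact (h2.eventually (hHo.mem_nhds hx)).filter_mono nhdsWithin_le_nhds
    generalize b.verts = l
    induction l with
    | nil => simp
    | cons a l ih => simpa using (h1 a).and ih
  filter_upwards [this] with ε hε
  exact hostSet_subset hH hs ht hε

/-- A change of the loop away from the bead. -/
theorem HostedOn.change_away {C H P P' T : Set Point} {u v x s t : Point} {R : Set Point}
    {M : Point →L[ℝ] Point} {ξ : Point →L[ℝ] ℝ} (hH : IsClosed H) (hP : P ⊆ H)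
    (hP' : P' ⊆ H) (hT : T ∩ H ⊆ {u, v}) (hL : IsLoop (P' ∪ T))
    (hiso : ∀ R, R ∩ H ⊆ {u, v} → Isotopic (R ∪ P) (R ∪ P'))
    (hc : Carrier x s t R) (e : P ∪ T = segment ℝ s t ∪ R) (hM : Positive M)
    (hf : ∀ y, ξ (M y) = b.f y) (hξ : 0 < ξ (t - s)) (hh : b.Hosted C x M s t R) (hx : x ∉ H) :
    b.HostedOn C (P' ∪ T) := by
  obtain ⟨δ, hδ, hball⟩ := Metric.isOpen_iff.1 hH.isOpen_compl x hx
  have hnear : ∀ z : Point, ∀ᶠ τ : ℝ in 𝓝[>] 0, x + τ • (z - x) ∈ Metric.ball x δ := by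
    intro z
    have h2 : Tendsto (fun τ : ℝ => x + τ • (z - x)) (𝓝 0) (𝓝 (x + (0 : ℝ) • (z - x))) :=
      Continuous.tendsto (by fun_prop) 0
    rw [zero_smul, add_zero] at h2
    exact (h2.eventually (Metric.ball_mem_nhds x hδ)).filter_mono nhdsWithin_le_nhds
  obtain ⟨τ, hs, ht, hτ⟩ :=
    ((hnear s).and ((hnear t).and (Ioo_mem_nhdsGT one_pos))).exists
  have hs' : x + τ • (s - x) ∈ openSegment ℝ x s := openSegment_param.2 ⟨τ, hτ.1, hτ.2, rfl⟩
  have ht' : x + τ • (t - x) ∈ openSegment ℝ x t := openSegment_param.2 ⟨τ, hτ.1, hτ.2, rfl⟩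
  have hξ' : 0 < ξ (x + τ • (t - x) - (x + τ • (s - x))) := by
    have e : x + τ • (t - x) - (x + τ • (s - x)) = τ • (t - s) := by module
    rw [e, map_smul, smul_eq_mul]
    exact mul_pos hτ.1 hξ
  obtain ⟨R', hc', e', hh'⟩ := hosted_shrink_iff (C := C) hc hs' ht' hM.1 hf hξ
  rw [hh'] at hh
  generalize x + τ • (s - x) = s' at *
  generalize x + τ • (t - x) = t' at *
  have hsub : segment ℝ s' t' ⊆ Hᶜ := ((convex_ball x δ).segment_subset hs ht).trans hball
  have hsT : segment ℝ s' t' ⊆ T := by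
    intro z hz
    have : z ∈ P ∪ T := by rw [e, ← e']; exact Or.inl hz
    exact this.resolve_left fun h => hsub hz (hP h)
  obtain ⟨R'', a1, a2, a3⟩ := hL.exists_complementary_arc (Arc.seg hc'.arc.ne.symm)
    (hsT.trans subset_union_right)
  have hc'' : Carrier x s' t' R'' := ⟨a1, hc'.mem, a2⟩
  refine ⟨x, s', t', R'', M, ξ, hc'', a3, hM, hf, hξ', hh.congr ?_⟩
  set Z := (T \ segment ℝ s' t') ∪ {s', t'} with hZ
  have hdP : ∀ z ∈ P, z ∉ segment ℝ s' t' := fun z hz h => hsub h (hP hz)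
  have hdP' : ∀ z ∈ P', z ∉ segment ℝ s' t' := fun z hz h => hsub h (hP' hz)
  have eR' : R' = Z ∪ P := by
    rw [hc'.eq_compl, e', ← e, union_sdiff_distrib, hZ]
    rw [sdiff_eq_self_iff_disjoint.2 (disjoint_right.2 hdP)]
    ext; simp only [mem_union]; tauto
  have eR'' : R'' = Z ∪ P' := by
    rw [hc''.eq_compl, ← a3, union_sdiff_distrib, hZ]
    rw [sdiff_eq_self_iff_disjoint.2 (disjoint_right.2 hdP')]
    ext; simp only [mem_union]; tauto
  have hZT : Z ⊆ T := union_subset sdiff_subset (by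
    rintro z (rfl | rfl)
    · exact hsT (left_mem_segment ℝ _ _)
    · exact hsT (right_mem_segment ℝ _ _))
  filter_upwards [eventually_hostSet_subset (b := b) x s' t' M (convex_ball x δ) Metric.isOpen_ball
    hs ht (Metric.mem_ball_self hδ)] with ε hε
  rw [eR', eR'', ← union_assoc _ Z P, ← union_assoc _ Z P']
  refine hiso _ ?_
  rintro z ⟨hz | hz, hz'⟩
  · exact absurd hz' (hball (hε hz))
  · exact hT ⟨hZT hz, hz'⟩

theorem carrier_triangle {p q w x : Point} {T : Set Point} (h : AffineIndependent ℝ ![p, q, w])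
    (hT : Arc q p T) (hi : T ∩ convexHull ℝ {p, q, w} ⊆ {p, q}) (hx : x ∈ openSegment ℝ p w) :
    Carrier x p w (segment ℝ w q ∪ T) := by
  have hne := affineIndependent_ne h
  have hs : segment ℝ p w ∩ segment ℝ p q ⊆ {p} := by
    rw [segment_symm ℝ p w]
    exact triangle_sides_inter (affineIndependent_swap (affineIndependent_swap'
      (affineIndependent_swap h)))
  have hs' : segment ℝ q w ∩ segment ℝ q p ⊆ {q} := by
    rw [segment_symm ℝ q w]
    exact triangle_sides_inter (affineIndependent_swap (affineIndependent_swap'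
      (affineIndependent_swap (affineIndependent_swap' h))))
  refine ⟨Arc.cons hne.2.2.symm hT ?_, hx, ?_⟩
  · rintro y ⟨hy, hy'⟩
    rcases hi ⟨hy', triangle_right _ _ _ hy⟩ with rfl | h1
    · rw [segment_symm] at hy
      exact absurd (hs' ⟨hy, right_mem_segment ℝ _ _⟩) hne.1
    · exact h1
  · rintro y ⟨hy, hy' | hy'⟩
    · exact Or.inr (triangle_sides_inter h ⟨hy, hy'⟩)
    · rcases hi ⟨hy', triangle_left _ _ _ hy⟩ with h1 | rfl
      · exact Or.inl h1
      · exact absurd (hs ⟨hy, right_mem_segment ℝ _ _⟩) hne.1.symm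

theorem HostedOn.forward {C : Set Point} {p q w x : Point} {T : Set Point}
    {M : Point →L[ℝ] Point} {ξ : Point →L[ℝ] ℝ} (h : AffineIndependent ℝ ![p, q, w])
    (hT : Arc q p T) (hi : T ∩ convexHull ℝ {p, q, w} ⊆ {p, q}) (hM : Positive M)
    (hf : ∀ y, ξ (M y) = b.f y) (hx : x ∈ openSegment ℝ p q) (hξ : 0 < ξ (q - p))
    (hh : b.Hosted C x M p q T) : b.HostedOn C ((segment ℝ p w ∪ segment ℝ w q) ∪ T) := by
  obtain ⟨ξ₁, h1, h2⟩ := exists_positive_functional h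
  have h3 : 0 < ξ₁ (q - p) := by
    have e : q - p = (q - w) + (w - p) := by module
    rw [e, map_add]; positivity
  obtain ⟨M₁, hM₁, hf₁, hh₁⟩ := hh.change_functional
    ⟨hT, hx, fun y hy => hi ⟨hy.2, triangle_base _ _ _ hy.1⟩⟩ hM hf hξ h3
  have hm : p + (1 / 2 : ℝ) • (w - p) ∈ openSegment ℝ p w :=
    openSegment_param.2 ⟨1 / 2, by norm_num, by norm_num, rfl⟩
  rw [hosted_triangle_iff hT hi h1 h2 hM₁.1 hf₁ hx hm] at hh₁
  exact ⟨_, p, w, _, M₁, ξ₁, carrier_triangle h hT hi hm, union_assoc _ _ _, hM₁, hf₁, h1, hh₁⟩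

theorem HostedOn.backward {C : Set Point} {p q w x : Point} {T : Set Point}
    {M : Point →L[ℝ] Point} {ξ : Point →L[ℝ] ℝ} (h : AffineIndependent ℝ ![p, q, w])
    (hT : Arc q p T) (hi : T ∩ convexHull ℝ {p, q, w} ⊆ {p, q}) (hM : Positive M)
    (hf : ∀ y, ξ (M y) = b.f y) (hx : x ∈ openSegment ℝ p w) (hξ : 0 < ξ (w - p))
    (hh : b.Hosted C x M p w (segment ℝ w q ∪ T)) : b.HostedOn C (segment ℝ p q ∪ T) := by
  obtain ⟨ξ₁, h1, h2⟩ := exists_positive_functional h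
  have h3 : 0 < ξ₁ (q - p) := by
    have e : q - p = (q - w) + (w - p) := by module
    rw [e, map_add]; positivity
  obtain ⟨M₁, hM₁, hf₁, hh₁⟩ := hh.change_functional (carrier_triangle h hT hi hx) hM hf hξ h1
  have hm : p + (1 / 2 : ℝ) • (q - p) ∈ openSegment ℝ p q :=
    openSegment_param.2 ⟨1 / 2, by norm_num, by norm_num, rfl⟩
  rw [← hosted_triangle_iff hT hi h1 h2 hM₁.1 hf₁ hm hx] at hh₁
  exact ⟨_, p, q, _, M₁, ξ₁, ⟨hT, hm, fun y hy => hi ⟨hy.2, triangle_base _ _ _ hy.1⟩⟩, rfl, hM₁,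
    hf₁, h3, hh₁⟩

theorem HostedOn.backward' {C : Set Point} {p q w x s t : Point} {T R : Set Point}
    {M : Point →L[ℝ] Point} {ξ : Point →L[ℝ] ℝ} (h : AffineIndependent ℝ ![p, q, w])
    (hT : Arc q p T) (hi : T ∩ convexHull ℝ {p, q, w} ⊆ {p, q}) (hM : Positive M)
    (hf : ∀ y, ξ (M y) = b.f y) (hx : x ∈ openSegment ℝ p w) (hc : Carrier x s t R)
    (hξ : 0 < ξ (t - s)) (he : segment ℝ s t ∪ R = (segment ℝ p w ∪ segment ℝ w q) ∪ T)
    (hh : b.Hosted C x M s t R) : b.HostedOn C (segment ℝ p q ∪ T) := by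
  have hc₂ := carrier_triangle h hT hi hx
  have he' : segment ℝ s t ∪ R = segment ℝ p w ∪ (segment ℝ w q ∪ T) := by rw [he, union_assoc]
  obtain ⟨r, hr, e⟩ := exists_parallel hc hc₂ he'
  rcases lt_or_gt_of_ne hr with hr | hr
  · rw [← hostedOn_rev_iff]
    have hξ₂ : 0 < (-ξ) (w - p) := by
      rw [neg_apply, e, map_smul, smul_eq_mul]; nlinarith
    refine HostedOn.backward (ξ := -ξ) h hT hi hM (fun y => by rw [neg_apply, hf, rev_f_apply])
      hx hξ₂ ?_
    rw [rev_hosted_iff]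
    exact hosted_change_segment hc hc₂.symm (by rw [he', segment_symm ℝ p w]) hM.1 hf hξ
      (by rw [← neg_sub, map_neg]; exact hξ₂) hh
  · have hξ₂ : 0 < ξ (w - p) := by
      rw [e, map_smul, smul_eq_mul]; positivity
    exact HostedOn.backward h hT hi hM hf hx hξ₂
      (hosted_change_segment hc hc₂ he' hM.1 hf hξ hξ₂ hh)

theorem HostedOn.forward' {C : Set Point} {p q w x s t : Point} {T R : Set Point}
    {M : Point →L[ℝ] Point} {ξ : Point →L[ℝ] ℝ} (h : AffineIndependent ℝ ![p, q, w])
    (hT : Arc q p T) (hi : T ∩ convexHull ℝ {p, q, w} ⊆ {p, q}) (hM : Positive M)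
    (hf : ∀ y, ξ (M y) = b.f y) (hx : x ∈ openSegment ℝ p q) (hc : Carrier x s t R)
    (hξ : 0 < ξ (t - s)) (he : segment ℝ s t ∪ R = segment ℝ p q ∪ T)
    (hh : b.Hosted C x M s t R) :
    b.HostedOn C ((segment ℝ p w ∪ segment ℝ w q) ∪ T) := by
  have hc₂ : Carrier x p q T := ⟨hT, hx, fun y hy => hi ⟨hy.2, triangle_base _ _ _ hy.1⟩⟩
  obtain ⟨r, hr, e⟩ := exists_parallel hc hc₂ he
  rcases lt_or_gt_of_ne hr with hr | hr
  · have hξ₂ : 0 < (-ξ) (q - p) := by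
      rw [neg_apply, e, map_smul, smul_eq_mul]; nlinarith
    rw [← hostedOn_rev_iff]
    refine HostedOn.forward (ξ := -ξ) h hT hi hM (fun y => by rw [neg_apply, hf, rev_f_apply])
      hx hξ₂ ?_
    rw [rev_hosted_iff]
    exact hosted_change_segment hc hc₂.symm (by rw [he, segment_symm ℝ p q]) hM.1 hf hξ
      (by rw [← neg_sub, map_neg]; exact hξ₂) hh
  · have hξ₂ : 0 < ξ (q - p) := by
      rw [e, map_smul, smul_eq_mul]; positivity
    exact HostedOn.forward h hT hi hM hf hx hξ₂
      (hosted_change_segment hc hc₂ he hM.1 hf hξ hξ₂ hh)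

theorem exists_mem_openSegment_notMem {s t : Point} (h : s ≠ t) (F : Finset Point) :
    ∃ y ∈ openSegment ℝ s t, y ∉ F := by
  have : (openSegment ℝ s t).Infinite := by
    rw [openSegment_eq_image_lineMap]
    exact (Ioo_infinite zero_lt_one).image ((AffineMap.lineMap_injective ℝ h).injOn)
  exact this.exists_notMem_finset F

theorem hostedOn_triangle {C : Set Point} {u v w : Point} {T : Set Point}
    (h : AffineIndependent ℝ ![u, v, w]) (hT : Arc v u T)
    (hi : T ∩ convexHull ℝ {u, v, w} ⊆ {u, v}) :
    b.HostedOn C (segment ℝ u v ∪ T) ↔ b.HostedOn C ((segment ℝ u w ∪ segment ℝ w v) ∪ T) := by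
  have hswap : ({v, u, w} : Set Point) = {u, v, w} := insert_comm v u {w}
  have hH : IsClosed (convexHull ℝ ({u, v, w} : Set Point)) :=
    ((Set.toFinite ({u, v, w} : Set Point)).isCompact_convexHull (𝕜 := ℝ)).isClosed
  have hne := affineIndependent_ne h
  have hT' : Arc u v T := hT.symm
  have hl : IsLoop (segment ℝ u v ∪ T) :=
    ⟨u, v, _, T, Arc.seg hne.1, hT, fun y hy => hi ⟨hy.2, triangle_base _ _ _ hy.1⟩, rfl⟩
  have hl' : IsLoop ((segment ℝ u w ∪ segment ℝ w v) ∪ T) := by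
    have := (carrier_triangle h hT hi (x := u + (1 / 2 : ℝ) • (w - u))
      (openSegment_param.2 ⟨1 / 2, by norm_num, by norm_num, rfl⟩)).isLoop
    rwa [union_assoc]
  have hsub : segment ℝ u w ∪ segment ℝ w v ⊆ convexHull ℝ {u, v, w} :=
    union_subset (triangle_left _ _ _) (triangle_right _ _ _)
  constructor
  · rintro ⟨x, s, t, R, M, ξ, hc, he, hM, hf, hξ, hh⟩
    by_cases hy : ∃ y ∈ openSegment ℝ s t, y ∉ convexHull ℝ ({u, v, w} : Set Point)
    · obtain ⟨y, hy, hy'⟩ := hy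
      exact HostedOn.change_away hH (triangle_base u v w) hsub hi hl'
        (fun R hR => isotopic_triangle h hR) (hc.of_mem hy) he hM hf hξ
        (hh.slide hc hy hM.1 hf hξ) hy'
    · push Not at hy
      obtain ⟨y, hy1, hy2⟩ := exists_mem_openSegment_notMem hc.arc.ne.symm ({u, v} : Finset Point)
      simp only [Finset.mem_insert, Finset.mem_singleton, not_or] at hy2
      have hyL : y ∈ segment ℝ u v ∪ T := by
        rw [he]; exact Or.inl (openSegment_subset_segment ℝ _ _ hy1)
      have hy3 : y ∈ segment ℝ u v := by
        refine hyL.resolve_right fun hyT => ?_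
        rcases hi ⟨hyT, hy y hy1⟩ with h1 | h1
        · exact hy2.1 h1
        · exact hy2.2 h1
      exact HostedOn.forward' h hT hi hM hf
        (mem_openSegment_of_ne_left_right (Ne.symm hy2.1) (Ne.symm hy2.2) hy3)
        (hc.of_mem hy1) hξ he.symm (hh.slide hc hy1 hM.1 hf hξ)
  · rintro ⟨x, s, t, R, M, ξ, hc, he, hM, hf, hξ, hh⟩
    by_cases hy : ∃ y ∈ openSegment ℝ s t, y ∉ convexHull ℝ ({u, v, w} : Set Point)
    · obtain ⟨y, hy, hy'⟩ := hy
      exact HostedOn.change_away hH hsub (triangle_base u v w) hi hl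
        (fun R hR => (isotopic_triangle h hR).symm) (hc.of_mem hy) he hM hf hξ
        (hh.slide hc hy hM.1 hf hξ) hy'
    · push Not at hy
      obtain ⟨y, hy1, hy2⟩ :=
        exists_mem_openSegment_notMem hc.arc.ne.symm ({u, v, w} : Finset Point)
      simp only [Finset.mem_insert, Finset.mem_singleton, not_or] at hy2
      have hyL : y ∈ (segment ℝ u w ∪ segment ℝ w v) ∪ T := by
        rw [he]; exact Or.inl (openSegment_subset_segment ℝ _ _ hy1)
      have hy3 : y ∈ segment ℝ u w ∪ segment ℝ w v := by
        refine hyL.resolve_right fun hyT => ?_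
        rcases hi ⟨hyT, hy y hy1⟩ with h1 | h1
        · exact hy2.1 h1
        · exact hy2.2.1 h1
      rcases hy3 with hy3 | hy3
      · exact HostedOn.backward' h hT hi hM hf
          (mem_openSegment_of_ne_left_right (Ne.symm hy2.1) (Ne.symm hy2.2.2) hy3)
          (hc.of_mem hy1) hξ he.symm (hh.slide hc hy1 hM.1 hf hξ)
      · rw [segment_symm ℝ u v]
        rw [segment_symm] at hy3
        refine HostedOn.backward' (affineIndependent_swap' h) hT.symm
          (by rw [hswap, pair_comm v u]; exact hi) hM hf
          (mem_openSegment_of_ne_left_right (Ne.symm hy2.2.1) (Ne.symm hy2.2.2) hy3)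
          (hc.of_mem hy1) hξ ?_ (hh.slide hc hy1 hM.1 hf hξ)
        rw [← he, segment_symm ℝ v w, segment_symm ℝ w u, union_comm (segment ℝ w v)]

theorem hostedOn_iff_of_isotopic {C L L' : Set Point} (hL : IsLoop L) (h : Isotopic L L') :
    b.HostedOn C L ↔ b.HostedOn C L' := by
  induction h with
  | rel K K' h =>
    obtain ⟨u, v, w, T, h1, h2, h3, rfl, rfl⟩ := h.exists_arc (Or.inl hL)
    exact hostedOn_triangle h1 h2 h3
  | refl K => exact Iff.rfl
  | symm K K' h ih =>
    have hh : Isotopic K K' := h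
    exact (ih (hh.isLoop_iff.2 hL)).symm
  | trans K K' K'' h h' ih ih' =>
    have hh : Isotopic K K' := h
    exact (ih hL).trans (ih' (hh.isLoop_iff.1 hL))

end Bead

/-! ### Beads on triangles -/

theorem affineIndependent_iff_pair {u v w : Point} : AffineIndependent ℝ ![u, v, w] ↔
    ∀ s t : ℝ, s • (v - u) + t • (w - u) = 0 → s = 0 ∧ t = 0 := by
  rw [affineIndependent_iff_linearIndependent_vsub ℝ _ (0 : Fin 3),
    ← linearIndependent_equiv (finSuccAboveEquiv (0 : Fin 3)), ← LinearIndependent.pair_iff]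
  have : (fun i : { x : Fin 3 // x ≠ 0 } => (![u, v, w] i -ᵥ ![u, v, w] 0 : Point)) ∘
      (finSuccAboveEquiv (0 : Fin 3)) = ![v - u, w - u] := by
    funext i
    fin_cases i <;> rfl
  rw [this]

theorem carrier_of_triangle {a b c x : Point} (h : AffineIndependent ℝ ![a, b, c])
    (hx : x ∈ openSegment ℝ a b) : Carrier x a b (segment ℝ b c ∪ segment ℝ c a) := by
  have hne := affineIndependent_ne h
  have h1 := affineIndependent_swap h
  refine ⟨Arc.cons hne.2.2 (Arc.seg hne.2.1.symm) ?_, hx, ?_⟩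
  · exact triangle_sides_inter (affineIndependent_swap' h)
  · rintro y ⟨hy, hy' | hy'⟩
    · exact Or.inr (triangle_sides_inter h1 ⟨hy, hy'⟩)
    · refine Or.inl ?_
      rw [segment_symm] at hy hy'
      exact triangle_sides_inter (affineIndependent_swap (affineIndependent_swap' h))
        ⟨hy, hy'⟩

theorem path_triple (a b c : Point) : path [a, b, c] = segment ℝ a b ∪ segment ℝ b c := by
  rw [path_cons_cons, path_pair]

theorem polygon_triangle (a b c : Point) :
    polygon [a, b, c] = segment ℝ a b ∪ (segment ℝ b c ∪ segment ℝ c a) := by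
  rw [polygon_cons]
  change path [a, b, c, a] = _
  rw [path_cons_cons, path_triple]

namespace Bead

variable {b : Bead}

theorem Hosted.move_triangle {C : Set Point} {a e c : ℝ → Point} (ha : Continuous a)
    (he : Continuous e) (hc : Continuous c)
    (h : ∀ r ∈ Icc (0 : ℝ) 1, AffineIndependent ℝ ![a r, e r, c r])
    (h0 : ∀ r ∈ Icc (0 : ℝ) 1, (0 : Point) ∈ openSegment ℝ (a r) (e r))
    (hfe : ∀ r ∈ Icc (0 : ℝ) 1, 0 < b.f (e r)) (hfa : ∀ r ∈ Icc (0 : ℝ) 1, b.f (a r) < 0)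
    (hh : b.Hosted C 0 (ContinuousLinearMap.id ℝ Point) (a 0) (e 0)
      (segment ℝ (e 0) (c 0) ∪ segment ℝ (c 0) (a 0))) :
    b.Hosted C 0 (ContinuousLinearMap.id ℝ Point) (a 1) (e 1)
      (segment ℝ (e 1) (c 1) ∪ segment ℝ (c 1) (a 1)) := by
  have key := eventually_isotopic_of_motion (b := b) (fun _ => 0)
    (fun _ => ContinuousLinearMap.id ℝ Point) (fun _ => b.f) a e [c] (by fun_prop) (by fun_prop)
    (by fun_prop) ha he (by simpa using hc) (fun _ => Function.injective_id) (fun _ _ => rfl)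
    (fun r hr => by simpa using hfe r hr) (fun r hr => by simpa using hfa r hr)
    (fun r hr => by
      have hcar := carrier_of_triangle (h r hr) (h0 r hr)
      refine hcar.isSimple ?_ (path_triple _ _ _).symm
      have hne := affineIndependent_ne (h r hr)
      refine ⟨hne.2.2, ?_, hne.2.1.symm, fun p hp => hp.2, trivial⟩
      change segment ℝ (e r) (c r) ∩ path [c r, a r] ⊆ {c r}
      rw [path_pair]
      exact triangle_sides_inter (affineIndependent_swap' (h r hr)))
  refine hh.congr ?_
  filter_upwards [key] with ε hε
  rw [← path_triple, ← path_triple]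
  exact hε 1 (by simp)

theorem affineIndependent_of_pair {d k : Point} (h : LinearIndependent ℝ ![d, k]) {l m : ℝ}
    (hl : 0 < l) (hm : 0 < m) : AffineIndependent ℝ ![(-l) • d, m • d, k] := by
  rw [LinearIndependent.pair_iff] at h
  rw [affineIndependent_iff_pair]
  intro s t hst
  have := h (s * (m + l) + t * l) t (by rw [← hst]; module)
  obtain ⟨h1, rfl⟩ := this
  rw [zero_mul, add_zero] at h1
  exact ⟨(mul_eq_zero.1 h1).resolve_right (by positivity), rfl⟩

theorem zero_mem_openSegment (d : Point) {l m : ℝ} (hl : 0 < l) (hm : 0 < m) :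
    (0 : Point) ∈ openSegment ℝ ((-l) • d) (m • d) := by
  refine openSegment_param.2 ⟨l / (l + m), by positivity, ?_, ?_⟩
  · rw [div_lt_one (by positivity)]; linarith
  · rw [← sub_smul, smul_smul, ← add_smul]
    have : -l + l / (l + m) * (m - -l) = 0 := by field_simp; ring
    rw [this, zero_smul]

/-- The bead on the side from `-d` to `d` of the triangle with vertices `-d`, `d`, `k`. -/
def OnPair (b : Bead) (C : Set Point) (d k : Point) : Prop :=
  LinearIndependent ℝ ![d, k] ∧ 0 < b.f d ∧
    b.Hosted C 0 (ContinuousLinearMap.id ℝ Point) (-d) d (segment ℝ d k ∪ segment ℝ k (-d))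

theorem OnPair.move {C : Set Point} {d k : ℝ → Point} (hd : Continuous d) (hk : Continuous k)
    (h : ∀ r ∈ Icc (0 : ℝ) 1, LinearIndependent ℝ ![d r, k r])
    (hf : ∀ r ∈ Icc (0 : ℝ) 1, 0 < b.f (d r)) (hh : b.OnPair C (d 0) (k 0)) :
    b.OnPair C (d 1) (k 1) := by
  refine ⟨h 1 (by simp), hf 1 (by simp), ?_⟩
  refine Hosted.move_triangle (a := fun r => -d r) (e := d) (c := k) (by fun_prop) hd hk ?_ ?_ hf ?_
    hh.2.2
  · intro r hr
    simpa using affineIndependent_of_pair (h r hr) one_pos one_pos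
  · intro r hr
    simpa using zero_mem_openSegment (d r) one_pos one_pos
  · intro r hr
    rw [map_neg]
    linarith [hf r hr]

theorem linearIndependent_of_notMem_span {d k n : Point} (hd : d ≠ 0)
    (hn : n ∉ Submodule.span ℝ {d, k}) {s : ℝ} (hs : s ≠ 0) (t : ℝ) :
    LinearIndependent ℝ ![d, t • k + s • n] := by
  rw [LinearIndependent.pair_iff]
  intro u v huv
  have hv : v = 0 := by
    by_contra hv
    apply hn
    rw [Submodule.mem_span_pair]
    refine ⟨-(u / (v * s)), -(t / s), ?_⟩
    have : (v * s) • n = -(u • d) - (v * t) • k := by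
      rw [eq_sub_iff_add_eq, eq_neg_iff_add_eq_zero, ← huv]; module
    have h2 : n = (v * s)⁻¹ • (-(u • d) - (v * t) • k) := by
      rw [← this, inv_smul_smul₀ (mul_ne_zero hv hs)]
    rw [h2, smul_sub, smul_neg, smul_smul, smul_smul, sub_eq_add_neg, neg_smul, neg_smul]
    congr 3
    · field_simp
    · field_simp
  rw [hv, zero_smul, add_zero] at huv
  exact ⟨(smul_eq_zero.1 huv).resolve_right hd, hv⟩

theorem OnPair.move_right {C : Set Point} {d k n : Point} (hh : b.OnPair C d k)
    (hn : n ∉ Submodule.span ℝ {d, k}) : b.OnPair C d n := by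
  have hd : d ≠ 0 := by
    rintro rfl
    simpa using hh.2.1
  have := OnPair.move (b := b) (C := C) (d := fun _ => d) (k := fun r => (1 - r) • k + r • n)
    (by fun_prop) (by fun_prop) ?_ (fun _ _ => hh.2.1) (by simpa using hh)
  · simpa using this
  · intro r hr
    by_cases h0 : r = 0
    · rw [h0]; simpa using hh.1
    · exact linearIndependent_of_notMem_span hd hn h0 _

theorem OnPair.move_left {C : Set Point} {d e n : Point} (hh : b.OnPair C d n) (he : 0 < b.f e)
    (hn : n ∉ Submodule.span ℝ {d, e}) : b.OnPair C e n := by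
  have hf : ∀ r ∈ Icc (0 : ℝ) 1, 0 < b.f ((1 - r) • d + r • e) := by
    intro r hr
    rw [map_add, map_smul, map_smul, smul_eq_mul, smul_eq_mul]
    rcases eq_or_lt_of_le hr.1 with h | h
    · rw [← h]; simpa using hh.2.1
    · have := mul_pos h he
      have := mul_nonneg (sub_nonneg.2 hr.2) hh.2.1.le
      linarith
  have := OnPair.move (b := b) (C := C) (d := fun r => (1 - r) • d + r • e) (k := fun _ => n)
    (by fun_prop) (by fun_prop) ?_ hf (by simpa using hh)
  · simpa using this
  · intro r hr
    have h0 : (1 - r) • d + r • e ≠ 0 := by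
      intro h0
      have := hf r hr
      rw [h0, map_zero] at this
      exact lt_irrefl _ this
    have h1 : n ∉ Submodule.span ℝ {(1 - r) • d + r • e, 0} := by
      intro h
      apply hn
      refine Submodule.span_le.2 ?_ h
      rintro y (rfl | rfl)
      · exact Submodule.mem_span_pair.2 ⟨_, _, rfl⟩
      · exact Submodule.zero_mem _
    simpa using linearIndependent_of_notMem_span h0 h1 one_ne_zero 0

theorem OnPair.change {C : Set Point} {d k e z : Point} (hh : b.OnPair C d k) (he : 0 < b.f e)
    (hez : LinearIndependent ℝ ![e, z]) : b.OnPair C e z := by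
  have hspan : ∀ x y : Point, Submodule.span ℝ {x, y} ≠ ⊤ := by
    intro x y h
    have h1 : Module.finrank ℝ (Submodule.span ℝ (({x, y} : Finset Point) : Set Point)) ≤ 2 :=
      (finrank_span_finset_le_card _).trans (Finset.card_le_two)
    rw [Finset.coe_pair, h, finrank_top] at h1
    simp at h1
  obtain ⟨n, hn⟩ : ∃ n : Point, n ∉ ⋃ p ∈ ({Submodule.span ℝ {d, k}, Submodule.span ℝ {d, e},
      Submodule.span ℝ {e, z}} : Finset (Submodule ℝ Point)), (p : Set Point) := by
    rw [← ne_univ_iff_exists_notMem]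
    apply Subspace.biUnion_ne_univ_of_top_notMem
    simp only [Finset.mem_insert, Finset.mem_singleton, not_or]
    exact ⟨(hspan _ _).symm, (hspan _ _).symm, (hspan _ _).symm⟩
  simp only [Finset.mem_insert, Finset.mem_singleton, iUnion_iUnion_eq_or_left, iUnion_iUnion_eq_left,
    mem_union, SetLike.mem_coe, not_or] at hn
  have h1 := (hh.move_right hn.1).move_left he hn.2.1
  refine h1.move_right ?_
  intro h
  obtain ⟨s, t, hst⟩ := Submodule.mem_span_pair.1 h
  by_cases ht : t = 0
  · rw [ht, zero_smul, add_zero] at hst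
    have := LinearIndependent.pair_iff.1 hez s (-1) (by rw [hst]; module)
    norm_num at this
  · apply hn.2.2
    rw [Submodule.mem_span_pair]
    refine ⟨-(s / t), t⁻¹, ?_⟩
    rw [← hst, smul_add, inv_smul_smul₀ ht, smul_smul, ← add_assoc, ← add_smul]
    have : -(s / t) + t⁻¹ * s = 0 := by field_simp; ring
    rw [this, zero_smul, zero_add]

theorem isKnot_of_image {K : Set Point} (f : Point ≃ᵃ[ℝ] Point) (h : IsKnot (f '' K)) :
    IsKnot K := by
  obtain ⟨l, hl, he⟩ := h
  refine ⟨l.map f.symm.toAffineMap, isSimple_map hl _ f.symm.injective, ?_⟩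
  rw [polygon_map, ← he, image_image]
  simp

theorem Hosted.normalize {C : Set Point} (hC : IsLoop C) {x s t : Point} {M : Point →L[ℝ] Point}
    (hM : Positive M) {c : Point} (hh : b.Hosted C x M s t (segment ℝ t c ∪ segment ℝ c s))
    (g : Point ≃ₗ[ℝ] Point) (hg : ∀ y, g y = M y) :
    b.Hosted C 0 (ContinuousLinearMap.id ℝ Point) (g.symm (s - x)) (g.symm (t - x))
      (segment ℝ (g.symm (t - x)) (g.symm (c - x)) ∪
        segment ℝ (g.symm (c - x)) (g.symm (s - x))) := by
  refine hh.congr ?_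
  filter_upwards [hh] with ε hε
  let F : Point ≃ᵃ[ℝ] Point := g.toAffineEquiv.trans (AffineEquiv.constVAdd ℝ Point x)
  have hF : ∀ y, F y = M y + x := fun y => by
    change x + g y = _; rw [hg, add_comm]
  have hFs : ∀ y, F (g.symm (y - x)) = y := fun y => by
    rw [hF, ← hg, LinearEquiv.apply_symm_apply, sub_add_cancel]
  set Y := b.hostSet 0 (ε • ContinuousLinearMap.id ℝ Point) (g.symm (s - x)) (g.symm (t - x)) ∪
    (segment ℝ (g.symm (t - x)) (g.symm (c - x)) ∪ segment ℝ (g.symm (c - x)) (g.symm (s - x)))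
    with hY
  have hseg : ∀ y z : Point, F '' segment ℝ y z = segment ℝ (F y) (F z) := fun y z =>
    image_segment ℝ F.toAffineMap y z
  have hfr : ∀ y, F (frame 0 (ε • ContinuousLinearMap.id ℝ Point) y) = frame x (ε • M) y := by
    intro y
    rw [hF, frame_apply, frame_apply]
    simp [add_comm]
  have e : F '' Y = b.hostSet x (ε • M) s t ∪ (segment ℝ t c ∪ segment ℝ c s) := by
    have hp := path_map (b.verts.map (frame 0 (ε • ContinuousLinearMap.id ℝ Point))) F.toAffineMap
    have hl : (b.verts.map (frame 0 (ε • ContinuousLinearMap.id ℝ Point))).map F.toAffineMap =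
        b.verts.map (frame x (ε • M)) := by
      rw [List.map_map]
      exact List.map_congr_left fun y _ => hfr y
    rw [hl] at hp
    have hp' : F '' path (b.verts.map (frame 0 (ε • ContinuousLinearMap.id ℝ Point))) =
      path (b.verts.map (frame x (ε • M))) := hp.symm
    rw [hY, hostSet, hostSet]
    simp only [image_union, hseg, hFs, hfr, hp']
  rw [← e]
  have hK : IsKnot Y := by
    apply isKnot_of_image F
    rw [e, isKnot_iff_isLoop]
    exact hε.isLoop_iff.2 hC
  have h1 := hM.2 Y hK
  have hK' : IsKnot (M '' Y) := by
    rw [isKnot_iff_isLoop] at hK ⊢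
    exact h1.isLoop_iff.1 hK
  have h2 := isotopic_translate hK' x
  rw [image_image] at h2
  have e2 : F '' Y = (fun y => M y + x) '' Y := image_congr fun y _ => hF y
  rw [e2]
  exact (h1.trans h2).symm

theorem HostedOn.exists_onPair {C : Set Point} (hC : IsLoop C) {p q w : Point}
    (h : AffineIndependent ℝ ![p, q, w]) (hh : b.HostedOn C (polygon [p, q, w])) :
    ∃ d k, b.OnPair C d k := by
  obtain ⟨x, s, t, R, M, ξ, hc, he, hM, hf, hξ, hh⟩ := hh
  rw [polygon_triangle] at he
  obtain ⟨y, hy1, hy2⟩ := exists_mem_openSegment_notMem hc.arc.ne.symm ({p, q, w} : Finset Point)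
  simp only [Finset.mem_insert, Finset.mem_singleton, not_or] at hy2
  obtain ⟨a, e, c, h1, h2, h3⟩ : ∃ a e c, AffineIndependent ℝ ![a, e, c] ∧ y ∈ openSegment ℝ a e ∧
      segment ℝ s t ∪ R = segment ℝ a e ∪ (segment ℝ e c ∪ segment ℝ c a) := by
    have hyL : y ∈ segment ℝ p q ∪ (segment ℝ q w ∪ segment ℝ w p) := by
      rw [he]; exact Or.inl (openSegment_subset_segment ℝ _ _ hy1)
    rcases hyL with hy | hy | hy
    · exact ⟨p, q, w, h,
        mem_openSegment_of_ne_left_right (Ne.symm hy2.1) (Ne.symm hy2.2.1) hy, he.symm⟩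
    · refine ⟨q, w, p, affineIndependent_swap (affineIndependent_swap' h),
        mem_openSegment_of_ne_left_right (Ne.symm hy2.2.1) (Ne.symm hy2.2.2) hy, ?_⟩
      rw [← he]; ext; simp only [mem_union]; tauto
    · refine ⟨w, p, q, affineIndependent_swap' (affineIndependent_swap h),
        mem_openSegment_of_ne_left_right (Ne.symm hy2.2.2) (Ne.symm hy2.1) hy, ?_⟩
      rw [← he]; ext; simp only [mem_union]; tauto
  obtain ⟨a, e, c, h1, h2, h3, h4⟩ : ∃ a e c, AffineIndependent ℝ ![a, e, c] ∧
      y ∈ openSegment ℝ a e ∧ 0 < ξ (e - a) ∧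
      segment ℝ s t ∪ R = segment ℝ a e ∪ (segment ℝ e c ∪ segment ℝ c a) := by
    obtain ⟨r, hr, er⟩ := exists_parallel (hc.of_mem hy1) (carrier_of_triangle h1 h2) h3
    rcases lt_or_gt_of_ne hr with hr | hr
    · refine ⟨e, a, c, affineIndependent_swap' h1, by rwa [openSegment_symm], ?_, ?_⟩
      · rw [← neg_sub, map_neg, er, map_smul, smul_eq_mul]; nlinarith
      · rw [h3, segment_symm ℝ a e, segment_symm ℝ e c, segment_symm ℝ c a]
        ext; simp only [mem_union]; tauto
    · refine ⟨a, e, c, h1, h2, ?_, h3⟩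
      rw [er, map_smul, smul_eq_mul]; positivity
  have h5 := hosted_change_segment (hc.of_mem hy1) (carrier_of_triangle h1 h2) h4 hM.1 hf hξ h3
    (hh.slide hc hy1 hM.1 hf hξ)
  let g : Point ≃ₗ[ℝ] Point := LinearEquiv.ofInjectiveEndo (M : Point →ₗ[ℝ] Point) hM.1
  have hg : ∀ y, g y = M y := fun y => rfl
  have h6 := h5.normalize hC hM g hg
  have hfg : ∀ z, b.f (g.symm z) = ξ z := fun z => by rw [← hf, ← hg, LinearEquiv.apply_symm_apply]
  obtain ⟨u, u0, u1, hu⟩ := openSegment_param.1 h2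
  set d := g.symm (e - y) with hd
  set k := g.symm (c - y) with hk
  have hl : 0 < u / (1 - u) := div_pos u0 (by linarith)
  have ea : g.symm (a - y) = (-(u / (1 - u))) • d := by
    have : a - y = (-(u / (1 - u))) • (e - y) := by
      have e1 : e - y = (1 - u) • (e - a) := by rw [hu]; module
      have e2 : a - y = (-u) • (e - a) := by rw [hu]; module
      rw [e1, e2, smul_smul]
      congr 1
      have : 1 - u ≠ 0 := by linarith
      field_simp
    rw [this, map_smul]
  rw [ea] at h6
  have hind : LinearIndependent ℝ ![d, k] := by
    rw [LinearIndependent.pair_iff]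
    intro α β hαβ
    have h7 : α • (e - y) + β • (c - y) = 0 := by
      rw [hd, hk, ← map_smul, ← map_smul, ← map_add] at hαβ
      exact (LinearEquiv.map_eq_zero_iff _).1 hαβ
    have h8 := affineIndependent_iff_pair.1 h1 (α * (1 - u) - β * u) β (by
      rw [← h7, hu]; module)
    obtain ⟨h9, rfl⟩ := h8
    rw [zero_mul, sub_zero] at h9
    exact ⟨(mul_eq_zero.1 h9).resolve_right (by linarith), rfl⟩
  have hfd : 0 < b.f d := by
    rw [hd, hfg]
    have e1 : e - y = (1 - u) • (e - a) := by rw [hu]; module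
    rw [e1, map_smul, smul_eq_mul]
    exact mul_pos (by linarith) h3
  refine ⟨d, k, hind, hfd, ?_⟩
  have hpos : ∀ r ∈ Icc (0 : ℝ) 1, 0 < (1 - r) * (u / (1 - u)) + r := by
    intro r hr
    rcases eq_or_lt_of_le hr.1 with h | h
    · rw [← h]; simpa using hl
    · have := mul_nonneg (sub_nonneg.2 hr.2) hl.le
      linarith
  have := Hosted.move_triangle (b := b) (C := C)
    (a := fun r => (-((1 - r) * (u / (1 - u)) + r)) • d) (e := fun _ => d) (c := fun _ => k)
    (by fun_prop) (by fun_prop) (by fun_prop)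
    (fun r hr => by simpa using affineIndependent_of_pair hind (hpos r hr) one_pos)
    (fun r hr => by simpa using zero_mem_openSegment d (hpos r hr) one_pos)
    (fun r hr => hfd)
    (fun r hr => by
      rw [map_smul, smul_eq_mul]
      nlinarith [mul_pos (hpos r hr) hfd])
    (by simpa using h6)
  simpa using this

/-- Up to isotopy, a bead can be inserted into a trivial knot in only one way. -/
theorem HostedOn.isotopic {C C' L L' : Set Point} (hC : IsLoop C) (hC' : IsLoop C')
    (hL : IsTrivial L) (hL' : IsTrivial L') (h : b.HostedOn C L) (h' : b.HostedOn C' L') :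
    Isotopic C C' := by
  have key : ∀ {C L : Set Point}, IsLoop C → IsTrivial L → b.HostedOn C L →
      ∃ d k, b.OnPair C d k := by
    rintro C L hC ⟨p, q, w, hi, he⟩ hh
    have h1 : IsLoop (polygon [p, q, w]) := by
      rw [polygon_triangle]
      exact (carrier_of_triangle hi (openSegment_param.2
        ⟨1 / 2, by norm_num, by norm_num, rfl⟩)).isLoop
    rw [hostedOn_iff_of_isotopic (he.isLoop_iff.2 h1) he] at hh
    exact hh.exists_onPair hC hi
  obtain ⟨d, k, h1⟩ := key hC hL h
  obtain ⟨d', k', h2⟩ := key hC' hL' h'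
  have h3 := h1.change h2.2.1 h2.1
  obtain ⟨ε, e1, e2⟩ := (h3.2.2.and h2.2.2).exists
  exact e1.symm.trans e2

end Bead

/-! ### Connected sums and beads -/

theorem path_extend (u v u' v' : Point) (E : List Point) :
    path (u' :: ((u :: (E ++ [v])) ++ [v'])) =
      segment ℝ u' u ∪ path (u :: (E ++ [v])) ∪ segment ℝ v v' := by
  rw [List.cons_append, path_cons_cons, ← List.cons_append]
  have := path_append (u :: E) [v'] v
  rw [path_pair] at this
  have e : u :: (E ++ [v]) ++ [v'] = u :: E ++ v :: [v'] := by simp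
  rw [e, this, union_assoc]; rfl

theorem simplePath_extend {φ g : Point →L[ℝ] ℝ} {γ h : ℝ} {u v u' v' : Point} {E : List Point}
    (hs : SimplePath (u :: (E ++ [v])))
    (hl : ∀ y ∈ path (u :: (E ++ [v])), h < φ y ∨ y = u ∨ y = v) (hu : φ u = h) (hv : φ v = h)
    (hu' : φ u' < h) (hv' : φ v' < h) (gu : γ < g u) (gu' : γ < g u') (gv : g v < γ)
    (gv' : g v' < γ) : SimplePath (u' :: ((u :: (E ++ [v])) ++ [v'])) := by
  have hU : ∀ y ∈ segment ℝ u' u, φ y < h ∨ y = u := by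
    intro y hy
    rw [segment_symm, ← path_pair] at hy
    refine (lt_or_eq_of_mem_path (f := -φ) (r := -h) (by rw [neg_apply, hu]) ?_ hy).imp
      (fun h => neg_lt_neg_iff.1 h) id
    simpa using hu'
  have hV : ∀ y ∈ segment ℝ v v', φ y < h ∨ y = v := by
    intro y hy
    rw [← path_pair] at hy
    refine (lt_or_eq_of_mem_path (f := -φ) (r := -h) (by rw [neg_apply, hv]) ?_ hy).imp
      (fun h => neg_lt_neg_iff.1 h) id
    simpa using hv'
  have gU : ∀ y ∈ segment ℝ u' u, γ < g y := fun y hy =>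
    (convex_lt g γ).segment_subset gu' gu hy
  have gV : ∀ y ∈ segment ℝ v v', g y < γ := fun y hy => by
    have := (convex_lt (-g) (-γ)).segment_subset (x := v) (y := v') (by simpa using gv)
      (by simpa using gv') hy
    simpa using this
  have hM : ∀ y ∈ path (u :: (E ++ [v])), h ≤ φ y := by
    intro y hy
    rcases hl y hy with h1 | rfl | rfl
    · exact h1.le
    · exact hu.ge
    · exact hv.ge
  have h2 : SimplePath (u :: (E ++ [v]) ++ [v']) := by
    have e : u :: (E ++ [v]) ++ [v'] = u :: E ++ v :: [v'] := by simp
    rw [e, simplePath_append]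
    refine ⟨hs, ⟨?_, fun p hp => hp.2, trivial⟩, ?_⟩
    · rintro rfl; linarith
    · rw [path_pair]
      rintro y ⟨hy, hy'⟩
      rcases hV y hy' with h1 | h1
      · linarith [hM y hy]
      · exact h1
  refine ⟨?_, ?_, h2⟩
  · rintro rfl; linarith
  · have e : path (u :: (E ++ [v]) ++ [v']) = path (u :: (E ++ [v])) ∪ segment ℝ v v' := by
      have := path_append (u :: E) [v'] v
      rw [path_pair] at this
      have e : u :: (E ++ [v]) ++ [v'] = u :: E ++ v :: [v'] := by simp
      rw [e, this]; rfl
    change segment ℝ u' u ∩ path (u :: (E ++ [v]) ++ [v']) ⊆ {u}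
    rw [e]
    rintro y ⟨hy, hy' | hy'⟩
    · rcases hU y hy with h1 | h1
      · linarith [hM y hy']
      · exact h1
    · linarith [gU y hy, gV y hy']

theorem level_extend {φ : Point →L[ℝ] ℝ} {h h' : ℝ} {u v u' v' : Point} {E : List Point}
    (hl : ∀ y ∈ path (u :: (E ++ [v])), h < φ y ∨ y = u ∨ y = v) (hu : φ u = h) (hv : φ v = h)
    (hu' : φ u' = h') (hv' : φ v' = h') (hh : h' < h) :
    ∀ y ∈ path (u' :: ((u :: (E ++ [v])) ++ [v'])), h' < φ y ∨ y = u' ∨ y = v' := by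
  rw [path_extend]
  rintro y ((hy | hy) | hy)
  · rw [← path_pair] at hy
    refine (lt_or_eq_of_mem_path hu'.ge ?_ hy).imp id Or.inl
    simpa [hu] using hh
  · left
    rcases hl y hy with h1 | rfl | rfl
    · linarith
    · rwa [hu]
    · rwa [hv]
  · rw [segment_symm, ← path_pair] at hy
    refine (lt_or_eq_of_mem_path hv'.ge ?_ hy).imp id Or.inr
    simpa [hv] using hh

theorem level_of_inner {φ : Point →L[ℝ] ℝ} {h : ℝ} {u v : Point} {E : List Point}
    (hu : φ u = h) (hv : φ v = h) (hE : ∀ y ∈ E, h < φ y) (hne : E ≠ []) :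
    ∀ y ∈ path (u :: (E ++ [v])), h < φ y ∨ y = u ∨ y = v := by
  obtain ⟨a, E, rfl⟩ := List.exists_cons_of_ne_nil hne
  rw [List.cons_append, path_cons_cons]
  rintro y (hy | hy)
  · rw [← path_pair] at hy
    refine (lt_or_eq_of_mem_path hu.ge ?_ hy).imp id Or.inl
    simpa using hE a (by simp)
  · rw [← path_reverse] at hy
    have e : (a :: (E ++ [v])).reverse = v :: (a :: E).reverse := by simp
    rw [e] at hy
    refine (lt_or_eq_of_mem_path hv.ge ?_ hy).imp id Or.inr
    intro z hz
    exact hE z (by simpa [or_comm] using hz)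

theorem isSimple_of_level {φ : Point →L[ℝ] ℝ} {h : ℝ} {u v : Point} {E : List Point}
    (hs : SimplePath (u :: (E ++ [v])))
    (hl : ∀ y ∈ path (u :: (E ++ [v])), h < φ y ∨ y = u ∨ y = v) (hu : φ u = h) (hv : φ v = h)
    (huv : u ≠ v) (hE : E ≠ []) : IsSimple (u :: (E ++ [v])) := by
  rw [isSimple_iff u v E [] (by simpa using hE)]
  refine ⟨hs, ⟨huv.symm, fun p hp => hp.2, trivial⟩, ?_⟩
  rintro y ⟨hy, hy'⟩
  rcases hl y hy with h1 | h1
  · exfalso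
    change y ∈ path [v, u] at hy'
    rw [path_pair] at hy'
    obtain ⟨t, -, -, rfl⟩ := segment_param.1 hy'
    simp [hu, hv] at h1
  · exact h1

/-- The two closing segments of a sum are on different sides of a plane. -/
theorem isSimple_of_levels {φ g : Point →L[ℝ] ℝ} {γ h₁ h₂ h₃ h₄ : ℝ} {p q q' p' a c s t : Point}
    {A B : List Point} (hA : SimplePath (p :: (A ++ [q]))) (hB : SimplePath (q' :: (B ++ [p'])))
    (lA : ∀ y ∈ path (p :: (A ++ [q])), φ y < h₁ ∨ y = p ∨ y = q)
    (lB : ∀ y ∈ path (q' :: (B ++ [p'])), h₄ < φ y ∨ y = q' ∨ y = p')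
    (hp : φ p = h₁) (hq : φ q = h₁) (ha : φ a = h₂) (hc : φ c = h₂) (hs : φ s = h₃) (ht : φ t = h₃)
    (hq' : φ q' = h₄) (hp' : φ p' = h₄) (h12 : h₁ < h₂) (h23 : h₂ < h₃) (h34 : h₃ < h₄)
    (gp : g p < γ) (ga : g a < γ) (gs : g s < γ) (gp' : g p' < γ)
    (gq : γ < g q) (gc : γ < g c) (gt : γ < g t) (gq' : γ < g q') :
    IsSimple (a :: ((p :: (A ++ [q])) ++ c :: (t :: ((q' :: (B ++ [p'])) ++ [s])))) := by
  have lA' : ∀ y ∈ path (p :: (A ++ [q])), -h₁ < (-φ) y ∨ y = p ∨ y = q := fun y hy => by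
    simpa using lA y hy
  have s1 : SimplePath (a :: ((p :: (A ++ [q])) ++ [c])) :=
    simplePath_extend (φ := -φ) (g := -g) (γ := -γ) hA lA' (by simpa using hp) (by simpa using hq)
      (by simpa [ha] using h12) (by simpa [hc] using h12) (by simpa using gp) (by simpa using ga)
      (by simpa using gq) (by simpa using gc)
  have l1 := level_extend (φ := -φ) (h' := -h₂) lA' (u' := a) (v' := c) (by simpa using hp)
    (by simpa using hq) (by simpa using ha) (by simpa using hc) (by simpa using h12)
  have s2 := simplePath_extend hB lB hq' hp' (by rwa [ht]) (by rwa [hs]) gq' gt gp' gs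
  have l2 := level_extend lB hq' hp' ht hs h34
  have s3 := simplePath_extend (u' := c) (v' := a) s2 l2 ht hs (by rwa [hc]) (by rwa [ha]) gt gc gs ga
  have l3 := level_extend (u' := c) (v' := a) l2 ht hs hc ha h23
  rw [isSimple_iff _ _ _ _ (by simp)]
  refine ⟨s1, s3, ?_⟩
  rintro y ⟨hy, hy'⟩
  rcases l1 y hy with h | h
  · rcases l3 y hy' with h' | h'
    · rw [neg_apply] at h; linarith
    · exact h'.symm
  · exact h

set_option maxHeartbeats 1000000 in
/-- An arc below a plane, as a bead. -/
theorem exists_bead {φ g : Point →L[ℝ] ℝ} {e p q : Point} {A : List Point} {η : ℝ} (hφe : φ e = 1)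
    (hge : g e = 0) (hp : φ p = 0) (hq : φ q = 0) (hg : g (q - p) = 1) (hη : 0 < η)
    (hA : SimplePath (p :: (A ++ [q]))) (hA0 : ∀ y ∈ A, φ y < 0) (hAne : A ≠ []) :
    ∃ b : Bead, ∀ (q' p' : Point) (B : List Point), SimplePath (q' :: (B ++ [p'])) →
      (∀ y ∈ B, η < φ y) → B ≠ [] → φ q' = η → φ p' = η → g ((1 / 2 : ℝ) • (p + q)) < g q' →
      g p' < g ((1 / 2 : ℝ) • (p + q)) →
      b.HostedOn (polygon (p :: (A ++ q :: (q' :: (B ++ [p'])))))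
        (polygon (q :: ((q' :: (B ++ [p'])) ++ [p]))) := by
  set m := (1 / 2 : ℝ) • (p + q) with hm
  have gm : g m = (g p + g q) / 2 := by rw [hm, map_smul, map_add, smul_eq_mul]; ring
  have φm : φ m = 0 := by rw [hm, map_smul, map_add, hp, hq]; simp
  clear_value m
  have hφg : φ (q - p) = 0 := by rw [map_sub, hp, hq, sub_zero]
  have hg' : g q = g p + 1 := by rw [map_sub] at hg; linarith
  obtain ⟨ρ, hρ0, hρ⟩ : ∃ ρ : ℝ, 0 < ρ ∧ ∀ y ∈ p :: (A ++ [q]), |g y - g m| < ρ := by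
    have : ∀ l : List Point, ∃ ρ : ℝ, 0 < ρ ∧ ∀ y ∈ l, |g y - g m| < ρ := by
      intro l
      induction l with
      | nil => exact ⟨1, one_pos, by simp⟩
      | cons z l ih =>
        obtain ⟨ρ, h1, h2⟩ := ih
        refine ⟨ρ + (|g z - g m| + 1), by positivity, ?_⟩
        intro y hy
        rcases List.mem_cons.1 hy with rfl | hy
        · linarith
        · have := abs_nonneg (g z - g m)
          linarith [h2 y hy]
    exact this _
  set x := m + (η / 2) • e with hx
  have gx : g x = g m := by rw [hx, map_add, map_smul, hge]; simp
  have φx : φ x = η / 2 := by rw [hx, map_add, map_smul, hφe, φm]; simp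
  clear_value x
  set a := x + ((-ρ) • (q - p) - (η / 4) • e) with ha
  set c := x + (ρ • (q - p) - (η / 4) • e) with hc
  have φa : φ a = η / 4 := by rw [ha, map_add, map_sub, map_smul, map_smul, hφg, hφe, φx]; simp; ring
  have φc : φ c = η / 4 := by rw [hc, map_add, map_sub, map_smul, map_smul, hφg, hφe, φx]; simp; ring
  have ga : g a = g m - ρ := by rw [ha, map_add, map_sub, map_smul, map_smul, hg, hge, gx]; simp; ring
  have gc : g c = g m + ρ := by rw [hc, map_add, map_sub, map_smul, map_smul, hg, hge, gx]; simp
  clear_value a c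
  have gp : g p < g m := by linarith
  have gq : g m < g q := by linarith
  let τ : Point →ᵃ[ℝ] Point := Bead.frame (-x) (ContinuousLinearMap.id ℝ Point)
  have hτ : ∀ y, τ y = y - x := fun y => by
    change -x + y = y - x; rw [neg_add_eq_sub]
  have hlA : ∀ y ∈ path (p :: (A ++ [q])), φ y < 0 ∨ y = p ∨ y = q := by
    have := level_of_inner (φ := -φ) (h := 0) (u := p) (v := q) (E := A) (by simp [hp])
      (by simp [hq]) (by simpa using hA0) hAne
    simpa using this
  have hbs : SimplePath (a :: ((p :: (A ++ [q])) ++ [c])) :=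
    simplePath_extend (φ := -φ) (g := -g) (γ := -g m) (h := 0) hA (by simpa using hlA)
      (by simp [hp]) (by simp [hq]) (by simp [φa, hη]) (by simp [φc, hη]) (by simpa using gp)
      (by simp [ga, hρ0]) (by simpa using gq) (by simp [gc, hρ0])
  let b : Bead :=
    { a := τ a
      c := τ c
      α := (p :: (A ++ [q])).map τ
      f := ρ⁻¹ • g
      simple := by
        have := hbs.map (F := τ) (Bead.frame_injective Function.injective_id)
        simpa using this
      left := by
        rw [smul_apply, hτ, map_sub, ga, gx, smul_eq_mul]; field_simp; ring
      right := by
        rw [smul_apply, hτ, map_sub, gc, gx, smul_eq_mul]; field_simp; ring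
      inner := by
        intro y hy
        obtain ⟨z, hz, rfl⟩ := List.mem_map.1 hy
        have := abs_lt.1 (hρ z hz)
        rw [smul_apply, hτ, map_sub, gx, smul_eq_mul, ← div_eq_inv_mul, lt_div_iff₀ hρ0,
          div_lt_iff₀ hρ0]
        exact ⟨by linarith, by linarith⟩ }
  have hbv : b.verts = (a :: ((p :: (A ++ [q])) ++ [c])).map τ := by
    simp [Bead.verts, b]
  refine ⟨b, ?_⟩
  intro q' p' B hB hBη hBne hq' hp' gq' gp'
  set s := x + (-(2 * ρ)) • (q - p) with hs
  set t := x + (2 * ρ) • (q - p) with ht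
  have φs : φ s = η / 2 := by rw [hs, map_add, map_smul, hφg, φx]; simp
  have φt : φ t = η / 2 := by rw [ht, map_add, map_smul, hφg, φx]; simp
  have gs : g s = g m - 2 * ρ := by rw [hs, map_add, map_smul, hg, gx]; simp; ring
  have gt : g t = g m + 2 * ρ := by rw [ht, map_add, map_smul, hg, gx]; simp
  clear_value s t
  have lB := level_of_inner hq' hp' hBη hBne
  have hηs : η / 2 < η := by linarith
  have hD : SimplePath (t :: ((q' :: (B ++ [p'])) ++ [s])) :=
    simplePath_extend hB lB hq' hp' (by rwa [φt]) (by rwa [φs]) gq' (by linarith) gp' (by linarith)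
  have lD := level_extend lB hq' hp' φt φs hηs
  have hst : t ≠ s := by
    intro h
    rw [h] at gt; linarith
  -- the loop that carries the bead
  have hcar : Carrier x s t (path (t :: ((q' :: (B ++ [p'])) ++ [s]))) := by
    refine ⟨hD.arc, openSegment_param.2 ⟨1 / 2, by norm_num, by norm_num, ?_⟩, ?_⟩
    · rw [hs, ht]; module
    · rintro y ⟨hy, hy'⟩
      rcases lD y hy' with h | h
      · obtain ⟨r, -, -, rfl⟩ := segment_param.1 hy
        simp [φs, φt] at h
      · exact h.symm
  have hloop : Isotopic (segment ℝ s t ∪ path (t :: ((q' :: (B ++ [p'])) ++ [s])))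
      (polygon (q :: ((q' :: (B ++ [p'])) ++ [p]))) := by
    have hpoly : ∀ t s : Point, polygon (t :: ((q' :: (B ++ [p'])) ++ [s])) =
        segment ℝ s t ∪ path (t :: ((q' :: (B ++ [p'])) ++ [s])) := by
      intro t s
      have := polygon_append t s (q' :: (B ++ [p'])) []
      rw [this, union_comm, List.nil_append, path_pair]
    rw [← hpoly]
    have := isotopic_of_motion ((fun r : ℝ => t + r • (q - t)) ::
      ((q' :: (B ++ [p'])).map (fun y _ => y) ++ [fun r : ℝ => s + r • (p - s)])) ?_ ?_
    · simpa [Function.comp_def] using this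
    · intro f hf
      apply Continuous.continuousOn
      simp only [List.mem_cons, List.mem_append, List.mem_map, List.not_mem_nil, or_false] at hf
      rcases hf with rfl | ⟨y, -, rfl⟩ | rfl <;> fun_prop
    · intro r hr
      have e1 : φ (t + r • (q - t)) = (1 - r) * (η / 2) := by
        rw [map_add, map_smul, map_sub, φt, hq, smul_eq_mul]; ring
      have e2 : φ (s + r • (p - s)) = (1 - r) * (η / 2) := by
        rw [map_add, map_smul, map_sub, φs, hp, smul_eq_mul]; ring
      have e3 : (1 - r) * (η / 2) < η := by nlinarith [hr.1, hr.2]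
      have e4 : g m < g (t + r • (q - t)) :=
        (convex_lt g (g m)).segment_subset (x := t) (y := q) (by simp only [mem_ofPred]; linarith) gq
          (segment_param.2 ⟨r, hr.1, hr.2, rfl⟩)
      have e5 : -g m < (-g) (s + r • (p - s)) :=
        (convex_lt (-g) (-g m)).segment_subset (x := s) (y := p)
          (by simp only [mem_ofPred, neg_apply]; linarith) (by simpa using gp)
          (segment_param.2 ⟨r, hr.1, hr.2, rfl⟩)
      rw [neg_apply, neg_lt_neg_iff] at e5
      have := isSimple_of_level
        (simplePath_extend hB lB hq' hp' (by rwa [e1]) (by rwa [e2]) gq' e4 gp' e5)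
        (level_extend lB hq' hp' e1 e2 e3) e1 e2 (by intro h; rw [h] at e4; linarith) (by simp)
      simpa [Function.comp_def] using this
  have hloop' : IsLoop (segment ℝ s t ∪ path (t :: ((q' :: (B ++ [p'])) ++ [s]))) := hcar.isLoop
  rw [← Bead.hostedOn_iff_of_isotopic hloop' hloop]
  refine ⟨x, s, t, _, ContinuousLinearMap.id ℝ Point, ρ⁻¹ • g, hcar, rfl, Bead.positive_id,
    fun _ => rfl, ?_, ?_⟩
  · have e1 : t - s = (4 * ρ) • (q - p) := by rw [hs, ht]; module
    rw [e1, map_smul, smul_apply, hg]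
    simp [hρ0]
  -- shrinking the bead
  have hframe : ∀ (ε : ℝ) (y : Point), Bead.frame x (ε • ContinuousLinearMap.id ℝ Point) (τ y) =
      x + ε • (y - x) := by
    intro ε y
    rw [Bead.frame_apply, hτ]; rfl
  have hsimple : ∀ ε : ℝ, 0 < ε → ε ≤ 1 → IsSimple (b.hostList x
      (ε • ContinuousLinearMap.id ℝ Point) (t :: ((q' :: (B ++ [p'])) ++ [s]))) := by
    intro ε ε0 ε1
    have hlow : ∀ y ∈ path b.verts, φ (Bead.frame x (ε • ContinuousLinearMap.id ℝ Point) y) < η / 2 := by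
      intro y hy
      rw [hbv, path_map] at hy
      obtain ⟨z, hz, rfl⟩ := hy
      have hz' : φ z < η / 2 := by
        have := path_subset_of_convex (convex_lt (-φ) (-(η / 2))) (l := a :: ((p :: (A ++ [q])) ++ [c]))
          (by
            intro w hw
            simp only [List.mem_cons, List.mem_append, List.not_mem_nil, or_false] at hw
            simp only [mem_ofPred, neg_apply, neg_lt_neg_iff]
            rcases hw with rfl | (rfl | hw | rfl) | rfl
            · linarith
            · linarith
            · linarith [hA0 w hw]
            · linarith
            · linarith) hz
        simpa using this
      rw [hframe, map_add, map_smul, map_sub, φx, smul_eq_mul]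
      nlinarith
    have hD0 : ∀ y ∈ path (t :: ((q' :: (B ++ [p'])) ++ [s])), η / 2 ≤ φ y := by
      intro y hy
      rcases lD y hy with h | rfl | rfl
      · exact h.le
      · exact φt.ge
      · exact φs.ge
    have hseg : ∀ w v : Point, φ w < η / 2 → φ v = η / 2 → ∀ y ∈ segment ℝ w v,
        φ y < η / 2 ∨ y = v := by
      intro w v hw hv y hy
      rw [segment_symm, ← path_pair] at hy
      refine (lt_or_eq_of_mem_path (f := -φ) (r := -(η / 2)) (by rw [neg_apply, hv]) ?_ hy).imp
        (fun h => neg_lt_neg_iff.1 h) id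
      simpa using hw
    refine Bead.isSimple_hostList (ξ := ρ⁻¹ • g) ?_ ε0 ?_ ?_ ?_ hD ?_ ?_ ?_
    · intro y z h
      exact smul_right_injective _ ε0.ne' h
    · intro y
      change (ρ⁻¹ • g) (ε • y) = _
      rw [map_smul]; rfl
    · have e1 : t - x = (2 * ρ) • (q - p) := by rw [ht]; module
      rw [e1, map_smul, smul_apply, hg, smul_eq_mul, smul_eq_mul, mul_one,
        mul_assoc, mul_inv_cancel₀ hρ0.ne']
      linarith
    · have e1 : s - x = (-(2 * ρ)) • (q - p) := by rw [hs]; module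
      rw [e1, map_smul, smul_apply, hg, smul_eq_mul, smul_eq_mul, mul_one,
        neg_mul, mul_assoc, mul_inv_cancel₀ hρ0.ne']
      linarith
    · rintro y ⟨hy, hy'⟩
      rcases hseg _ _ (hlow _ (mem_path_of_mem (by simp [Bead.verts]))) φt y hy with h | h
      · linarith [hD0 y hy']
      · exact h
    · rintro y ⟨hy, hy'⟩
      rw [segment_symm] at hy
      rcases hseg _ _ (hlow _ (head_mem_path _ _)) φs y hy with h | h
      · linarith [hD0 y hy']
      · exact h
    · rw [disjoint_left, path_map]
      rintro _ ⟨y, hy, rfl⟩ hy'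
      linarith [hD0 _ hy', hlow y hy]
  have hshrink : ∀ ε : ℝ, 0 < ε → ε ≤ 1 → Isotopic
      (polygon (b.hostList x ((1 : ℝ) • ContinuousLinearMap.id ℝ Point)
        (t :: ((q' :: (B ++ [p'])) ++ [s]))))
      (polygon (b.hostList x (ε • ContinuousLinearMap.id ℝ Point)
        (t :: ((q' :: (B ++ [p'])) ++ [s])))) := by
    intro ε ε0 ε1
    have e0 : ∀ r : ℝ, b.hostList x ((1 + r * (ε - 1)) • ContinuousLinearMap.id ℝ Point)
        (t :: ((q' :: (B ++ [p'])) ++ [s])) =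
        (b.verts.map (fun y (r : ℝ) =>
          Bead.frame x ((1 + r * (ε - 1)) • ContinuousLinearMap.id ℝ Point) y) ++
        (t :: ((q' :: (B ++ [p'])) ++ [s])).map (fun y _ => y)).map fun f : ℝ → Point => f r := by
      intro r
      simp [Bead.hostList, Function.comp_def]
    have := isotopic_of_motion (b.verts.map (fun y (r : ℝ) =>
          Bead.frame x ((1 + r * (ε - 1)) • ContinuousLinearMap.id ℝ Point) y) ++
        (t :: ((q' :: (B ++ [p'])) ++ [s])).map (fun y _ => y)) ?_ ?_
    · rw [← e0, ← e0] at this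
      simpa using this
    · intro f hf
      apply Continuous.continuousOn
      rcases List.mem_append.1 hf with hf | hf
      · obtain ⟨y, -, rfl⟩ := List.mem_map.1 hf
        change Continuous fun r : ℝ => x + (1 + r * (ε - 1)) • y
        fun_prop
      · obtain ⟨y, -, rfl⟩ := List.mem_map.1 hf
        fun_prop
    · intro r hr
      rw [← e0]
      refine hsimple _ ?_ ?_
      · nlinarith [hr.1, hr.2]
      · nlinarith [hr.1, hr.2]
  have hhost : b.hostList x ((1 : ℝ) • ContinuousLinearMap.id ℝ Point)
      (t :: ((q' :: (B ++ [p'])) ++ [s])) =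
      a :: ((p :: (A ++ [q])) ++ c :: (t :: ((q' :: (B ++ [p'])) ++ [s]))) := by
    have e1 : b.verts.map (Bead.frame x ((1 : ℝ) • ContinuousLinearMap.id ℝ Point)) =
        a :: ((p :: (A ++ [q])) ++ [c]) := by
      rw [hbv, List.map_map]
      have : ∀ y, (Bead.frame x ((1 : ℝ) • ContinuousLinearMap.id ℝ Point) ∘ τ) y = id y := by
        intro y
        rw [Function.comp_apply, hframe, one_smul, add_sub_cancel]; rfl
      rw [List.map_congr_left fun y _ => this y, List.map_id]
    rw [Bead.hostList, e1]
    simp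
  have hfull : Isotopic
      (polygon (a :: ((p :: (A ++ [q])) ++ c :: (t :: ((q' :: (B ++ [p'])) ++ [s])))))
      (polygon (p :: (A ++ q :: (q' :: (B ++ [p']))))) := by
    have := isotopic_of_motion ((fun r : ℝ => a + r • ((p + (1 / 4 : ℝ) • (p' - p)) - a)) ::
      ((p :: (A ++ [q])).map (fun y _ => y) ++
      (fun r : ℝ => c + r • ((q + (1 / 4 : ℝ) • (q' - q)) - c)) ::
      ((fun r : ℝ => t + r • ((q + (1 / 2 : ℝ) • (q' - q)) - t)) ::
      ((q' :: (B ++ [p'])).map (fun y _ => y) ++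
      [fun r : ℝ => s + r • ((p + (1 / 2 : ℝ) • (p' - p)) - s)])))) ?_ ?_
    · simp only [List.map_cons, List.map_append, List.map_nil, List.map_map, Function.comp_def,
        List.map_id', zero_smul, add_zero, one_smul, add_sub_cancel] at this
      have e1 : polygon ((p + (1 / 4 : ℝ) • (p' - p)) :: ((p :: (A ++ [q])) ++
          (q + (1 / 4 : ℝ) • (q' - q)) :: ((q + (1 / 2 : ℝ) • (q' - q)) ::
          ((q' :: (B ++ [p'])) ++ [p + (1 / 2 : ℝ) • (p' - p)])))) =
          polygon (p :: (A ++ q :: (q' :: (B ++ [p'])))) := by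
        have hsub : ∀ w w' : Point, segment ℝ w w' = segment ℝ w (w + (1 / 4 : ℝ) • (w' - w)) ∪
            segment ℝ (w + (1 / 4 : ℝ) • (w' - w)) (w + (1 / 2 : ℝ) • (w' - w)) ∪
            segment ℝ (w + (1 / 2 : ℝ) • (w' - w)) w' := by
          intro w w'
          have h1 : w + (1 / 2 : ℝ) • (w' - w) ∈ segment ℝ w w' :=
            segment_param.2 ⟨1 / 2, by norm_num, by norm_num, rfl⟩
          have h2 : w + (1 / 4 : ℝ) • (w' - w) ∈ segment ℝ w (w + (1 / 2 : ℝ) • (w' - w)) :=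
            segment_param.2 ⟨1 / 2, by norm_num, by norm_num, by module⟩
          rw [segment_union_segment h2, segment_union_segment h1]
        have h3 := polygon_append (p + (1 / 4 : ℝ) • (p' - p)) (q + (1 / 4 : ℝ) • (q' - q))
          (p :: (A ++ [q])) ((q + (1 / 2 : ℝ) • (q' - q)) ::
          ((q' :: (B ++ [p'])) ++ [p + (1 / 2 : ℝ) • (p' - p)]))
        rw [h3, path_extend, path_extend, path_extend, polygon_append]
        have h4 := path_extend q' p' q p B
        have e5 : q' :: (B ++ [p']) ++ [p] = q' :: (B ++ [p'] ++ [p]) := rfl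
        rw [h4, hsub q q', segment_symm ℝ p' p, hsub p p',
          segment_symm ℝ (p + (1 / 4 : ℝ) • (p' - p)) p, segment_symm ℝ p' (p + _),
          segment_symm ℝ (p + (1 / 2 : ℝ) • (p' - p)) (p + (1 / 4 : ℝ) • (p' - p))]
        ext; simp only [mem_union]; tauto
      rw [← e1]
      exact this
    · intro f hf
      apply Continuous.continuousOn
      simp only [List.mem_cons, List.mem_append, List.mem_map, List.not_mem_nil, or_false] at hf
      rcases hf with rfl | ⟨y, -, rfl⟩ | rfl | rfl | ⟨y, -, rfl⟩ | rfl <;> fun_prop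
    · intro r hr
      have lev : ∀ (w w' : Point) (h : ℝ), φ w = h → φ w' = h → φ (w + r • (w' - w)) = h := by
        intro w w' h h1 h2
        rw [map_add, map_smul, map_sub, h1, h2]; simp
      have pos : ∀ w w' : Point, g m < g w → g m < g w' → g m < g (w + r • (w' - w)) :=
        fun w w' h h' => (convex_lt g (g m)).segment_subset (x := w) (y := w') h h'
          (segment_param.2 ⟨r, hr.1, hr.2, rfl⟩)
      have neg : ∀ w w' : Point, g w < g m → g w' < g m → g (w + r • (w' - w)) < g m := by
        intro w w' h h'
        have := (convex_lt (-g) (-g m)).segment_subset (x := w) (y := w') (by simpa using h)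
          (by simpa using h') (segment_param.2 ⟨r, hr.1, hr.2, rfl⟩)
        simpa using this
      have gcomb : ∀ (w w' : Point) (u : ℝ), g (w + u • (w' - w)) = (1 - u) * g w + u * g w' := by
        intro w w' u
        rw [map_add, map_smul, map_sub, smul_eq_mul]; ring
      have φcomb : ∀ (w w' : Point) (u : ℝ), φ w = 0 → φ w' = η → φ (w + u • (w' - w)) = u * η := by
        intro w w' u h h'
        rw [map_add, map_smul, map_sub, smul_eq_mul, h, h']; ring
      have := isSimple_of_levels (g := g) (γ := g m) hA hB hlA lB hp hq
        (lev a (p + (1 / 4 : ℝ) • (p' - p)) (η / 4) φa (by rw [φcomb _ _ _ hp hp']; ring))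
        (lev c (q + (1 / 4 : ℝ) • (q' - q)) (η / 4) φc (by rw [φcomb _ _ _ hq hq']; ring))
        (lev s (p + (1 / 2 : ℝ) • (p' - p)) (η / 2) φs (by rw [φcomb _ _ _ hp hp']; ring))
        (lev t (q + (1 / 2 : ℝ) • (q' - q)) (η / 2) φt (by rw [φcomb _ _ _ hq hq']; ring))
        hq' hp' (by linarith) (by linarith) (by linarith) gp
        (neg _ _ (by linarith) (by rw [gcomb]; linarith))
        (neg _ _ (by linarith) (by rw [gcomb]; linarith)) gp' gq
        (pos _ _ (by linarith) (by rw [gcomb]; linarith))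
        (pos _ _ (by linarith) (by rw [gcomb]; linarith)) gq'
      simpa [Function.comp_def] using this
  refine Bead.eventually_of_lt one_pos fun ε ε0 ε1 => ?_
  rw [← Bead.polygon_hostList]
  refine (hshrink ε ε0 ε1.le).symm.trans ?_
  rw [hhost]
  exact hfull

theorem SimplePath.shorten {u v u' : Point} {l : List Point} (h : SimplePath (u :: v :: l))
    (hu' : u' ∈ openSegment ℝ u v) : SimplePath (u' :: v :: l) := by
  refine ⟨?_, ?_, h.2.2⟩
  · rintro rfl
    exact h.1 (right_mem_openSegment_iff.1 hu')
  · refine Subset.trans (inter_subset_inter_left _ ?_) h.2.1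
    exact (convex_segment u v).segment_subset (openSegment_subset_segment ℝ _ _ hu')
      (right_mem_segment ℝ _ _)

theorem path_subdivide {u v u' : Point} (l : List Point) (hu' : u' ∈ openSegment ℝ u v) :
    path (u :: u' :: v :: l) = path (u :: v :: l) := by
  rw [path_cons_cons, path_cons_cons, path_cons_cons, ← union_assoc,
    segment_union_segment (openSegment_subset_segment ℝ _ _ hu')]

theorem truncate {u v u' v' : Point} {B : List Point} (hB : B ≠ [])
    (hu : u' ∈ openSegment ℝ u (B.head hB)) (hv : v' ∈ openSegment ℝ v (B.getLast hB)) :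
    (SimplePath (u :: (B ++ [v])) → SimplePath (u' :: (B ++ [v']))) ∧
      path (u :: ((u' :: (B ++ [v'])) ++ [v])) = path (u :: (B ++ [v])) := by
  obtain ⟨c, D, hD⟩ : ∃ c D, B = c :: D := List.exists_cons_of_ne_nil hB
  obtain ⟨d, F, hF⟩ : ∃ d F, B.reverse = d :: F :=
    List.exists_cons_of_ne_nil (by simpa using hB)
  have hc : B.head hB = c := by simp [hD]
  have hd : B.getLast hB = d := by
    rw [← List.head_reverse (by simpa using hB)]; simp [hF]
  rw [hc] at hu
  rw [hd] at hv
  have r1 : ∀ w w' : Point, (w :: (B ++ [w'])).reverse = w' :: d :: (F ++ [w]) := by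
    intro w w'; simp [hF]
  constructor
  · intro h
    have h1 : SimplePath (u' :: (B ++ [v])) := by
      rw [hD] at h ⊢
      exact h.shorten hu
    have h2 := h1.reverse
    rw [r1] at h2
    have h3 := (h2.shorten hv).reverse
    rwa [← r1, List.reverse_reverse] at h3
  · have e1 : path (u :: ((u' :: (B ++ [v'])) ++ [v])) = path (u :: (B ++ [v', v])) := by
      have := path_subdivide (D ++ [v', v]) hu
      rw [hD]
      simpa using this
    rw [e1, ← path_reverse, ← path_reverse (u :: (B ++ [v])), r1]
    have e2 : (u :: (B ++ [v', v])).reverse = v :: v' :: d :: (F ++ [u]) := by simp [hF]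
    rw [e2]
    exact path_subdivide _ hv

theorem polygon_close (u v : Point) (E : List Point) :
    polygon (u :: (E ++ [v])) = path (u :: (E ++ [v])) ∪ segment ℝ v u := by
  have := polygon_append u v E []
  rw [this, List.nil_append, path_pair]

/-- If one summand of a connected sum is trivial, then the sum is isotopic to the other summand. -/
theorem isotopic_of_isTrivial_summand {φ g : Point →L[ℝ] ℝ} {e p q : Point} {A B : List Point}
    (hφe : φ e = 1) (hge : g e = 0) (hp : φ p = 0) (hq : φ q = 0) (hg : g (q - p) = 1)
    (hA : A ≠ []) (hA0 : ∀ y ∈ A, φ y < 0) (hB : B ≠ []) (hB0 : ∀ y ∈ B, 0 < φ y)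
    (hs : IsSimple (p :: (A ++ q :: B))) (ht : IsTrivial (polygon (q :: (B ++ [p])))) :
    Isotopic (polygon (p :: (A ++ q :: B))) (polygon (p :: (A ++ [q]))) := by
  have hs' := hs
  rw [isSimple_iff _ _ _ _ (by simp [hA])] at hs
  obtain ⟨sA, sB, -⟩ := hs
  set m := (1 / 2 : ℝ) • (p + q) with hm
  have gm : g m = (g p + g q) / 2 := by rw [hm, map_smul, map_add, smul_eq_mul]; ring
  have φm : φ m = 0 := by rw [hm, map_smul, map_add, hp, hq]; simp
  have hg' : g q = g p + 1 := by rw [map_sub] at hg; linarith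
  have ev : ∀ (c : ℝ) (w w' : Point), Tendsto (fun η : ℝ => g (w + (η / c) • (w' - w))) (𝓝 0)
      (𝓝 (g w)) := by
    intro c w w'
    have : Tendsto (fun η : ℝ => g (w + (η / c) • (w' - w))) (𝓝 0)
        (𝓝 (g (w + ((0 : ℝ) / c) • (w' - w)))) := by
      apply Continuous.tendsto (f := fun η : ℝ => g (w + (η / c) • (w' - w)))
      have : ∀ η : ℝ, g (w + (η / c) • (w' - w)) = g w + (η / c) * g (w' - w) := fun η => by
        rw [map_add, map_smul, smul_eq_mul]
      simp only [this]
      exact continuous_const.add ((continuous_id.div_const c).mul continuous_const)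
    simpa using this
  have ev1 : ∀ᶠ η : ℝ in 𝓝[>] 0, ∀ y ∈ B, η < φ y := by
    have : ∀ l : List Point, (∀ y ∈ l, 0 < φ y) → ∀ᶠ η : ℝ in 𝓝[>] 0, ∀ y ∈ l, η < φ y := by
      intro l hl
      induction l with
      | nil => simp
      | cons a l ih =>
        have h1 : ∀ᶠ η : ℝ in 𝓝[>] 0, η < φ a :=
          (eventually_lt_nhds (hl a (by simp))).filter_mono nhdsWithin_le_nhds
        simpa using h1.and (ih fun y hy => hl y (by simp [hy]))
    exact this B hB0
  have ev2 := ((ev (φ (B.head hB)) q (B.head hB)).eventually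
    (lt_mem_nhds (show g m < g q by linarith))).filter_mono (nhdsWithin_le_nhds (s := Ioi 0))
  have ev3 := ((ev (φ (B.getLast hB)) p (B.getLast hB)).eventually
    (gt_mem_nhds (show g p < g m by linarith))).filter_mono (nhdsWithin_le_nhds (s := Ioi 0))
  obtain ⟨η, h1, h2, h3, hη⟩ := (ev1.and (ev2.and (ev3.and eventually_mem_nhdsWithin))).exists
  have hη0 : 0 < η := hη
  obtain ⟨b, hb⟩ := exists_bead hφe hge hp hq hg hη0 sA hA0 hA
  rw [← hm] at hb
  have φcomb : ∀ (w w' : Point), φ w = 0 → 0 < φ w' → φ (w + (η / φ w') • (w' - w)) = η := by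
    intro w w' h h'
    rw [map_add, map_smul, map_sub, smul_eq_mul, h]
    field_simp
    ring
  have hopen : ∀ w w' : Point, η < φ w' → w + (η / φ w') • (w' - w) ∈ openSegment ℝ w w' :=
    fun w w' h => openSegment_param.2 ⟨_, div_pos hη0 (hη0.trans h),
      (div_lt_one (hη0.trans h)).2 h, rfl⟩
  have key : ∀ (B : List Point) (hB : B ≠ []), (∀ y ∈ B, η < φ y) →
      SimplePath (q :: (B ++ [p])) →
      g m < g (q + (η / φ (B.head hB)) • (B.head hB - q)) →
      g (p + (η / φ (B.getLast hB)) • (B.getLast hB - p)) < g m →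
      b.HostedOn (polygon (p :: (A ++ q :: B))) (polygon (q :: (B ++ [p]))) := by
    intro B hB hBη sB h2 h3
    have hh := hBη _ (List.head_mem hB)
    have hl := hBη _ (List.getLast_mem hB)
    obtain ⟨t1, t2⟩ := truncate hB (hopen q _ hh) (hopen p _ hl)
    have := hb _ _ B (t1 sB) hBη hB (φcomb _ _ hq (hη0.trans hh)) (φcomb _ _ hp (hη0.trans hl)) h2 h3
    rw [polygon_append, polygon_close, t2, ← polygon_append, ← polygon_close] at this
    exact this
  have k1 := key B hB h1 sB h2 h3
  clear_value m
  set z := m + (2 * η) • e with hz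
  have φz : φ z = 2 * η := by
    rw [hz, map_add, φm, map_smul, hφe]; simp
  have gz : g z = g m := by
    rw [hz, map_add, map_smul, hge]; simp
  clear_value z
  have hpq : p ≠ q := by rintro rfl; simp at hg
  have haff : AffineIndependent ℝ ![q, p, z] :=
    affineIndependent_of_functional hpq.symm (φ : Point →ₗ[ℝ] ℝ) (hq.trans hp.symm)
      (by change φ z ≠ φ q; rw [φz, hq]; positivity)
  have hne := affineIndependent_ne haff
  have haff' := affineIndependent_swap haff
  have sZ : SimplePath (q :: ([z] ++ [p])) := by
    refine ⟨hne.2.1, ?_, hne.2.2.symm, fun y hy => hy.2, trivial⟩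
    change segment ℝ q z ∩ path [z, p] ⊆ {z}
    rw [path_pair]
    exact triangle_sides_inter haff
  have k2 := key [z] (by simp) (by simp [φz]; linarith) sZ
    (by
      simp only [List.head_cons, φz, map_add, map_smul, map_sub, gz, smul_eq_mul]
      have : η / (2 * η) = 1 / 2 := by field_simp
      rw [this]; linarith)
    (by
      simp only [List.getLast_singleton, φz, map_add, map_smul, map_sub, gz, smul_eq_mul]
      have : η / (2 * η) = 1 / 2 := by field_simp
      rw [this]; linarith)
  have hlA : ∀ y ∈ path (p :: (A ++ [q])), φ y < 0 ∨ y = p ∨ y = q := by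
    have := level_of_inner (φ := -φ) (h := 0) (u := p) (v := q) (E := A) (by simp [hp])
      (by simp [hq]) (by simpa using hA0) hA
    simpa using this
  have hsJ : IsSimple (p :: (A ++ [q])) :=
    isSimple_of_level (φ := -φ) (h := 0) sA (by simpa using hlA) (by simp [hp]) (by simp [hq]) hpq hA
  have hJ : IsLoop (polygon (p :: (A ++ [q]))) := (isKnot_iff_isLoop _).1 ⟨_, hsJ, rfl⟩
  have hJz : Isotopic (polygon (p :: (A ++ [q]))) (polygon (p :: (A ++ q :: [z]))) := by
    rw [polygon_close, polygon_append]
    change Isotopic _ (_ ∪ path [q, z, p])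
    rw [path_triple]
    refine isotopic_triangle haff ?_
    rintro y ⟨hy, hy'⟩
    have h0 : 0 ≤ φ y := by
      refine convexHull_min ?_ (convex_le φ 0) hy'
      rintro w (rfl | rfl | hw)
      · exact hq.ge
      · exact hp.ge
      · rw [mem_singleton_iff.1 hw]
        change 0 ≤ φ z
        rw [φz]; positivity
    rcases hlA y hy with h | h | h
    · linarith
    · exact Or.inr h
    · exact Or.inl h
  refine (Bead.HostedOn.isotopic ((isKnot_iff_isLoop _).1 ⟨_, hs', rfl⟩) (hJz.isLoop_iff.1 hJ)
    ht ?_ k1 k2).trans hJz.symm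
  exact ⟨q, z, p, haff', Isotopic.refl _⟩

theorem exists_separating_functional {p q : Point} (hpq : p ≠ q) (h : p 0 = q 0) :
    ∃ g : Point →L[ℝ] ℝ, g ![1, 0, 0] = 0 ∧ g (q - p) = 1 := by
  set N := (q 1 - p 1) ^ 2 + (q 2 - p 2) ^ 2 with hN
  have hN0 : N ≠ 0 := by
    intro h0
    apply hpq
    have h1 : q 1 - p 1 = 0 := by
      have := sq_nonneg (q 1 - p 1); have := sq_nonneg (q 2 - p 2)
      exact pow_eq_zero_iff (two_ne_zero) |>.1 (by linarith)
    have h2 : q 2 - p 2 = 0 := by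
      have := sq_nonneg (q 1 - p 1); have := sq_nonneg (q 2 - p 2)
      exact pow_eq_zero_iff (two_ne_zero) |>.1 (by linarith)
    funext i
    fin_cases i
    · exact h
    · change p 1 = q 1; linarith
    · change p 2 = q 2; linarith
  refine ⟨N⁻¹ • ((q 1 - p 1) • ContinuousLinearMap.proj (1 : Fin 3) +
    (q 2 - p 2) • ContinuousLinearMap.proj (2 : Fin 3)), by simp, ?_⟩
  simp only [smul_apply, add_apply, ContinuousLinearMap.proj_apply, Pi.sub_apply, smul_eq_mul]
  rw [← pow_two, ← pow_two, ← hN, inv_mul_cancel₀ hN0]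

theorem ne_of_isSimple {p q : Point} {A B : List Point} (h : IsSimple (p :: (A ++ q :: B)))
    (hA : A ≠ []) : p ≠ q := by
  rw [isSimple_iff _ _ _ _ (by simp [hA])] at h
  exact h.1.arc.ne

theorem isotopic_left_of_isTrivial {p q : Point} {A B : List Point} (hp : p 0 = 0) (hq : q 0 = 0)
    (hA : A ≠ []) (hA0 : ∀ y ∈ A, y 0 < 0) (hB : B ≠ []) (hB0 : ∀ y ∈ B, 0 < y 0)
    (hs : IsSimple (p :: A ++ q :: B)) (ht : IsTrivial (polygon (q :: B ++ [p]))) :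
    Isotopic (polygon (p :: A ++ q :: B)) (polygon (p :: A ++ [q])) := by
  obtain ⟨g, g1, g2⟩ := exists_separating_functional (ne_of_isSimple hs hA) (hp.trans hq.symm)
  exact isotopic_of_isTrivial_summand (φ := ContinuousLinearMap.proj (0 : Fin 3)) (e := ![1, 0, 0])
    (by simp) g1 hp hq g2 hA hA0 hB hB0 hs ht

theorem isotopic_right_of_isTrivial {p q : Point} {A B : List Point} (hp : p 0 = 0) (hq : q 0 = 0)
    (hA : A ≠ []) (hA0 : ∀ y ∈ A, y 0 < 0) (hB : B ≠ []) (hB0 : ∀ y ∈ B, 0 < y 0)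
    (hs : IsSimple (p :: A ++ q :: B)) (ht : IsTrivial (polygon (p :: A ++ [q]))) :
    Isotopic (polygon (p :: A ++ q :: B)) (polygon (q :: B ++ [p])) := by
  obtain ⟨g, g1, g2⟩ := exists_separating_functional (ne_of_isSimple hs hA).symm (hq.trans hp.symm)
  rw [polygon_append_comm]
  rw [isSimple_append_comm] at hs
  refine isotopic_of_isTrivial_summand (φ := -ContinuousLinearMap.proj (0 : Fin 3))
    (e := -![1, 0, 0]) (g := g) (by simp) (by rw [map_neg, g1, neg_zero]) (by simp [hq]) (by simp [hp])
    g2 hB (by simpa using hB0) hA (by simpa using hA0) hs ht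

/-! ### Braids with empty layers -/

theorem point_ext {p : Point} {a b c : ℝ} (h0 : p 0 = a) (h1 : p 1 = b) (h2 : p 2 = c) :
    p = ![a, b, c] := by
  funext i
  fin_cases i
  · exact h0
  · exact h1
  · exact h2

theorem mem_seg {p : Point} {a b c d e f : ℝ} : p ∈ segment ℝ ![a, b, c] ![d, e, f] ↔
    ∃ t : ℝ, 0 ≤ t ∧ t ≤ 1 ∧ p 0 = a + t * (d - a) ∧ p 1 = b + t * (e - b) ∧
      p 2 = c + t * (f - c) := by
  rw [segment_param]
  constructor
  · rintro ⟨t, h0, h1, rfl⟩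
    exact ⟨t, h0, h1, by simp, by simp, by simp⟩
  · rintro ⟨t, h0, h1, h2, h3, h4⟩
    refine ⟨t, h0, h1, ?_⟩
    funext i
    fin_cases i <;> simp [h2, h3, h4]

/-- The vertical strand in position `j` between the heights `k` and `k + 1`. -/
def vertical (j k : ℕ) : Set Point := segment ℝ ![(j : ℝ), (k : ℝ), 0] ![(j : ℝ), (k : ℝ) + 1, 0]

/-- The top point of a crossing. -/
noncomputable def crest (i k : ℕ) (s : Bool) : Point :=
  ![(i : ℝ) + 1 / 2, (k : ℝ) + 1 / 2, if s then 1 else -1]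

/-- The two strands of a crossing. -/
def crossing (i k : ℕ) (s : Bool) : Set Point :=
  segment ℝ ![(i : ℝ), (k : ℝ), 0] (crest i k s) ∪
    segment ℝ (crest i k s) ![(i : ℝ) + 1, (k : ℝ) + 1, 0] ∪
    segment ℝ ![(i : ℝ) + 1, (k : ℝ), 0] ![(i : ℝ), (k : ℝ) + 1, 0]

/-- The vertical strands in the positions from `lo` to `hi - 1`, other than `i` and `i + 1`. -/
def verticals (lo hi k : ℕ) (P : ℕ → Prop) : Set Point :=
  {p | ∃ j, lo ≤ j ∧ j < hi ∧ P j ∧ p ∈ vertical j k}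

/-- A layer with strands in the positions from `lo` to `hi - 1`, with at most one crossing. -/
def layer (lo hi k : ℕ) : Option (ℕ × Bool) → Set Point
  | none => verticals lo hi k fun _ => True
  | some a => crossing a.1 k a.2 ∪ verticals lo hi k fun j => j ≠ a.1 ∧ j ≠ a.1 + 1

/-- Consecutive layers, starting at the height `k`. -/
def layers (lo hi : ℕ) : ℕ → List (Option (ℕ × Bool)) → Set Point
  | _, [] => ∅
  | k, o :: w => layer lo hi k o ∪ layers lo hi (k + 1) w

/-- The closing arcs in the positions from `lo` to `hi - 1`. -/
def closing (lo hi c : ℕ) : Set Point := {p | ∃ j, lo ≤ j ∧ j < hi ∧ p ∈ closingArc c j}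

/-- The closed braid of a word with empty letters. -/
def sparseBraid (lo hi : ℕ) (w : List (Option (ℕ × Bool))) : Set Point :=
  layers lo hi 0 w ∪ closing lo hi w.length

/-- All letters of the word are crossings of strands between `lo` and `hi - 1`. -/
def Fits (lo hi : ℕ) (w : List (Option (ℕ × Bool))) : Prop :=
  ∀ a, some a ∈ w → lo ≤ a.1 ∧ a.1 + 1 < hi

theorem layers_append (lo hi k : ℕ) (w v : List (Option (ℕ × Bool))) :
    layers lo hi k (w ++ v) = layers lo hi k w ∪ layers lo hi (k + w.length) v := by
  induction w generalizing k with
  | nil => simp [layers]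
  | cons o w ih =>
    rw [List.cons_append, layers, layers, ih, union_assoc, List.length_cons]
    congr 3
    omega

/-- The letters of a braid word. -/
def letter {n : ℕ} (a : Fin (n - 1) × Bool) : Option (ℕ × Bool) := some ((a.1 : ℕ), a.2)

theorem layer_letter {n : ℕ} (k : ℕ) (a : Fin (n - 1) × Bool) :
    layer 0 n k (letter a) = braidLayer n k a := by
  ext p
  simp only [layer, letter, braidLayer, crossing, crest, verticals, vertical, mem_union, mem_iUnion,
    mem_ofPred]
  apply or_congr Iff.rfl
  constructor
  · rintro ⟨j, -, hj, h, hp⟩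
    exact ⟨⟨j, hj⟩, h, hp⟩
  · rintro ⟨j, h, hp⟩
    exact ⟨j, Nat.zero_le _, j.2, h, hp⟩

theorem layers_letter {n : ℕ} (k : ℕ) (β : BraidWord n) :
    layers 0 n k (β.map letter) = ⋃ l : Fin β.length, braidLayer n (k + l) (β.get l) := by
  induction β generalizing k with
  | nil => simp [layers]
  | cons a β ih =>
    rw [List.map_cons, layers, ih, layer_letter]
    ext p
    simp only [mem_union, mem_iUnion]
    constructor
    · rintro (h | ⟨l, h⟩)
      · exact ⟨⟨0, by simp⟩, h⟩
      · refine ⟨l.succ, ?_⟩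
        have e : k + ((l.succ : Fin (β.length + 1)) : ℕ) = k + 1 + l := by
          rw [Fin.val_succ]; omega
        rw [e]
        exact h
    · rintro ⟨l, h⟩
      refine Fin.cases (motive := fun l => p ∈ braidLayer n (k + (l : ℕ)) ((a :: β).get l) → _) ?_ ?_ l h
      · exact fun h => Or.inl h
      · intro l h
        right
        refine ⟨l, ?_⟩
        have e : k + ((l.succ : Fin (β.length + 1)) : ℕ) = k + 1 + l := by
          rw [Fin.val_succ]; omega
        rw [e] at h
        exact h

theorem closedBraid_eq {n : ℕ} (β : BraidWord n) :
    closedBraid β = sparseBraid 0 n (β.map letter) := by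
  rw [closedBraid, sparseBraid, layers_letter, List.length_map]
  congr 1
  · simp
  · ext p
    simp only [closing, mem_iUnion, mem_ofPred]
    constructor
    · rintro ⟨j, h⟩
      exact ⟨j, Nat.zero_le _, j.2, h⟩
    · rintro ⟨j, -, hj, h⟩
      exact ⟨⟨j, hj⟩, h⟩

theorem fits_letter {n : ℕ} (β : BraidWord n) : Fits 0 n (β.map letter) := by
  intro a ha
  obtain ⟨x, -, hx⟩ := List.mem_map.1 ha
  rw [letter, Option.some.injEq] at hx
  rw [← hx]
  have := x.1.2
  exact ⟨Nat.zero_le _, by simp only; omega⟩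

theorem mem_vertical {j k : ℕ} {p : Point} : p ∈ vertical j k ↔
    p 0 = j ∧ (k : ℝ) ≤ p 1 ∧ p 1 ≤ k + 1 ∧ p 2 = 0 := by
  rw [vertical, mem_seg]
  constructor
  · rintro ⟨t, h0, h1, h2, h3, h4⟩
    refine ⟨by linarith, by linarith, by linarith, by linarith⟩
  · rintro ⟨h0, h1, h2, h3⟩
    exact ⟨p 1 - k, by linarith, by linarith, by linarith, by linarith, by linarith⟩

theorem crossing_bounds {i k : ℕ} {s : Bool} {p : Point} (h : p ∈ crossing i k s) :
    ((i : ℝ) ≤ p 0 ∧ p 0 ≤ i + 1) ∧ ((k : ℝ) ≤ p 1 ∧ p 1 ≤ k + 1) ∧ (-1 ≤ p 2 ∧ p 2 ≤ 1) ∧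
      (p 1 = k → p = ![(i : ℝ), (k : ℝ), 0] ∨ p = ![(i : ℝ) + 1, (k : ℝ), 0]) ∧
      (p 1 = k + 1 → p = ![(i : ℝ), (k : ℝ) + 1, 0] ∨ p = ![(i : ℝ) + 1, (k : ℝ) + 1, 0]) := by
  rw [crossing, crest] at h
  have hσ : (if s then (1 : ℝ) else -1) = 1 ∨ (if s then (1 : ℝ) else -1) = -1 := by
    cases s <;> simp
  generalize (if s then (1 : ℝ) else -1) = σ at h hσ
  rcases h with (h | h) | h <;> obtain ⟨t, h0, h1, h2, h3, h4⟩ := mem_seg.1 h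
  · refine ⟨⟨by linarith, by linarith⟩, ⟨by linarith, by linarith⟩, ?_, ?_, ?_⟩
    · rcases hσ with rfl | rfl <;> constructor <;> linarith
    · intro h5
      have : t = 0 := by linarith
      subst this
      exact Or.inl (point_ext (by linarith) (by linarith) (by linarith))
    · intro h5; linarith
  · refine ⟨⟨by linarith, by linarith⟩, ⟨by linarith, by linarith⟩, ?_, ?_, ?_⟩
    · rcases hσ with rfl | rfl <;> constructor <;> linarith
    · intro h5; linarith
    · intro h5
      have : t = 1 := by linarith
      subst this
      exact Or.inr (point_ext (by linarith) (by linarith) (by linarith))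
  · refine ⟨⟨by linarith, by linarith⟩, ⟨by linarith, by linarith⟩, ⟨by linarith, by linarith⟩, ?_, ?_⟩
    · intro h5
      have : t = 0 := by linarith
      subst this
      exact Or.inr (point_ext (by linarith) (by linarith) (by linarith))
    · intro h5
      have : t = 1 := by linarith
      subst this
      exact Or.inl (point_ext (by linarith) (by linarith) (by linarith))

/-- The points `(j, y, 0)` in the positions from `lo` to `hi - 1`. -/
def IsLattice (lo hi : ℕ) (p : Point) (y : ℝ) : Prop :=
  ∃ j : ℕ, lo ≤ j ∧ j < hi ∧ p = ![(j : ℝ), y, 0]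

theorem layer_bounds {lo hi k : ℕ} {o : Option (ℕ × Bool)}
    (ho : ∀ a, o = some a → lo ≤ a.1 ∧ a.1 + 1 < hi) {p : Point} (h : p ∈ layer lo hi k o) :
    ((lo : ℝ) ≤ p 0 ∧ p 0 + 1 ≤ hi) ∧ ((k : ℝ) ≤ p 1 ∧ p 1 ≤ k + 1) ∧ (-1 ≤ p 2 ∧ p 2 ≤ 1) ∧
      (p 1 = k → IsLattice lo hi p k) ∧ (p 1 = k + 1 → IsLattice lo hi p (k + 1)) := by
  have hv : ∀ P, p ∈ verticals lo hi k P →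
      ((lo : ℝ) ≤ p 0 ∧ p 0 + 1 ≤ hi) ∧ ((k : ℝ) ≤ p 1 ∧ p 1 ≤ k + 1) ∧ (-1 ≤ p 2 ∧ p 2 ≤ 1) ∧
      (p 1 = k → IsLattice lo hi p k) ∧ (p 1 = k + 1 → IsLattice lo hi p (k + 1)) := by
    rintro P ⟨j, h1, h2, -, h3⟩
    obtain ⟨a0, a1, a2, a3⟩ := mem_vertical.1 h3
    have h1' : (lo : ℝ) ≤ j := by exact_mod_cast h1
    have h2' : (j : ℝ) + 1 ≤ hi := by exact_mod_cast h2
    exact ⟨⟨by linarith, by linarith⟩, ⟨a1, a2⟩, ⟨by linarith, by linarith⟩,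
      fun h => ⟨j, h1, h2, point_ext a0 h a3⟩, fun h => ⟨j, h1, h2, point_ext a0 h a3⟩⟩
  cases o with
  | none => exact hv _ h
  | some a =>
    rcases h with h | h
    · obtain ⟨l1, l2⟩ := ho a rfl
      obtain ⟨a0, a1, a2, a3, a4⟩ := crossing_bounds h
      have l1' : (lo : ℝ) ≤ a.1 := by exact_mod_cast l1
      have l2' : (a.1 : ℝ) + 1 + 1 ≤ hi := by exact_mod_cast l2
      refine ⟨⟨by linarith, by linarith⟩, a1, a2, fun h => ?_, fun h => ?_⟩
      · rcases a3 h with h' | h'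
        · exact ⟨a.1, l1, by omega, h'⟩
        · exact ⟨a.1 + 1, by omega, l2, by rw [h']; simp⟩
      · rcases a4 h with h' | h'
        · exact ⟨a.1, l1, by omega, h'⟩
        · exact ⟨a.1 + 1, by omega, l2, by rw [h']; simp⟩
    · exact hv _ h

theorem Fits.of_cons {lo hi : ℕ} {o : Option (ℕ × Bool)} {w : List (Option (ℕ × Bool))}
    (h : Fits lo hi (o :: w)) : (∀ a, o = some a → lo ≤ a.1 ∧ a.1 + 1 < hi) ∧ Fits lo hi w :=
  ⟨fun a ha => h a (by simp [ha]), fun a ha => h a (by simp [ha])⟩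

theorem layers_bounds {lo hi k : ℕ} {w : List (Option (ℕ × Bool))} (hw : Fits lo hi w) {p : Point}
    (h : p ∈ layers lo hi k w) :
    ((lo : ℝ) ≤ p 0 ∧ p 0 + 1 ≤ hi) ∧ ((k : ℝ) ≤ p 1 ∧ p 1 ≤ (k + w.length : ℕ)) ∧
      (-1 ≤ p 2 ∧ p 2 ≤ 1) ∧ (p 1 = k → IsLattice lo hi p k) ∧
      (p 1 = (k + w.length : ℕ) → IsLattice lo hi p (k + w.length : ℕ)) := by
  induction w generalizing k with
  | nil => exact absurd h (by simp [layers])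
  | cons o w ih =>
    obtain ⟨ho, hw⟩ := hw.of_cons
    have e : k + (o :: w).length = (k + 1) + w.length := by rw [List.length_cons]; omega
    rw [e]
    rcases h with h | h
    · obtain ⟨a0, a1, a2, a3, a4⟩ := layer_bounds ho h
      have : (0 : ℝ) ≤ w.length := Nat.cast_nonneg _
      push_cast
      refine ⟨a0, ⟨a1.1, by linarith⟩, a2, a3, fun h => ?_⟩
      have h0 : (w.length : ℝ) = 0 := by linarith
      rw [h0, add_zero] at h ⊢
      exact a4 h
    · obtain ⟨a0, a1, a2, a3, a4⟩ := ih hw h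
      push_cast at a1 a3 a4 ⊢
      exact ⟨a0, ⟨by linarith, a1.2⟩, a2, fun h => absurd h (by linarith), a4⟩

theorem closingArc_bounds {c j : ℕ} {p : Point} (h : p ∈ closingArc c j) :
    p 0 = j ∧ -2 ≤ p 2 ∧ p 2 ≤ 0 ∧ (p 2 = -2 ∨ (p 1 < 0 ∨ p = ![(j : ℝ), 0, 0]) ∨
      ((c : ℝ) < p 1 ∨ p = ![(j : ℝ), (c : ℝ), 0])) := by
  rcases h with (h | h) | h <;> obtain ⟨t, h0, h1, h2, h3, h4⟩ := mem_seg.1 h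
  · refine ⟨by linarith, by linarith, by linarith, Or.inr (Or.inr ?_)⟩
    rcases eq_or_lt_of_le h0 with h5 | h5
    · subst h5
      exact Or.inr (point_ext (by linarith) (by linarith) (by linarith))
    · left; linarith
  · exact ⟨by linarith, by linarith, by linarith, Or.inl (by linarith)⟩
  · refine ⟨by linarith, by linarith, by linarith, Or.inr (Or.inl ?_)⟩
    rcases eq_or_lt_of_le h1 with h5 | h5
    · subst h5
      exact Or.inr (point_ext (by linarith) (by linarith) (by linarith))
    · left; linarith

theorem mem_tri {u v w p : Point} (h : p ∈ convexHull ℝ {u, v, w}) :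
    ∃ b c : ℝ, 0 ≤ b ∧ 0 ≤ c ∧ b + c ≤ 1 ∧ ∀ i, p i = u i + b * (v i - u i) + c * (w i - u i) := by
  obtain ⟨a, b, c, h0, h1, h2, h3, rfl⟩ := mem_triangle.1 h
  refine ⟨b, c, h1, h2, by linarith, fun i => ?_⟩
  have : a = 1 - b - c := by linarith
  subst this
  simp only [Pi.add_apply, Pi.smul_apply, smul_eq_mul]
  ring

theorem isotopic_move {u v w : Point} {R S S' : Set Point} (h : AffineIndependent ℝ ![u, v, w])
    (hR : ∀ p ∈ R, p ∈ convexHull ℝ {u, v, w} → p = u ∨ p = v) (hS : S = R ∪ segment ℝ u v)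
    (hS' : S' = R ∪ (segment ℝ u w ∪ segment ℝ w v)) : Isotopic S S' := by
  rw [hS, hS']
  exact isotopic_triangle h fun p hp => hR p hp.1 hp.2

theorem affineIndependent_of_coord {u v w : Point} (h : ∀ s t : ℝ,
    (∀ i, s * (v i - u i) + t * (w i - u i) = 0) → s = 0 ∧ t = 0) :
    AffineIndependent ℝ ![u, v, w] :=
  affineIndependent_iff_pair.2 fun s t hst => h s t fun i => congrFun hst i

section LocalMoves

variable {x y σ : ℝ} {O : Set Point}

/-- A crossing is moved down. -/
theorem isotopic_lower_crossing (hσ : σ = 1 ∨ σ = -1)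
    (hO : ∀ p ∈ O, x ≤ p 0 → p 0 ≤ x + 1 → y ≤ p 1 → p 1 ≤ y + 2 → -1 ≤ p 2 → p 2 ≤ 1 →
      (p = ![x, y, 0] ∨ p = ![x + 1, y, 0]) ∨ (p = ![x, y + 2, 0] ∨ p = ![x + 1, y + 2, 0])) :
    Isotopic
      (O ∪ ((segment ℝ ![x, y, 0] ![x, y + 1, 0] ∪ segment ℝ ![x + 1, y, 0] ![x + 1, y + 1, 0]) ∪
        (segment ℝ ![x, y + 1, 0] ![x + 1 / 2, y + 3 / 2, σ] ∪
        segment ℝ ![x + 1 / 2, y + 3 / 2, σ] ![x + 1, y + 2, 0] ∪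
        segment ℝ ![x + 1, y + 1, 0] ![x, y + 2, 0])))
      (O ∪ ((segment ℝ ![x, y, 0] ![x + 1 / 2, y + 1 / 2, σ] ∪
        segment ℝ ![x + 1 / 2, y + 1 / 2, σ] ![x + 1, y + 1, 0] ∪
        segment ℝ ![x + 1, y, 0] ![x, y + 1, 0]) ∪
        (segment ℝ ![x, y + 1, 0] ![x, y + 2, 0] ∪
          segment ℝ ![x + 1, y + 1, 0] ![x + 1, y + 2, 0]))) := by
  set P : Point := ![x, y, 0] with hP
  set P₁ : Point := ![x, y + 1, 0] with hP₁
  set M : Point := ![x + 1 / 2, y + 3 / 2, σ] with hM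
  set Q : Point := ![x + 1, y + 2, 0] with hQ
  set A : Point := ![x + 1, y, 0] with hA
  set A₁ : Point := ![x + 1, y + 1, 0] with hA₁
  set B : Point := ![x, y + 2, 0] with hB
  set M' : Point := ![x + 1 / 2, y + 1 / 2, σ] with hM'
  have aux : ∀ {u v w : Point} {R : Set Point},
      (∀ p ∈ R, ∀ b c : ℝ, 0 ≤ b → 0 ≤ c → b + c ≤ 1 → p 0 = u 0 + b * (v 0 - u 0) + c * (w 0 - u 0) →
        p 1 = u 1 + b * (v 1 - u 1) + c * (w 1 - u 1) → p 2 = u 2 + b * (v 2 - u 2) + c * (w 2 - u 2) →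
        p = u ∨ p = v) →
      ∀ p ∈ R, p ∈ convexHull ℝ {u, v, w} → p = u ∨ p = v := by
    intro u v w R h p hp hp'
    obtain ⟨b, c, h0, h1, h2, h3⟩ := mem_tri hp'
    exact h p hp b c h0 h1 h2 (h3 0) (h3 1) (h3 2)
  have i1 : Isotopic (O ∪ ((segment ℝ P P₁ ∪ segment ℝ A A₁) ∪
      (segment ℝ P₁ M ∪ segment ℝ M Q ∪ segment ℝ A₁ B)))
      (O ∪ (segment ℝ P P₁ ∪ segment ℝ P₁ M ∪ segment ℝ M Q) ∪ segment ℝ A B) := by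
    refine (isotopic_move (u := A) (v := B) (w := A₁)
      (R := O ∪ (segment ℝ P P₁ ∪ segment ℝ P₁ M ∪ segment ℝ M Q)) ?_ (aux ?_) rfl ?_).symm
    · refine affineIndependent_of_coord fun s t h => ?_
      have h0 := h 0
      have h1 := h 1
      simp only [hA, hB, hA₁, Matrix.cons_val] at h0 h1
      constructor <;> linarith
    · intro p hp b c hb hc hbc e0 e1 e2
      simp only [hA, hB, hA₁, Matrix.cons_val] at e0 e1 e2
      rcases hp with hp | (hp | hp) | hp
      · rcases hO p hp (by linarith) (by linarith) (by linarith) (by linarith) (by linarith)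
          (by linarith) with (h | h) | (h | h)
        all_goals
          have f0 := congrFun h 0
          have f1 := congrFun h 1
          have f2 := congrFun h 2
          simp only [hP, hA, hB, hQ, Matrix.cons_val] at f0 f1 f2
          first | exact Or.inl h | exact Or.inr h | (exfalso; linarith)
      all_goals
        obtain ⟨t, t0, t1, f0, f1, f2⟩ := mem_seg.1 hp
        rcases hσ with rfl | rfl <;> exfalso <;> linarith
    · ac_rfl
  have i2 : Isotopic (O ∪ (segment ℝ P P₁ ∪ segment ℝ P₁ M ∪ segment ℝ M Q) ∪ segment ℝ A B)
      (O ∪ (segment ℝ M Q ∪ segment ℝ A B) ∪ segment ℝ P M) := by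
    refine (isotopic_move (u := P) (v := M) (w := P₁)
      (R := O ∪ (segment ℝ M Q ∪ segment ℝ A B)) ?_ (aux ?_) rfl ?_).symm
    · refine affineIndependent_of_coord fun s t h => ?_
      have h0 := h 0
      have h1 := h 1
      simp only [hP, hM, hP₁, Matrix.cons_val] at h0 h1
      constructor <;> linarith
    · intro p hp b c hb hc hbc e0 e1 e2
      simp only [hP, hM, hP₁, Matrix.cons_val] at e0 e1 e2
      rcases hp with hp | hp | hp
      · have hz : -1 ≤ p 2 ∧ p 2 ≤ 1 := by
          rcases hσ with rfl | rfl <;> constructor <;> linarith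
        rcases hO p hp (by linarith) (by linarith) (by linarith) (by linarith) hz.1 hz.2
          with (h | h) | (h | h)
        all_goals
          have f0 := congrFun h 0
          have f1 := congrFun h 1
          have f2 := congrFun h 2
          simp only [hP, hA, hB, hQ, Matrix.cons_val] at f0 f1 f2
          rcases hσ with rfl | rfl <;>
          first | exact Or.inl h | exact Or.inr h | (exfalso; linarith)
      all_goals
        obtain ⟨t, t0, t1, f0, f1, f2⟩ := mem_seg.1 hp
        rcases hσ with rfl | rfl <;>
        first
          | (exfalso; linarith)
          | exact Or.inr (point_ext (by linarith) (by linarith) (by linarith))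
    · ac_rfl
  have i3 : Isotopic (O ∪ (segment ℝ M Q ∪ segment ℝ A B) ∪ segment ℝ P M)
      (O ∪ (segment ℝ M Q ∪ segment ℝ A B) ∪ (segment ℝ P M' ∪ segment ℝ M' M)) := by
    refine isotopic_move (u := P) (v := M) (w := M')
      (R := O ∪ (segment ℝ M Q ∪ segment ℝ A B)) ?_ (aux ?_) rfl rfl
    · refine affineIndependent_of_coord fun s t h => ?_
      have h0 := h 0
      have h1 := h 1
      simp only [hP, hM, hM', Matrix.cons_val] at h0 h1
      constructor <;> linarith
    · intro p hp b c hb hc hbc e0 e1 e2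
      simp only [hP, hM, hM', Matrix.cons_val] at e0 e1 e2
      rcases hp with hp | hp | hp
      · have hz : -1 ≤ p 2 ∧ p 2 ≤ 1 := by
          rcases hσ with rfl | rfl <;> constructor <;> linarith
        rcases hO p hp (by linarith) (by linarith) (by linarith) (by linarith) hz.1 hz.2
          with (h | h) | (h | h)
        all_goals
          have f0 := congrFun h 0
          have f1 := congrFun h 1
          have f2 := congrFun h 2
          simp only [hP, hA, hB, hQ, Matrix.cons_val] at f0 f1 f2
          rcases hσ with rfl | rfl <;>
          first | exact Or.inl h | exact Or.inr h | (exfalso; linarith)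
      all_goals
        obtain ⟨t, t0, t1, f0, f1, f2⟩ := mem_seg.1 hp
        rcases hσ with rfl | rfl <;>
        first
          | (exfalso; linarith)
          | exact Or.inr (point_ext (by linarith) (by linarith) (by linarith))
  have i4 : Isotopic (O ∪ (segment ℝ M Q ∪ segment ℝ A B) ∪ (segment ℝ P M' ∪ segment ℝ M' M))
      (O ∪ (segment ℝ P M' ∪ segment ℝ A B) ∪ segment ℝ M' Q) := by
    refine (isotopic_move (u := M') (v := Q) (w := M)
      (R := O ∪ (segment ℝ P M' ∪ segment ℝ A B)) ?_ (aux ?_) rfl ?_).symm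
    · refine affineIndependent_of_coord fun s t h => ?_
      have h0 := h 0
      have h1 := h 1
      simp only [hQ, hM, hM', Matrix.cons_val] at h0 h1
      constructor <;> linarith
    · intro p hp b c hb hc hbc e0 e1 e2
      simp only [hQ, hM, hM', Matrix.cons_val] at e0 e1 e2
      rcases hp with hp | hp | hp
      · have hz : -1 ≤ p 2 ∧ p 2 ≤ 1 := by
          rcases hσ with rfl | rfl <;> constructor <;> linarith
        rcases hO p hp (by linarith) (by linarith) (by linarith) (by linarith) hz.1 hz.2
          with (h | h) | (h | h)
        all_goals
          have f0 := congrFun h 0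
          have f1 := congrFun h 1
          have f2 := congrFun h 2
          simp only [hP, hA, hB, hQ, Matrix.cons_val] at f0 f1 f2
          rcases hσ with rfl | rfl <;>
          first | exact Or.inl h | exact Or.inr h | (exfalso; linarith)
      all_goals
        obtain ⟨t, t0, t1, f0, f1, f2⟩ := mem_seg.1 hp
        rcases hσ with rfl | rfl <;>
        first
          | (exfalso; linarith)
          | exact Or.inl (point_ext (by linarith) (by linarith) (by linarith))
    · ac_rfl
  have i5 : Isotopic (O ∪ (segment ℝ P M' ∪ segment ℝ A B) ∪ segment ℝ M' Q)
      (O ∪ (segment ℝ P M' ∪ segment ℝ A B) ∪ (segment ℝ M' A₁ ∪ segment ℝ A₁ Q)) := by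
    refine isotopic_move (u := M') (v := Q) (w := A₁)
      (R := O ∪ (segment ℝ P M' ∪ segment ℝ A B)) ?_ (aux ?_) rfl rfl
    · refine affineIndependent_of_coord fun s t h => ?_
      have h0 := h 0
      have h1 := h 1
      simp only [hQ, hA₁, hM', Matrix.cons_val] at h0 h1
      constructor <;> linarith
    · intro p hp b c hb hc hbc e0 e1 e2
      simp only [hQ, hA₁, hM', Matrix.cons_val] at e0 e1 e2
      rcases hp with hp | hp | hp
      · have hz : -1 ≤ p 2 ∧ p 2 ≤ 1 := by
          rcases hσ with rfl | rfl <;> constructor <;> linarith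
        rcases hO p hp (by linarith) (by linarith) (by linarith) (by linarith) hz.1 hz.2
          with (h | h) | (h | h)
        all_goals
          have f0 := congrFun h 0
          have f1 := congrFun h 1
          have f2 := congrFun h 2
          simp only [hP, hA, hB, hQ, Matrix.cons_val] at f0 f1 f2
          rcases hσ with rfl | rfl <;>
          first | exact Or.inl h | exact Or.inr h | (exfalso; linarith)
      all_goals
        obtain ⟨t, t0, t1, f0, f1, f2⟩ := mem_seg.1 hp
        rcases hσ with rfl | rfl <;>
        first
          | (exfalso; linarith)
          | exact Or.inl (point_ext (by linarith) (by linarith) (by linarith))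
  have i6 : Isotopic (O ∪ (segment ℝ P M' ∪ segment ℝ A B) ∪ (segment ℝ M' A₁ ∪ segment ℝ A₁ Q))
      (O ∪ ((segment ℝ P M' ∪ segment ℝ M' A₁ ∪ segment ℝ A P₁) ∪
        (segment ℝ P₁ B ∪ segment ℝ A₁ Q))) := by
    refine isotopic_move (u := A) (v := B) (w := P₁)
      (R := O ∪ (segment ℝ P M' ∪ segment ℝ M' A₁ ∪ segment ℝ A₁ Q)) ?_ (aux ?_) ?_ ?_
    · refine affineIndependent_of_coord fun s t h => ?_
      have h0 := h 0
      have h1 := h 1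
      simp only [hA, hB, hP₁, Matrix.cons_val] at h0 h1
      constructor <;> linarith
    · intro p hp b c hb hc hbc e0 e1 e2
      simp only [hA, hB, hP₁, Matrix.cons_val] at e0 e1 e2
      rcases hp with hp | (hp | hp) | hp
      · rcases hO p hp (by linarith) (by linarith) (by linarith) (by linarith) (by linarith)
          (by linarith) with (h | h) | (h | h)
        all_goals
          have f0 := congrFun h 0
          have f1 := congrFun h 1
          have f2 := congrFun h 2
          simp only [hP, hA, hB, hQ, Matrix.cons_val] at f0 f1 f2
          first | exact Or.inl h | exact Or.inr h | (exfalso; linarith)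
      all_goals
        obtain ⟨t, t0, t1, f0, f1, f2⟩ := mem_seg.1 hp
        rcases hσ with rfl | rfl <;> exfalso <;> linarith
    · ac_rfl
    · ac_rfl
  exact i1.trans (i2.trans (i3.trans (i4.trans (i5.trans i6))))

end LocalMoves

/-- A strand that turns back at a crossing is straightened. -/
theorem isotopic_straighten {x y σ δ : ℝ} {O : Set Point} (hσ : σ = 1 ∨ σ = -1)
    (hδ : δ = 1 / 2 ∨ δ = -1 / 2)
    (hO : ∀ p ∈ O, |p 0 - x| ≤ 1 / 2 → |p 1 - y| ≤ 1 / 2 → |p 2| ≤ 1 →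
      p = ![x, y - δ, 0] ∨ p = ![x, y + δ, 0]) :
    Isotopic (O ∪ (segment ℝ ![x, y - δ, 0] ![x + δ, y, σ] ∪
        (segment ℝ ![x + δ, y, σ] ![x + δ, y, 0] ∪ segment ℝ ![x + δ, y, 0] ![x, y + δ, 0])))
      (O ∪ segment ℝ ![x, y - δ, 0] ![x, y + δ, 0]) := by
  have h1 : Isotopic (O ∪ segment ℝ ![x, y - δ, 0] ![x + δ, y, σ] ∪
      segment ℝ ![x + δ, y, σ] ![x, y + δ, 0])
      (O ∪ (segment ℝ ![x, y - δ, 0] ![x + δ, y, σ] ∪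
        (segment ℝ ![x + δ, y, σ] ![x + δ, y, 0] ∪ segment ℝ ![x + δ, y, 0] ![x, y + δ, 0]))) := by
    refine isotopic_move (u := ![x + δ, y, σ]) (v := ![x, y + δ, 0]) (w := ![x + δ, y, 0])
      (R := O ∪ segment ℝ ![x, y - δ, 0] ![x + δ, y, σ]) ?_ ?_ rfl (union_assoc _ _ _).symm
    · refine affineIndependent_of_coord fun s t h => ?_
      have h0 := h 0
      have h1 := h 2
      simp only [Matrix.cons_val] at h0 h1
      rcases hσ with rfl | rfl <;> rcases hδ with rfl | rfl <;> constructor <;> linarith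
    · intro p hp hh
      obtain ⟨b, c, hb, hc, hbc, e⟩ := mem_tri hh
      have e0 := e 0
      have e1 := e 1
      have e2 := e 2
      simp only [Matrix.cons_val] at e0 e1 e2
      rcases hp with hp | hp
      · rcases hO p hp (abs_le.2 (by rcases hδ with rfl | rfl <;> constructor <;> linarith))
          (abs_le.2 (by rcases hδ with rfl | rfl <;> constructor <;> linarith))
          (abs_le.2 (by rcases hσ with rfl | rfl <;> constructor <;> linarith)) with h | h
        · have f1 := congrFun h 1
          simp only [Matrix.cons_val] at f1
          rcases hδ with rfl | rfl <;> (exfalso; linarith)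
        · exact Or.inr h
      · obtain ⟨t, t0, t1, f0, f1, f2⟩ := mem_seg.1 hp
        left
        rcases hδ with rfl | rfl <;> rcases hσ with rfl | rfl <;>
          exact point_ext (by linarith) (by linarith) (by linarith)
  have h2 : Isotopic (O ∪ segment ℝ ![x, y - δ, 0] ![x, y + δ, 0])
      (O ∪ segment ℝ ![x, y - δ, 0] ![x + δ, y, σ] ∪ segment ℝ ![x + δ, y, σ] ![x, y + δ, 0]) := by
    refine isotopic_move (u := ![x, y - δ, 0]) (v := ![x, y + δ, 0]) (w := ![x + δ, y, σ])
      (R := O) ?_ ?_ rfl (union_assoc _ _ _)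
    · refine affineIndependent_of_coord fun s t h => ?_
      have h0 := h 0
      have h1 := h 1
      simp only [Matrix.cons_val] at h0 h1
      rcases hδ with rfl | rfl <;> constructor <;> linarith
    · intro p hp hh
      obtain ⟨b, c, hb, hc, hbc, e⟩ := mem_tri hh
      have e0 := e 0
      have e1 := e 1
      have e2 := e 2
      simp only [Matrix.cons_val] at e0 e1 e2
      exact hO p hp (abs_le.2 (by rcases hδ with rfl | rfl <;> constructor <;> linarith))
          (abs_le.2 (by rcases hδ with rfl | rfl <;> constructor <;> linarith))
          (abs_le.2 (by rcases hσ with rfl | rfl <;> constructor <;> linarith))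
  exact (h2.trans h1).symm

/-- A vertical strand below a closing arc is absorbed. -/
theorem isotopic_absorb {x y : ℝ} {O : Set Point} (hy : 0 ≤ y)
    (hO : ∀ p ∈ O, p 0 = x → y ≤ p 1 → p = ![x, y, 0]) :
    Isotopic (O ∪ (segment ℝ ![x, y, 0] ![x, y + 1, 0] ∪ (segment ℝ ![x, y + 1, 0] ![x, y + 1 + 1, -2] ∪
        segment ℝ ![x, y + 1 + 1, -2] ![x, -1, -2])))
      (O ∪ (segment ℝ ![x, y, 0] ![x, y + 1, -2] ∪ segment ℝ ![x, y + 1, -2] ![x, -1, -2])) := by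
  have hD : (![x, y + 1, -2] : Point) ∈ segment ℝ ![x, y + 1 + 1, -2] ![x, -1, -2] := by
    rw [mem_seg]
    refine ⟨1 / (y + 3), by positivity, by rw [div_le_one (by positivity)]; linarith, ?_, ?_, ?_⟩
    · simp
    · simp only [Matrix.cons_val]; field_simp; ring
    · simp
  have h1 : Isotopic (O ∪ segment ℝ ![x, y + 1 + 1, -2] ![x, -1, -2] ∪
      segment ℝ ![x, y, 0] ![x, y + 1 + 1, -2])
      (O ∪ (segment ℝ ![x, y, 0] ![x, y + 1, 0] ∪ (segment ℝ ![x, y + 1, 0] ![x, y + 1 + 1, -2] ∪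
        segment ℝ ![x, y + 1 + 1, -2] ![x, -1, -2]))) := by
    refine isotopic_move (u := ![x, y, 0]) (v := ![x, y + 1 + 1, -2]) (w := ![x, y + 1, 0])
      (R := O ∪ segment ℝ ![x, y + 1 + 1, -2] ![x, -1, -2]) ?_ ?_ rfl (by ac_rfl)
    · refine affineIndependent_of_coord fun s t h => ?_
      have h0 := h 1
      have h1 := h 2
      simp only [Matrix.cons_val] at h0 h1
      constructor <;> linarith
    · intro p hp hh
      obtain ⟨b, c, hb, hc, hbc, e⟩ := mem_tri hh
      have e0 := e 0
      have e1 := e 1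
      have e2 := e 2
      simp only [Matrix.cons_val] at e0 e1 e2
      rcases hp with hp | hp
      · exact Or.inl (hO p hp (by linarith) (by linarith))
      · obtain ⟨t, t0, t1, f0, f1, f2⟩ := mem_seg.1 hp
        exact Or.inr (point_ext (by linarith) (by linarith) (by linarith))
  have h2 : Isotopic
      (O ∪ (segment ℝ ![x, y, 0] ![x, y + 1, -2] ∪ segment ℝ ![x, y + 1, -2] ![x, -1, -2]))
      (O ∪ segment ℝ ![x, y + 1 + 1, -2] ![x, -1, -2] ∪
        segment ℝ ![x, y, 0] ![x, y + 1 + 1, -2]) := by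
    refine (isotopic_move (u := ![x, y, 0]) (v := ![x, y + 1, -2]) (w := ![x, y + 1 + 1, -2])
      (R := O ∪ segment ℝ ![x, y + 1, -2] ![x, -1, -2]) ?_ ?_ (by ac_rfl) ?_)
    · refine affineIndependent_of_coord fun s t h => ?_
      have h0 := h 1
      have h1 := h 2
      simp only [Matrix.cons_val] at h0 h1
      constructor <;> linarith
    · intro p hp hh
      obtain ⟨b, c, hb, hc, hbc, e⟩ := mem_tri hh
      have e0 := e 0
      have e1 := e 1
      have e2 := e 2
      simp only [Matrix.cons_val] at e0 e1 e2
      rcases hp with hp | hp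
      · exact Or.inl (hO p hp (by linarith) (by linarith))
      · obtain ⟨t, t0, t1, f0, f1, f2⟩ := mem_seg.1 hp
        have := mul_nonneg t0 (show 0 ≤ y + 2 by linarith)
        exact Or.inr (point_ext (by linarith) (by linarith) (by linarith))
    · rw [← segment_union_segment hD]
      ext; simp only [mem_union]; tauto
  exact (h2.trans h1).symm

/-! ### Removing empty layers -/

/-- A closed braid without the layers between two given heights. -/
def outside (lo hi l : ℕ) (w₁ w₂ : List (Option (ℕ × Bool))) : Set Point :=
  layers lo hi 0 w₁ ∪ layers lo hi (w₁.length + l) w₂ ∪ closing lo hi (w₁.length + l + w₂.length)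

theorem closing_bounds {lo hi c : ℕ} {p : Point} (h : p ∈ closing lo hi c) (h0 : 0 ≤ p 1)
    (h1 : p 1 ≤ c) (h2 : -1 ≤ p 2) : IsLattice lo hi p 0 ∨ IsLattice lo hi p c := by
  obtain ⟨j, a, b, h⟩ := h
  obtain ⟨-, -, -, h3 | (h3 | h3) | (h3 | h3)⟩ := closingArc_bounds h
  · linarith
  · linarith
  · exact Or.inl ⟨j, a, b, h3⟩
  · linarith
  · exact Or.inr ⟨j, a, b, h3⟩

theorem IsLattice.height {lo hi : ℕ} {p : Point} {y : ℝ} (h : IsLattice lo hi p y) : p 1 = y := by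
  obtain ⟨j, -, -, rfl⟩ := h
  simp

theorem outside_bounds {lo hi l : ℕ} {w₁ w₂ : List (Option (ℕ × Bool))} (h₁ : Fits lo hi w₁)
    (h₂ : Fits lo hi w₂) {p : Point} (h : p ∈ outside lo hi l w₁ w₂) (h0 : (w₁.length : ℝ) ≤ p 1)
    (h1 : p 1 ≤ w₁.length + l) (h2 : -1 ≤ p 2) :
    IsLattice lo hi p w₁.length ∨ IsLattice lo hi p (w₁.length + l) := by
  have n1 : (0 : ℝ) ≤ w₁.length := Nat.cast_nonneg _
  have n2 : (0 : ℝ) ≤ w₂.length := Nat.cast_nonneg _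
  rcases h with (h | h) | h
  · obtain ⟨-, a1, -, -, a2⟩ := layers_bounds h₁ h
    rw [zero_add] at a1 a2
    exact Or.inl (a2 (le_antisymm a1.2 h0))
  · obtain ⟨-, a1, -, a2, -⟩ := layers_bounds h₂ h
    push_cast at a1 a2
    exact Or.inr (a2 (le_antisymm h1 a1.1))
  · have hc := closing_bounds h (by linarith) (by push_cast; linarith) h2
    push_cast at hc
    rcases hc with hc | hc
    · left
      have := hc.height
      have e : (w₁.length : ℝ) = 0 := by linarith
      rwa [e]
    · right
      have := hc.height
      have e : (w₁.length : ℝ) + l + w₂.length = w₁.length + l := by linarith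
      rwa [e] at hc

theorem sparseBraid_append (lo hi : ℕ) (w₁ v w₂ : List (Option (ℕ × Bool))) :
    sparseBraid lo hi (w₁ ++ (v ++ w₂)) =
      outside lo hi v.length w₁ w₂ ∪ layers lo hi w₁.length v := by
  rw [sparseBraid, layers_append, layers_append, outside]
  simp only [List.length_append, zero_add, Nat.add_assoc]
  ac_rfl

theorem Fits.append {lo hi : ℕ} {w v : List (Option (ℕ × Bool))} :
    Fits lo hi (w ++ v) ↔ Fits lo hi w ∧ Fits lo hi v := by
  constructor
  · exact fun h => ⟨fun a ha => h a (List.mem_append_left _ ha),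
      fun a ha => h a (List.mem_append_right _ ha)⟩
  · rintro ⟨h, h'⟩ a ha
    exact (List.mem_append.1 ha).elim (h a) (h' a)

theorem verticals_split {lo hi i : ℕ} (k : ℕ) (h : lo ≤ i) (h' : i + 1 < hi) :
    verticals lo hi k (fun _ => True) =
      verticals lo hi k (fun j => j ≠ i ∧ j ≠ i + 1) ∪ (vertical i k ∪ vertical (i + 1) k) := by
  ext p
  simp only [verticals, mem_union, mem_ofPred]
  constructor
  · rintro ⟨j, h1, h2, -, h3⟩
    by_cases hj : j = i
    · subst hj; exact Or.inr (Or.inl h3)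
    · by_cases hj' : j = i + 1
      · subst hj'; exact Or.inr (Or.inr h3)
      · exact Or.inl ⟨j, h1, h2, ⟨hj, hj'⟩, h3⟩
  · rintro (⟨j, h1, h2, -, h3⟩ | h3 | h3)
    · exact ⟨j, h1, h2, trivial, h3⟩
    · exact ⟨i, h, by omega, trivial, h3⟩
    · exact ⟨i + 1, by omega, h', trivial, h3⟩

theorem eq_or_eq_of_cast {i j : ℕ} (h : (i : ℝ) ≤ j) (h' : (j : ℝ) ≤ i + 1) : j = i ∨ j = i + 1 := by
  have h1 : i ≤ j := by exact_mod_cast h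
  have h2 : j ≤ i + 1 := by exact_mod_cast h'
  omega

theorem isotopic_swap {lo hi : ℕ} {w₁ w₂ : List (Option (ℕ × Bool))} {a : ℕ × Bool}
    (h₁ : Fits lo hi w₁) (ha : lo ≤ a.1 ∧ a.1 + 1 < hi) (h₂ : Fits lo hi w₂) :
    Isotopic (sparseBraid lo hi (w₁ ++ none :: some a :: w₂))
      (sparseBraid lo hi (w₁ ++ some a :: none :: w₂)) := by
  obtain ⟨i, s⟩ := a
  have e1 := sparseBraid_append lo hi w₁ [none, some (i, s)] w₂
  have e2 := sparseBraid_append lo hi w₁ [some (i, s), none] w₂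
  simp only [List.cons_append, List.nil_append, List.length_cons, List.length_nil, zero_add] at e1 e2
  rw [e1, e2]
  simp only [layers, layer, union_empty]
  set k := w₁.length with hk
  rw [verticals_split k ha.1 ha.2, verticals_split (k + 1) ha.1 ha.2]
  have hσ : (if s then (1 : ℝ) else -1) = 1 ∨ (if s then (1 : ℝ) else -1) = -1 := by
    cases s <;> simp
  have key := isotopic_lower_crossing (x := (i : ℝ)) (y := (k : ℝ)) (O := outside lo hi 2 w₁ w₂ ∪
    (verticals lo hi k (fun j => j ≠ i ∧ j ≠ i + 1) ∪
      verticals lo hi (k + 1) (fun j => j ≠ i ∧ j ≠ i + 1))) hσ ?_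
  · simp only [vertical, crossing, crest] at key ⊢
    push_cast at key ⊢
    have r1 : (k : ℝ) + 1 + 1 = k + 2 := by ring
    have r2 : (k : ℝ) + 1 + 1 / 2 = k + 3 / 2 := by ring
    simp only [r1, r2] at key ⊢
    convert key using 1 <;> (ext; simp only [mem_union]; tauto)
  · intro p hp x0 x1 y0 y1 z0 z1
    rcases hp with hp | ⟨j, -, -, hj, hp⟩ | ⟨j, -, -, hj, hp⟩
    · rcases outside_bounds h₁ h₂ hp y0 (by push_cast; exact y1) z0 with ⟨j, -, -, rfl⟩ | ⟨j, -, -, rfl⟩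
      · simp only [Matrix.cons_val] at x0 x1
        left
        rcases eq_or_eq_of_cast x0 x1 with rfl | rfl
        · left; rfl
        · right; push_cast; rfl
      · simp only [Matrix.cons_val] at x0 x1
        right
        rcases eq_or_eq_of_cast x0 x1 with rfl | rfl
        · left; rfl
        · right; push_cast; rfl
    all_goals
      rw [(mem_vertical.1 hp).1] at x0 x1
      rcases eq_or_eq_of_cast x0 x1 with h | h
      · exact absurd h hj.1
      · exact absurd h hj.2

/-- The closing arcs of a braid with an empty last layer, after the first `m` strands of that
layer have been absorbed. -/
def partialClosing (lo hi c m : ℕ) : Set Point :=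
  {p | ∃ j, lo ≤ j ∧ j < hi ∧ ((j < m ∧ p ∈ closingArc c j) ∨
    (m ≤ j ∧ p ∈ vertical j c ∪ closingArc (c + 1) j))}

theorem isotopic_absorb_strand {lo hi m : ℕ} {w : List (Option (ℕ × Bool))} (hw : Fits lo hi w)
    (h1 : lo ≤ m) (h2 : m < hi) :
    Isotopic (layers lo hi 0 w ∪ partialClosing lo hi w.length m)
      (layers lo hi 0 w ∪ partialClosing lo hi w.length (m + 1)) := by
  set c := w.length with hc
  let D : Set Point := {p | ∃ j, lo ≤ j ∧ j < hi ∧ j ≠ m ∧ ((j < m ∧ p ∈ closingArc c j) ∨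
    (m ≤ j ∧ p ∈ vertical j c ∪ closingArc (c + 1) j))}
  have e1 : partialClosing lo hi c m = D ∪ (vertical m c ∪ closingArc (c + 1) m) := by
    ext p
    constructor
    · rintro ⟨j, a, b, h⟩
      by_cases hj : j = m
      · subst hj
        rcases h with h | h
        · omega
        · exact Or.inr h.2
      · exact Or.inl ⟨j, a, b, hj, h⟩
    · rintro (⟨j, a, b, -, h⟩ | h)
      · exact ⟨j, a, b, h⟩
      · exact ⟨m, h1, h2, Or.inr ⟨le_rfl, h⟩⟩
  have e2 : partialClosing lo hi c (m + 1) = D ∪ closingArc c m := by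
    ext p
    constructor
    · rintro ⟨j, a, b, h⟩
      by_cases hj : j = m
      · subst hj
        rcases h with h | h
        · exact Or.inr h.2
        · omega
      · exact Or.inl ⟨j, a, b, hj, h.imp (fun h => ⟨by omega, h.2⟩) fun h => ⟨by omega, h.2⟩⟩
    · rintro (⟨j, a, b, hj, h⟩ | h)
      · exact ⟨j, a, b, h.imp (fun h => ⟨by omega, h.2⟩) fun h => ⟨by omega, h.2⟩⟩
      · exact ⟨m, h1, h2, Or.inl ⟨by omega, h⟩⟩
  rw [e1, e2]
  have hc0 : (0 : ℝ) ≤ c := Nat.cast_nonneg _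
  have key := isotopic_absorb (x := (m : ℝ)) (y := (c : ℝ)) (O := layers lo hi 0 w ∪ (D ∪
    segment ℝ ![(m : ℝ), -1, -2] ![(m : ℝ), 0, 0])) hc0 ?_
  · simp only [vertical, closingArc]
    push_cast
    convert key using 1 <;> (ext; simp only [mem_union]; tauto)
  · intro p hp x0 y0
    rcases hp with hp | ⟨j, -, -, hj, h⟩ | hp
    · obtain ⟨-, a1, -, -, a2⟩ := layers_bounds hw hp
      rw [zero_add] at a1 a2
      obtain ⟨j, -, -, rfl⟩ := a2 (le_antisymm a1.2 y0)
      simp only [Matrix.cons_val] at x0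
      rw [x0]
    · exfalso
      have : p 0 = j := by
        rcases h with ⟨-, h⟩ | ⟨-, h | h⟩
        · exact (closingArc_bounds h).1
        · exact (mem_vertical.1 h).1
        · exact (closingArc_bounds h).1
      rw [this] at x0
      exact hj (by exact_mod_cast x0)
    · obtain ⟨t, t0, t1, f0, f1, f2⟩ := mem_seg.1 hp
      exact point_ext x0 (by linarith) (by linarith)

theorem isotopic_remove_last {lo hi : ℕ} {w : List (Option (ℕ × Bool))} (hw : Fits lo hi w)
    (h : lo ≤ hi) : Isotopic (sparseBraid lo hi (w ++ [none])) (sparseBraid lo hi w) := by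
  have e1 : sparseBraid lo hi (w ++ [none]) =
      layers lo hi 0 w ∪ partialClosing lo hi w.length lo := by
    rw [sparseBraid, layers_append, List.length_append, List.length_singleton]
    simp only [layers, layer, union_empty, zero_add]
    rw [union_assoc]
    congr 1
    ext p
    simp only [verticals, closing, partialClosing, mem_union, mem_ofPred]
    constructor
    · rintro (⟨j, a, b, -, hp⟩ | ⟨j, a, b, hp⟩)
      · exact ⟨j, a, b, Or.inr ⟨a, Or.inl hp⟩⟩
      · exact ⟨j, a, b, Or.inr ⟨a, Or.inr hp⟩⟩
    · rintro ⟨j, a, b, ⟨c, hp⟩ | ⟨-, hp | hp⟩⟩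
      · omega
      · exact Or.inl ⟨j, a, b, trivial, hp⟩
      · exact Or.inr ⟨j, a, b, hp⟩
  have e2 : sparseBraid lo hi w = layers lo hi 0 w ∪ partialClosing lo hi w.length hi := by
    rw [sparseBraid]
    congr 1
    ext p
    simp only [closing, partialClosing, mem_ofPred]
    constructor
    · rintro ⟨j, a, b, hp⟩
      exact ⟨j, a, b, Or.inl ⟨b, hp⟩⟩
    · rintro ⟨j, a, b, ⟨c, hp⟩ | ⟨c, -⟩⟩
      · exact ⟨j, a, b, hp⟩
      · omega
  rw [e1, e2]
  have : ∀ m, lo ≤ m → m ≤ hi → Isotopic (layers lo hi 0 w ∪ partialClosing lo hi w.length lo)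
      (layers lo hi 0 w ∪ partialClosing lo hi w.length m) := by
    intro m hm
    induction m, hm using Nat.le_induction with
    | base => exact fun _ => Isotopic.refl _
    | succ m hm ih => exact fun h' => (ih (by omega)).trans (isotopic_absorb_strand hw hm (by omega))
  exact this hi h le_rfl

theorem isotopic_remove_none {lo hi : ℕ} (h : lo ≤ hi) {w₁ w₂ : List (Option (ℕ × Bool))}
    (h₁ : Fits lo hi w₁) (h₂ : Fits lo hi w₂) :
    Isotopic (sparseBraid lo hi (w₁ ++ none :: w₂)) (sparseBraid lo hi (w₁ ++ w₂)) := by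
  induction w₂ generalizing w₁ with
  | nil =>
    rw [List.append_nil]
    exact isotopic_remove_last h₁ h
  | cons o w₂ ih =>
    obtain ⟨ho, h₃⟩ := h₂.of_cons
    have hf : Fits lo hi (w₁ ++ [o]) :=
      Fits.append.2 ⟨h₁, fun a ha => ho a (List.mem_singleton.1 ha).symm⟩
    have := ih hf h₃
    simp only [List.append_assoc, List.cons_append, List.nil_append] at this
    refine Isotopic.trans ?_ this
    cases o with
    | none => exact Isotopic.refl _
    | some a => exact isotopic_swap h₁ (ho a rfl) h₃

/-- Empty layers can be removed. -/
theorem isotopic_reduceOption {lo hi : ℕ} (h : lo ≤ hi) {w₁ w₂ : List (Option (ℕ × Bool))}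
    (h₁ : Fits lo hi w₁) (h₂ : Fits lo hi w₂) :
    Isotopic (sparseBraid lo hi (w₁ ++ w₂)) (sparseBraid lo hi (w₁ ++ w₂.reduceOption.map some)) := by
  induction w₂ generalizing w₁ with
  | nil => exact Isotopic.refl _
  | cons o w₂ ih =>
    obtain ⟨ho, h₃⟩ := h₂.of_cons
    cases o with
    | none =>
      rw [List.reduceOption_cons_of_none]
      exact (isotopic_remove_none h h₁ h₃).trans (ih h₁ h₃)
    | some a =>
      rw [List.reduceOption_cons_of_some]
      have hf : Fits lo hi (w₁ ++ [some a]) :=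
        Fits.append.2 ⟨h₁, fun b hb => ho b (List.mem_singleton.1 hb).symm⟩
      simpa using ih hf h₃

/-! ### Cutting a closed braid at a generator that is used only once -/

/-- The word without the letters that do not satisfy `f`. -/
def restrict (f : ℕ → Bool) (w : List (Option (ℕ × Bool))) : List (Option (ℕ × Bool)) :=
  w.map fun o => o.filter fun a => f a.1

theorem restrict_length (f : ℕ → Bool) (w : List (Option (ℕ × Bool))) :
    (restrict f w).length = w.length := List.length_map _

theorem mem_restrict {f : ℕ → Bool} {w : List (Option (ℕ × Bool))} {a : ℕ × Bool}
    (h : some a ∈ restrict f w) : some a ∈ w ∧ f a.1 = true := by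
  obtain ⟨o, ho, he⟩ := List.mem_map.1 h
  rw [Option.filter_eq_some_iff] at he
  exact ⟨he.1 ▸ ho, he.2⟩

theorem Fits.restrict_left {lo hi i : ℕ} {w : List (Option (ℕ × Bool))} (h : Fits lo hi w) :
    Fits lo (i + 1) (restrict (fun a => decide (a < i)) w) := by
  intro a ha
  obtain ⟨h1, h2⟩ := mem_restrict ha
  have := of_decide_eq_true h2
  exact ⟨(h a h1).1, by omega⟩

theorem Fits.restrict_right {lo hi i : ℕ} {w : List (Option (ℕ × Bool))} (h : Fits lo hi w) :
    Fits (i + 1) hi (restrict (fun a => decide (i < a)) w) := by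
  intro a ha
  obtain ⟨h1, h2⟩ := mem_restrict ha
  have := of_decide_eq_true h2
  exact ⟨by omega, (h a h1).2⟩

theorem verticals_union {lo hi i k : ℕ} (h1 : lo ≤ i + 1) (h2 : i < hi) (P : ℕ → Prop) :
    verticals lo hi k P = verticals lo (i + 1) k P ∪ verticals (i + 1) hi k P := by
  ext p
  simp only [verticals, mem_union, mem_ofPred]
  constructor
  · rintro ⟨j, a, b, c, d⟩
    by_cases hj : j < i + 1
    · exact Or.inl ⟨j, a, hj, c, d⟩
    · exact Or.inr ⟨j, by omega, b, c, d⟩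
  · rintro (⟨j, a, b, c, d⟩ | ⟨j, a, b, c, d⟩)
    · exact ⟨j, a, by omega, c, d⟩
    · exact ⟨j, by omega, b, c, d⟩

theorem closing_union {lo hi i c : ℕ} (h1 : lo ≤ i + 1) (h2 : i < hi) :
    closing lo hi c = closing lo (i + 1) c ∪ closing (i + 1) hi c := by
  ext p
  simp only [closing, mem_union, mem_ofPred]
  constructor
  · rintro ⟨j, a, b, d⟩
    by_cases hj : j < i + 1
    · exact Or.inl ⟨j, a, hj, d⟩
    · exact Or.inr ⟨j, by omega, b, d⟩
  · rintro (⟨j, a, b, d⟩ | ⟨j, a, b, d⟩)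
    · exact ⟨j, a, by omega, d⟩
    · exact ⟨j, by omega, b, d⟩

theorem verticals_congr {lo hi k : ℕ} {P Q : ℕ → Prop} (h : ∀ j, lo ≤ j → j < hi → (P j ↔ Q j)) :
    verticals lo hi k P = verticals lo hi k Q := by
  ext p
  simp only [verticals, mem_ofPred]
  exact exists_congr fun j => and_congr_right fun a => and_congr_right fun b =>
    and_congr_left fun _ => h j a b

theorem layer_cut {lo hi i k : ℕ} {o : Option (ℕ × Bool)} (h1 : lo ≤ i + 1) (h2 : i < hi)
    (ho : ∀ a, o = some a → a.1 ≠ i) :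
    layer lo hi k o = layer lo (i + 1) k (o.filter fun a => decide (a.1 < i)) ∪
      layer (i + 1) hi k (o.filter fun a => decide (i < a.1)) := by
  cases o with
  | none => exact verticals_union h1 h2 _
  | some a =>
    have hne := ho a rfl
    rcases lt_or_gt_of_ne hne with h | h
    · have h' : ¬ i < a.1 := by omega
      simp only [Option.filter_some, h, h', decide_true, decide_false, if_true, Bool.false_eq_true,
        if_false, layer]
      rw [verticals_union h1 h2, union_assoc]
      congr 2
      exact verticals_congr fun j hj _ => by simp only [iff_true]; omega
    · have h' : ¬ a.1 < i := by omega
      simp only [Option.filter_some, h, h', decide_true, decide_false, if_true, Bool.false_eq_true,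
        if_false, layer]
      rw [verticals_union h1 h2, union_left_comm]
      congr 1
      exact verticals_congr fun j _ hj => by simp only [iff_true]; omega

theorem layers_cut {lo hi i : ℕ} (h1 : lo ≤ i + 1) (h2 : i < hi) (k : ℕ)
    {w : List (Option (ℕ × Bool))} (hw : ∀ a, some a ∈ w → a.1 ≠ i) :
    layers lo hi k w = layers lo (i + 1) k (restrict (fun a => decide (a < i)) w) ∪
      layers (i + 1) hi k (restrict (fun a => decide (i < a)) w) := by
  induction w generalizing k with
  | nil => simp [layers, restrict]
  | cons o w ih =>
    have e := ih (k + 1) fun a ha => hw a (List.mem_cons_of_mem _ ha)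
    simp only [restrict, List.map_cons, layers] at e ⊢
    rw [e, layer_cut h1 h2 (fun a ha => hw a (by simp [ha]))]
    ac_rfl

theorem outside_cut {lo hi i l : ℕ} (h1 : lo ≤ i + 1) (h2 : i < hi)
    {w₁ w₂ : List (Option (ℕ × Bool))} (hw₁ : ∀ a, some a ∈ w₁ → a.1 ≠ i)
    (hw₂ : ∀ a, some a ∈ w₂ → a.1 ≠ i) :
    outside lo hi l w₁ w₂ =
      outside lo (i + 1) l (restrict (fun a => decide (a < i)) w₁)
        (restrict (fun a => decide (a < i)) w₂) ∪
      outside (i + 1) hi l (restrict (fun a => decide (i < a)) w₁)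
        (restrict (fun a => decide (i < a)) w₂) := by
  simp only [outside, restrict_length]
  rw [layers_cut h1 h2 _ hw₁, layers_cut h1 h2 _ hw₂, closing_union h1 h2]
  ac_rfl

/-- The part of a closed braid on the left of a crossing. -/
def leftPart (lo i : ℕ) (s : Bool) (w₁ w₂ : List (Option (ℕ × Bool))) : Set Point :=
  outside lo (i + 1) 1 w₁ w₂ ∪ verticals lo (i + 1) w₁.length (fun j => j ≠ i) ∪
    (segment ℝ ![(i : ℝ), (w₁.length : ℝ), 0] (crest i w₁.length s) ∪
      segment ℝ ![(i : ℝ) + 1 / 2, (w₁.length : ℝ) + 1 / 2, 0] ![(i : ℝ), (w₁.length : ℝ) + 1, 0])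

/-- The part of a closed braid on the right of a crossing. -/
def rightPart (hi i : ℕ) (s : Bool) (w₁ w₂ : List (Option (ℕ × Bool))) : Set Point :=
  outside (i + 1) hi 1 w₁ w₂ ∪ verticals (i + 1) hi w₁.length (fun j => j ≠ i + 1) ∪
    (segment ℝ (crest i w₁.length s) ![(i : ℝ) + 1, (w₁.length : ℝ) + 1, 0] ∪
      segment ℝ ![(i : ℝ) + 1, (w₁.length : ℝ), 0]
        ![(i : ℝ) + 1 / 2, (w₁.length : ℝ) + 1 / 2, 0])

theorem sparseBraid_cut {lo hi i : ℕ} (s : Bool) (h1 : lo ≤ i) (h2 : i < hi)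
    {w₁ w₂ : List (Option (ℕ × Bool))} (hw₁ : ∀ a, some a ∈ w₁ → a.1 ≠ i)
    (hw₂ : ∀ a, some a ∈ w₂ → a.1 ≠ i) :
    sparseBraid lo hi (w₁ ++ some (i, s) :: w₂) =
      leftPart lo i s (restrict (fun a => decide (a < i)) w₁)
        (restrict (fun a => decide (a < i)) w₂) ∪
      rightPart hi i s (restrict (fun a => decide (i < a)) w₁)
        (restrict (fun a => decide (i < a)) w₂) := by
  have e1 := sparseBraid_append lo hi w₁ [some (i, s)] w₂
  simp only [List.cons_append, List.nil_append, List.length_singleton, layers, layer,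
    union_empty] at e1
  rw [e1, outside_cut (h1.trans (Nat.le_succ i)) h2 hw₁ hw₂, verticals_union (h1.trans (Nat.le_succ i)) h2]
  simp only [leftPart, rightPart, restrict_length]
  have e2 : verticals lo (i + 1) w₁.length (fun j => j ≠ i ∧ j ≠ i + 1) =
      verticals lo (i + 1) w₁.length (fun j => j ≠ i) :=
    verticals_congr fun j _ hj => by omega
  have e3 : verticals (i + 1) hi w₁.length (fun j => j ≠ i ∧ j ≠ i + 1) =
      verticals (i + 1) hi w₁.length (fun j => j ≠ i + 1) :=
    verticals_congr fun j hj _ => by omega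
  have e4 : (![(i : ℝ) + 1 / 2, (w₁.length : ℝ) + 1 / 2, 0] : Point) ∈
      segment ℝ ![(i : ℝ) + 1, (w₁.length : ℝ), 0] ![(i : ℝ), (w₁.length : ℝ) + 1, 0] :=
    mem_seg.2 ⟨1 / 2, by norm_num, by norm_num, by simp; ring, by simp, by simp⟩
  rw [e2, e3, crossing, ← segment_union_segment e4]
  ext; simp only [mem_union]; tauto

theorem outside_left_right {lo hi l : ℕ} {w₁ w₂ : List (Option (ℕ × Bool))} (h₁ : Fits lo hi w₁)
    (h₂ : Fits lo hi w₂) {p : Point} (h : p ∈ outside lo hi l w₁ w₂) :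
    (lo : ℝ) ≤ p 0 ∧ p 0 + 1 ≤ hi := by
  rcases h with (h | h) | ⟨j, a, b, h⟩
  · exact (layers_bounds h₁ h).1
  · exact (layers_bounds h₂ h).1
  · rw [(closingArc_bounds h).1]
    exact ⟨by exact_mod_cast a, by exact_mod_cast b⟩

theorem verticals_left_right {lo hi k : ℕ} {P : ℕ → Prop} {p : Point}
    (h : p ∈ verticals lo hi k P) : (lo : ℝ) ≤ p 0 ∧ p 0 + 1 ≤ hi := by
  obtain ⟨j, a, b, -, h⟩ := h
  rw [(mem_vertical.1 h).1]
  exact ⟨by exact_mod_cast a, by exact_mod_cast b⟩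

theorem leftPart_bounds {lo i : ℕ} {s : Bool} {w₁ w₂ : List (Option (ℕ × Bool))}
    (h₁ : Fits lo (i + 1) w₁) (h₂ : Fits lo (i + 1) w₂) {p : Point} (h : p ∈ leftPart lo i s w₁ w₂) :
    p 0 < i + 1 / 2 ∨ p = crest i w₁.length s ∨
      p = ![(i : ℝ) + 1 / 2, (w₁.length : ℝ) + 1 / 2, 0] := by
  rcases h with (h | h) | h | h
  · have := outside_left_right h₁ h₂ h
    push_cast at this
    left; linarith
  · have := verticals_left_right h
    push_cast at this
    left; linarith
  · obtain ⟨t, t0, t1, f0, f1, f2⟩ := mem_seg.1 h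
    rcases eq_or_lt_of_le t1 with rfl | t1
    · exact Or.inr (Or.inl (point_ext (by linarith) (by linarith) (by linarith)))
    · left; linarith
  · obtain ⟨t, t0, t1, f0, f1, f2⟩ := mem_seg.1 h
    rcases eq_or_lt_of_le t0 with rfl | t0
    · exact Or.inr (Or.inr (point_ext (by linarith) (by linarith) (by linarith)))
    · left; linarith

theorem rightPart_bounds {hi i : ℕ} {s : Bool} {w₁ w₂ : List (Option (ℕ × Bool))}
    (h₁ : Fits (i + 1) hi w₁) (h₂ : Fits (i + 1) hi w₂) {p : Point}
    (h : p ∈ rightPart hi i s w₁ w₂) :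
    (i : ℝ) + 1 / 2 < p 0 ∨ p = crest i w₁.length s ∨
      p = ![(i : ℝ) + 1 / 2, (w₁.length : ℝ) + 1 / 2, 0] := by
  rcases h with (h | h) | h | h
  · have := outside_left_right h₁ h₂ h
    push_cast at this
    left; linarith
  · have := verticals_left_right h
    push_cast at this
    left; linarith
  · obtain ⟨t, t0, t1, f0, f1, f2⟩ := mem_seg.1 h
    rcases eq_or_lt_of_le t0 with rfl | t0
    · exact Or.inr (Or.inl (point_ext (by linarith) (by linarith) (by linarith)))
    · left; linarith
  · obtain ⟨t, t0, t1, f0, f1, f2⟩ := mem_seg.1 h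
    rcases eq_or_lt_of_le t1 with rfl | t1
    · exact Or.inr (Or.inr (point_ext (by linarith) (by linarith) (by linarith)))
    · left; linarith

theorem verticals_single {lo hi i : ℕ} (k : ℕ) (h : lo ≤ i) (h' : i < hi) :
    verticals lo hi k (fun _ => True) = verticals lo hi k (fun j => j ≠ i) ∪ vertical i k := by
  ext p
  simp only [verticals, mem_union, mem_ofPred]
  constructor
  · rintro ⟨j, h1, h2, -, h3⟩
    by_cases hj : j = i
    · subst hj; exact Or.inr h3
    · exact Or.inl ⟨j, h1, h2, hj, h3⟩
  · rintro (⟨j, h1, h2, -, h3⟩ | h3)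
    · exact ⟨j, h1, h2, trivial, h3⟩
    · exact ⟨i, h, h', trivial, h3⟩

theorem sparseBraid_none {lo hi i : ℕ} (h : lo ≤ i) (h' : i < hi)
    (w₁ w₂ : List (Option (ℕ × Bool))) : sparseBraid lo hi (w₁ ++ none :: w₂) =
      outside lo hi 1 w₁ w₂ ∪ verticals lo hi w₁.length (fun j => j ≠ i) ∪ vertical i w₁.length := by
  have e1 := sparseBraid_append lo hi w₁ [none] w₂
  simp only [List.cons_append, List.nil_append, List.length_singleton, layers, layer,
    union_empty] at e1
  rw [e1, verticals_single _ h h', union_assoc]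

theorem eq_of_cast_near {i j : ℕ} (h : |(j : ℝ) - i| ≤ 1 / 2) : j = i := by
  obtain ⟨h1, h2⟩ := abs_le.1 h
  have h3 : (j : ℝ) < i + 1 := by linarith
  have h4 : (i : ℝ) < j + 1 := by linarith
  have h5 : j < i + 1 := by exact_mod_cast h3
  have h6 : i < j + 1 := by exact_mod_cast h4
  omega

theorem near_bounds {lo hi i : ℕ} {w₁ w₂ : List (Option (ℕ × Bool))} (h₁ : Fits lo hi w₁)
    (h₂ : Fits lo hi w₂) {p : Point}
    (h : p ∈ outside lo hi 1 w₁ w₂ ∪ verticals lo hi w₁.length (fun j => j ≠ i))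
    (h0 : |p 0 - i| ≤ 1 / 2) (h1 : |p 1 - (w₁.length + 1 / 2)| ≤ 1 / 2) (h2 : |p 2| ≤ 1) :
    p = ![(i : ℝ), (w₁.length : ℝ), 0] ∨ p = ![(i : ℝ), (w₁.length : ℝ) + 1, 0] := by
  have h1' := abs_le.1 h1
  have h2' := abs_le.1 h2
  rcases h with h | ⟨j, -, -, hj, h⟩
  · rcases outside_bounds h₁ h₂ h (by linarith) (by push_cast; linarith) h2'.1 with
      ⟨j, -, -, rfl⟩ | ⟨j, -, -, rfl⟩
    · have e : j = i := eq_of_cast_near (by simpa using h0)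
      exact Or.inl (by rw [e])
    · have e : j = i := eq_of_cast_near (by simpa using h0)
      exact Or.inr (by rw [e]; simp)
  · rw [(mem_vertical.1 h).1] at h0
    exact absurd (eq_of_cast_near h0) hj

theorem isotopic_leftPart {lo i : ℕ} (s : Bool) {w₁ w₂ : List (Option (ℕ × Bool))} (h : lo ≤ i)
    (h₁ : Fits lo (i + 1) w₁) (h₂ : Fits lo (i + 1) w₂) :
    Isotopic (leftPart lo i s w₁ w₂ ∪ segment ℝ (crest i w₁.length s)
      ![(i : ℝ) + 1 / 2, (w₁.length : ℝ) + 1 / 2, 0])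
      (sparseBraid lo (i + 1) ((w₁ ++ w₂).reduceOption.map some)) := by
  have hf : Fits lo (i + 1) (w₁ ++ w₂) := Fits.append.2 ⟨h₁, h₂⟩
  have hle : lo ≤ i + 1 := by omega
  have r1 := isotopic_reduceOption hle (w₁ := []) (fun a ha => by simp at ha) hf
  have r2 := isotopic_remove_none hle h₁ h₂
  refine Isotopic.trans ?_ (r2.trans r1)
  rw [sparseBraid_none h (Nat.lt_succ_self i)]
  have hσ : (if s then (1 : ℝ) else -1) = 1 ∨ (if s then (1 : ℝ) else -1) = -1 := by
    cases s <;> simp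
  have key := isotopic_straighten (x := (i : ℝ)) (y := (w₁.length : ℝ) + 1 / 2) (δ := 1 / 2)
    (O := outside lo (i + 1) 1 w₁ w₂ ∪ verticals lo (i + 1) w₁.length (fun j => j ≠ i)) hσ
    (Or.inl rfl)
  have r3 : (w₁.length : ℝ) + 1 / 2 - 1 / 2 = w₁.length := by ring
  have r4 : (w₁.length : ℝ) + 1 / 2 + 1 / 2 = w₁.length + 1 := by ring
  simp only [r3, r4] at key
  have key := key fun p hp h0 h1 h2 => near_bounds h₁ h₂ hp h0 h1 h2
  simp only [leftPart, vertical, crest]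
  convert key using 1
  ext; simp only [mem_union]; tauto

theorem isotopic_rightPart {hi i : ℕ} (s : Bool) {w₁ w₂ : List (Option (ℕ × Bool))} (h : i + 1 < hi)
    (h₁ : Fits (i + 1) hi w₁) (h₂ : Fits (i + 1) hi w₂) :
    Isotopic (rightPart hi i s w₁ w₂ ∪ segment ℝ (crest i w₁.length s)
      ![(i : ℝ) + 1 / 2, (w₁.length : ℝ) + 1 / 2, 0])
      (sparseBraid (i + 1) hi ((w₁ ++ w₂).reduceOption.map some)) := by
  have hf : Fits (i + 1) hi (w₁ ++ w₂) := Fits.append.2 ⟨h₁, h₂⟩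
  have r1 := isotopic_reduceOption h.le (w₁ := []) (fun a ha => by simp at ha) hf
  have r2 := isotopic_remove_none h.le h₁ h₂
  refine Isotopic.trans ?_ (r2.trans r1)
  rw [sparseBraid_none le_rfl h]
  have hσ : (if s then (1 : ℝ) else -1) = 1 ∨ (if s then (1 : ℝ) else -1) = -1 := by
    cases s <;> simp
  have key := isotopic_straighten (x := (i : ℝ) + 1) (y := (w₁.length : ℝ) + 1 / 2) (δ := -1 / 2)
    (O := outside (i + 1) hi 1 w₁ w₂ ∪ verticals (i + 1) hi w₁.length (fun j => j ≠ i + 1)) hσ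
    (Or.inr rfl)
  have r3 : (w₁.length : ℝ) + 1 / 2 - -1 / 2 = w₁.length + 1 := by ring
  have r4 : (w₁.length : ℝ) + 1 / 2 + -1 / 2 = w₁.length := by ring
  have r5 : (i : ℝ) + 1 + -1 / 2 = i + 1 / 2 := by ring
  simp only [r3, r4, r5] at key
  have key := key fun p hp h0 h1 h2 =>
    (near_bounds (i := i + 1) h₁ h₂ hp (by push_cast; exact h0) h1 h2).symm.imp
      (fun h => by rw [h]; push_cast; rfl) (fun h => by rw [h]; push_cast; rfl)
  simp only [rightPart, vertical, crest]
  push_cast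
  rw [segment_symm ℝ ![(i : ℝ) + 1, (w₁.length : ℝ) + 1, 0],
    segment_symm ℝ ![(i : ℝ) + 1 / 2, (w₁.length : ℝ) + 1 / 2, 0],
    segment_symm ℝ ![(i : ℝ) + 1, (w₁.length : ℝ) + 1, 0]] at key
  convert key using 1
  ext; simp only [mem_union]; tauto

/-! ### Translation of braids -/

/-- The word with all letters moved to the right. -/
def shiftWord (d : ℕ) (w : List (Option (ℕ × Bool))) : List (Option (ℕ × Bool)) :=
  w.map fun o => o.map fun a => (a.1 + d, a.2)

theorem image_shift_segment (d x y z x' y' z' : ℝ) :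
    (fun p : Point => p + ![d, 0, 0]) '' segment ℝ ![x, y, z] ![x', y', z'] =
      segment ℝ ![x + d, y, z] ![x' + d, y', z'] := by
  have := image_segment ℝ (AffineMap.id ℝ Point + AffineMap.const ℝ Point (![d, 0, 0] : Point))
    ![x, y, z] ![x', y', z']
  have e1 : ∀ a b c : ℝ, (![a, b, c] : Point) + ![d, 0, 0] = ![a + d, b, c] := fun a b c => by
    ext i; fin_cases i <;> simp
  rw [← e1, ← e1]
  exact this

theorem exists_shift {lo hi d : ℕ} {P : ℕ → Prop} :
    (∃ j, lo + d ≤ j ∧ j < hi + d ∧ P j) ↔ ∃ j, lo ≤ j ∧ j < hi ∧ P (j + d) := by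
  constructor
  · rintro ⟨j, a, b, h⟩
    exact ⟨j - d, by omega, by omega, by rwa [Nat.sub_add_cancel (by omega)]⟩
  · rintro ⟨j, a, b, h⟩
    exact ⟨j + d, by omega, by omega, h⟩

theorem vertical_shift (j d k : ℕ) :
    vertical (j + d) k = (fun p : Point => p + ![(d : ℝ), 0, 0]) '' vertical j k := by
  rw [vertical, vertical, image_shift_segment]
  push_cast; rfl

theorem closingArc_shift (c j d : ℕ) :
    closingArc c (j + d) = (fun p : Point => p + ![(d : ℝ), 0, 0]) '' closingArc c j := by
  rw [closingArc, closingArc, image_union, image_union, image_shift_segment, image_shift_segment,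
    image_shift_segment]
  push_cast; rfl

theorem crossing_shift (i d k : ℕ) (s : Bool) :
    crossing (i + d) k s = (fun p : Point => p + ![(d : ℝ), 0, 0]) '' crossing i k s := by
  rw [crossing, crossing, image_union, image_union, crest, crest, image_shift_segment,
    image_shift_segment, image_shift_segment]
  push_cast
  simp only [add_right_comm]

theorem verticals_shift (lo hi d k : ℕ) (P : ℕ → Prop) : verticals (lo + d) (hi + d) k P =
    (fun p : Point => p + ![(d : ℝ), 0, 0]) '' verticals lo hi k (fun j => P (j + d)) := by
  ext q
  simp only [verticals, mem_ofPred]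
  rw [exists_shift (P := fun j => P j ∧ q ∈ vertical j k)]
  constructor
  · rintro ⟨j, a, b, c, h⟩
    rw [vertical_shift] at h
    obtain ⟨p, hp, rfl⟩ := h
    exact ⟨p, ⟨j, a, b, c, hp⟩, rfl⟩
  · rintro ⟨p, ⟨j, a, b, c, h⟩, rfl⟩
    refine ⟨j, a, b, c, ?_⟩
    rw [vertical_shift]
    exact ⟨p, h, rfl⟩

theorem closing_shift (lo hi d c : ℕ) : closing (lo + d) (hi + d) c =
    (fun p : Point => p + ![(d : ℝ), 0, 0]) '' closing lo hi c := by
  ext q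
  simp only [closing, mem_ofPred]
  rw [exists_shift (P := fun j => q ∈ closingArc c j)]
  constructor
  · rintro ⟨j, a, b, h⟩
    rw [closingArc_shift] at h
    obtain ⟨p, hp, rfl⟩ := h
    exact ⟨p, ⟨j, a, b, hp⟩, rfl⟩
  · rintro ⟨p, ⟨j, a, b, h⟩, rfl⟩
    refine ⟨j, a, b, ?_⟩
    rw [closingArc_shift]
    exact ⟨p, h, rfl⟩

theorem layers_shift (lo hi d k : ℕ) (w : List (Option (ℕ × Bool))) :
    layers (lo + d) (hi + d) k (shiftWord d w) =
      (fun p : Point => p + ![(d : ℝ), 0, 0]) '' layers lo hi k w := by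
  induction w generalizing k with
  | nil => simp [layers, shiftWord]
  | cons o w ih =>
    have := ih (k + 1)
    simp only [shiftWord, List.map_cons, layers, image_union] at this ⊢
    rw [this]
    congr 1
    cases o with
    | none => exact verticals_shift lo hi d k _
    | some a =>
      simp only [Option.map_some, layer, image_union]
      rw [crossing_shift, verticals_shift]
      congr 3
      funext j
      simp only [eq_iff_iff]
      omega

theorem sparseBraid_shift (lo hi d : ℕ) (w : List (Option (ℕ × Bool))) :
    sparseBraid (lo + d) (hi + d) (shiftWord d w) =
      (fun p : Point => p + ![(d : ℝ), 0, 0]) '' sparseBraid lo hi w := by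
  rw [sparseBraid, sparseBraid, image_union, layers_shift, closing_shift, shiftWord, List.length_map]

theorem IsSimple.nodup {l : List Point} (h : IsSimple l) : l.Nodup := by
  have e : (edges l).map Prod.fst = l := List.map_fst_zip (by simp)
  rw [← e, List.Nodup, List.pairwise_map]
  refine h.2.imp fun {a b} hd (he : a.1 = b.1) => Set.disjoint_left.1 hd (?_ : a.1 ∈ _) ?_
  · exact ⟨0, by simp, by simp⟩
  · exact ⟨0, by simp, by simp [he]⟩

/-! ### Loops that meet a plane in two points -/

/-- The sets `L` and `R` lie on the left and on the right of the plane `x = h`, up to the common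
points `u` and `v` on this plane. -/
structure Divided (h : ℝ) (u v : Point) (L R : Set Point) : Prop where
  left_eq : u 0 = h
  right_eq : v 0 = h
  left_bound : ∀ p ∈ L, p 0 < h ∨ p = u ∨ p = v
  right_bound : ∀ p ∈ R, h < p 0 ∨ p = u ∨ p = v

namespace Divided

variable {h : ℝ} {u v : Point} {L R : Set Point}

theorem inter_subset (hd : Divided h u v L R) : L ∩ R ⊆ {u, v} := by
  rintro p ⟨hp, hp'⟩
  rcases hd.left_bound p hp with h1 | h1
  · rcases hd.right_bound p hp' with h2 | h2
    · linarith
    · exact h2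
  · exact h1

theorem eq_of_mem_plane (hd : Divided h u v L R) {p : Point} (hp : p ∈ L ∪ R) (h0 : p 0 = h) :
    p = u ∨ p = v := by
  rcases hp with hp | hp
  · exact (hd.left_bound p hp).resolve_left (by rw [h0]; exact lt_irrefl _)
  · exact (hd.right_bound p hp).resolve_left (by rw [h0]; exact lt_irrefl _)

theorem arc_side (hd : Divided h u v L R) {S : Set Point} (hS : Arc u v S) (hSX : S ⊆ L ∪ R) :
    (∀ p ∈ S \ {u, v}, p 0 < h) ∨ ∀ p ∈ S \ {u, v}, h < p 0 := by
  have ho : IsOpen {p : Point | p 0 < h} := isOpen_lt (continuous_apply 0) continuous_const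
  have ho' : IsOpen {p : Point | h < p 0} := isOpen_lt continuous_const (continuous_apply 0)
  refine isPreconnected_iff_subset_of_disjoint.1 hS.isPreconnected_diff _ _ ho ho' ?_ ?_
  · rintro p ⟨hp, hp'⟩
    rcases lt_trichotomy (p 0) h with h1 | h1 | h1
    · exact Or.inl h1
    · exact absurd (hd.eq_of_mem_plane (hSX hp) h1) hp'
    · exact Or.inr h1
  · refine eq_empty_of_forall_notMem fun p hp => ?_
    have h1 : p 0 < h := hp.2.1
    have h2 : h < p 0 := hp.2.2
    linarith

theorem ne_of_lt (hd : Divided h u v L R) {p : Point} (hp : p 0 ≠ h) : p ∉ ({u, v} : Set Point) := by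
  rintro (rfl | rfl)
  · exact hp hd.left_eq
  · exact hp hd.right_eq

theorem arcs_of_sides (hd : Divided h u v L R) (hL : u ∈ L ∧ v ∈ L) (hR : u ∈ R ∧ v ∈ R)
    {S T : Set Point} (hS : Arc u v S) (hT : Arc v u T) (hX : L ∪ R = S ∪ T)
    (h1 : ∀ p ∈ S \ {u, v}, p 0 < h) (h2 : ∀ p ∈ T \ {u, v}, h < p 0) :
    Arc u v L ∧ Arc v u R := by
  have e1 : L = S := by
    ext p
    by_cases hp : p ∈ ({u, v} : Set Point)
    · rcases hp with rfl | rfl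
      · exact ⟨fun _ => hS.left_mem, fun _ => hL.1⟩
      · exact ⟨fun _ => hS.right_mem, fun _ => hL.2⟩
    · constructor
      · intro h3
        rcases (hX ▸ Or.inl h3 : p ∈ S ∪ T) with h4 | h4
        · exact h4
        · exact absurd (h2 p ⟨h4, hp⟩) (not_lt.2 ((hd.left_bound p h3).resolve_right hp).le)
      · intro h3
        rcases (hX ▸ Or.inl h3 : p ∈ L ∪ R) with h4 | h4
        · exact h4
        · exact absurd (h1 p ⟨h3, hp⟩) (not_lt.2 ((hd.right_bound p h4).resolve_right hp).le)
  have e2 : R = T := by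
    ext p
    by_cases hp : p ∈ ({u, v} : Set Point)
    · rcases hp with rfl | rfl
      · exact ⟨fun _ => hT.right_mem, fun _ => hR.1⟩
      · exact ⟨fun _ => hT.left_mem, fun _ => hR.2⟩
    · constructor
      · intro h3
        rcases (hX ▸ Or.inr h3 : p ∈ S ∪ T) with h4 | h4
        · exact absurd (h1 p ⟨h4, hp⟩) (not_lt.2 ((hd.right_bound p h3).resolve_right hp).le)
        · exact h4
      · intro h3
        rcases (hX ▸ Or.inr h3 : p ∈ L ∪ R) with h4 | h4
        · exact absurd (h2 p ⟨h3, hp⟩) (not_lt.2 ((hd.left_bound p h4).resolve_right hp).le)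
        · exact h4
  rw [e1, e2]
  exact ⟨hS, hT⟩

theorem arcs (hd : Divided h u v L R) (huv : u ≠ v) (hL : u ∈ L ∧ v ∈ L) (hR : u ∈ R ∧ v ∈ R)
    (hX : IsLoop (L ∪ R)) (nL : ∃ p ∈ L, p 0 < h) (nR : ∃ p ∈ R, h < p 0) :
    Arc u v L ∧ Arc v u R := by
  obtain ⟨S, T, hS, hT, -, e⟩ := hX.loopAt (Or.inl hL.1) (Or.inl hL.2) huv
  obtain ⟨x, hx, hx'⟩ := nL
  obtain ⟨y, hy, hy'⟩ := nR
  have hx2 := hd.ne_of_lt hx'.ne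
  have hy2 := hd.ne_of_lt hy'.ne'
  have hx3 : x ∈ S ∪ T := e ▸ Or.inl hx
  have hy3 : y ∈ S ∪ T := e ▸ Or.inr hy
  rcases hd.arc_side hS (e ▸ subset_union_left) with h1 | h1 <;>
    rcases hd.arc_side hT.symm (e ▸ subset_union_right) with h2 | h2
  · rcases hy3 with h3 | h3
    · linarith [h1 y ⟨h3, hy2⟩]
    · linarith [h2 y ⟨h3, hy2⟩]
  · exact hd.arcs_of_sides hL hR hS hT e h1 h2
  · exact hd.arcs_of_sides hL hR hT.symm hS.symm (by rw [e, union_comm]) h2 h1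
  · rcases hx3 with h3 | h3
    · linarith [h1 x ⟨h3, hx2⟩]
    · linarith [h2 x ⟨h3, hx2⟩]

theorem segment_eq (hd : Divided h u v L R) {p : Point} (hp : p ∈ segment ℝ u v) : p 0 = h := by
  rw [segment_param] at hp
  obtain ⟨t, -, -, rfl⟩ := hp
  simp [hd.left_eq, hd.right_eq]

theorem segment_ne_empty (huv : u ≠ v) : ∃ p ∈ segment ℝ u v, p ∉ ({u, v} : Set Point) := by
  refine ⟨midpoint ℝ u v, midpoint_mem_segment u v, ?_⟩
  rintro (h1 | h1)
  · exact huv ((midpoint_eq_left_iff ℝ).1 h1)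
  · exact huv ((midpoint_eq_right_iff ℝ).1 h1)

theorem exists_vertices (hd : Divided h u v L R) (hL : Arc u v L) (hR : Arc v u R) :
    ∃ A B : List Point, A ≠ [] ∧ (∀ a ∈ A, a 0 < h) ∧ B ≠ [] ∧ (∀ b ∈ B, h < b 0) ∧
      IsSimple (u :: A ++ v :: B) ∧ L ∪ R = polygon (u :: A ++ v :: B) ∧
      L ∪ segment ℝ u v = polygon (u :: A ++ [v]) ∧
      R ∪ segment ℝ u v = polygon (v :: B ++ [u]) := by
  obtain ⟨A, B, hs, rfl, rfl⟩ := exists_isSimple hL hR hd.inter_subset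
  obtain ⟨z, hz, hz'⟩ := segment_ne_empty hL.ne
  have hA : A ≠ [] := by
    rintro rfl
    exact hz' (hd.eq_of_mem_plane (Or.inl (by rwa [List.nil_append, path_pair])) (hd.segment_eq hz))
  have hB : B ≠ [] := by
    rintro rfl
    exact hz' (hd.eq_of_mem_plane (Or.inr (by rwa [List.nil_append, path_pair, segment_symm]))
      (hd.segment_eq hz))
  have hnd := hs.nodup
  simp only [List.nodup_cons, List.mem_append, List.mem_cons, List.nodup_append, not_or] at hnd
  obtain ⟨⟨n1, -, n3⟩, -, ⟨n4, -⟩, n5⟩ := hnd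
  refine ⟨A, B, hA, fun a ha => ?_, hB, fun b hb => ?_, hs, (polygon_append u v A B).symm,
    (polygon_close u v A).trans (by rw [segment_symm]) |>.symm, (polygon_close v u B).symm⟩
  · refine (hd.left_bound a (mem_path_of_mem (by simp [ha]))).resolve_right ?_
    rintro (rfl | rfl)
    · exact n1 ha
    · exact n5 _ ha _ (Or.inl rfl) rfl
  · refine (hd.right_bound b (mem_path_of_mem (by simp [hb]))).resolve_right ?_
    rintro (rfl | rfl)
    · exact n3 hb
    · exact n4 hb

theorem isKnot_left (hd : Divided h u v L R) (hL : Arc u v L) : IsKnot (L ∪ segment ℝ u v) := by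
  rw [isKnot_iff_isLoop]
  refine ⟨u, v, L, segment ℝ u v, hL, (Arc.seg hL.ne).symm, ?_, rfl⟩
  rintro p ⟨hp, hp'⟩
  exact hd.eq_of_mem_plane (Or.inl hp) (hd.segment_eq hp')

theorem isKnot_right (hd : Divided h u v L R) (hR : Arc v u R) : IsKnot (R ∪ segment ℝ u v) := by
  rw [isKnot_iff_isLoop]
  refine ⟨u, v, R, segment ℝ u v, hR.symm, (Arc.seg hR.ne.symm).symm, ?_, rfl⟩
  rintro p ⟨hp, hp'⟩
  exact hd.eq_of_mem_plane (Or.inr hp) (hd.segment_eq hp')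

theorem isKnot_union (hd : Divided h u v L R) (hL : Arc u v L) (hR : Arc v u R) :
    IsKnot (L ∪ R) := by
  rw [isKnot_iff_isLoop]
  exact ⟨u, v, L, R, hL, hR, hd.inter_subset, rfl⟩

theorem translate (hd : Divided h u v L R) (d : ℝ) : Divided (h + d) (u + ![d, 0, 0])
    (v + ![d, 0, 0]) ((fun p => p + ![d, 0, 0]) '' L) ((fun p => p + ![d, 0, 0]) '' R) where
  left_eq := by simp [hd.left_eq]
  right_eq := by simp [hd.right_eq]
  left_bound := by
    rintro _ ⟨p, hp, rfl⟩
    exact (hd.left_bound p hp).imp (fun h => by simpa using h)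
      (Or.imp (fun h => by rw [h]) fun h => by rw [h])
  right_bound := by
    rintro _ ⟨p, hp, rfl⟩
    exact (hd.right_bound p hp).imp (fun h => by simpa using h)
      (Or.imp (fun h => by rw [h]) fun h => by rw [h])

end Divided

theorem IsTrivial.of_isotopic {K K' : Set Point} (h : IsTrivial K) (h' : Isotopic K' K) :
    IsTrivial K' := by
  obtain ⟨a, b, c, h1, h2⟩ := h
  exact ⟨a, b, c, h1, h'.trans h2⟩

theorem arc_translate {u v : Point} {S : Set Point} (h : Arc u v S) (d : Point) :
    Arc (u + d) (v + d) ((fun p => p + d) '' S) := by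
  have hs : ∀ a b : Point, (fun p => p + d) '' segment ℝ a b = segment ℝ (a + d) (b + d) :=
    fun a b => image_segment ℝ (AffineMap.id ℝ Point + AffineMap.const ℝ Point d) a b
  induction h with
  | @seg u v h => rw [hs]; exact Arc.seg fun e => h (add_right_cancel e)
  | @cons u v w S h1 h2 h3 ih =>
    rw [image_union, hs]
    refine Arc.cons (fun e => h1 (add_right_cancel e)) ih ?_
    rw [← hs, ← image_inter (add_left_injective d)]
    exact (image_mono h3).trans (by simp)

theorem segment_translate (a b d : Point) :
    (fun p => p + d) '' segment ℝ a b = segment ℝ (a + d) (b + d) :=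
  image_segment ℝ (AffineMap.id ℝ Point + AffineMap.const ℝ Point d) a b

namespace Divided

variable {h : ℝ} {u v : Point} {L R : Set Point}

/-- A prime knot that a plane cuts in two points is isotopic to one of its two halves, closed with
a segment. The other half is trivial. -/
theorem isTrivial_or_isTrivial (hd : Divided h u v L R) (hL : Arc u v L) (hR : Arc v u R)
    {K : Set Point} (hK : IsPrimeKnot K) (hLR : Isotopic (L ∪ R) K) :
    IsTrivial (L ∪ segment ℝ u v) ∨ IsTrivial (R ∪ segment ℝ u v) := by
  have hd' := hd.translate (-h)
  rw [add_neg_cancel] at hd'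
  obtain ⟨A, B, hA, hA0, hB, hB0, hs, e1, e2, e3⟩ :=
    hd'.exists_vertices (arc_translate hL _) (arc_translate hR _)
  refine hK.2.2 _ _ (hd.isKnot_left hL) (hd.isKnot_right hR)
    ⟨_, _, A, B, hd'.left_eq, hd'.right_eq, hA, hA0, hB, hB0, hs, ?_, ?_, ?_⟩
  · rw [← e1, ← image_union]
    exact hLR.symm.trans (isotopic_translate (hd.isKnot_union hL hR) _)
  · rw [← e2, ← segment_translate, ← image_union]
    exact isotopic_translate (hd.isKnot_left hL) _
  · rw [← e3, ← segment_translate, ← image_union]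
    exact isotopic_translate (hd.isKnot_right hR) _

theorem isotopic_left (hd : Divided h u v L R) (hL : Arc u v L) (hR : Arc v u R)
    (ht : IsTrivial (R ∪ segment ℝ u v)) : Isotopic (L ∪ R) (L ∪ segment ℝ u v) := by
  have hd' := hd.translate (-h)
  rw [add_neg_cancel] at hd'
  obtain ⟨A, B, hA, hA0, hB, hB0, hs, e1, e2, e3⟩ :=
    hd'.exists_vertices (arc_translate hL _) (arc_translate hR _)
  have t1 := isotopic_translate (hd.isKnot_union hL hR) ![-h, 0, 0]
  have t2 := isotopic_translate (hd.isKnot_left hL) ![-h, 0, 0]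
  have t3 := isotopic_translate (hd.isKnot_right hR) ![-h, 0, 0]
  rw [image_union, e1] at t1
  rw [image_union, segment_translate, e2] at t2
  rw [image_union, segment_translate, e3] at t3
  exact t1.trans ((isotopic_left_of_isTrivial hd'.left_eq hd'.right_eq hA hA0 hB hB0 hs
    (ht.of_isotopic t3.symm)).trans t2.symm)

theorem isotopic_right (hd : Divided h u v L R) (hL : Arc u v L) (hR : Arc v u R)
    (ht : IsTrivial (L ∪ segment ℝ u v)) : Isotopic (L ∪ R) (R ∪ segment ℝ u v) := by
  have hd' := hd.translate (-h)
  rw [add_neg_cancel] at hd'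
  obtain ⟨A, B, hA, hA0, hB, hB0, hs, e1, e2, e3⟩ :=
    hd'.exists_vertices (arc_translate hL _) (arc_translate hR _)
  have t1 := isotopic_translate (hd.isKnot_union hL hR) ![-h, 0, 0]
  have t2 := isotopic_translate (hd.isKnot_left hL) ![-h, 0, 0]
  have t3 := isotopic_translate (hd.isKnot_right hR) ![-h, 0, 0]
  rw [image_union, e1] at t1
  rw [image_union, segment_translate, e2] at t2
  rw [image_union, segment_translate, e3] at t3
  exact t1.trans ((isotopic_right_of_isTrivial hd'.left_eq hd'.right_eq hA hA0 hB hB0 hs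
    (ht.of_isotopic t2.symm)).trans t3.symm)

end Divided

/-! ### Factors of closed braids -/

/-- The letters of a braid word, with generators indexed by natural numbers. -/
def word {n : ℕ} (β : BraidWord n) : List (ℕ × Bool) := β.map fun a => ((a.1 : ℕ), a.2)

theorem length_word {n : ℕ} (β : BraidWord n) : (word β).length = β.length := List.length_map _

theorem map_letter {n : ℕ} (β : BraidWord n) : β.map letter = (word β).map some := by
  rw [word, List.map_map]
  rfl

theorem closedBraid_word {n : ℕ} (β : BraidWord n) :
    closedBraid β = sparseBraid 0 n ((word β).map some) := by
  rw [closedBraid_eq, map_letter]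

theorem fits_map_some {lo hi : ℕ} {w : List (ℕ × Bool)} :
    Fits lo hi (w.map some) ↔ ∀ a ∈ w, lo ≤ a.1 ∧ a.1 + 1 < hi := by
  simp [Fits]

theorem fits_word {n : ℕ} (β : BraidWord n) : Fits 0 n ((word β).map some) :=
  map_letter β ▸ fits_letter β

theorem exists_word_eq {lo hi : ℕ} {w : List (ℕ × Bool)} (hw : Fits lo hi (w.map some)) :
    ∃ β : BraidWord (hi - lo), (word β).map (fun a => (a.1 + lo, a.2)) = w := by
  rw [fits_map_some] at hw
  induction w with
  | nil => exact ⟨[], rfl⟩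
  | cons a w ih =>
    obtain ⟨β, hβ⟩ := ih fun a ha => hw a (List.mem_cons_of_mem _ ha)
    obtain ⟨h1, h2⟩ := hw a List.mem_cons_self
    refine ⟨(⟨a.1 - lo, by omega⟩, a.2) :: β, ?_⟩
    rw [word] at hβ ⊢
    rw [List.map_cons, List.map_cons, hβ]
    congr 1
    ext1
    · simp only; omega
    · rfl

theorem exists_braidWord {lo hi : ℕ} (h : lo ≤ hi) {w : List (ℕ × Bool)}
    (hw : Fits lo hi (w.map some)) :
    ∃ β : BraidWord (hi - lo), β.length = w.length ∧
      sparseBraid lo hi (w.map some) = (fun p => p + ![(lo : ℝ), 0, 0]) '' closedBraid β := by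
  obtain ⟨β, rfl⟩ := exists_word_eq hw
  refine ⟨β, by rw [List.length_map, length_word], ?_⟩
  have := sparseBraid_shift 0 (hi - lo) lo ((word β).map some)
  rw [zero_add, Nat.sub_add_cancel h] at this
  rw [closedBraid_word, ← this, shiftWord, List.map_map, List.map_map]
  rfl

theorem isotopic_of_isLoop_translate {K : Set Point} {v : Point}
    (h : IsLoop ((fun x => x + v) '' K)) : Isotopic ((fun x => x + v) '' K) K := by
  have := isotopic_translate ((isKnot_iff_isLoop _).2 h) (-v)
  rwa [image_image, show (fun x : Point => x + v + -v) = id by funext x; simp, image_id] at this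

theorem exists_isotopic_closedBraid {lo hi : ℕ} (h : lo ≤ hi) {w : List (ℕ × Bool)}
    (hw : Fits lo hi (w.map some)) (hl : IsLoop (sparseBraid lo hi (w.map some))) :
    ∃ β : BraidWord (hi - lo), β.length = w.length ∧
      Isotopic (sparseBraid lo hi (w.map some)) (closedBraid β) := by
  obtain ⟨β, h1, h2⟩ := exists_braidWord h hw
  refine ⟨β, h1, ?_⟩
  rw [h2] at hl ⊢
  exact isotopic_of_isLoop_translate hl

theorem reduceOption_restrict (f : ℕ → Bool) (w : List (ℕ × Bool)) :
    (restrict f (w.map some)).reduceOption = w.filter fun a => f a.1 := by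
  induction w with
  | nil => rfl
  | cons a w ih =>
    rw [restrict, List.map_map] at ih ⊢
    rw [List.map_cons, List.filter_cons, Function.comp_apply, Option.filter_some]
    cases h : f a.1
    · simp only [Bool.false_eq_true, if_false, List.reduceOption_cons_of_none]
      exact ih
    · simp only [if_true, List.reduceOption_cons_of_some, ih]

theorem reduceOption_restrict_append (f : ℕ → Bool) (w w' : List (ℕ × Bool)) :
    (restrict f (w.map some) ++ restrict f (w'.map some)).reduceOption =
      (w ++ w').filter fun a => f a.1 := by
  rw [List.reduceOption_append, reduceOption_restrict, reduceOption_restrict, List.filter_append]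

theorem length_filter_lt_add_length_filter_gt {i : ℕ} {w : List (ℕ × Bool)}
    (hw : ∀ a ∈ w, a.1 ≠ i) : (w.filter fun a => decide (a.1 < i)).length +
      (w.filter fun a => decide (i < a.1)).length = w.length := by
  induction w with
  | nil => rfl
  | cons a w ih =>
    have := ih fun a ha => hw a (List.mem_cons_of_mem _ ha)
    have h1 := hw a List.mem_cons_self
    rcases lt_or_gt_of_ne h1 with h | h
    · have h' : ¬ i < a.1 := by omega
      simp only [List.filter_cons, h, h', decide_true, decide_false, if_true, List.length_cons,
        Bool.false_eq_true, if_false]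
      omega
    · have h' : ¬ a.1 < i := by omega
      simp only [List.filter_cons, h, h', decide_true, decide_false, if_true, List.length_cons,
        Bool.false_eq_true, if_false]
      omega

theorem divided_parts {lo hi i : ℕ} (s : Bool) {l₁ l₂ r₁ r₂ : List (Option (ℕ × Bool))}
    (hl₁ : Fits lo (i + 1) l₁) (hl₂ : Fits lo (i + 1) l₂) (hr₁ : Fits (i + 1) hi r₁)
    (hr₂ : Fits (i + 1) hi r₂) (hlen : r₁.length = l₁.length) :
    Divided (i + 1 / 2) (crest i l₁.length s) ![(i : ℝ) + 1 / 2, (l₁.length : ℝ) + 1 / 2, 0]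
      (leftPart lo i s l₁ l₂) (rightPart hi i s r₁ r₂) where
  left_eq := by simp [crest]
  right_eq := by simp
  left_bound _ hp := leftPart_bounds hl₁ hl₂ hp
  right_bound _ hp := by
    rw [← hlen]
    exact rightPart_bounds hr₁ hr₂ hp

/-- A closed braid in which a generator is used once consists of two parts, on the left and on the
right of this crossing. Closing up the parts yields closed braids. -/
theorem exists_divided {n i : ℕ} (s : Bool) (hi : i + 1 < n) {w₁ w₂ : List (ℕ × Bool)}
    (h₁ : ∀ a ∈ w₁, a.1 ≠ i) (h₂ : ∀ a ∈ w₂, a.1 ≠ i) (hf₁ : Fits 0 n (w₁.map some))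
    (hf₂ : Fits 0 n (w₂.map some)) :
    ∃ (L R : Set Point) (h : ℝ) (u v : Point), Divided h u v L R ∧ u ≠ v ∧ (u ∈ L ∧ v ∈ L) ∧
      (u ∈ R ∧ v ∈ R) ∧ (∃ p ∈ L, p 0 < h) ∧ (∃ p ∈ R, h < p 0) ∧
      sparseBraid 0 n ((w₁ ++ (i, s) :: w₂).map some) = L ∪ R ∧
      Isotopic (L ∪ segment ℝ u v)
        (sparseBraid 0 (i + 1) (((w₁ ++ w₂).filter fun a => decide (a.1 < i)).map some)) ∧
      Isotopic (R ∪ segment ℝ u v)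
        (sparseBraid (i + 1) n (((w₁ ++ w₂).filter fun a => decide (i < a.1)).map some)) := by
  have hlen : (restrict (fun a => decide (i < a)) (w₁.map some)).length =
      (restrict (fun a => decide (a < i)) (w₁.map some)).length := by
    rw [restrict_length, restrict_length]
  have e := sparseBraid_cut (hi := n) s (Nat.zero_le i) (by omega) (w₁ := w₁.map some)
    (w₂ := w₂.map some) (fun a ha => h₁ a (by simpa using ha)) fun a ha => h₂ a (by simpa using ha)
  have i1 := isotopic_leftPart s (Nat.zero_le i) hf₁.restrict_left hf₂.restrict_left
  have i2 := isotopic_rightPart s hi hf₁.restrict_right hf₂.restrict_right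
  rw [reduceOption_restrict_append] at i1 i2
  rw [hlen] at i2
  refine ⟨_, _, _, _, _, divided_parts s hf₁.restrict_left hf₂.restrict_left hf₁.restrict_right
    hf₂.restrict_right hlen, ?_, ⟨?_, ?_⟩, ⟨?_, ?_⟩, ⟨![(i : ℝ), (w₁.map some).length, 0], ?_, ?_⟩,
    ⟨![(i : ℝ) + 1, (w₁.map some).length, 0], ?_, ?_⟩, ?_, i1, i2⟩
  · intro h
    have := congrFun h 2
    cases s <;> simp [crest] at this
  · exact Or.inr (Or.inl (right_mem_segment ℝ _ _))
  · exact Or.inr (Or.inr (left_mem_segment ℝ _ _))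
  · rw [← hlen]
    exact Or.inr (Or.inl (left_mem_segment ℝ _ _))
  · rw [← hlen]
    exact Or.inr (Or.inr (right_mem_segment ℝ _ _))
  · rw [← restrict_length (fun a => decide (a < i))]
    exact Or.inr (Or.inl (left_mem_segment ℝ _ _))
  · simp
  · rw [← restrict_length (fun a => decide (i < a))]
    exact Or.inr (Or.inr (left_mem_segment ℝ _ _))
  · simp
    norm_num
  · rw [← e, List.map_append, List.map_cons]

theorem exists_mem_word {n : ℕ} {β : BraidWord n} (h : IsLoop (closedBraid β)) {i : ℕ}
    (hi : i + 1 < n) : ∃ a ∈ word β, a.1 = i := by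
  by_contra! hne
  have hw : ∀ a, some a ∈ (word β).map some → a.1 ≠ i := fun a ha => hne a (by simpa using ha)
  have hf := fits_word β
  have e : closedBraid β = outside 0 (i + 1) 0
      (restrict (fun a => decide (a < i)) ((word β).map some)) [] ∪ outside (i + 1) n 0
      (restrict (fun a => decide (i < a)) ((word β).map some)) [] := by
    have := outside_cut (lo := 0) (hi := n) (i := i) (l := 0) (w₂ := []) (Nat.zero_le _) (by omega)
      hw (by simp)
    simp only [restrict, List.map_nil] at this
    rw [restrict, restrict, ← this, closedBraid_word, sparseBraid, outside]
    simp [layers]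
  have h0 : (![(0 : ℝ), 0, 0] : Point) ∈ closedBraid β := by
    refine Or.inr (mem_iUnion.2 ⟨⟨0, by omega⟩, Or.inr ?_⟩)
    simpa using right_mem_segment ℝ _ _
  have h1 : (![(i : ℝ) + 1, 0, 0] : Point) ∈ closedBraid β := by
    refine Or.inr (mem_iUnion.2 ⟨⟨i + 1, by omega⟩, Or.inr ?_⟩)
    simpa using right_mem_segment ℝ _ _
  have ho : IsOpen {p : Point | p 0 < i + 1 / 2} := isOpen_lt (continuous_apply 0) continuous_const
  have ho' : IsOpen {p : Point | i + 1 / 2 < p 0} := isOpen_lt continuous_const (continuous_apply 0)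
  obtain ⟨p, -, h2, h3⟩ := h.isPreconnected _ _ ho ho' (fun p hp => by
    rw [e] at hp
    rcases hp with hp | hp
    · have := outside_left_right hf.restrict_left (by simp [Fits]) hp
      push_cast at this
      exact Or.inl (by change p 0 < _; linarith)
    · have := outside_left_right hf.restrict_right (by simp [Fits]) hp
      push_cast at this
      exact Or.inr (by change _ < p 0; linarith)) ⟨_, h0, by
        change (0 : ℝ) < _; positivity⟩ ⟨_, h1, by change (i : ℝ) + 1 / 2 < i + 1; linarith⟩
  have h2 : p 0 < i + 1 / 2 := h2
  have h3 : (i : ℝ) + 1 / 2 < p 0 := h3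
  linarith

theorem length_ge_of_count_ge {n k : ℕ} (β : BraidWord n)
    (h : ∀ i, i + 1 < n → k ≤ ((word β).map Prod.fst).count i) : (n - 1) * k ≤ β.length := by
  have e : ((word β).map Prod.fst).length = β.length := by rw [List.length_map, length_word]
  rw [← e, ← Multiset.coe_card,
    ← Multiset.sum_count_eq_card (s := Finset.range (n - 1)) (m := ((word β).map Prod.fst : List ℕ))]
  · rw [← smul_eq_mul]
    conv_lhs => rw [← Finset.card_range (n - 1)]
    refine Finset.card_nsmul_le_sum _ _ _ fun i hi => ?_
    rw [Multiset.coe_count]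
    exact h i (by have := Finset.mem_range.1 hi; omega)
  · intro i hi
    simp only [Multiset.mem_coe, List.mem_map, word] at hi
    obtain ⟨_, ⟨a, -, rfl⟩, rfl⟩ := hi
    exact Finset.mem_range.2 a.1.2

theorem length_add_one_ge {n : ℕ} {β : BraidWord n} (h : IsLoop (closedBraid β)) :
    n ≤ β.length + 1 := by
  have := length_ge_of_count_ge (k := 1) β fun i hi => by
    obtain ⟨a, ha, rfl⟩ := exists_mem_word h hi
    exact List.one_le_count_iff.2 (List.mem_map_of_mem ha)
  omega

theorem exists_append_of_count_eq_one {w : List (ℕ × Bool)} {i : ℕ}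
    (h : (w.map Prod.fst).count i = 1) : ∃ w₁ s w₂, w = w₁ ++ (i, s) :: w₂ ∧
      (∀ a ∈ w₁, a.1 ≠ i) ∧ ∀ a ∈ w₂, a.1 ≠ i := by
  obtain ⟨a, ha, rfl⟩ := List.mem_map.1 (List.one_le_count_iff.1 h.ge)
  obtain ⟨w₁, w₂, rfl⟩ := List.append_of_mem ha
  rw [List.map_append, List.map_cons, List.count_append, List.count_cons_self] at h
  refine ⟨w₁, a.2, w₂, rfl, fun b hb he => ?_, fun b hb he => ?_⟩
  · have := List.one_le_count_iff.2 (he ▸ List.mem_map_of_mem hb : a.1 ∈ w₁.map Prod.fst)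
    omega
  · have := List.one_le_count_iff.2 (he ▸ List.mem_map_of_mem hb : a.1 ∈ w₂.map Prod.fst)
    omega

/-- If a braid that represents a prime knot uses a generator once, then the knot is represented by
a braid with fewer strands. -/
theorem exists_represents_of_count_eq_one {K : Set Point} (hK : IsPrimeKnot K) {n : ℕ}
    {β : BraidWord n} (hβ : Represents β K) {i : ℕ} (hi : i + 1 < n)
    (h1 : ((word β).map Prod.fst).count i = 1) :
    ∃ (n' : ℕ) (β' : BraidWord n'), Represents β' K ∧ n' < n ∧
      β'.length + n ≤ β.length + n' := by
  obtain ⟨w₁, s, w₂, e, h₁, h₂⟩ := exists_append_of_count_eq_one h1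
  have hloop : IsLoop (closedBraid β) := hβ.isLoop_iff.2 ((isKnot_iff_isLoop K).1 hK.1)
  have hf := fits_word β
  rw [e, List.map_append, List.map_cons, Fits.append] at hf
  obtain ⟨hf₁, hf₂⟩ := hf
  replace hf₂ := hf₂.of_cons.2
  obtain ⟨L, R, h, u, v, hd, huv, hL, hR, nL, nR, e1, i1, i2⟩ :=
    exists_divided s hi h₁ h₂ hf₁ hf₂
  rw [← e, ← closedBraid_word] at e1
  have hβ' : Isotopic (L ∪ R) K := e1 ▸ hβ
  obtain ⟨aL, aR⟩ := hd.arcs huv hL hR (e1 ▸ hloop) nL nR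
  have hf : Fits 0 n ((w₁ ++ w₂).map some) := by
    rw [List.map_append]
    exact Fits.append.2 ⟨hf₁, hf₂⟩
  rw [fits_map_some] at hf
  obtain ⟨β₁, b1, b2⟩ := exists_isotopic_closedBraid (Nat.zero_le (i + 1))
    (w := (w₁ ++ w₂).filter fun a => decide (a.1 < i))
    (fits_map_some.2 fun a ha => by
      have := List.mem_filter.1 ha
      have h3 := of_decide_eq_true this.2
      omega) (i1.isLoop_iff.1 ((isKnot_iff_isLoop _).1 (hd.isKnot_left aL)))
  obtain ⟨β₂, c1, c2⟩ := exists_isotopic_closedBraid hi.le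
    (w := (w₁ ++ w₂).filter fun a => decide (i < a.1))
    (fits_map_some.2 fun a ha => by
      have := List.mem_filter.1 ha
      have h3 := of_decide_eq_true this.2
      have h4 := hf a this.1
      omega) (i2.isLoop_iff.1 ((isKnot_iff_isLoop _).1 (hd.isKnot_right aR)))
  replace i1 := i1.trans b2
  replace i2 := i2.trans c2
  have l1 := length_add_one_ge (i1.isLoop_iff.1 ((isKnot_iff_isLoop _).1 (hd.isKnot_left aL)))
  have l2 := length_add_one_ge (i2.isLoop_iff.1 ((isKnot_iff_isLoop _).1 (hd.isKnot_right aR)))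
  have l3 := length_filter_lt_add_length_filter_gt (i := i) (w := w₁ ++ w₂) fun a ha =>
    (List.mem_append.1 ha).elim (h₁ a) (h₂ a)
  have l4 := congrArg List.length e
  rw [length_word] at l4
  simp only [List.length_append, List.length_cons] at l3 l4
  rcases hd.isTrivial_or_isTrivial aL aR hK hβ' with ht | ht
  · exact ⟨_, β₂, i2.symm.trans ((hd.isotopic_right aL aR ht).symm.trans hβ'), by omega, by omega⟩
  · exact ⟨_, β₁, i1.symm.trans ((hd.isotopic_left aL aR ht).symm.trans hβ'), by omega, by omega⟩

/-! ### Stabilization -/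

theorem arc_of_isLoop_union_segment {u v : Point} {S : Set Point} (huv : u ≠ v) (hu : u ∈ S)
    (hv : v ∈ S) (hS : S ∩ segment ℝ u v ⊆ {u, v}) (hl : IsLoop (S ∪ segment ℝ u v)) :
    Arc u v S := by
  obtain ⟨T, hT, h1, h2⟩ := hl.exists_complementary_arc (Arc.seg huv) subset_union_right
  have e : S = T := by
    ext p
    by_cases hp : p ∈ ({u, v} : Set Point)
    · rcases hp with rfl | rfl
      · exact ⟨fun _ => hT.right_mem, fun _ => hu⟩
      · exact ⟨fun _ => hT.left_mem, fun _ => hv⟩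
    · constructor
      · intro h3
        rcases (h2 ▸ Or.inl h3 : p ∈ segment ℝ u v ∪ T) with h4 | h4
        · exact absurd (hS ⟨h3, h4⟩) hp
        · exact h4
      · intro h3
        rcases (h2 ▸ Or.inr h3 : p ∈ S ∪ segment ℝ u v) with h4 | h4
        · exact h4
        · exact absurd (h1 ⟨h4, h3⟩) hp
  rw [e]
  exact hT.symm

theorem isTrivial_closingArc (j : ℕ) : IsTrivial (closingArc 0 j) := by
  refine ⟨![(j : ℝ), 0, 0], ![(j : ℝ), 1, -2], ![(j : ℝ), -1, -2], ?_, ?_⟩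
  · refine affineIndependent_of_coord fun s t h => ?_
    have h1 := h 1
    have h2 := h 2
    simp at h1 h2
    exact ⟨by linarith, by linarith⟩
  · rw [polygon_triangle, closingArc, union_assoc, Nat.cast_zero, zero_add]
    exact Isotopic.refl _

theorem sparseBraid_nil (j : ℕ) : sparseBraid j (j + 1) [] = closingArc 0 j := by
  ext p
  simp only [sparseBraid, layers, closing, empty_union, List.length_nil, mem_ofPred]
  constructor
  · rintro ⟨k, h1, h2, h⟩
    rwa [show j = k by omega]
  · exact fun h => ⟨j, le_rfl, Nat.lt_succ_self j, h⟩

/-- Adding a strand with one crossing to a braid that represents a knot. -/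
theorem exists_represents_succ {K : Set Point} (hK : IsLoop K) {n : ℕ} (hn : 1 ≤ n)
    {β : BraidWord n} (hβ : Represents β K) :
    ∃ β' : BraidWord (n + 1), Represents β' K ∧ β'.length = β.length + 1 := by
  obtain ⟨i, rfl⟩ : ∃ i, n = i + 1 := ⟨n - 1, by omega⟩
  have hw := fits_map_some.1 (fits_word β)
  have hf : Fits 0 (i + 2) ((word β).map some) := fits_map_some.2 fun a ha => by
    have := hw a ha
    omega
  obtain ⟨β', e⟩ := exists_word_eq (lo := 0) (hi := i + 2) (w := word β ++ [(i, true)]) (by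
    rw [List.map_append, Fits.append]
    exact ⟨hf, fits_map_some.2 (by simp)⟩)
  simp only [add_zero, Prod.mk.eta, List.map_id'] at e
  refine ⟨β', ?_, ?_⟩
  · obtain ⟨L, R, h, u, v, hd, huv, hL, hR, nL, nR, e1, i1, i2⟩ :=
      exists_divided (n := i + 2) (w₁ := word β) (w₂ := []) true (Nat.lt_succ_self (i + 1))
        (fun a ha => by have := hw a ha; omega) (by simp) hf (by simp [Fits])
    have f1 : ((word β ++ []).filter fun a : ℕ × Bool => decide (a.1 < i)) = word β := by
      rw [List.append_nil, List.filter_eq_self]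
      exact fun a ha => decide_eq_true (by have := hw a ha; omega)
    have f2 : ((word β ++ []).filter fun a : ℕ × Bool => decide (i < a.1)) = [] := by
      rw [List.append_nil, List.filter_eq_nil_iff]
      exact fun a ha => by rw [decide_eq_true_eq]; have := hw a ha; omega
    rw [f1, ← closedBraid_word] at i1
    rw [f2, List.map_nil, sparseBraid_nil] at i2
    have ht := (isTrivial_closingArc (i + 1)).of_isotopic i2
    have hlR : IsLoop (R ∪ segment ℝ u v) := by
      obtain ⟨a, b, c, h3, h4⟩ := ht
      refine h4.isLoop_iff.2 ?_
      rw [polygon_triangle]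
      exact (carrier_of_triangle h3 (midpoint_mem_openSegment a b)).isLoop
    have aL := arc_of_isLoop_union_segment huv hL.1 hL.2 (fun p hp =>
      hd.eq_of_mem_plane (Or.inl hp.1) (hd.segment_eq hp.2)) (i1.isLoop_iff.2 (hβ.isLoop_iff.2 hK))
    have aR := arc_of_isLoop_union_segment huv hR.1 hR.2 (fun p hp =>
      hd.eq_of_mem_plane (Or.inr hp.1) (hd.segment_eq hp.2)) hlR
    have key := (hd.isotopic_left aL aR.symm ht).trans (i1.trans hβ)
    rw [← e1, ← e] at key
    rw [Represents, closedBraid_word]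
    exact key
  · have := congrArg List.length e
    rw [length_word, List.length_append, length_word] at this
    exact this

/-! ### The permutation of a braid -/

/-- The transposition of strands at a letter. -/
def transposition {n : ℕ} (a : Fin (n - 1) × Bool) : Equiv.Perm (Fin n) :=
  Equiv.swap ⟨a.1, by omega⟩ ⟨a.1 + 1, by omega⟩

/-- The permutation of strands of a braid. -/
def strandPerm {n : ℕ} : BraidWord n → Equiv.Perm (Fin n)
  | [] => 1
  | a :: β => strandPerm β * transposition a

theorem sign_strandPerm {n : ℕ} (β : BraidWord n) :
    Equiv.Perm.sign (strandPerm β) = (-1) ^ β.length := by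
  induction β with
  | nil => simp [strandPerm]
  | cons a β ih =>
    rw [strandPerm, Equiv.Perm.sign_mul, ih, transposition, Equiv.Perm.sign_swap, List.length_cons,
      pow_succ]
    simp

/-- The part of the strand that starts in the position `j` in the layer of a letter. -/
def strand {n : ℕ} (k : ℕ) (a : Fin (n - 1) × Bool) (j : Fin n) : Set Point :=
  if (j : ℕ) = a.1 then
    segment ℝ ![(j : ℝ), (k : ℝ), 0] (crest j k a.2) ∪
      segment ℝ (crest j k a.2) ![(j : ℝ) + 1, (k : ℝ) + 1, 0]
  else if (j : ℕ) = a.1 + 1 then segment ℝ ![(j : ℝ), (k : ℝ), 0] ![(j : ℝ) - 1, (k : ℝ) + 1, 0]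
  else vertical j k

/-- The strand of a braid that starts in the position `j`. -/
def thread {n : ℕ} : ℕ → BraidWord n → Fin n → Set Point
  | _, [], _ => ∅
  | k, a :: β, j => strand k a j ∪ thread (k + 1) β (transposition a j)

theorem isClosed_strand {n : ℕ} (k : ℕ) (a : Fin (n - 1) × Bool) (j : Fin n) :
    IsClosed (strand k a j) := by
  rw [strand]
  split_ifs
  · exact (isClosed_segment _ _).union (isClosed_segment _ _)
  · exact isClosed_segment _ _
  · exact isClosed_segment _ _

theorem isClosed_thread {n : ℕ} (k : ℕ) (β : BraidWord n) (j : Fin n) :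
    IsClosed (thread k β j) := by
  induction β generalizing k j with
  | nil => exact isClosed_empty
  | cons a β ih => exact (isClosed_strand k a j).union (ih _ _)

theorem layer_eq_iUnion_strand {n : ℕ} (k : ℕ) (a : Fin (n - 1) × Bool) :
    layer 0 n k (letter a) = ⋃ j, strand k a j := by
  ext p
  simp only [letter, layer, mem_union, mem_iUnion, verticals, mem_ofPred]
  constructor
  · rintro (h | ⟨j, -, hj, ⟨h1, h2⟩, h⟩)
    · rcases h with h | h
      · refine ⟨⟨a.1, by omega⟩, ?_⟩
        rw [strand, if_pos rfl]
        exact h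
      · refine ⟨⟨a.1 + 1, by omega⟩, ?_⟩
        rw [strand, if_neg (by simp), if_pos rfl]
        push_cast
        rwa [add_sub_cancel_right]
    · refine ⟨⟨j, hj⟩, ?_⟩
      rwa [strand, if_neg h1, if_neg h2]
  · rintro ⟨j, h⟩
    rw [strand] at h
    split_ifs at h with h1 h2
    · rw [h1] at h
      exact Or.inl (Or.inl h)
    · left; right
      rw [h2] at h
      push_cast at h
      rwa [add_sub_cancel_right] at h
    · exact Or.inr ⟨j, Nat.zero_le _, j.2, ⟨h1, h2⟩, h⟩

theorem layers_eq_iUnion_thread {n : ℕ} (k : ℕ) (β : BraidWord n) :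
    layers 0 n k (β.map letter) = ⋃ j, thread k β j := by
  induction β generalizing k with
  | nil => simp [layers, thread]
  | cons a β ih =>
    simp only [List.map_cons, layers, thread, iUnion_union_distrib, ih, layer_eq_iUnion_strand]
    rw [(transposition a).surjective.iUnion_comp fun j => thread (k + 1) β j]

theorem transposition_val {n : ℕ} (a : Fin (n - 1) × Bool) (j : Fin n) :
    ((transposition a j : Fin n) : ℕ) =
      if (j : ℕ) = a.1 then (a.1 : ℕ) + 1 else if (j : ℕ) = a.1 + 1 then (a.1 : ℕ) else j := by
  rw [transposition, Equiv.swap_apply_def]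
  simp only [Fin.ext_iff]
  split_ifs <;> rfl

theorem strand_bounds {n k : ℕ} {a : Fin (n - 1) × Bool} {j : Fin n} {p : Point}
    (h : p ∈ strand k a j) : ((k : ℝ) ≤ p 1 ∧ p 1 ≤ k + 1) ∧ -1 ≤ p 2 ∧
      (p 1 = k → p 0 = j) ∧ (p 1 = k + 1 → p 0 = (transposition a j : Fin n)) := by
  have hσ : (if a.2 then (1 : ℝ) else -1) = 1 ∨ (if a.2 then (1 : ℝ) else -1) = -1 := by
    cases a.2 <;> simp
  rw [transposition_val]
  rw [strand, crest] at h
  generalize (if a.2 then (1 : ℝ) else -1) = σ at h hσ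
  split_ifs at h ⊢ with h1 h2
  · rw [← h1]
    push_cast
    rcases h with h | h <;> obtain ⟨t, t0, t1, f0, f1, f2⟩ := mem_seg.1 h
    · refine ⟨⟨by linarith, by linarith⟩, ?_, fun h => by linarith, fun h => by linarith⟩
      rcases hσ with rfl | rfl <;> linarith
    · refine ⟨⟨by linarith, by linarith⟩, ?_, fun h => by linarith, fun h => by linarith⟩
      rcases hσ with rfl | rfl <;> linarith
  · obtain ⟨t, t0, t1, f0, f1, f2⟩ := mem_seg.1 h
    have h3 : (j : ℝ) = (a.1 : ℕ) + 1 := by exact_mod_cast h2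
    exact ⟨⟨by linarith, by linarith⟩, by linarith, fun h => by linarith, fun h => by linarith⟩
  · obtain ⟨f0, f1, f2, f3⟩ := mem_vertical.1 h
    exact ⟨⟨f1, f2⟩, by linarith, fun _ => f0, fun _ => f0⟩

theorem disjoint_strand {n k : ℕ} {a : Fin (n - 1) × Bool} {j j' : Fin n} (hj : j ≠ j') :
    Disjoint (strand k a j) (strand k a j') := by
  rw [Set.disjoint_left]
  intro p
  have hσ : (if a.2 then (1 : ℝ) else -1) ≠ 0 := by cases a.2 <;> simp
  wlog hlt : (j : ℕ) < j' generalizing j j' with H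
  · exact fun h h' => H hj.symm (by have := Fin.val_ne_of_ne hj; omega) h' h
  intro h h'
  rw [strand, crest] at h h'
  generalize (if a.2 then (1 : ℝ) else -1) = σ at h h' hσ
  have hlt' : (j : ℝ) + 1 ≤ j' := by exact_mod_cast hlt
  have b1 : (j : ℕ) ≠ a.1 → p 0 ≤ j := fun h1 => by
    rw [if_neg h1] at h
    split_ifs at h
    · obtain ⟨t, t0, t1, f0, f1, f2⟩ := mem_seg.1 h
      linarith
    · exact (mem_vertical.1 h).1.le
  have b2 : (j' : ℕ) ≠ a.1 + 1 → (j' : ℝ) ≤ p 0 := fun h1 => by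
    rw [if_neg h1] at h'
    split_ifs at h'
    · rcases h' with h' | h' <;> obtain ⟨t, t0, t1, f0, f1, f2⟩ := mem_seg.1 h' <;> linarith
    · exact (mem_vertical.1 h').1.ge
  by_cases h1 : (j : ℕ) = a.1 <;> by_cases h2 : (j' : ℕ) = a.1 + 1
  · rw [if_pos h1] at h
    rw [if_neg (by omega), if_pos h2] at h'
    have h3 : (j' : ℝ) = j + 1 := by rw [h2, h1]; push_cast; ring
    obtain ⟨t, t0, t1, f0, f1, f2⟩ := mem_seg.1 h'
    rcases h with h | h <;> obtain ⟨s, s0, s1, g0, g1, g2⟩ := mem_seg.1 h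
    · have e : s = 1 := by linarith
      subst e
      exact hσ (by linarith)
    · have e : s = 0 := by linarith
      subst e
      exact hσ (by linarith)
  · have := b2 h2
    have h3 : (j : ℝ) + 2 ≤ j' := by exact_mod_cast (by omega : (j : ℕ) + 2 ≤ j')
    rw [if_pos h1] at h
    rcases h with h | h <;> obtain ⟨t, t0, t1, f0, f1, f2⟩ := mem_seg.1 h <;> linarith
  · have := b1 h1
    have h3 : (j : ℝ) + 2 ≤ j' := by exact_mod_cast (by omega : (j : ℕ) + 2 ≤ j')
    rw [if_neg (by omega), if_pos h2] at h'
    obtain ⟨t, t0, t1, f0, f1, f2⟩ := mem_seg.1 h'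
    linarith
  · linarith [b1 h1, b2 h2]

theorem thread_bounds {n k : ℕ} {β : BraidWord n} {j : Fin n} {p : Point}
    (h : p ∈ thread k β j) : ((k : ℝ) ≤ p 1 ∧ p 1 ≤ k + β.length) ∧ -1 ≤ p 2 ∧
      (p 1 = k → p 0 = j) ∧ (p 1 = k + β.length → p 0 = (strandPerm β j : Fin n)) := by
  induction β generalizing k j with
  | nil => exact h.elim
  | cons a β ih =>
    have hl : (0 : ℝ) ≤ β.length := Nat.cast_nonneg _
    rw [List.length_cons]
    push_cast
    rcases h with h | h
    · obtain ⟨h1, h2, h3, h4⟩ := strand_bounds h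
      refine ⟨⟨h1.1, by linarith⟩, h2, h3, fun h5 => ?_⟩
      have h6 : (β.length : ℝ) = 0 := by linarith
      have h7 : β = [] := List.length_eq_zero_iff.1 (by exact_mod_cast h6)
      subst h7
      simpa [strandPerm] using h4 (by linarith)
    · obtain ⟨h1, h2, h3, h4⟩ := ih h
      push_cast at h1 h3 h4
      exact ⟨⟨by linarith, by linarith⟩, h2, fun h5 => by linarith, fun h5 => h4 (by linarith)⟩

theorem fin_eq_of_cast {n : ℕ} {j j' : Fin n} (h : (j : ℝ) = j') : j = j' :=
  Fin.ext (by exact_mod_cast h)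

theorem disjoint_thread {n k : ℕ} {β : BraidWord n} {j j' : Fin n} (hj : j ≠ j') :
    Disjoint (thread k β j) (thread k β j') := by
  induction β generalizing k j j' with
  | nil => exact disjoint_bot_left
  | cons a β ih =>
    have key : ∀ {j j' : Fin n}, j ≠ j' →
        Disjoint (strand k a j) (thread (k + 1) β (transposition a j')) := by
      intro j j' hj
      rw [Set.disjoint_left]
      intro p h h'
      obtain ⟨h1, -, -, h2⟩ := strand_bounds h
      obtain ⟨h3, -, h4, -⟩ := thread_bounds h'
      push_cast at h3 h4
      have h5 : p 1 = k + 1 := le_antisymm h1.2 h3.1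
      exact hj ((transposition a).injective (fin_eq_of_cast ((h2 h5).symm.trans (h4 h5))))
    rw [thread, thread, disjoint_union_left, disjoint_union_right, disjoint_union_right]
    exact ⟨⟨disjoint_strand hj, key hj⟩, (key hj.symm).symm,
      ih ((transposition a).injective.ne hj)⟩

theorem disjoint_thread_closingArc {n : ℕ} {β : BraidWord n} {j j' : Fin n} (h1 : j ≠ j')
    (h2 : strandPerm β j ≠ j') : Disjoint (thread 0 β j) (closingArc β.length j') := by
  rw [Set.disjoint_left]
  intro p h h'
  obtain ⟨b1, b2, b3, b4⟩ := thread_bounds h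
  obtain ⟨c1, -, -, c2 | (c2 | c2) | (c2 | c2)⟩ := closingArc_bounds h'
  · linarith
  · have := b1.1
    push_cast at this
    linarith
  · exact h1 (fin_eq_of_cast ((b3 (by rw [c2]; simp)).symm.trans c1))
  · have := b1.2
    push_cast at this
    linarith
  · exact h2 (fin_eq_of_cast ((b4 (by rw [c2]; simp)).symm.trans c1))

theorem isClosed_closingArc (c j : ℕ) : IsClosed (closingArc c j) :=
  ((isClosed_segment _ _).union (isClosed_segment _ _)).union (isClosed_segment _ _)

theorem closedBraid_eq_iUnion {n : ℕ} (β : BraidWord n) :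
    closedBraid β = ⋃ j : Fin n, (thread 0 β j ∪ closingArc β.length j) := by
  rw [iUnion_union_distrib, ← layers_eq_iUnion_thread, layers_letter, closedBraid]
  simp

theorem mem_of_strandPerm_invariant {n : ℕ} {β : BraidWord n} (h : IsLoop (closedBraid β))
    {S : Set (Fin n)} (hS : ∀ j, strandPerm β j ∈ S ↔ j ∈ S) {i : Fin n} (hi : i ∈ S) (j : Fin n) :
    j ∈ S := by
  by_contra hj
  let X : Set (Fin n) → Set Point := fun S => ⋃ j ∈ S, (thread 0 β j ∪ closingArc β.length j)
  have hX : ∀ S, IsClosed (X S) := fun S => (toFinite S).isClosed_biUnion fun j _ =>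
    (isClosed_thread 0 β j).union (isClosed_closingArc _ _)
  have hmem : ∀ (S : Set (Fin n)) (j : Fin n), j ∈ S → (![(j : ℝ), 0, 0] : Point) ∈ X S :=
    fun S j hj => mem_biUnion hj (Or.inr (Or.inr (right_mem_segment ℝ _ _)))
  have hsub : ∀ S, X S ⊆ closedBraid β := fun S => by
    rw [closedBraid_eq_iUnion]
    exact iUnion₂_subset fun j _ => subset_iUnion (fun j : Fin n =>
      thread 0 β j ∪ closingArc β.length j) j
  obtain ⟨p, -, hp, hp'⟩ := isPreconnected_closed_iff.1 h.isPreconnected _ _ (hX S) (hX Sᶜ)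
    (by
      rw [closedBraid_eq_iUnion]
      refine iUnion_subset fun j => ?_
      by_cases hj : j ∈ S
      · exact (subset_biUnion_of_mem (u := fun j : Fin n =>
          thread 0 β j ∪ closingArc β.length j) hj).trans subset_union_left
      · exact (subset_biUnion_of_mem (u := fun j : Fin n =>
          thread 0 β j ∪ closingArc β.length j) (show j ∈ Sᶜ from hj)).trans subset_union_right)
    ⟨_, hsub S (hmem S i hi), hmem S i hi⟩ ⟨_, hsub Sᶜ (hmem Sᶜ j hj), hmem Sᶜ j hj⟩
  obtain ⟨a, ha, h1⟩ := mem_iUnion₂.1 hp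
  obtain ⟨b, hb, h2⟩ := mem_iUnion₂.1 hp'
  have hab : a ≠ b := fun e => hb (e ▸ ha)
  rcases h1 with h1 | h1 <;> rcases h2 with h2 | h2
  · exact Set.disjoint_left.1 (disjoint_thread hab) h1 h2
  · exact Set.disjoint_left.1 (disjoint_thread_closingArc hab
      fun e => hb (e ▸ (hS a).2 ha)) h1 h2
  · exact Set.disjoint_left.1 (disjoint_thread_closingArc hab.symm
      fun e => hb ((hS b).1 (e ▸ ha))) h2 h1
  · exact hab (fin_eq_of_cast ((closingArc_bounds h1).1.symm.trans (closingArc_bounds h2).1))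

/-- The closure of a braid with `n` strands is a knot only if the number of crossings has the parity
of `n - 1`. -/
theorem length_parity {n : ℕ} (hn : 2 ≤ n) {β : BraidWord n} (h : IsLoop (closedBraid β)) :
    Even (β.length + n + 1) := by
  have hsame : ∀ i j, (strandPerm β).SameCycle i j := fun i j =>
    mem_of_strandPerm_invariant h (S := {j | (strandPerm β).SameCycle i j})
      (fun _ => Equiv.Perm.sameCycle_apply_right) (Equiv.Perm.SameCycle.refl _ _) j
  have hne : ∀ i, strandPerm β i ≠ i := fun i hi => by
    have : ∃ j : Fin n, j ≠ i := by
      have : Nontrivial (Fin n) := Fin.nontrivial_iff_two_le.2 hn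
      exact exists_ne i
    obtain ⟨j, hj⟩ := this
    exact hj (((hsame i j).eq_of_left hi).symm)
  have hc : (strandPerm β).IsCycle := ⟨⟨0, by omega⟩, hne _, fun j _ => hsame _ j⟩
  have hs : (strandPerm β).support = Finset.univ := by
    ext i
    simp [hne i]
  have h1 := hc.sign
  rw [sign_strandPerm, hs, Finset.card_univ, Fintype.card_fin] at h1
  by_contra ho
  have h3 : Odd (β.length + n + 1) := Nat.not_even_iff_odd.1 ho
  have h4 : ((-1 : ℤˣ)) ^ (β.length + n + 1) = 1 := by
    rw [pow_succ, pow_add, h1]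
    have : ((-1 : ℤˣ)) ^ n * (-1) ^ n = 1 := by rw [← mul_pow]; simp
    simp [this]
  rw [h3.neg_one_pow] at h4
  exact absurd h4 (by decide)

/-! ### The functions `b` and `b'` -/

theorem b_le {K : Set Point} {n : ℕ} {β : BraidWord n} (h : Represents β K) : b n K ≤ β.length :=
  Nat.sInf_le ⟨β, h, rfl⟩

theorem braidLength_le {K : Set Point} {n : ℕ} {β : BraidWord n} (h : Represents β K) :
    braidLength K ≤ β.length :=
  Nat.sInf_le ⟨n, β, h, rfl⟩

theorem exists_represents_b {K : Set Point} {n : ℕ} (h : 0 < b n K) :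
    ∃ β : BraidWord n, Represents β K ∧ β.length = b n K :=
  Nat.sInf_mem (Nat.nonempty_of_pos_sInf h)

/-- A lower bound for the number of crossings of a braid that represents a prime knot. -/
theorem add_le_length {K : Set Point} (hK : IsPrimeKnot K) {m : ℕ} (hm0 : 1 ≤ m) (hm : Even m)
    (hl : braidLength K = 2 * m + 1) {n : ℕ} {β : BraidWord n} (hβ : Represents β K) :
    n + m + 1 ≤ β.length := by
  induction n using Nat.strong_induction_on with
  | _ n ih =>
  have h1 := braidLength_le hβ
  by_cases hnm : n ≤ m
  · omega
  have hloop : IsLoop (closedBraid β) := hβ.isLoop_iff.2 ((isKnot_iff_isLoop K).1 hK.1)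
  by_cases hc : ∃ i, i + 1 < n ∧ ((word β).map Prod.fst).count i = 1
  · obtain ⟨i, hi, hc⟩ := hc
    obtain ⟨n', β', h2, h3, h4⟩ := exists_represents_of_count_eq_one hK hβ hi hc
    have := ih n' h3 h2
    omega
  push Not at hc
  have h2 := length_ge_of_count_ge (k := 2) β fun i hi => by
    have h3 := hc i hi
    obtain ⟨a, ha, rfl⟩ := exists_mem_word hloop hi
    have h4 := List.one_le_count_iff.2 (List.mem_map_of_mem (f := Prod.fst) ha)
    omega
  obtain ⟨x, hx⟩ := length_parity (by omega) hloop
  obtain ⟨y, hy⟩ := hm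
  omega

theorem exists_represents_add {K : Set Point} (hK : IsLoop K) {m : ℕ} (hm : 1 ≤ m)
    {β : BraidWord m} (hβ : Represents β K) (d : ℕ) :
    ∃ β' : BraidWord (m + d), Represents β' K ∧ β'.length = β.length + d := by
  induction d with
  | zero => exact ⟨β, hβ, rfl⟩
  | succ d ih =>
    obtain ⟨β', h1, h2⟩ := ih
    obtain ⟨β'', h3, h4⟩ := exists_represents_succ hK (by omega) h1
    exact ⟨β'', h3, by omega⟩

end BraidStrands

theorem corollary3p6 (K : Set BraidStrands.Point) (m : ℕ)
    (hK : BraidStrands.IsPrimeKnot K)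
    (hm : BraidStrands.braidIndex K = m)
    (hl : BraidStrands.b m K = BraidStrands.braidLength K)
    (hb : BraidStrands.b' m K = (m : ℤ) + 1) :
    ∀ n : ℕ, m ≤ n → BraidStrands.b' n K = (m : ℤ) + 1 := by
  open BraidStrands in
  intro n hn
  have hb' : b m K = 2 * m + 1 := by rw [b'] at hb; omega
  have hloop : IsLoop K := (isKnot_iff_isLoop K).1 hK.1
  obtain ⟨β, h1, h2⟩ := exists_represents_b (K := K) (n := m) (by omega)
  have hm2 : 2 ≤ m := by
    by_contra hlt
    rw [hb'] at h2
    match β, h2 with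
    | a :: _, _ => have := a.1.2; omega
  obtain ⟨x, hx⟩ := length_parity hm2 (h1.isLoop_iff.2 hloop)
  have hme : Even m := by
    rw [Nat.even_iff]
    omega
  obtain ⟨d, rfl⟩ := Nat.exists_eq_add_of_le hn
  obtain ⟨β', h3, h4⟩ := exists_represents_add hloop (by omega) h1 d
  have hle := b_le h3
  have hne : {c : ℕ | ∃ β : BraidWord (m + d), Represents β K ∧ β.length = c}.Nonempty :=
    ⟨_, β', h3, rfl⟩
  obtain ⟨β'', h5, h6⟩ : ∃ β : BraidWord (m + d), Represents β K ∧ β.length = b (m + d) K :=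
    Nat.sInf_mem hne
  have hge := add_le_length hK (by omega) hme (hl.symm.trans hb') h5
  rw [b']
  push_cast
  omega
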